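/- **Setting.** Consider scalar QED, $\mathcal L=(D_\mu\phi)^*(D^\mu\phi)-\tfrac14F_{\mu\nu}F^{\mu\nu}$ with $D_\mu=\partial_\mu-igA_\mu$ ($g=-e$), a massless scalar and metric $(+,-,-,-)$. All matrix elements are tree-level ones: sums of tree Feynman diagrams with physical external particles. Let $i\mathcal M=\langle X_3X_4;X_s|\epsilon_1(p_1)\epsilon_2(p_2)\rangle$ be the amplitude (without the momentum-conserving delta function) for two photons to produce two jets and soft radiation. The jets $X_3$ and $X_4$ consist of any fixed numbers of scalars, antiscalars and photons and have the total charge of one scalar and of one antiscalar, respectively; $X_s$ is a neutral set of soft photons, scalars and antiscalars. Each photon has a physical polarization vector, $k\cdot\epsilon=0$, $\epsilon^*\cdot\epsilon=-1$. Let $P_3,P_4$ be the total momenta of the jets, $P_1=p_1$, $n_j=(1,\vec P_j/|\vec P_j|)$, $\bar n_j=(1,-\vec P_j/|\vec P_j|)$. In units of the hard scale, the momenta of the particles in jet $j$ scale as $(n_j\cdot q,\bar n_j\cdot q,q_\perp)\sim(\lambda^2,1,\lambda)$, soft momenta have components $\lesssim\lambda^2$, and the four directions of $p_1,p_2,P_3,P_4$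 are well separated. Moreover, no invariant is smaller than its generic size: $\bar n_j\cdot q\gtrsim1$ in jet $j$; $n_j\cdot k\gtrsim\lambda^2$ for soft $k$; $q\cdot q'\gtrsim\lambda^2$ for two particles of the same jet, and $k\cdot k'\gtrsim\lambda^4$ for two soft particles, if at least one of the two is charged; and $p_a\cdot k\gtrsim\lambda^2$ for a soft charged particle. All these relations hold up to a common constant $K$. Let $Y_j^\dagger=\exp\big(ig\int_0^\infty ds\,n_j\cdot A(sn_j)\big)$ be the outgoing Wilson line along $n_j$, let $W_j=\exp\big(-ig\int_0^\infty ds\,t_j\cdot A(st_j)\big)$ with $t_j$ light-like and not collinear to $n_j$, and let $\bar W_a=\exp\big(ig\int_{-\infty}^0ds\,t_a\cdot A(st_a)\big)$ with $t_a$ light-like and not collinear to $p_a$ ($a=1,2$). Let $n_3'$, $n_4'$ and $n'_s$ be the numbers of particles in $X_3$ beyond one, in $X_4$ beyond one, and in $X_s$. Write $A\cong B$ ("equal at leading power") if $|A-B|\le C\,\lambda\cdot\lambda^{-(n_3'+n_4'+2n_s')}$ for all sufficiently small $\lambda$, where $C$ and the smallness threshold depend only on $g$, on $K$ and on the particle content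 of the three sectors. **Theorem.** (a) For all physical polarization vectors, $$\langle X_3X_4;X_s|\epsilon_1(p_1)\epsilon_2(p_2)\rangle\cong-2i\Big[g^{\mu\nu}-\frac{P_4^\mu P_3^\nu}{P_4\cdot P_1}-\frac{P_3^\mu P_4^\nu}{P_3\cdot P_1}\Big]\langle0|\bar W_1^\dagger D_\mu\bar W_1|\epsilon_1(p_1)\rangle\langle0|\bar W_2^\dagger D_\nu\bar W_2|\epsilon_2(p_2)\rangle\;\langle X_3|\phi^*W_3|0\rangle\langle X_4|W_4^\dagger\phi|0\rangle\langle X_s|Y_3^\dagger Y_4|0\rangle .$$ (b) The factorization holds for each diagram of the hard process separately. Sort the diagrams of the full amplitude according to where photon 2 enters relative to the vertex that absorbs photon 1 on a scalar line: at the same four-point vertex, or through the branch at the outgoing-scalar end of the line ($t$-channel), or through the branch at its outgoing-antiscalar end ($u$-channel). The amplitude is the sum of these three parts, and if all polarization vectors have components bounded by $K$ (as they have for reference vectors that are not collinear to the photon momentum), then each part is $\cong$ the right-hand side of (a) with the square bracket replaced by $g^{\mu\nu}$, $-P_4^\mu P_3^\nu/(P_4\cdot P_1)$ and $-P_3^\mu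 P_4^\nu/(P_3\cdot P_1)$, respectively, and with $\bar W_a^\dagger D_\mu\bar W_a$ replaced by $-igA_\mu$. -/

import Mathlib

noncomputable section

namespace ScalarQED

open scoped Topology

/-! ### Minkowski space -/

/-- Real four-vectors, with contravariant components; the component `0` is the time component. -/
abbrev Vec : Type := Fin 4 → ℝ

/-- Complex four-vectors, with contravariant components. -/
abbrev CVec : Type := Fin 4 → ℂ

/-- The diagonal entries of the metric `diag (1, -1, -1, -1)`. -/
def metric (μ : Fin 4) : ℝ := if μ = 0 then 1 else -1

/-- The Minkowski product of real four-vectors. -/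
def mdot (a b : Vec) : ℝ := ∑ μ, metric μ * a μ * b μ

/-- The complex-bilinear Minkowski product. -/
def cdot (a b : CVec) : ℂ := ∑ μ, (metric μ : ℂ) * a μ * b μ

/-- A real four-vector regarded as a complex one. -/
def toC (a : Vec) : CVec := fun μ => (a μ : ℂ)

/-- The length of the spatial part. -/
def spatialNorm (P : Vec) : ℝ := Real.sqrt (P 1 ^ 2 + P 2 ^ 2 + P 3 ^ 2)

/-- The light-like vector `n = (1, P / |P|)` along the spatial part of `P`. -/
def lightDir (P : Vec) : Vec := fun μ => if μ = 0 then 1 else P μ / spatialNorm P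

/-- The light-like vector `nbar = (1, - P / |P|)`. -/
def lightDirBar (P : Vec) : Vec := fun μ => if μ = 0 then 1 else - (P μ / spatialNorm P)

/-- The transverse part `V - (n·V) nbar / 2 - (nbar·V) n / 2` in the light-cone coordinates
defined by the direction of `P`. -/
def perp (P V : Vec) : Vec := fun μ =>
  V μ - mdot (lightDir P) V / 2 * lightDirBar P μ - mdot (lightDirBar P) V / 2 * lightDir P μ

/-! ### Tree-level matrix elements of scalar QED

The Lagrangian is `L = (D_μ φ)^* (D^μ φ) - F_{μν} F^{μν} / 4` with `D_μ = ∂_μ - i g A_μ` and a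
massless scalar.  Matrix elements between the vacuum and the multi-particle states built from a
set of external legs are stored as functions of the set `S` of legs: `F S` is the tree-level
coefficient with which the operator `F` at `x = 0` creates exactly the legs in `S`, the dependence
on `x` being `exp (i k_S · x)` with `k_S` the total outgoing momentum. -/

/-- The species of a particle. -/
inductive Species : Type
  | photon
  | scalar
  | antiscalar
  deriving DecidableEq

/-- The electric charge in units of the charge of the scalar. -/
def Species.charge : Species → ℤ
  | .photon => 0
  | .scalar => 1
  | .antiscalar => -1

/-- An external leg.  All legs are treated as outgoing: an incoming leg has `mom = - p`.  For a
photon, `wave` is the complex conjugate of the polarization vector if the photon is outgoing and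
the polarization vector itself if it is incoming. -/
structure Leg : Type where
  species : Species
  mom : Vec
  wave : CVec

variable {α : Type*} [DecidableEq α]

/-- The matrix elements of a product of two operators (taken at the same point) in the absence of
contractions between the two: every leg is attached to one of the factors. -/
def conv (F G : Finset α → ℂ) : Finset α → ℂ := fun S => ∑ T ∈ S.powerset, F T * G (S \ T)

/-- The matrix elements of the unit operator. -/
def convOne : Finset α → ℂ := fun S => if S = ∅ then 1 else 0

/-- Powers for the product `conv`. -/
def convPow (F : Finset α → ℂ) : ℕ → Finset α → ℂ
  | 0 => convOne
  | m + 1 => conv F (convPow F m)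

/-- The exponential series for the product `conv`, for `F` with `F ∅ = 0` (so that the powers
beyond the number of legs do not contribute). -/
def convExp (F : Finset α → ℂ) : Finset α → ℂ := fun S =>
  ∑ m ∈ Finset.range (S.card + 1), ((m.factorial : ℂ))⁻¹ * convPow F m S

/-- Keep only those contributions in which the leg `x` is attached. -/
def withLeg (x : α) (F : Finset α → ℂ) : Finset α → ℂ := fun S => if x ∈ S then F S else 0

/-- The total outgoing momentum of a set of legs. -/
def totalMom (leg : α → Leg) (S : Finset α) : Vec := ∑ i ∈ S, (leg i).mom

/-- The derivative `∂^μ` (contravariant index). -/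
def pd (leg : α → Leg) (μ : Fin 4) (F : Finset α → ℂ) : Finset α → ℂ := fun S =>
  Complex.I * (totalMom leg S μ : ℂ) * F S

/-- The fields `φ^*`, `φ` and `A^μ`, each given by its matrix elements. -/
structure Fields (α : Type*) where
  phiStar : Finset α → ℂ
  phi : Finset α → ℂ
  A : Fin 4 → Finset α → ℂ

/-- The right-hand side of `□ φ^* = - i g (2 A·∂φ^* + (∂·A) φ^*) + g² A² φ^*`. -/
def phiStarSource (g : ℝ) (leg : α → Leg) (F : Fields α) : Finset α → ℂ := fun S =>
  ∑ μ, (metric μ : ℂ) *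
    (- Complex.I * g * (2 * conv (F.A μ) (pd leg μ F.phiStar) S
        + conv (pd leg μ (F.A μ)) F.phiStar S)
      + (g : ℂ) ^ 2 * conv (F.A μ) (conv (F.A μ) F.phiStar) S)

/-- The right-hand side of `□ φ = i g (2 A·∂φ + (∂·A) φ) + g² A² φ`. -/
def phiSource (g : ℝ) (leg : α → Leg) (F : Fields α) : Finset α → ℂ := fun S =>
  ∑ μ, (metric μ : ℂ) *
    (Complex.I * g * (2 * conv (F.A μ) (pd leg μ F.phi) S
        + conv (pd leg μ (F.A μ)) F.phi S)
      + (g : ℂ) ^ 2 * conv (F.A μ) (conv (F.A μ) F.phi) S)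

/-- The part `i g (φ ∂^ν φ^* - φ^* ∂^ν φ)` of the electromagnetic current (three-point vertex). -/
def cubicCurrent (g : ℝ) (leg : α → Leg) (phiStar phi : Finset α → ℂ) (ν : Fin 4) :
    Finset α → ℂ := fun S =>
  Complex.I * g * (conv phi (pd leg ν phiStar) S - conv phiStar (pd leg ν phi) S)

/-- The part `- 2 g² A^ν φ^* φ` of the electromagnetic current (four-point vertex). -/
def quarticCurrent (g : ℝ) (A : Fin 4 → Finset α → ℂ) (phiStar phi : Finset α → ℂ) (ν : Fin 4) :
    Finset α → ℂ := fun S =>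
  - 2 * (g : ℂ) ^ 2 * conv (A ν) (conv phiStar phi) S

/-- The right-hand side of `□ A^ν = i g (φ ∂^ν φ^* - φ^* ∂^ν φ) - 2 g² A^ν φ^* φ`, the Maxwell
equation in Feynman gauge. -/
def photonSource (g : ℝ) (leg : α → Leg) (F : Fields α) (ν : Fin 4) : Finset α → ℂ := fun S =>
  cubicCurrent g leg F.phiStar F.phi ν S + quarticCurrent g F.A F.phiStar F.phi ν S

/-- The external wave function of a one-leg set: the value `w i` on `{i}`, and zero on sets that
are not singletons. -/
def external (w : α → ℂ) : Finset α → ℂ := fun S => if S.card = 1 then ∑ i ∈ S, w i else 0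

/-- The operator `□⁻¹`; on the plane wave `exp (i k_S · x)` the operator `□` is `- k_S²`. -/
def propagate (leg : α → Leg) (J : Finset α → ℂ) : Finset α → ℂ := fun S =>
  - J S / (mdot (totalMom leg S) (totalMom leg S) : ℂ)

/-- One step of the perturbative solution of the field equations: external wave functions plus
propagators attached to the sources. An outgoing scalar is created by `φ^*`, an outgoing
antiscalar by `φ`. (On singletons the sources vanish as soon as the fields vanish on `∅`.) -/
def fieldStep (g : ℝ) (leg : α → Leg) (F : Fields α) : Fields α where
  phiStar := fun S =>
    external (fun i => if (leg i).species = .scalar then 1 else 0) S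
      + propagate leg (phiStarSource g leg F) S
  phi := fun S =>
    external (fun i => if (leg i).species = .antiscalar then 1 else 0) S
      + propagate leg (phiSource g leg F) S
  A := fun μ S =>
    external (fun i => if (leg i).species = .photon then (leg i).wave μ else 0) S
      + propagate leg (photonSource g leg F μ) S

/-- The tree-level matrix elements `⟨S| φ^* |0⟩`, `⟨S| φ |0⟩`, `⟨S| A^μ |0⟩`: the sum over all
tree Feynman diagrams (in Feynman gauge) with external legs `S` and one leg ending on the field.
The iteration is stationary on `S` after `S.card` steps. -/
def treeFields [Fintype α] (g : ℝ) (leg : α → Leg) : Fields α :=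
  (fieldStep g leg)^[Fintype.card α] ⟨fun _ => 0, fun _ => 0, fun _ _ => 0⟩

/-! ### Wilson lines -/

/-- Matrix elements of `∫_0^∞ ds v·A(s v) exp (- ε s)` in the limit `ε → 0+`. -/
def outgoingRay (leg : α → Leg) (A : Fin 4 → Finset α → ℂ) (v : Vec) : Finset α → ℂ := fun S =>
  Filter.limUnder (𝓝[>] (0 : ℝ)) fun ε : ℝ =>
    ∫ s in Set.Ioi (0 : ℝ),
      cdot (toC v) (fun μ => A μ S) *
        Complex.exp (Complex.I * ((s * mdot v (totalMom leg S) : ℝ) : ℂ)) *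
        (Real.exp (- ε * s) : ℂ)

/-- Matrix elements of `∫_{-∞}^0 ds v·A(s v) exp (ε s)` in the limit `ε → 0+`. -/
def incomingRay (leg : α → Leg) (A : Fin 4 → Finset α → ℂ) (v : Vec) : Finset α → ℂ := fun S =>
  Filter.limUnder (𝓝[>] (0 : ℝ)) fun ε : ℝ =>
    ∫ s in Set.Iic (0 : ℝ),
      cdot (toC v) (fun μ => A μ S) *
        Complex.exp (Complex.I * ((s * mdot v (totalMom leg S) : ℝ) : ℂ)) *
        (Real.exp (ε * s) : ℂ)

/-- The outgoing Wilson line `Y_v = exp (- i g ∫_0^∞ ds v·A(s v))`; also `W_j`, with `v = t_j`. -/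
def wilsonOut (g : ℝ) (leg : α → Leg) (A : Fin 4 → Finset α → ℂ) (v : Vec) : Finset α → ℂ :=
  convExp fun S => - Complex.I * g * outgoingRay leg A v S

/-- The outgoing Wilson line `Y_v^† = exp (i g ∫_0^∞ ds v·A(s v))`; also `W_j^†`. -/
def wilsonOutDag (g : ℝ) (leg : α → Leg) (A : Fin 4 → Finset α → ℂ) (v : Vec) : Finset α → ℂ :=
  convExp fun S => Complex.I * g * outgoingRay leg A v S

/-- The incoming Wilson line `exp (i g ∫_{-∞}^0 ds v·A(s v))`. -/
def wilsonIn (g : ℝ) (leg : α → Leg) (A : Fin 4 → Finset α → ℂ) (v : Vec) : Finset α → ℂ :=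
  convExp fun S => Complex.I * g * incomingRay leg A v S

/-- The adjoint incoming Wilson line `exp (- i g ∫_{-∞}^0 ds v·A(s v))`. -/
def wilsonInDag (g : ℝ) (leg : α → Leg) (A : Fin 4 → Finset α → ℂ) (v : Vec) : Finset α → ℂ :=
  convExp fun S => - Complex.I * g * incomingRay leg A v S

/-- The covariant derivative `D_μ = ∂_μ - i g A_μ` (covariant index). -/
def covD (g : ℝ) (leg : α → Leg) (A : Fin 4 → Finset α → ℂ) (μ : Fin 4) (F : Finset α → ℂ) :
    Finset α → ℂ := fun S =>
  (metric μ : ℂ) * (pd leg μ F S - Complex.I * g * conv (A μ) F S)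

/-! ### The process `γ γ → X₃ X₄ ; X_s` -/

/-- The sector to which a particle of the final state belongs. -/
inductive Sector : Type
  | jet3
  | jet4
  | soft
  deriving DecidableEq

/-- Momenta and polarizations of the process, and the directions of the collinear Wilson lines.
The final-state particles are labelled by `ι`, the two incoming photons by `Fin 2` (photon `1` is
`0`, photon `2` is `1`). -/
structure Kinematics (ι : Type*) where
  q : ι → Vec
  pol : ι → CVec
  p : Fin 2 → Vec
  polIn : Fin 2 → CVec
  t3 : Vec
  t4 : Vec
  tIn : Fin 2 → Vec

variable {ι : Type*} [Fintype ι] [DecidableEq ι]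

/-- The final-state particles in a sector. -/
def members (sec : ι → Sector) (s : Sector) : Finset ι := Finset.univ.filter fun i => sec i = s

/-- The total charge of a sector. -/
def sectorCharge (sp : ι → Species) (sec : ι → Sector) (s : Sector) : ℤ :=
  ∑ i ∈ members sec s, (sp i).charge

/-- The exponent in the leading power `λ ^ (-leadingExponent)` of the amplitude: one power for each
additional particle in a jet, two powers for each soft particle. -/
def leadingExponent (sec : ι → Sector) : ℤ :=
  (((members sec .jet3).card : ℤ) - 1) + (((members sec .jet4).card : ℤ) - 1)
    + 2 * ((members sec .soft).card : ℤ)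

namespace Kinematics

variable (kin : Kinematics ι)

/-- The total momentum of a sector. -/
def sectorMom (sec : ι → Sector) (s : Sector) : Vec := ∑ i ∈ members sec s, kin.q i

/-- The external legs: the outgoing particles and the two incoming photons. -/
def legs (sp : ι → Species) : ι ⊕ Fin 2 → Leg
  | .inl i => ⟨sp i, kin.q i, fun μ => star (kin.pol i μ)⟩
  | .inr a => ⟨.photon, - kin.p a, kin.polIn a⟩

/-- The legs of a sector of the final state. -/
def state (sec : ι → Sector) (s : Sector) : Finset (ι ⊕ Fin 2) :=
  (members sec s).map Function.Embedding.inl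

/-- All legs except the incoming photon `1`. -/
def allButFirst : Finset (ι ⊕ Fin 2) := Finset.univ.erase (Sum.inr 0)

/-- The diagrams sorted by the place where the incoming photon `2` enters the scalar line on which
the incoming photon `1` is absorbed: at the same four-point vertex (`contact`), on the side of
the outgoing scalar (`tChannel`) or on the side of the outgoing antiscalar (`uChannel`). -/
inductive Channel : Type
  | contact
  | tChannel
  | uChannel
  deriving DecidableEq

/-- The tree-level amplitude `i M = ⟨X₃ X₄ ; X_s | ε₁(p₁) ε₂(p₂)⟩`, without the factor
`(2π)⁴ δ⁴` of momentum conservation: the amputated photon leg contracted with `ε₁`. -/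
def amplitude (g : ℝ) (sp : ι → Species) : ℂ :=
  - Complex.I * cdot (kin.polIn 0) fun ν =>
    photonSource g (kin.legs sp) (treeFields g (kin.legs sp)) ν allButFirst

/-- The part of the amplitude that is given by the diagrams of one channel. -/
def channelAmplitude (g : ℝ) (sp : ι → Species) : Channel → ℂ
  | .contact => - Complex.I * cdot (kin.polIn 0) fun ν =>
      quarticCurrent g (fun μ => withLeg (Sum.inr 1) ((treeFields g (kin.legs sp)).A μ))
        (treeFields g (kin.legs sp)).phiStar (treeFields g (kin.legs sp)).phi ν allButFirst
  | .tChannel => - Complex.I * cdot (kin.polIn 0) fun ν =>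
      cubicCurrent g (kin.legs sp) (withLeg (Sum.inr 1) (treeFields g (kin.legs sp)).phiStar)
          (treeFields g (kin.legs sp)).phi ν allButFirst
        + quarticCurrent g (treeFields g (kin.legs sp)).A
          (withLeg (Sum.inr 1) (treeFields g (kin.legs sp)).phiStar)
          (treeFields g (kin.legs sp)).phi ν allButFirst
  | .uChannel => - Complex.I * cdot (kin.polIn 0) fun ν =>
      cubicCurrent g (kin.legs sp) (treeFields g (kin.legs sp)).phiStar
          (withLeg (Sum.inr 1) (treeFields g (kin.legs sp)).phi) ν allButFirst
        + quarticCurrent g (treeFields g (kin.legs sp)).A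
          (treeFields g (kin.legs sp)).phiStar
          (withLeg (Sum.inr 1) (treeFields g (kin.legs sp)).phi) ν allButFirst

/-- The tensor of a channel in the hard coefficient, with `P₁ = p₁` and `P₃`, `P₄` the total
momenta of the jets: `g^{μν}`, `- P₄^μ P₃^ν / (P₄·P₁)` and `- P₃^μ P₄^ν / (P₃·P₁)`. -/
def hardTensor (sec : ι → Sector) (μ ν : Fin 4) : Channel → ℝ
  | .contact => if μ = ν then metric μ else 0
  | .tChannel => - (kin.sectorMom sec .jet4 μ * kin.sectorMom sec .jet3 ν)
      / mdot (kin.sectorMom sec .jet4) (kin.p 0)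
  | .uChannel => - (kin.sectorMom sec .jet3 μ * kin.sectorMom sec .jet4 ν)
      / mdot (kin.sectorMom sec .jet3) (kin.p 0)

/-- `⟨0| Wbar_a^† D_μ Wbar_a |ε_a(p_a)⟩` for the incoming photon `a`. -/
def incomingME (g : ℝ) (sp : ι → Species) (a : Fin 2) (μ : Fin 4) : ℂ :=
  conv (wilsonInDag g (kin.legs sp) (treeFields g (kin.legs sp)).A (kin.tIn a))
    (covD g (kin.legs sp) (treeFields g (kin.legs sp)).A μ
      (wilsonIn g (kin.legs sp) (treeFields g (kin.legs sp)).A (kin.tIn a)))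
    {Sum.inr a}

/-- `⟨0| - i g A_μ |ε_a(p_a)⟩` for the incoming photon `a`. -/
def incomingField (g : ℝ) (sp : ι → Species) (a : Fin 2) (μ : Fin 4) : ℂ :=
  - Complex.I * g * ((metric μ : ℂ) * (treeFields g (kin.legs sp)).A μ {Sum.inr a})

/-- `⟨X₃| φ^* W₃ |0⟩`. -/
def collinear3 (g : ℝ) (sp : ι → Species) (sec : ι → Sector) : ℂ :=
  conv (treeFields g (kin.legs sp)).phiStar
    (wilsonOut g (kin.legs sp) (treeFields g (kin.legs sp)).A kin.t3) (state sec .jet3)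

/-- `⟨X₄| W₄^† φ |0⟩`. -/
def collinear4 (g : ℝ) (sp : ι → Species) (sec : ι → Sector) : ℂ :=
  conv (wilsonOutDag g (kin.legs sp) (treeFields g (kin.legs sp)).A kin.t4)
    (treeFields g (kin.legs sp)).phi (state sec .jet4)

/-- `⟨X_s| Y₃^† Y₄ |0⟩`, with `Y_j` along the direction `n_j` of the jet `j`. -/
def softME (g : ℝ) (sp : ι → Species) (sec : ι → Sector) : ℂ :=
  conv
    (wilsonOutDag g (kin.legs sp) (treeFields g (kin.legs sp)).A
      (lightDir (kin.sectorMom sec .jet3)))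
    (wilsonOut g (kin.legs sp) (treeFields g (kin.legs sp)).A
      (lightDir (kin.sectorMom sec .jet4)))
    (state sec .soft)

/-- The factorized expression
`-2 i [g^{μν} - P₄^μ P₃^ν/(P₄·P₁) - P₃^μ P₄^ν/(P₃·P₁)] ⟨0|Wbar₁^† D_μ Wbar₁|ε₁⟩`
`⟨0|Wbar₂^† D_ν Wbar₂|ε₂⟩ ⟨X₃|φ^* W₃|0⟩ ⟨X₄|W₄^† φ|0⟩ ⟨X_s|Y₃^† Y₄|0⟩`. -/
def factorized (g : ℝ) (sp : ι → Species) (sec : ι → Sector) : ℂ :=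
  - 2 * Complex.I *
    (∑ μ, ∑ ν,
      ((kin.hardTensor sec μ ν .contact + kin.hardTensor sec μ ν .tChannel
          + kin.hardTensor sec μ ν .uChannel : ℝ) : ℂ)
        * kin.incomingME g sp 0 μ * kin.incomingME g sp 1 ν)
    * kin.collinear3 g sp sec * kin.collinear4 g sp sec * kin.softME g sp sec

/-- The factorized expression of a single channel, with the gauge field itself in the matrix
elements of the incoming photons. -/
def channelFactorized (g : ℝ) (sp : ι → Species) (sec : ι → Sector) (c : Channel) : ℂ :=
  - 2 * Complex.I *
    (∑ μ, ∑ ν, (kin.hardTensor sec μ ν c : ℂ)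
        * kin.incomingField g sp 0 μ * kin.incomingField g sp 1 ν)
    * kin.collinear3 g sp sec * kin.collinear4 g sp sec * kin.softME g sp sec

/-- On-shell massless momenta with positive energy, momentum conservation, and physical
polarization vectors, `k·ε = 0` and `ε^*·ε = -1`. -/
structure Physical (sp : ι → Species) : Prop where
  onShell : ∀ i, mdot (kin.q i) (kin.q i) = 0 ∧ 0 < kin.q i 0
  onShellIn : ∀ a, mdot (kin.p a) (kin.p a) = 0 ∧ 0 < kin.p a 0
  conservation : ∑ i, kin.q i = kin.p 0 + kin.p 1
  polarization : ∀ i, sp i = .photon →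
    cdot (toC (kin.q i)) (kin.pol i) = 0 ∧ cdot (star (kin.pol i)) (kin.pol i) = -1
  polarizationIn : ∀ a,
    cdot (toC (kin.p a)) (kin.polIn a) = 0 ∧ cdot (star (kin.polIn a)) (kin.polIn a) = -1

/-- Light-like directions of the collinear Wilson lines, not collinear to their sectors. -/
structure WilsonDirections (sec : ι → Sector) (K : ℝ) : Prop where
  out3 : mdot kin.t3 kin.t3 = 0 ∧ 0 < kin.t3 0 ∧ kin.t3 0 ≤ K
  sep3 : 1 / K ≤ mdot kin.t3 (lightDir (kin.sectorMom sec .jet3))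
  out4 : mdot kin.t4 kin.t4 = 0 ∧ 0 < kin.t4 0 ∧ kin.t4 0 ≤ K
  sep4 : 1 / K ≤ mdot kin.t4 (lightDir (kin.sectorMom sec .jet4))
  inc : ∀ a, mdot (kin.tIn a) (kin.tIn a) = 0 ∧ 0 < kin.tIn a 0 ∧ kin.tIn a 0 ≤ K
  sepIn : ∀ a, 1 / K ≤ mdot (kin.tIn a) (kin.p a)

/-- The power counting of a two-jet state with soft radiation, in units of the hard scale: all
`∼` hold up to the factor `K`.  Collinear momenta scale as `(λ², 1, λ)` in the light-cone
coordinates `(n·q, nbar·q, q_⊥)` of their jet, soft momenta as `(λ², λ², λ²)`; the incoming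
photons and the jets point in well-separated directions; and the invariants that occur in
propagators are not smaller than their generic size (which involves the particles pairwise, and
only pairs with at least one charged particle, as well as the angles of soft particles). -/
structure PowerCounting (sp : ι → Species) (sec : ι → Sector) (K lam : ℝ) : Prop where
  collinear : ∀ s, s ≠ .soft → ∀ i ∈ members sec s,
    mdot (lightDir (kin.sectorMom sec s)) (kin.q i) ≤ K * lam ^ 2 ∧
    mdot (lightDirBar (kin.sectorMom sec s)) (kin.q i) ≤ K ∧
    1 / K ≤ mdot (lightDirBar (kin.sectorMom sec s)) (kin.q i) ∧
    ∀ μ, |perp (kin.sectorMom sec s) (kin.q i) μ| ≤ K * lam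
  soft : ∀ i ∈ members sec .soft, ∀ μ, |kin.q i μ| ≤ K * lam ^ 2
  incomingEnergy : ∀ a, kin.p a 0 ≤ K
  sepBeams : 1 / K ≤ mdot (kin.p 0) (kin.p 1)
  sepJets : 1 / K ≤ mdot (lightDir (kin.sectorMom sec .jet3)) (lightDir (kin.sectorMom sec .jet4))
  sepBeamJet : ∀ a, ∀ s, s ≠ .soft → 1 / K ≤ mdot (kin.p a) (lightDir (kin.sectorMom sec s))
  sepSoftJet : ∀ i ∈ members sec .soft, ∀ s, s ≠ .soft →
    lam ^ 2 / K ≤ mdot (lightDir (kin.sectorMom sec s)) (kin.q i)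
  resolvedJet : ∀ s, s ≠ .soft → ∀ i ∈ members sec s, ∀ j ∈ members sec s, i ≠ j →
    sp i ≠ .photon → lam ^ 2 / K ≤ mdot (kin.q i) (kin.q j)
  resolvedSoft : ∀ i ∈ members sec .soft, ∀ j ∈ members sec .soft, i ≠ j →
    sp i ≠ .photon → lam ^ 4 / K ≤ mdot (kin.q i) (kin.q j)
  resolvedBeam : ∀ i ∈ members sec .soft, sp i ≠ .photon →
    ∀ a, lam ^ 2 / K ≤ mdot (kin.p a) (kin.q i)

/-- Polarization vectors with bounded components, as for helicity polarization vectors whose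
reference vectors are not collinear to the momentum of the photon. -/
def GenericPolarizations (sp : ι → Species) (K : ℝ) : Prop :=
  (∀ i, sp i = .photon → ∀ μ, ‖kin.pol i μ‖ ≤ K) ∧ ∀ a μ, ‖kin.polIn a μ‖ ≤ K

end Kinematics

end ScalarQED

end

open ScalarQED

/-!
The proof is an estimate of tree-level fields by induction over sets of external legs.

*Fields and gauge invariance.* The tree-level fields are functions of finite sets of legs. With the
product that distributes the legs over the two factors they form the commutative ring `SetFun`, on
which the derivatives, and the operation that keeps the terms with a given leg, are derivations. In
this ring the Feynman rules are the classical field equations: the charged fields are annihilated by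
the covariant d'Alembertian (`covBox_treeScalar`), whose gauge covariance (`covBox_gauge`) and the
invariance and conservation of the current (`current_gauge`, `current_conservation`) are formal
identities. They hold off shell for all sets of legs without photon `1`, whose vertex is the current.

*Choice of gauge.* The gauge parameter `Family.gauge` is chosen separately on each kind of sets of
legs: axial along the collinear Wilson line on the legs of one jet, temporal for a single soft
photon. In this gauge the wave functions are bounded, and dressing a field by a collinear Wilson line
amounts to the gauge transformation itself, so that the collinear matrix elements are the transformed
charged fields on the legs of the jets (`Family.scalar_jet3`, `Family.scalar_jet4`). The soft matrix
element does not change (`Family.softFactor_eq`), because the gauge parameters cancel between the two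
oppositely charged Wilson lines.

*Power counting.* A `PowerSystem` collects the field equations and the sizes of momenta, wave
functions and propagators in a filtered ring, and the estimates for its fields follow by induction
over the set of legs: soft fields (`PowerSystem.soft_mem`), fields of one jet with additional soft
legs (`PowerSystem.jet_bound`), of both jets (`PowerSystem.both_mem`), and of these together with
photon `2` (`PowerSystem.beam_bound`). The coupling of soft fields to a jet is eikonal. The enhanced
part of the current of a jet points along the direction `n` of the jet and drops out in the axial
gauge, up to a term along the momentum of the emitted field. The soft emission from a charged field
of a jet exponentiates into a Wilson line, and charge conservation in the jets fixes which of the two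
charged fields each jet comes from. The product of the two charged fields thus factorizes into the
jets and the soft Wilson lines (`PowerSystem.pp_full_mem`), and photon `2` enters next to this
product at leading power (`PowerSystem.contact_mem`, `PowerSystem.beam_cubic_mem`), with a
propagator that depends only on the total momentum of a jet.

*Uniformity.* The constants have to be independent of the process. The ring of a `PowerSystem` is
therefore taken to be the functions on a `Family` of processes, filtered by uniform bounds in powers
of `λ` (`powFiltration`); propagators are invertible elements by the lower bounds of
`Kinematics.resolved`.

*Incoming photons.* For the sum of the three channels both incoming photons are put into the axial
gauges of their Wilson lines, where all physical polarization vectors are bounded; the amplitude does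
not change by current conservation (`Family.amplitude_eq`), and the right-hand side is written in
this gauge (`Family.factorized_eq`). A single channel is not invariant under gauge transformations of
photon `2`, but it is invariant under those that are trivial on all sets with photon `2`
(`Family.channelAmp_of_c_eq_zero`), so that the estimates apply to given bounded polarization vectors.
-/
noncomputable section
namespace ScalarQED
open scoped Topology

set_option linter.unusedSectionVars false

/-! ### The ring of functions of finite sets of legs -/

/-- Functions of finite sets of legs with the product `conv`, as a commutative ring. -/
def SetFun (α : Type*) : Type _ := Finset α → ℂ

namespace SetFun

instance (α : Type*) : AddCommGroup (SetFun α) := inferInstanceAs (AddCommGroup (Finset α → ℂ))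
instance (α : Type*) : Module ℂ (SetFun α) := inferInstanceAs (Module ℂ (Finset α → ℂ))

variable {α : Type*} [DecidableEq α]

instance : Mul (SetFun α) := ⟨conv⟩
instance : One (SetFun α) := ⟨convOne⟩

theorem mul_apply (F G : SetFun α) (S : Finset α) :
    (F * G) S = ∑ T ∈ S.powerset, F T * G (S \ T) := rfl

theorem one_apply (S : Finset α) : (1 : SetFun α) S = if S = ∅ then 1 else 0 := rfl

theorem add_apply (F G : SetFun α) (S : Finset α) : (F + G) S = F S + G S := rfl

theorem sub_apply (F G : SetFun α) (S : Finset α) : (F - G) S = F S - G S := rfl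

theorem neg_apply (F : SetFun α) (S : Finset α) : (-F) S = -F S := rfl

theorem zero_apply (S : Finset α) : (0 : SetFun α) S = 0 := rfl

theorem smul_apply (c : ℂ) (F : SetFun α) (S : Finset α) : (c • F) S = c * F S := rfl

theorem sum_apply {β : Type*} (s : Finset β) (F : β → SetFun α) (S : Finset α) :
    (∑ i ∈ s, F i) S = ∑ i ∈ s, F i S := Finset.sum_apply S s F

@[ext] theorem ext {F G : SetFun α} (h : ∀ S, F S = G S) : F = G := funext h

protected theorem mul_comm (F G : SetFun α) : F * G = G * F := by
  ext S
  rw [mul_apply, mul_apply]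
  refine Finset.sum_nbij' (fun T => S \ T) (fun T => S \ T) ?_ ?_ ?_ ?_ ?_
  · intro T _; simp
  · intro T _; simp
  · intro T hT; simpa using hT
  · intro T hT; simpa using hT
  · intro T hT
    rw [Finset.sdiff_sdiff_eq_self (Finset.mem_powerset.1 hT), mul_comm]

protected theorem one_mul (F : SetFun α) : 1 * F = F := by
  ext S
  rw [mul_apply, Finset.sum_eq_single ∅]
  · simp [one_apply]
  · intro T _ hT; simp [one_apply, hT]
  · simp

protected theorem mul_assoc (F G H : SetFun α) : F * G * H = F * (G * H) := by
  ext S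
  simp only [mul_apply, Finset.sum_mul, Finset.mul_sum]
  rw [Finset.sum_sigma', Finset.sum_sigma']
  refine Finset.sum_nbij' (fun p => ⟨p.2, p.1 \ p.2⟩) (fun p => ⟨p.1 ∪ p.2, p.1⟩) ?_ ?_ ?_ ?_ ?_
  · rintro ⟨T, U⟩ h
    simp only [Finset.mem_sigma, Finset.mem_powerset] at h ⊢
    exact ⟨h.2.trans h.1, Finset.sdiff_subset_sdiff h.1 le_rfl⟩
  · rintro ⟨T, U⟩ h
    simp only [Finset.mem_sigma, Finset.mem_powerset] at h ⊢
    exact ⟨Finset.union_subset h.1 (h.2.trans Finset.sdiff_subset), Finset.subset_union_left⟩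
  · rintro ⟨T, U⟩ h
    simp only [Finset.mem_sigma, Finset.mem_powerset] at h
    simp [Finset.union_sdiff_of_subset h.2]
  · rintro ⟨T, U⟩ h
    simp only [Finset.mem_sigma, Finset.mem_powerset] at h
    have : Disjoint T U := Finset.disjoint_of_subset_right h.2 Finset.disjoint_sdiff
    simp [Finset.union_sdiff_cancel_left this]
  · rintro ⟨T, U⟩ h
    simp only [Finset.mem_sigma, Finset.mem_powerset] at h
    have e : (S \ U) \ (T \ U) = S \ T := by
      ext a
      have := @h.2 a
      simp only [Finset.mem_sdiff]
      tauto
    simp only [e, mul_assoc]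

instance : CommRing (SetFun α) where
  __ := (inferInstance : AddCommGroup (SetFun α))
  __ := (inferInstance : Mul (SetFun α))
  __ := (inferInstance : One (SetFun α))
  mul_assoc := SetFun.mul_assoc
  one_mul := SetFun.one_mul
  mul_one F := by rw [SetFun.mul_comm, SetFun.one_mul]
  mul_comm := SetFun.mul_comm
  left_distrib F G H := by
    ext S; simp only [mul_apply, add_apply, mul_add, Finset.sum_add_distrib]
  right_distrib F G H := by
    ext S; simp only [mul_apply, add_apply, add_mul, Finset.sum_add_distrib]
  zero_mul F := by ext S; simp [mul_apply, zero_apply]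
  mul_zero F := by ext S; simp [mul_apply, zero_apply]

instance : Algebra ℂ (SetFun α) := Algebra.ofModule
  (fun c F G => by
    ext S; simp only [mul_apply, smul_apply, Finset.mul_sum, mul_assoc])
  (fun c F G => by
    ext S; simp only [mul_apply, smul_apply, Finset.mul_sum, mul_left_comm])

/-- A function of finite sets as an element of the ring of set functions. -/
def of (F : Finset α → ℂ) : SetFun α := F

theorem of_apply (F : Finset α → ℂ) (S : Finset α) : of F S = F S := rfl

theorem conv_apply (F G : Finset α → ℂ) (S : Finset α) : conv F G S = (of F * of G) S := rfl

theorem of_conv (F G : Finset α → ℂ) : of (conv F G) = of F * of G := rfl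

/-- Multiplication by an additive function of the set of legs, as a linear map. -/
def weightLin (w : α → ℂ) : SetFun α →ₗ[ℂ] SetFun α where
  toFun F := fun S => (∑ i ∈ S, w i) * F S
  map_add' F G := funext fun S => mul_add _ (F S) (G S)
  map_smul' c F := funext fun S => mul_left_comm _ c (F S)

theorem weightLin_apply (w : α → ℂ) (F : SetFun α) (S : Finset α) :
    weightLin w F S = (∑ i ∈ S, w i) * F S := rfl

/-- Multiplication by an additive function of the set of legs, as a derivation. -/
def weight (w : α → ℂ) : Derivation ℂ (SetFun α) (SetFun α) :=
  Derivation.mk' (weightLin w) fun F G => by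
    ext S
    rw [smul_eq_mul, smul_eq_mul, SetFun.mul_comm G, add_apply, weightLin_apply, mul_apply,
      mul_apply, mul_apply, Finset.mul_sum, ← Finset.sum_add_distrib]
    refine Finset.sum_congr rfl fun T hT => ?_
    rw [← Finset.sum_sdiff (Finset.mem_powerset.1 hT), weightLin_apply, weightLin_apply]
    ring

theorem weight_apply (w : α → ℂ) (F : SetFun α) (S : Finset α) :
    weight w F S = (∑ i ∈ S, w i) * F S := rfl

theorem mul_empty (F G : SetFun α) : (F * G) ∅ = F ∅ * G ∅ := by simp [mul_apply]

/-- A factor that vanishes on `∅` has to absorb at least one leg, so that the powers are locally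
nilpotent. -/
theorem pow_apply_eq_zero {F : SetFun α} (hF : F ∅ = 0) {m : ℕ} {S : Finset α} (h : S.card < m) :
    (F ^ m) S = 0 := by
  induction m generalizing S with
  | zero => omega
  | succ m ih =>
    rw [pow_succ', mul_apply]
    refine Finset.sum_eq_zero fun T hT => ?_
    by_cases h0 : T = ∅
    · simp [h0, hF]
    · have h1 := Finset.card_sdiff_add_card_eq_card (Finset.mem_powerset.1 hT)
      have h2 := Finset.card_pos.2 (Finset.nonempty_iff_ne_empty.2 h0)
      rw [ih (by omega), mul_zero]

theorem convPow_eq (F : SetFun α) (m : ℕ) : convPow F m = (F ^ m : SetFun α) := by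
  induction m with
  | zero => rfl
  | succ m ih =>
    rw [pow_succ', ← ih]; rfl

/-- The value of a product on `S` only depends on the values of the factors on subsets of `S`. -/
theorem mul_congr {F F' G G' : SetFun α} {S : Finset α} (hF : ∀ T ⊆ S, F T = F' T)
    (hG : ∀ T ⊆ S, G T = G' T) : (F * G) S = (F' * G') S := by
  simp only [mul_apply]
  refine Finset.sum_congr rfl fun T hT => ?_
  rw [hF T (Finset.mem_powerset.1 hT), hG _ Finset.sdiff_subset]

theorem pow_congr {F F' : SetFun α} {S : Finset α} (hF : ∀ T ⊆ S, F T = F' T) (m : ℕ) :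
    (F ^ m) S = (F' ^ m) S := by
  induction m generalizing S with
  | zero => simp
  | succ m ih =>
    rw [pow_succ, pow_succ]
    exact mul_congr (fun T hT => ih fun U hU => hF U (hU.trans hT)) hF

/-- The exponential `convExp` as a map of the ring of set functions. -/
def exp (F : SetFun α) : SetFun α := convExp F

theorem exp_congr {F F' : SetFun α} {S : Finset α} (hF : ∀ T ⊆ S, F T = F' T) :
    exp F S = exp F' S := by
  simp only [exp, convExp, convPow_eq, pow_congr hF]

variable [Fintype α]

theorem pow_eq_zero {F : SetFun α} (hF : F ∅ = 0) : F ^ (Fintype.card α + 1) = 0 := by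
  ext S
  rw [pow_apply_eq_zero hF, zero_apply]
  exact Nat.lt_succ_of_le (Finset.card_le_univ S)

instance : Module ℚ (SetFun α) := Module.compHom _ (algebraMap ℚ ℂ)

theorem exp_eq_sum {F : SetFun α} (hF : F ∅ = 0) :
    exp F = ∑ m ∈ Finset.range (Fintype.card α + 1), ((m.factorial : ℂ))⁻¹ • F ^ m := by
  ext S
  rw [sum_apply]
  simp only [exp, convExp, convPow_eq, smul_apply]
  refine Finset.sum_subset ?_ ?_
  · intro m hm
    have := Finset.card_le_univ S
    simp only [Finset.mem_range] at hm ⊢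
    omega
  · intro m _ hm
    rw [pow_apply_eq_zero hF (by simpa using hm), mul_zero]

/-- On finitely many legs, the convolution exponential is the exponential of a nilpotent element, so
that the functional equation of the latter applies. -/
theorem exp_eq_nilpotentExp {F : SetFun α} (hF : F ∅ = 0) : exp F = IsNilpotent.exp F := by
  rw [exp_eq_sum hF, IsNilpotent.exp_eq_sum (pow_eq_zero hF)]
  refine Finset.sum_congr rfl fun m _ => ?_
  change _ = (algebraMap ℚ ℂ _) • (F ^ m)
  simp

theorem exp_add {F G : SetFun α} (hF : F ∅ = 0) (hG : G ∅ = 0) :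
    exp (F + G) = exp F * exp G := by
  rw [exp_eq_nilpotentExp hF, exp_eq_nilpotentExp hG, exp_eq_nilpotentExp (by rw [add_apply, hF, hG, add_zero])]
  exact IsNilpotent.exp_add_of_commute (mul_comm F G) ⟨_, pow_eq_zero hF⟩ ⟨_, pow_eq_zero hG⟩

theorem exp_empty (F : SetFun α) : exp F ∅ = 1 := by
  simp [exp, convExp, convPow, convOne]

theorem exp_zero : exp (0 : SetFun α) = 1 := by
  rw [exp_eq_nilpotentExp rfl, IsNilpotent.exp_zero]

theorem exp_mul_exp_neg {F : SetFun α} (hF : F ∅ = 0) : exp F * exp (-F) = 1 := by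
  rw [← exp_add hF (by rw [neg_apply, hF, neg_zero]), add_neg_cancel, exp_zero]

theorem derivation_exp (D : Derivation ℂ (SetFun α) (SetFun α)) {F : SetFun α}
    (hF : F ∅ = 0) (hD : D F ∅ = 0) :
    D (exp F) = D F * exp F := by
  have key : ∀ n : ℕ, D (∑ m ∈ Finset.range (n + 1), ((m.factorial : ℂ))⁻¹ • F ^ m)
      = D F * ∑ m ∈ Finset.range n, ((m.factorial : ℂ))⁻¹ • F ^ m := by
    intro n
    induction n with
    | zero => simp
    | succ n ih =>
      rw [Finset.sum_range_succ, map_add, ih, Finset.sum_range_succ _ n, mul_add, D.map_smul,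
        Derivation.leibniz_pow]
      congr 1
      rw [Nat.add_sub_cancel, Nat.factorial_succ, smul_eq_mul, ← Nat.cast_smul_eq_nsmul ℂ, smul_smul,
        mul_smul_comm, mul_comm (D F)]
      congr 1
      have : (n.factorial : ℂ) ≠ 0 := by exact_mod_cast n.factorial_ne_zero
      have : ((n : ℂ) + 1) ≠ 0 := by exact_mod_cast n.succ_ne_zero
      push_cast
      field_simp
  rw [exp_eq_sum hF, key, Finset.sum_range_succ, mul_add]
  have : D F * ((((Fintype.card α).factorial : ℂ))⁻¹ • F ^ Fintype.card α) = 0 := by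
    rw [mul_smul_comm]
    have : D F * F ^ Fintype.card α = 0 := by
      ext S
      rw [mul_apply]
      refine Finset.sum_eq_zero fun T hT => ?_
      by_cases h0 : T = ∅
      · rw [h0, hD, zero_mul]
      · have h1 := Finset.card_sdiff_add_card_eq_card (Finset.mem_powerset.1 hT)
        have h2 := Finset.card_pos.2 (Finset.nonempty_iff_ne_empty.2 h0)
        have h3 := Finset.card_le_univ S
        rw [pow_apply_eq_zero hF (by omega), mul_zero]
    rw [this, smul_zero]
  rw [this, add_zero]

theorem mul_singleton (F G : SetFun α) (i : α) :
    (F * G) {i} = F ∅ * G {i} + F {i} * G ∅ := by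
  have : ({i} : Finset α).powerset = {∅, {i}} := by
    ext T; simp [Finset.subset_singleton_iff]
  rw [mul_apply, this, Finset.sum_pair (Finset.singleton_ne_empty i).symm]
  simp

theorem exp_singleton (F : SetFun α) (i : α) : exp F {i} = F {i} := by
  simp only [exp, convExp, Finset.card_singleton, Finset.sum_range_succ, Finset.range_zero, convPow_eq,
    pow_zero, pow_one, one_apply, Finset.sum_empty]
  simp

end SetFun
end ScalarQED
end

noncomputable section
namespace ScalarQED
open scoped Topology
set_option linter.unusedSectionVars false

variable {α : Type*} [DecidableEq α]

/-! ### Gauge covariance and current conservation -/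

/-- The derivative `∂^μ` as a derivation of the ring of set functions. -/
def deriv4 (leg : α → Leg) (μ : Fin 4) : Derivation ℂ (SetFun α) (SetFun α) :=
  SetFun.weight fun i => Complex.I * ((leg i).mom μ : ℂ)

theorem totalMom_apply (leg : α → Leg) (S : Finset α) (μ : Fin 4) :
    totalMom leg S μ = ∑ i ∈ S, (leg i).mom μ := Finset.sum_apply μ S _

theorem deriv4_apply (leg : α → Leg) (μ : Fin 4) (F : SetFun α) (S : Finset α) :
    deriv4 leg μ F S = Complex.I * (totalMom leg S μ : ℂ) * F S := by
  rw [deriv4, SetFun.weight_apply, totalMom_apply, ← Finset.mul_sum]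
  push_cast
  rfl

theorem of_pd (leg : α → Leg) (μ : Fin 4) (F : Finset α → ℂ) :
    SetFun.of (pd leg μ F) = deriv4 leg μ (SetFun.of F) := by
  ext S
  rw [deriv4_apply]; rfl

/-- The operator `(∂ + i s g A)²`, with `s = 1` for the field `φ^*` and `s = -1` for `φ`. -/
def covBox (g : ℝ) (leg : α → Leg) (s : ℂ) (A : Fin 4 → SetFun α) (F : SetFun α) : SetFun α :=
  ∑ μ, (metric μ : ℂ) • (deriv4 leg μ (deriv4 leg μ F)
    + (Complex.I * s * g) • (2 * (A μ * deriv4 leg μ F) + deriv4 leg μ (A μ) * F)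
    - ((g : ℂ) ^ 2) • (A μ * (A μ * F)))

/-- The electromagnetic current with the fields in the ring of set functions. -/
def current (g : ℝ) (leg : α → Leg) (A : Fin 4 → SetFun α) (F G : SetFun α) (ν : Fin 4) :
    SetFun α :=
  (Complex.I * g) • (G * deriv4 leg ν F - F * deriv4 leg ν G)
    - (2 * (g : ℂ) ^ 2) • (A ν * (F * G))

theorem photonSource_apply (g : ℝ) (leg : α → Leg) (F : Fields α) (ν : Fin 4) (S : Finset α) :
    photonSource g leg F ν S = current g leg (fun μ => .of (F.A μ)) (.of F.phiStar) (.of F.phi) ν S := by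
  simp only [photonSource, cubicCurrent, quarticCurrent, SetFun.of_conv,
    SetFun.conv_apply, of_pd, current]
  rw [SetFun.sub_apply, SetFun.smul_apply, SetFun.smul_apply, SetFun.sub_apply]
  ring

theorem covBox_apply (g : ℝ) (leg : α → Leg) (s : ℂ) (A : Fin 4 → SetFun α) (F : SetFun α)
    (S : Finset α) : covBox g leg s A F S =
      - (mdot (totalMom leg S) (totalMom leg S) : ℂ) * F S
        + ∑ μ, (metric μ : ℂ) * (Complex.I * s * g * (2 * (A μ * deriv4 leg μ F) S
          + (deriv4 leg μ (A μ) * F) S) - (g : ℂ) ^ 2 * (A μ * (A μ * F)) S) := by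
  have h2 : ∀ G : SetFun α, (2 * G) S = 2 * G S := fun G => by
    rw [two_mul, SetFun.add_apply, two_mul]
  simp only [covBox, SetFun.sum_apply, SetFun.smul_apply, SetFun.add_apply, SetFun.sub_apply,
    deriv4_apply, h2, mdot]
  push_cast
  rw [← Finset.sum_neg_distrib, Finset.sum_mul, ← Finset.sum_add_distrib]
  refine Finset.sum_congr rfl fun μ _ => ?_
  linear_combination (metric μ : ℂ) * (totalMom leg S μ : ℂ) ^ 2 * F S * Complex.I_sq

theorem covBox_one_apply (g : ℝ) (leg : α → Leg) (F : Fields α) (S : Finset α) :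
    covBox g leg 1 (fun μ => .of (F.A μ)) (.of F.phiStar) S =
      - (mdot (totalMom leg S) (totalMom leg S) : ℂ) * F.phiStar S - phiStarSource g leg F S := by
  rw [covBox_apply]
  simp only [phiStarSource, SetFun.of_conv, SetFun.conv_apply, of_pd, sub_eq_add_neg]
  rw [← Finset.sum_neg_distrib, SetFun.of_apply]
  congr 1
  refine Finset.sum_congr rfl fun μ _ => ?_
  ring

theorem covBox_neg_one_apply (g : ℝ) (leg : α → Leg) (F : Fields α) (S : Finset α) :
    covBox g leg (-1) (fun μ => .of (F.A μ)) (.of F.phi) S =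
      - (mdot (totalMom leg S) (totalMom leg S) : ℂ) * F.phi S - phiSource g leg F S := by
  rw [covBox_apply]
  simp only [phiSource, SetFun.of_conv, SetFun.conv_apply, of_pd, sub_eq_add_neg]
  rw [← Finset.sum_neg_distrib, SetFun.of_apply]
  congr 1
  refine Finset.sum_congr rfl fun μ _ => ?_
  ring

/-- Gauge covariance of `(∂ + i s g A)²`: here `E` plays the role of `exp(-i s g r)`, of which only
the derivative matters. -/
theorem covBox_gauge (g : ℝ) (leg : α → Leg) {s : ℂ} (hs : s ^ 2 = 1) (A : Fin 4 → SetFun α)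
    (F r E : SetFun α)
    (hE : ∀ μ, deriv4 leg μ E = (-(Complex.I * s * g)) • (deriv4 leg μ r * E)) :
    covBox g leg s (fun μ => A μ + deriv4 leg μ r) (E * F) = E * covBox g leg s A F := by
  rw [covBox, covBox, Finset.mul_sum]
  refine Finset.sum_congr rfl fun μ _ => ?_
  rw [mul_smul_comm]
  congr 1
  have hEμ := hE μ
  set D := deriv4 leg μ
  have hc : (algebraMap ℂ (SetFun α) (Complex.I * s * g)) ^ 2
      = - (algebraMap ℂ (SetFun α) ((g : ℂ) ^ 2)) := by
    rw [← map_pow, ← map_neg]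
    congr 1
    rw [mul_pow, mul_pow, hs, Complex.I_sq]; ring
  simp only [D.leibniz, map_add, map_neg, hEμ, smul_eq_mul, Algebra.smul_def, neg_mul]
  simp only [D.map_algebraMap]
  generalize algebraMap ℂ (SetFun α) (Complex.I * s * g) = c at *
  generalize algebraMap ℂ (SetFun α) ((g : ℂ) ^ 2) = c2 at *
  have hc2 : c2 = - c ^ 2 := by rw [hc, neg_neg]
  rw [hc2]
  ring

/-- Gauge invariance of the current, with `E` and `E'` in the role of the inverse gauge factors
`exp(-i g r)` and `exp(i g r)` of the fields `φ^*` and `φ`. -/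
theorem current_gauge (g : ℝ) (leg : α → Leg) (A : Fin 4 → SetFun α)
    (F G r E E' : SetFun α) (hEE : E * E' = 1)
    (hE : ∀ μ, deriv4 leg μ E = (-(Complex.I * 1 * g)) • (deriv4 leg μ r * E))
    (hE' : ∀ μ, deriv4 leg μ E' = (-(Complex.I * (-1) * g)) • (deriv4 leg μ r * E')) (ν : Fin 4) :
    current g leg (fun μ => A μ + deriv4 leg μ r) (E * F) (E' * G) ν = current g leg A F G ν := by
  rw [current, current]
  have hEν := hE ν
  have hEν' := hE' ν
  set D := deriv4 leg ν
  have hc : (algebraMap ℂ (SetFun α) (Complex.I * g)) ^ 2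
      = - (algebraMap ℂ (SetFun α) ((g : ℂ) ^ 2)) := by
    rw [← map_pow, ← map_neg]
    congr 1
    rw [mul_pow, Complex.I_sq]; ring
  have e1 : (-(Complex.I * 1 * g)) = -(Complex.I * g) := by ring
  have e2 : (-(Complex.I * (-1) * g)) = (Complex.I * g) := by ring
  have e3 : algebraMap ℂ (SetFun α) 2 = 2 := map_ofNat _ 2
  rw [e1] at hEν
  rw [e2] at hEν'
  simp only [D.leibniz, hEν, hEν', smul_eq_mul, Algebra.smul_def, map_neg, map_mul _ (2 : ℂ), e3]
  generalize algebraMap ℂ (SetFun α) (Complex.I * g) = c at *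
  generalize algebraMap ℂ (SetFun α) ((g : ℂ) ^ 2) = c2 at *
  have hc2 : c2 = - c ^ 2 := by rw [hc, neg_neg]
  rw [hc2]
  linear_combination (c * (G * D F - F * D G) + 2 * c ^ 2 * A ν * F * G) * hEE

/-- The divergence of the current is a combination of the field equations, for arbitrary fields. -/
theorem current_conservation (g : ℝ) (leg : α → Leg) (A : Fin 4 → SetFun α) (F G : SetFun α) :
    ∑ ν, (metric ν : ℂ) • deriv4 leg ν (current g leg A F G ν)
      = (Complex.I * g) • (G * covBox g leg 1 A F - F * covBox g leg (-1) A G) := by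
  simp only [covBox, Finset.mul_sum]
  rw [← Finset.sum_sub_distrib, Finset.smul_sum]
  refine Finset.sum_congr rfl fun μ _ => ?_
  rw [mul_smul_comm, mul_smul_comm, ← smul_sub, smul_comm]
  congr 1
  rw [current]
  set D := deriv4 leg μ
  have hc : (algebraMap ℂ (SetFun α) (Complex.I * g)) ^ 2
      = - (algebraMap ℂ (SetFun α) ((g : ℂ) ^ 2)) := by
    rw [← map_pow, ← map_neg]
    congr 1
    rw [mul_pow, Complex.I_sq]; ring
  have e1 : (Complex.I * 1 * g) = (Complex.I * g) := by ring
  have e2 : (Complex.I * (-1) * g) = -(Complex.I * g) := by ring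
  have e3 : algebraMap ℂ (SetFun α) 2 = 2 := map_ofNat _ 2
  simp only [e1, e2, D.leibniz, map_sub, D.map_smul, smul_eq_mul]
  simp only [Algebra.smul_def, map_neg, map_mul _ (2 : ℂ), e3]
  generalize algebraMap ℂ (SetFun α) (Complex.I * g) = c at *
  generalize algebraMap ℂ (SetFun α) ((g : ℂ) ^ 2) = c2 at *
  have hc2 : c2 = - c ^ 2 := by rw [hc, neg_neg]
  rw [hc2]
  ring

/-! ### The tree-level fields -/

theorem SetFun.mul_congr_of_card_lt {F F' G G' : SetFun α} {n : ℕ} (h0 : F ∅ = 0) (h0' : F' ∅ = 0)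
    (h1 : G ∅ = 0) (h1' : G' ∅ = 0) (hF : ∀ S, S.card < n → F S = F' S)
    (hG : ∀ S, S.card < n → G S = G' S) {S : Finset α} (hS : S.card ≤ n) :
    (F * G) S = (F' * G') S := by
  simp only [SetFun.mul_apply]
  refine Finset.sum_congr rfl fun T hT => ?_
  have h := Finset.card_sdiff_add_card_eq_card (Finset.mem_powerset.1 hT)
  by_cases hT0 : T = ∅
  · simp [hT0, h0, h0']
  by_cases hT1 : S \ T = ∅
  · simp [hT1, h1, h1']
  have h2 := Finset.card_pos.2 (Finset.nonempty_iff_ne_empty.2 hT0)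
  have h3 := Finset.card_pos.2 (Finset.nonempty_iff_ne_empty.2 hT1)
  rw [hF T (by omega), hG _ (by omega)]

/-- Fields without vacuum expectation value. -/
def Fields.VanishEmpty (F : Fields α) : Prop :=
  F.phiStar ∅ = 0 ∧ F.phi ∅ = 0 ∧ ∀ μ, F.A μ ∅ = 0

/-- Fields that agree on all sets of less than `n` legs. -/
def Fields.AgreeBelow (n : ℕ) (F G : Fields α) : Prop := ∀ S : Finset α, S.card < n →
  F.phiStar S = G.phiStar S ∧ F.phi S = G.phi S ∧ ∀ μ, F.A μ S = G.A μ S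

theorem propagate_empty (leg : α → Leg) (J : Finset α → ℂ) : propagate leg J ∅ = 0 := by
  simp [propagate, totalMom, mdot]

theorem fieldStep_vanishEmpty (g : ℝ) (leg : α → Leg) (F : Fields α) :
    (fieldStep g leg F).VanishEmpty := by
  refine ⟨?_, ?_, fun μ => ?_⟩ <;> simp [fieldStep, propagate_empty, external]

/-- The sources are products of at least two fields without vacuum expectation value. Their values
on `n` legs only involve the fields on less than `n` legs. -/
theorem fieldStep_agreeBelow (g : ℝ) (leg : α → Leg) {F G : Fields α} (hF : F.VanishEmpty)
    (hG : G.VanishEmpty) {n : ℕ} (h : F.AgreeBelow n G) :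
    (fieldStep g leg F).AgreeBelow (n + 1) (fieldStep g leg G) := by
  intro S hS
  have hS' : S.card ≤ n := Nat.lt_succ_iff.1 hS
  obtain ⟨f1, f2, f3⟩ := hF
  obtain ⟨g1, g2, g3⟩ := hG
  have f1' : SetFun.of F.phiStar ∅ = 0 := f1
  have f2' : SetFun.of F.phi ∅ = 0 := f2
  have f3' : ∀ μ, SetFun.of (F.A μ) ∅ = 0 := f3
  have g1' : SetFun.of G.phiStar ∅ = 0 := g1
  have g2' : SetFun.of G.phi ∅ = 0 := g2
  have g3' : ∀ μ, SetFun.of (G.A μ) ∅ = 0 := g3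
  have d0 : ∀ μ (H : SetFun α), H ∅ = 0 → deriv4 leg μ H ∅ = 0 := fun μ H hH => by
    rw [deriv4_apply, hH, mul_zero]
  have dc : ∀ μ (H H' : SetFun α), (∀ S, S.card < n → H S = H' S) →
      ∀ S, S.card < n → deriv4 leg μ H S = deriv4 leg μ H' S := fun μ H H' hH S hS => by
    rw [deriv4_apply, deriv4_apply, hH S hS]
  have m0 : ∀ (H H' : SetFun α), H ∅ = 0 → (H * H') ∅ = 0 := fun H H' hH => by
    rw [SetFun.mul_empty, hH, zero_mul]
  have a1 : ∀ S : Finset α, S.card < n → SetFun.of F.phiStar S = SetFun.of G.phiStar S := fun S hS => (h S hS).1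
  have a2 : ∀ S : Finset α, S.card < n → SetFun.of F.phi S = SetFun.of G.phi S := fun S hS => (h S hS).2.1
  have a3 : ∀ μ, ∀ S : Finset α, S.card < n → SetFun.of (F.A μ) S = SetFun.of (G.A μ) S := fun μ S hS => (h S hS).2.2 μ
  have mc : ∀ {H H' K K' : SetFun α} (_ : H ∅ = 0) (_ : H' ∅ = 0)
    (_ : K ∅ = 0) (_ : K' ∅ = 0) (_ : ∀ S, S.card < n → H S = H' S)
    (_ : ∀ S, S.card < n → K S = K' S), ∀ S, S.card < n → (H * K) S = (H' * K') S :=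
    fun x1 x2 x3 x4 x5 x6 S hS => SetFun.mul_congr_of_card_lt x1 x2 x3 x4 x5 x6 hS.le
  refine ⟨?_, ?_, fun μ => ?_⟩
  · simp only [fieldStep, propagate, phiStarSource, SetFun.of_conv, SetFun.conv_apply, of_pd]
    congr 3
    refine Finset.sum_congr rfl fun μ _ => ?_
    rw [SetFun.mul_congr_of_card_lt (f3' μ) (g3' μ) (d0 μ _ f1') (d0 μ _ g1') (a3 μ) (dc μ _ _ a1) hS',
      SetFun.mul_congr_of_card_lt (d0 μ _ (f3' μ)) (d0 μ _ (g3' μ)) f1' g1' (dc μ _ _ (a3 μ)) a1 hS',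
      SetFun.mul_congr_of_card_lt (f3' μ) (g3' μ) (m0 _ _ (f3' μ)) (m0 _ _ (g3' μ)) (a3 μ)
        (mc (f3' μ) (g3' μ) f1' g1' (a3 μ) a1) hS']
  · simp only [fieldStep, propagate, phiSource, SetFun.of_conv, SetFun.conv_apply, of_pd]
    congr 3
    refine Finset.sum_congr rfl fun μ _ => ?_
    rw [SetFun.mul_congr_of_card_lt (f3' μ) (g3' μ) (d0 μ _ f2') (d0 μ _ g2') (a3 μ) (dc μ _ _ a2) hS',
      SetFun.mul_congr_of_card_lt (d0 μ _ (f3' μ)) (d0 μ _ (g3' μ)) f2' g2' (dc μ _ _ (a3 μ)) a2 hS',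
      SetFun.mul_congr_of_card_lt (f3' μ) (g3' μ) (m0 _ _ (f3' μ)) (m0 _ _ (g3' μ)) (a3 μ)
        (mc (f3' μ) (g3' μ) f2' g2' (a3 μ) a2) hS']
  · simp only [fieldStep, propagate, photonSource, cubicCurrent, quarticCurrent,
      SetFun.of_conv, SetFun.conv_apply, of_pd]
    rw [SetFun.mul_congr_of_card_lt f2' g2' (d0 μ _ f1') (d0 μ _ g1') a2 (dc μ _ _ a1) hS',
      SetFun.mul_congr_of_card_lt f1' g1' (d0 μ _ f2') (d0 μ _ g2') a1 (dc μ _ _ a2) hS',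
      SetFun.mul_congr_of_card_lt (f3' μ) (g3' μ) (m0 _ _ f1') (m0 _ _ g1') (a3 μ)
        (mc f1' g1' f2' g2' a1 a2) hS']

variable [Fintype α]

theorem iterate_fieldStep_vanishEmpty {g : ℝ} {leg : α → Leg} {u : ℕ → Fields α}
    (h0 : u 0 = ⟨fun _ => 0, fun _ => 0, fun _ _ => 0⟩)
    (hu : ∀ m, u (m + 1) = fieldStep g leg (u m)) (m : ℕ) : (u m).VanishEmpty := by
  cases m with
  | zero => rw [h0]; exact ⟨rfl, rfl, fun _ => rfl⟩
  | succ m => rw [hu]; exact fieldStep_vanishEmpty g leg _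

/-- Each iteration of the field equations adds the sets with one more leg, and leaves the smaller
ones unchanged. -/
theorem iterate_fieldStep_agreeBelow {g : ℝ} {leg : α → Leg} {u : ℕ → Fields α}
    (h0 : u 0 = ⟨fun _ => 0, fun _ => 0, fun _ _ => 0⟩)
    (hu : ∀ m, u (m + 1) = fieldStep g leg (u m)) (m : ℕ) :
    (fieldStep g leg (u m)).AgreeBelow (m + 1) (u m) := by
  have hv := iterate_fieldStep_vanishEmpty h0 hu
  induction m with
  | zero =>
    intro S hS
    have : S = ∅ := by rw [← Finset.card_eq_zero]; omega
    subst this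
    obtain ⟨h1, h2, h3⟩ := fieldStep_vanishEmpty g leg (u 0)
    obtain ⟨h1', h2', h3'⟩ := hv 0
    exact ⟨h1.trans h1'.symm, h2.trans h2'.symm, fun μ => (h3 μ).trans (h3' μ).symm⟩
  | succ m ih =>
    have h := fieldStep_agreeBelow g leg (fieldStep_vanishEmpty g leg _) (hv m) ih
    rw [← hu m] at h
    exact h

theorem treeFields_vanishEmpty (g : ℝ) (leg : α → Leg) : (treeFields g leg).VanishEmpty :=
  iterate_fieldStep_vanishEmpty (u := fun m => (fieldStep g leg)^[m] _) rfl
    (fun m => Function.iterate_succ_apply' _ m _) _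

/-- The tree-level fields solve the perturbative field equations. -/
theorem fieldStep_treeFields (g : ℝ) (leg : α → Leg) (S : Finset α) :
    (fieldStep g leg (treeFields g leg)).phiStar S = (treeFields g leg).phiStar S ∧
    (fieldStep g leg (treeFields g leg)).phi S = (treeFields g leg).phi S ∧
    ∀ μ, (fieldStep g leg (treeFields g leg)).A μ S = (treeFields g leg).A μ S :=
  iterate_fieldStep_agreeBelow (u := fun m => (fieldStep g leg)^[m] _) rfl
    (fun m => Function.iterate_succ_apply' _ m _) (Fintype.card α) S
    (Nat.lt_succ_of_le (Finset.card_le_univ S))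

end ScalarQED
end

noncomputable section
namespace ScalarQED
open scoped Topology
set_option linter.unusedSectionVars false

variable {α : Type*} [DecidableEq α]

/-! ### Charge conservation -/

/-- The function `F` is supported on sets of legs of total charge `c`. -/
def ChargeSupp (q : α → ℤ) (c : ℤ) (F : SetFun α) : Prop := ∀ S, F S ≠ 0 → ∑ i ∈ S, q i = c

namespace ChargeSupp

variable {q : α → ℤ} {c d : ℤ} {F G : SetFun α}

theorem apply_eq_zero (h : ChargeSupp q c F) {S : Finset α} (hS : ∑ i ∈ S, q i ≠ c) : F S = 0 := by
  by_contra h0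
  exact hS (h S h0)

theorem mul (hF : ChargeSupp q c F) (hG : ChargeSupp q d G) : ChargeSupp q (c + d) (F * G) := by
  intro S hS
  rw [SetFun.mul_apply] at hS
  obtain ⟨T, hT, h⟩ := Finset.exists_ne_zero_of_sum_ne_zero hS
  rw [← Finset.sum_sdiff (Finset.mem_powerset.1 hT), hF T (left_ne_zero_of_mul h),
    hG _ (right_ne_zero_of_mul h), add_comm]

theorem add (hF : ChargeSupp q c F) (hG : ChargeSupp q c G) : ChargeSupp q c (F + G) := by
  intro S hS
  rw [SetFun.add_apply] at hS
  by_cases h : F S = 0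
  · exact hG S (fun h' => hS (by rw [h, h', add_zero]))
  · exact hF S h

theorem smul (a : ℂ) (hF : ChargeSupp q c F) : ChargeSupp q c (a • F) := fun S hS =>
  hF S (right_ne_zero_of_mul (by rwa [SetFun.smul_apply] at hS))

theorem deriv (leg : α → Leg) (μ : Fin 4) (hF : ChargeSupp q c F) :
    ChargeSupp q c (deriv4 leg μ F) := fun S hS =>
  hF S (right_ne_zero_of_mul (by rwa [deriv4_apply] at hS))

theorem one : ChargeSupp q 0 (1 : SetFun α) := by
  intro S hS
  rw [SetFun.one_apply] at hS
  have : S = ∅ := by by_contra h; simp [h] at hS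
  simp [this]

theorem pow (hF : ChargeSupp q 0 F) (m : ℕ) : ChargeSupp q 0 (F ^ m) := by
  induction m with
  | zero => rw [pow_zero]; exact one
  | succ m ih => rw [pow_succ]; simpa using ih.mul hF

theorem exp (hF : ChargeSupp q 0 F) : ChargeSupp q 0 (SetFun.exp F) := by
  intro S hS
  simp only [SetFun.exp, convExp, SetFun.convPow_eq] at hS
  obtain ⟨m, _, h⟩ := Finset.exists_ne_zero_of_sum_ne_zero hS
  exact hF.pow m S (right_ne_zero_of_mul h)

end ChargeSupp

/-- Fields that conserve charge. -/
def Fields.Charged (q : α → ℤ) (F : Fields α) : Prop :=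
  ChargeSupp q 1 (.of F.phiStar) ∧ ChargeSupp q (-1) (.of F.phi) ∧ ∀ μ, ChargeSupp q 0 (.of (F.A μ))

theorem phiStarSource_chargeSupp (g : ℝ) (leg : α → Leg) {q : α → ℤ} {F : Fields α}
    (hF : F.Charged q) {S : Finset α} (hS : ∑ i ∈ S, q i ≠ 1) : phiStarSource g leg F S = 0 := by
  obtain ⟨h1, -, h3⟩ := hF
  simp only [phiStarSource, SetFun.conv_apply, SetFun.of_conv, of_pd]
  refine Finset.sum_eq_zero fun μ _ => ?_
  rw [((h3 μ).mul (h1.deriv leg μ)).apply_eq_zero (by simpa using hS),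
    (((h3 μ).deriv leg μ).mul h1).apply_eq_zero (by simpa using hS),
    ((h3 μ).mul ((h3 μ).mul h1)).apply_eq_zero (by simpa using hS)]
  ring

theorem phiSource_chargeSupp (g : ℝ) (leg : α → Leg) {q : α → ℤ} {F : Fields α}
    (hF : F.Charged q) {S : Finset α} (hS : ∑ i ∈ S, q i ≠ -1) : phiSource g leg F S = 0 := by
  obtain ⟨-, h1, h3⟩ := hF
  simp only [phiSource, SetFun.conv_apply, SetFun.of_conv, of_pd]
  refine Finset.sum_eq_zero fun μ _ => ?_
  rw [((h3 μ).mul (h1.deriv leg μ)).apply_eq_zero (by simpa using hS),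
    (((h3 μ).deriv leg μ).mul h1).apply_eq_zero (by simpa using hS),
    ((h3 μ).mul ((h3 μ).mul h1)).apply_eq_zero (by simpa using hS)]
  ring

theorem photonSource_chargeSupp (g : ℝ) (leg : α → Leg) {q : α → ℤ} {F : Fields α}
    (hF : F.Charged q) (ν : Fin 4) {S : Finset α} (hS : ∑ i ∈ S, q i ≠ 0) :
    photonSource g leg F ν S = 0 := by
  obtain ⟨h1, h2, h3⟩ := hF
  simp only [photonSource, cubicCurrent, quarticCurrent, SetFun.conv_apply, SetFun.of_conv, of_pd]
  rw [(h2.mul (h1.deriv leg ν)).apply_eq_zero (by simpa using hS),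
    (h1.mul (h2.deriv leg ν)).apply_eq_zero (by simpa using hS),
    ((h3 ν).mul (h1.mul h2)).apply_eq_zero (by simpa using hS)]
  ring

theorem external_eq_zero_or (w : α → ℂ) (S : Finset α) :
    external w S = 0 ∨ ∃ i, S = {i} ∧ external w S = w i := by
  by_cases h : S.card = 1
  · obtain ⟨i, rfl⟩ := Finset.card_eq_one.1 h
    exact Or.inr ⟨i, rfl, by simp [external]⟩
  · exact Or.inl (by simp [external, h])

theorem fieldStep_charged (g : ℝ) (leg : α → Leg) {F : Fields α}
    (hF : F.Charged fun i => (leg i).species.charge) :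
    (fieldStep g leg F).Charged fun i => (leg i).species.charge := by
  refine ⟨?_, ?_, fun μ => ?_⟩ <;> intro S hS <;> by_contra hc <;> apply hS
  · change external _ S + propagate leg _ S = 0
    rw [propagate, phiStarSource_chargeSupp g leg hF hc, neg_zero, zero_div, add_zero]
    rcases external_eq_zero_or _ S with h | ⟨i, rfl, h⟩
    · exact h
    · rw [h, if_neg]
      intro h'
      simp [h', Species.charge] at hc
  · change external _ S + propagate leg _ S = 0
    rw [propagate, phiSource_chargeSupp g leg hF hc, neg_zero, zero_div, add_zero]
    rcases external_eq_zero_or _ S with h | ⟨i, rfl, h⟩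
    · exact h
    · rw [h, if_neg]
      intro h'
      simp [h', Species.charge] at hc
  · change external _ S + propagate leg _ S = 0
    rw [propagate, photonSource_chargeSupp g leg hF μ hc, neg_zero, zero_div, add_zero]
    rcases external_eq_zero_or _ S with h | ⟨i, rfl, h⟩
    · exact h
    · rw [h, if_neg]
      intro h'
      simp [h', Species.charge] at hc

theorem treeFields_charged [Fintype α] (g : ℝ) (leg : α → Leg) :
    (treeFields g leg).Charged fun i => (leg i).species.charge := by
  unfold treeFields
  generalize Fintype.card α = m
  induction m with
  | zero => exact ⟨fun S h => absurd rfl h, fun S h => absurd rfl h, fun μ S h => absurd rfl h⟩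
  | succ m ih => rw [Function.iterate_succ_apply']; exact fieldStep_charged g leg ih

/-- Sets of photons only do not source the gauge field: there is no vertex with photons alone. -/
theorem photonSource_eq_zero_of_neutral (g : ℝ) (leg : α → Leg) {q : α → ℤ} {F : Fields α}
    (hF : F.Charged q) (ν : Fin 4) {S : Finset α} (hS : ∀ i ∈ S, q i = 0) :
    photonSource g leg F ν S = 0 := by
  obtain ⟨h1, h2, -⟩ := hF
  have h0 : ∀ T ⊆ S, SetFun.of F.phi T = 0 := fun T hT => h2.apply_eq_zero (by
    rw [Finset.sum_eq_zero fun i hi => hS i (hT hi)]; decide)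
  have m1 : ∀ G : SetFun α, ∀ T ⊆ S, (G * SetFun.of F.phi) T = 0 := fun G T hT => by
    rw [SetFun.mul_apply]
    exact Finset.sum_eq_zero fun U _ => by rw [h0 _ (Finset.sdiff_subset.trans hT), mul_zero]
  have m2 : ∀ G : SetFun α, (G * deriv4 leg ν (SetFun.of F.phi)) S = 0 := fun G => by
    rw [SetFun.mul_apply]
    exact Finset.sum_eq_zero fun U _ => by
      rw [deriv4_apply, h0 _ Finset.sdiff_subset, mul_zero, mul_zero]
  simp only [photonSource, cubicCurrent, quarticCurrent, SetFun.conv_apply, SetFun.of_conv, of_pd]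
  rw [mul_comm (SetFun.of F.phi), m1 _ S le_rfl, m2, ← mul_assoc, m1 _ S le_rfl]
  ring

/-! ### The field equations -/

variable [Fintype α]

/-- The field `φ^*` (for `true`) or `φ` (for `false`) of the tree-level solution. -/
def treeScalar (g : ℝ) (leg : α → Leg) : Bool → SetFun α
  | true => .of (treeFields g leg).phiStar
  | false => .of (treeFields g leg).phi

/-- The gauge field of the tree-level solution. -/
def treePhoton (g : ℝ) (leg : α → Leg) (μ : Fin 4) : SetFun α := .of ((treeFields g leg).A μ)

/-- The charge `1` of the scalar (for `true`) and `-1` of the antiscalar (for `false`). -/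
def sgn : Bool → ℤ
  | true => 1
  | false => -1

theorem treeScalar_chargeSupp (g : ℝ) (leg : α → Leg) (σ : Bool) :
    ChargeSupp (fun i => (leg i).species.charge) (sgn σ) (treeScalar g leg σ) := by
  cases σ
  · exact (treeFields_charged g leg).2.1
  · exact (treeFields_charged g leg).1

theorem treePhoton_chargeSupp (g : ℝ) (leg : α → Leg) (μ : Fin 4) :
    ChargeSupp (fun i => (leg i).species.charge) 0 (treePhoton g leg μ) :=
  (treeFields_charged g leg).2.2 μ

theorem treeScalar_empty (g : ℝ) (leg : α → Leg) (σ : Bool) : treeScalar g leg σ ∅ = 0 := by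
  cases σ
  · exact (treeFields_vanishEmpty g leg).2.1
  · exact (treeFields_vanishEmpty g leg).1

theorem treePhoton_empty (g : ℝ) (leg : α → Leg) (μ : Fin 4) : treePhoton g leg μ ∅ = 0 :=
  (treeFields_vanishEmpty g leg).2.2 μ

theorem SetFun.mul_apply_of_card_le_one {F G : SetFun α} (hF : F ∅ = 0) (hG : G ∅ = 0)
    {S : Finset α} (hS : S.card ≤ 1) : (F * G) S = 0 := by
  rcases Nat.le_one_iff_eq_zero_or_eq_one.1 hS with h | h
  · rw [Finset.card_eq_zero] at h
    rw [h, SetFun.mul_empty, hF, zero_mul]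
  · obtain ⟨i, rfl⟩ := Finset.card_eq_one.1 h
    rw [SetFun.mul_singleton, hF, hG, zero_mul, mul_zero, add_zero]

theorem deriv4_empty (leg : α → Leg) (μ : Fin 4) {F : SetFun α} (hF : F ∅ = 0) :
    deriv4 leg μ F ∅ = 0 := by rw [deriv4_apply, hF, mul_zero]

theorem photonSource_of_card_le_one (g : ℝ) (leg : α → Leg) (μ : Fin 4) {S : Finset α}
    (hS : S.card ≤ 1) : photonSource g leg (treeFields g leg) μ S = 0 := by
  have h1 := treeScalar_empty g leg true
  have h2 := treeScalar_empty g leg false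
  have h3 := treePhoton_empty g leg μ
  simp only [treeScalar, treePhoton] at h1 h2 h3
  simp only [photonSource, cubicCurrent, quarticCurrent, SetFun.conv_apply, SetFun.of_conv, of_pd]
  rw [SetFun.mul_apply_of_card_le_one h2 (deriv4_empty leg μ h1) hS,
    SetFun.mul_apply_of_card_le_one h1 (deriv4_empty leg μ h2) hS,
    SetFun.mul_apply_of_card_le_one h3 (by rw [SetFun.mul_empty, h1, zero_mul]) hS]
  ring

theorem treePhoton_singleton (g : ℝ) (leg : α → Leg) (μ : Fin 4) (i : α) :
    treePhoton g leg μ {i} = if (leg i).species = .photon then (leg i).wave μ else 0 := by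
  rw [treePhoton, SetFun.of_apply, ← (fieldStep_treeFields g leg {i}).2.2 μ]
  simp [fieldStep, external, propagate, photonSource_of_card_le_one]

theorem treePhoton_of_two_le_card (g : ℝ) (leg : α → Leg) (μ : Fin 4) {S : Finset α}
    (hS : 2 ≤ S.card) : treePhoton g leg μ S = - photonSource g leg (treeFields g leg) μ S
      / (mdot (totalMom leg S) (totalMom leg S) : ℂ) := by
  rw [treePhoton, SetFun.of_apply, ← (fieldStep_treeFields g leg S).2.2 μ]
  have : S.card ≠ 1 := by omega
  simp [fieldStep, external, propagate, this]

/-- On-shell legs, such that no propagator of a charged line is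
singular unless it carries the momentum of the leg `bad`. -/
structure NonSingular (leg : α → Leg) (bad : α) : Prop where
  onShell : ∀ i, mdot (leg i).mom (leg i).mom = 0
  propagator : ∀ S : Finset α, bad ∉ S → 2 ≤ S.card → ∑ i ∈ S, (leg i).species.charge ≠ 0 →
    mdot (totalMom leg S) (totalMom leg S) ≠ 0

theorem totalMom_singleton (leg : α → Leg) (i : α) : totalMom leg {i} = (leg i).mom := by
  simp [totalMom]

/-- The tree-level charged fields solve `(∂ ± i g A)² F = 0` with the full gauge field. On sets with
the charge of the field no propagator is singular, so that the perturbative equation can be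
multiplied by the square of the momentum; on all other sets both sides vanish. -/
theorem covBox_treeScalar (g : ℝ) {leg : α → Leg} {bad : α} (h : NonSingular leg bad) (σ : Bool)
    {S : Finset α} (hS : bad ∉ S) :
    covBox g leg (sgn σ : ℂ) (treePhoton g leg) (treeScalar g leg σ) S = 0 := by
  have h0 := treeScalar_empty g leg σ
  have h3 := treePhoton_empty g leg
  by_cases h2 : 2 ≤ S.card
  · have h1 : S.card ≠ 1 := by omega
    have hf := fieldStep_treeFields g leg S
    cases σ
    · have e : ((sgn false : ℤ) : ℂ) = -1 := by simp [sgn]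
      rw [e]
      change covBox g leg (-1) (fun μ => .of ((treeFields g leg).A μ))
        (.of (treeFields g leg).phi) S = 0
      rw [covBox_neg_one_apply]
      by_cases hc : ∑ i ∈ S, (leg i).species.charge = -1
      · have hk := h.propagator S hS h2 (by rw [hc]; decide)
        rw [← hf.2.1]
        have hk' : (mdot (totalMom leg S) (totalMom leg S) : ℂ) ≠ 0 := by exact_mod_cast hk
        simp only [fieldStep, external, propagate, h1, if_false, zero_add]
        field_simp
        ring
      · rw [phiSource_chargeSupp g leg (treeFields_charged g leg) hc, sub_zero]
        have := (treeScalar_chargeSupp g leg false).apply_eq_zero hc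
        simp only [treeScalar, SetFun.of_apply] at this
        rw [this, mul_zero]
    · have e : ((sgn true : ℤ) : ℂ) = 1 := by simp [sgn]
      rw [e]
      change covBox g leg 1 (fun μ => .of ((treeFields g leg).A μ))
        (.of (treeFields g leg).phiStar) S = 0
      rw [covBox_one_apply]
      by_cases hc : ∑ i ∈ S, (leg i).species.charge = 1
      · have hk := h.propagator S hS h2 (by rw [hc]; decide)
        rw [← hf.1]
        have hk' : (mdot (totalMom leg S) (totalMom leg S) : ℂ) ≠ 0 := by exact_mod_cast hk
        simp only [fieldStep, external, propagate, h1, if_false, zero_add]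
        field_simp
        ring
      · rw [phiStarSource_chargeSupp g leg (treeFields_charged g leg) hc, sub_zero]
        have := (treeScalar_chargeSupp g leg true).apply_eq_zero hc
        simp only [treeScalar, SetFun.of_apply] at this
        rw [this, mul_zero]
  · have hS1 : S.card ≤ 1 := by omega
    rw [covBox_apply, Finset.sum_eq_zero, add_zero]
    · rcases Nat.le_one_iff_eq_zero_or_eq_one.1 hS1 with h | h'
      · rw [Finset.card_eq_zero] at h
        rw [h, h0, mul_zero]
      · obtain ⟨i, rfl⟩ := Finset.card_eq_one.1 h'
        rw [totalMom_singleton, h.onShell i]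
        simp
    · intro μ _
      rw [SetFun.mul_apply_of_card_le_one (h3 μ) (deriv4_empty leg μ h0) hS1,
        SetFun.mul_apply_of_card_le_one (deriv4_empty leg μ (h3 μ)) h0 hS1,
        SetFun.mul_apply_of_card_le_one (h3 μ) (by rw [SetFun.mul_empty, h0, mul_zero]) hS1]
      ring

theorem SetFun.mul_apply_eq_zero (F : SetFun α) {G : SetFun α} {S : Finset α}
    (hG : ∀ T ⊆ S, G T = 0) : (F * G) S = 0 := by
  rw [SetFun.mul_apply]
  exact Finset.sum_eq_zero fun T _ => by rw [hG _ Finset.sdiff_subset, mul_zero]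

/-- The current of the tree-level fields is conserved. -/
theorem momentum_dot_photonSource (g : ℝ) {leg : α → Leg} {bad : α} (h : NonSingular leg bad)
    {S : Finset α} (hS : bad ∉ S) :
    cdot (toC (totalMom leg S)) (fun ν => photonSource g leg (treeFields g leg) ν S) = 0 := by
  have key := congrArg (fun F : SetFun α => F S) (current_conservation g leg (treePhoton g leg)
    (treeScalar g leg true) (treeScalar g leg false))
  simp only [SetFun.sum_apply, SetFun.smul_apply, SetFun.sub_apply, deriv4_apply] at key
  have e1 := fun T (hT : T ⊆ S) => covBox_treeScalar g h true (S := T) (fun hb => hS (hT hb))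
  have e2 := fun T (hT : T ⊆ S) => covBox_treeScalar g h false (S := T) (fun hb => hS (hT hb))
  simp only [sgn, Int.cast_one, Int.cast_neg] at e1 e2
  rw [SetFun.mul_apply_eq_zero _ e1, SetFun.mul_apply_eq_zero _ e2] at key
  have hI := Complex.I_ne_zero
  rw [← mul_right_inj' hI, mul_zero, cdot, Finset.mul_sum]
  refine Eq.trans ?_ (key.trans (by ring))
  refine Finset.sum_congr rfl fun μ _ => ?_
  rw [photonSource_apply]
  change Complex.I * ((metric μ : ℂ) * (totalMom leg S μ : ℂ) * current g leg (treePhoton g leg)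
    (treeScalar g leg true) (treeScalar g leg false) μ S) = _
  ring

end ScalarQED
end

noncomputable section
namespace ScalarQED
open scoped Topology
set_option linter.unusedSectionVars false

variable {α : Type*} [DecidableEq α]

/-! ### Gauge-transformed fields -/

/-- The value of a vector field on a set of legs. -/
def vec (A : Fin 4 → SetFun α) (S : Finset α) : CVec := fun μ => A μ S

/-- The total momentum of a set of legs as a complex vector. -/
def kvec (leg : α → Leg) (S : Finset α) : CVec := toC (totalMom leg S)

theorem cdot_comm (a b : CVec) : cdot a b = cdot b a :=
  Finset.sum_congr rfl fun μ _ => by ring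

theorem cdot_add (a b c : CVec) : cdot a (b + c) = cdot a b + cdot a c := by
  simp only [cdot, Pi.add_apply, mul_add, Finset.sum_add_distrib]

theorem add_cdot (a b c : CVec) : cdot (a + b) c = cdot a c + cdot b c := by
  rw [cdot_comm, cdot_add, cdot_comm c, cdot_comm c]

theorem cdot_smul (a b : CVec) (z : ℂ) : cdot a (z • b) = z * cdot a b := by
  simp only [cdot, Pi.smul_apply, smul_eq_mul, Finset.mul_sum]
  exact Finset.sum_congr rfl fun μ _ => by ring

theorem smul_cdot (a b : CVec) (z : ℂ) : cdot (z • a) b = z * cdot a b := by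
  rw [cdot_comm, cdot_smul, cdot_comm]

theorem cdot_toC (a b : Vec) : cdot (toC a) (toC b) = (mdot a b : ℂ) := by
  simp [cdot, mdot, toC]

theorem mdot_comm (a b : Vec) : mdot a b = mdot b a :=
  Finset.sum_congr rfl fun μ _ => by ring

theorem sum_cdot_vec (A : Fin 4 → SetFun α) (T : Finset α) :
    ∑ U ∈ T.powerset, cdot (vec A U) (vec A (T \ U)) = ∑ μ, (metric μ : ℂ) * (A μ * A μ) T := by
  simp only [cdot, vec, SetFun.mul_apply, Finset.mul_sum]
  rw [Finset.sum_comm]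
  exact Finset.sum_congr rfl fun μ _ => Finset.sum_congr rfl fun U _ => by ring

/-- The field equation `(∂ + i s g A)² F = 0` on a set of legs, in momentum space. -/
theorem ksq_mul_of_covBox_eq_zero {g : ℝ} {leg : α → Leg} {s : ℂ} {A : Fin 4 → SetFun α}
    {F : SetFun α} {S : Finset α} (h : covBox g leg s A F S = 0) :
    cdot (kvec leg S) (kvec leg S) * F S = - ∑ T ∈ S.powerset,
      (s * g * (2 * cdot (vec A T) (kvec leg (S \ T)) + cdot (vec A T) (kvec leg T))
        + (g : ℂ) ^ 2 * ∑ U ∈ T.powerset, cdot (vec A U) (vec A (T \ U))) * F (S \ T) := by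
  rw [covBox_apply, ← cdot_toC, neg_mul, neg_add_eq_zero] at h
  rw [show kvec leg S = toC (totalMom leg S) from rfl, h, ← Finset.sum_neg_distrib]
  simp only [sum_cdot_vec]
  have e : ∀ μ, (metric μ : ℂ) * (Complex.I * s * g * (2 * (A μ * deriv4 leg μ F) S
      + (deriv4 leg μ (A μ) * F) S) - (g : ℂ) ^ 2 * (A μ * (A μ * F)) S)
      = ∑ T ∈ S.powerset, (metric μ : ℂ) * (- (s * g * (2 * (A μ T * kvec leg (S \ T) μ)
        + A μ T * kvec leg T μ)) - (g : ℂ) ^ 2 * (A μ * A μ) T) * F (S \ T) := by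
    intro μ
    rw [← mul_assoc (A μ), SetFun.mul_apply _ (deriv4 leg μ F), SetFun.mul_apply _ F,
      SetFun.mul_apply _ F, Finset.mul_sum, ← Finset.sum_add_distrib, Finset.mul_sum,
      Finset.mul_sum, ← Finset.sum_sub_distrib, Finset.mul_sum]
    refine Finset.sum_congr rfl fun T _ => ?_
    rw [deriv4_apply, deriv4_apply]
    simp only [kvec, toC]
    linear_combination (metric μ : ℂ) * s * g * (2 * (A μ T * (totalMom leg (S \ T) μ : ℂ))
        + A μ T * (totalMom leg T μ : ℂ)) * F (S \ T) * Complex.I_sq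
  rw [Finset.sum_congr rfl fun μ _ => e μ, Finset.sum_comm]
  refine Finset.sum_congr rfl fun T _ => ?_
  simp only [cdot, vec, Fin.sum_univ_four]
  ring

theorem current_apply (g : ℝ) (leg : α → Leg) (A : Fin 4 → SetFun α) (F G : SetFun α) (ν : Fin 4)
    (S : Finset α) : current g leg A F G ν S =
      - g * ∑ T ∈ S.powerset, (kvec leg T ν - kvec leg (S \ T) ν) * (F T * G (S \ T))
        - 2 * (g : ℂ) ^ 2 * ∑ T ∈ S.powerset, A ν T * (F * G) (S \ T) := by
  rw [current, SetFun.sub_apply, SetFun.smul_apply, SetFun.smul_apply, SetFun.sub_apply,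
    mul_comm G, SetFun.mul_apply, SetFun.mul_apply, SetFun.mul_apply (A ν),
    ← Finset.sum_sub_distrib, Finset.mul_sum, Finset.mul_sum (a := -(g : ℂ))]
  congr 1
  refine Finset.sum_congr rfl fun T _ => ?_
  rw [deriv4_apply, deriv4_apply]
  simp only [kvec, toC]
  linear_combination g * ((totalMom leg T ν : ℂ) - (totalMom leg (S \ T) ν : ℂ)) *
    (F T * G (S \ T)) * Complex.I_sq

variable [Fintype α]

/-- The charged fields after the gauge transformation with the parameter `r`. -/
def hatScalar (g : ℝ) (leg : α → Leg) (r : SetFun α) (σ : Bool) : SetFun α :=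
  SetFun.exp ((-(Complex.I * (sgn σ : ℂ) * g)) • r) * treeScalar g leg σ

/-- The gauge field after the gauge transformation with the parameter `r`. -/
def hatPhoton (g : ℝ) (leg : α → Leg) (r : SetFun α) (μ : Fin 4) : SetFun α :=
  treePhoton g leg μ + deriv4 leg μ r

theorem smul_empty {r : SetFun α} (hr : r ∅ = 0) (c : ℂ) : (c • r) ∅ = 0 := by
  rw [SetFun.smul_apply, hr, mul_zero]

theorem deriv4_exp (leg : α → Leg) {r : SetFun α} (hr : r ∅ = 0) (c : ℂ) (μ : Fin 4) :
    deriv4 leg μ (SetFun.exp (c • r)) = c • (deriv4 leg μ r * SetFun.exp (c • r)) := by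
  rw [SetFun.derivation_exp _ (smul_empty hr c) (deriv4_empty leg μ (smul_empty hr c)),
    Derivation.map_smul, smul_mul_assoc]

theorem sgn_sq (σ : Bool) : ((sgn σ : ℤ) : ℂ) ^ 2 = 1 := by cases σ <;> simp [sgn]

/-- The gauge-transformed fields solve the same field equation. -/
theorem covBox_hatScalar (g : ℝ) {leg : α → Leg} {bad : α} (h : NonSingular leg bad) {r : SetFun α}
    (hr : r ∅ = 0) (σ : Bool) {S : Finset α} (hS : bad ∉ S) :
    covBox g leg (sgn σ : ℂ) (hatPhoton g leg r) (hatScalar g leg r σ) S = 0 := by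
  have := covBox_gauge g leg (sgn_sq σ) (treePhoton g leg) (treeScalar g leg σ) r
    (SetFun.exp ((-(Complex.I * (sgn σ : ℂ) * g)) • r)) (fun μ => deriv4_exp leg hr _ μ)
  change covBox g leg (sgn σ : ℂ) (fun μ => treePhoton g leg μ + deriv4 leg μ r)
    (SetFun.exp ((-(Complex.I * (sgn σ : ℂ) * g)) • r) * treeScalar g leg σ) S = 0
  rw [this]
  exact SetFun.mul_apply_eq_zero _ fun T hT => covBox_treeScalar g h σ (fun hb => hS (hT hb))

theorem exp_gauge_mul (g : ℝ) {r : SetFun α} (hr : r ∅ = 0) :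
    SetFun.exp ((-(Complex.I * (sgn true : ℂ) * g)) • r)
      * SetFun.exp ((-(Complex.I * (sgn false : ℂ) * g)) • r) = 1 := by
  have : (-(Complex.I * (sgn false : ℂ) * g)) • r = -((-(Complex.I * (sgn true : ℂ) * g)) • r) := by
    rw [← neg_smul]; congr 1; simp [sgn]
  rw [this]
  exact SetFun.exp_mul_exp_neg (smul_empty hr _)

theorem current_hat_aux (g : ℝ) (leg : α → Leg) {r : SetFun α} (hr : r ∅ = 0)
    (F G : SetFun α) (ν : Fin 4) :
    current g leg (hatPhoton g leg r) (SetFun.exp ((-(Complex.I * (sgn true : ℂ) * g)) • r) * F)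
      (SetFun.exp ((-(Complex.I * (sgn false : ℂ) * g)) • r) * G) ν
      = current g leg (treePhoton g leg) F G ν := by
  refine current_gauge g leg (treePhoton g leg) F G r _ _ (exp_gauge_mul g hr) ?_ ?_ ν
  · intro μ
    rw [deriv4_exp leg hr]
    simp [sgn]
  · intro μ
    rw [deriv4_exp leg hr]
    simp [sgn]

/-- The source of the gauge field can be computed in any gauge. -/
theorem photonSource_eq_current_hat (g : ℝ) (leg : α → Leg) {r : SetFun α} (hr : r ∅ = 0)
    (ν : Fin 4) (S : Finset α) : photonSource g leg (treeFields g leg) ν S =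
      current g leg (hatPhoton g leg r) (hatScalar g leg r true) (hatScalar g leg r false) ν S := by
  rw [photonSource_apply]
  exact congrArg (fun F : SetFun α => F S) (current_hat_aux g leg hr (treeScalar g leg true)
    (treeScalar g leg false) ν).symm

theorem hatScalar_chargeSupp (g : ℝ) (leg : α → Leg) {r : SetFun α}
    (hr : ChargeSupp (fun i => (leg i).species.charge) 0 r) (σ : Bool) :
    ChargeSupp (fun i => (leg i).species.charge) (sgn σ) (hatScalar g leg r σ) := by
  have := (hr.smul (-(Complex.I * (sgn σ : ℂ) * g))).exp.mul (treeScalar_chargeSupp g leg σ)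
  rwa [zero_add] at this

theorem hatPhoton_chargeSupp (g : ℝ) (leg : α → Leg) {r : SetFun α}
    (hr : ChargeSupp (fun i => (leg i).species.charge) 0 r) (μ : Fin 4) :
    ChargeSupp (fun i => (leg i).species.charge) 0 (hatPhoton g leg r μ) :=
  (treePhoton_chargeSupp g leg μ).add (hr.deriv leg μ)

theorem hatScalar_singleton (g : ℝ) (leg : α → Leg) (r : SetFun α) (σ : Bool) (i : α) :
    hatScalar g leg r σ {i} = treeScalar g leg σ {i} := by
  rw [hatScalar, SetFun.mul_singleton, SetFun.exp_empty, treeScalar_empty, one_mul, mul_zero,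
    add_zero]

theorem treeScalar_singleton (g : ℝ) (leg : α → Leg) (σ : Bool) (i : α) :
    treeScalar g leg σ {i} = if (leg i).species.charge = sgn σ then 1 else 0 := by
  have e1 := treeScalar_empty g leg true
  have e2 := treeScalar_empty g leg false
  have e3 := treePhoton_empty g leg
  simp only [treeScalar, treePhoton] at e1 e2 e3
  have hc : ({i} : Finset α).card ≤ 1 := by simp
  cases σ
  · rw [treeScalar, SetFun.of_apply, ← (fieldStep_treeFields g leg {i}).2.1]
    have : phiSource g leg (treeFields g leg) {i} = 0 := by
      simp only [phiSource, SetFun.conv_apply, SetFun.of_conv, of_pd]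
      refine Finset.sum_eq_zero fun μ _ => ?_
      rw [SetFun.mul_apply_of_card_le_one (e3 μ) (deriv4_empty leg μ e2) hc,
        SetFun.mul_apply_of_card_le_one (deriv4_empty leg μ (e3 μ)) e2 hc,
        SetFun.mul_apply_of_card_le_one (e3 μ) (by rw [SetFun.mul_empty, e2, mul_zero]) hc]
      ring
    simp only [fieldStep, external, propagate, this, Finset.card_singleton, Finset.sum_singleton]
    cases h : (leg i).species <;> simp [Species.charge, sgn]
  · rw [treeScalar, SetFun.of_apply, ← (fieldStep_treeFields g leg {i}).1]
    have : phiStarSource g leg (treeFields g leg) {i} = 0 := by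
      simp only [phiStarSource, SetFun.conv_apply, SetFun.of_conv, of_pd]
      refine Finset.sum_eq_zero fun μ _ => ?_
      rw [SetFun.mul_apply_of_card_le_one (e3 μ) (deriv4_empty leg μ e1) hc,
        SetFun.mul_apply_of_card_le_one (deriv4_empty leg μ (e3 μ)) e1 hc,
        SetFun.mul_apply_of_card_le_one (e3 μ) (by rw [SetFun.mul_empty, e1, mul_zero]) hc]
      ring
    simp only [fieldStep, external, propagate, this, Finset.card_singleton, Finset.sum_singleton]
    cases h : (leg i).species <;> simp [Species.charge, sgn]

/-! ### Channels -/

/-- The projection to the terms in which the leg `a` is attached; it is a derivation, because the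
leg is attached to exactly one of the factors of a product. -/
def attach (a : α) : Derivation ℂ (SetFun α) (SetFun α) :=
  SetFun.weight fun i => if i = a then 1 else 0

theorem attach_apply (a : α) (F : SetFun α) (S : Finset α) :
    attach a F S = if a ∈ S then F S else 0 := by
  rw [attach, SetFun.weight_apply, Finset.sum_ite_eq']
  split_ifs <;> simp

theorem of_withLeg (a : α) (F : Finset α → ℂ) : SetFun.of (withLeg a F) = attach a (.of F) := by
  ext S
  rw [attach_apply]; rfl

theorem attach_deriv4 (a : α) (leg : α → Leg) (μ : Fin 4) (F : SetFun α) :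
    attach a (deriv4 leg μ F) = deriv4 leg μ (attach a F) := by
  ext S
  rw [attach_apply, deriv4_apply, deriv4_apply, attach_apply]
  split_ifs <;> simp

/-- The part of the current that belongs to a channel, where the leg `a` plays the role of the
incoming photon `2`. -/
def channelCurrent (g : ℝ) (leg : α → Leg) (a : α) (A : Fin 4 → SetFun α) (F G : SetFun α)
    (ν : Fin 4) : Kinematics.Channel → SetFun α
  | .contact => -((2 * (g : ℂ) ^ 2) • (attach a (A ν) * (F * G)))
  | .tChannel => current g leg A (attach a F) G ν
  | .uChannel => current g leg A F (attach a G) ν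

/-- The three channels add up to the part of the current in which the leg `a` is attached. -/
theorem attach_current (g : ℝ) (leg : α → Leg) (a : α) (A : Fin 4 → SetFun α) (F G : SetFun α)
    (ν : Fin 4) : attach a (current g leg A F G ν) = channelCurrent g leg a A F G ν .contact
      + channelCurrent g leg a A F G ν .tChannel + channelCurrent g leg a A F G ν .uChannel := by
  simp only [channelCurrent, current, map_sub, Derivation.leibniz,
    attach_deriv4, smul_eq_mul, Algebra.smul_def, Derivation.map_algebraMap]
  ring

/-- Each channel is separately invariant under gauge transformations whose parameter does not
involve the leg `a`. -/
theorem channelCurrent_hat (g : ℝ) (leg : α → Leg) {a : α} {r : SetFun α} (hr : r ∅ = 0)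
    (ha : ∀ S, a ∈ S → r S = 0) (ν : Fin 4) (c : Kinematics.Channel) :
    channelCurrent g leg a (hatPhoton g leg r) (hatScalar g leg r true) (hatScalar g leg r false)
      ν c = channelCurrent g leg a (treePhoton g leg) (treeScalar g leg true)
        (treeScalar g leg false) ν c := by
  have h0 : attach a r = 0 := by
    ext S
    rw [attach_apply]
    split_ifs with h
    · rw [ha S h]; rfl
    · rfl
  have hE : ∀ z : ℂ, attach a (SetFun.exp (z • r)) = 0 := fun z => by
    rw [SetFun.derivation_exp _ (smul_empty hr z), Derivation.map_smul, h0, smul_zero, zero_mul]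
    rw [Derivation.map_smul, h0, smul_zero]; rfl
  have hF : ∀ σ, attach a (hatScalar g leg r σ)
      = SetFun.exp ((-(Complex.I * (sgn σ : ℂ) * g)) • r) * attach a (treeScalar g leg σ) := by
    intro σ
    rw [hatScalar, Derivation.leibniz, hE, smul_zero, add_zero, smul_eq_mul]
  cases c
  · simp only [channelCurrent]
    have : hatScalar g leg r true * hatScalar g leg r false
        = treeScalar g leg true * treeScalar g leg false := by
      rw [hatScalar, hatScalar]
      linear_combination treeScalar g leg true * treeScalar g leg false * exp_gauge_mul g hr
    rw [this, hatPhoton, map_add, attach_deriv4, h0, map_zero, add_zero]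
  · simp only [channelCurrent, hF]
    exact current_hat_aux g leg hr _ _ ν
  · simp only [channelCurrent, hF]
    exact current_hat_aux g leg hr _ _ ν

/-! ### Wilson lines -/

/-- The Fourier integral along an outgoing ray, regularized by a damping factor, is the eikonal
propagator. -/
theorem outgoingRay_of_ne {leg : α → Leg} {A : Fin 4 → Finset α → ℂ} {v : Vec} {S : Finset α}
    (h : mdot v (totalMom leg S) ≠ 0) : outgoingRay leg A v S =
      Complex.I * cdot (toC v) (fun μ => A μ S) / (mdot v (totalMom leg S) : ℂ) := by
  set a : ℝ := mdot v (totalMom leg S)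
  set b : ℂ := cdot (toC v) (fun μ => A μ S)
  have ha : (a : ℂ) ≠ 0 := by exact_mod_cast h
  have hint : ∀ ε : ℝ, 0 < ε → (∫ s in Set.Ioi (0 : ℝ),
      b * Complex.exp (Complex.I * ((s * a : ℝ) : ℂ)) * (Real.exp (- ε * s) : ℂ))
        = b * (-1 / (Complex.I * a - ε)) := by
    intro ε hε
    have hre : (Complex.I * a - ε).re < 0 := by simpa using hε
    rw [show (-1 : ℂ) / (Complex.I * a - ε)
      = - Complex.exp ((Complex.I * a - ε) * (0 : ℝ)) / (Complex.I * a - ε) by simp,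
      ← integral_exp_mul_complex_Ioi hre 0, ← MeasureTheory.integral_const_mul]
    refine MeasureTheory.integral_congr_ae (Filter.Eventually.of_forall fun s => ?_)
    simp only []
    rw [mul_assoc, Complex.ofReal_exp, ← Complex.exp_add]
    congr 2
    push_cast
    ring
  refine Filter.Tendsto.limUnder_eq (Filter.Tendsto.congr' (f₁ := fun ε : ℝ =>
    b * (-1 / (Complex.I * a - ε))) ?_ ?_)
  · filter_upwards [self_mem_nhdsWithin] with ε hε using (hint ε hε).symm
  · have hc : ContinuousAt (fun ε : ℝ => b * (-1 / (Complex.I * a - ε))) 0 := by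
      refine ContinuousAt.mul continuousAt_const (ContinuousAt.div continuousAt_const ?_ ?_)
      · fun_prop
      · simp [h]
    have := hc.tendsto.mono_left (nhdsWithin_le_nhds (s := Set.Ioi 0))
    convert this using 2
    simp only [Complex.ofReal_zero, sub_zero]
    field_simp
    linear_combination b * Complex.I_sq

/-- The Fourier integral along an incoming ray, regularized by a damping factor, is the eikonal
propagator. -/
theorem incomingRay_of_ne {leg : α → Leg} {A : Fin 4 → Finset α → ℂ} {v : Vec} {S : Finset α}
    (h : mdot v (totalMom leg S) ≠ 0) : incomingRay leg A v S =
      - Complex.I * cdot (toC v) (fun μ => A μ S) / (mdot v (totalMom leg S) : ℂ) := by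
  set a : ℝ := mdot v (totalMom leg S)
  set b : ℂ := cdot (toC v) (fun μ => A μ S)
  have ha : (a : ℂ) ≠ 0 := by exact_mod_cast h
  have hint : ∀ ε : ℝ, 0 < ε → (∫ s in Set.Iic (0 : ℝ),
      b * Complex.exp (Complex.I * ((s * a : ℝ) : ℂ)) * (Real.exp (ε * s) : ℂ))
        = b * (1 / (Complex.I * a + ε)) := by
    intro ε hε
    have hre : 0 < (Complex.I * a + ε).re := by simpa using hε
    rw [show (1 : ℂ) / (Complex.I * a + ε)
      = Complex.exp ((Complex.I * a + ε) * (0 : ℝ)) / (Complex.I * a + ε) by simp,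
      ← integral_exp_mul_complex_Iic hre 0, ← MeasureTheory.integral_const_mul]
    refine MeasureTheory.integral_congr_ae (Filter.Eventually.of_forall fun s => ?_)
    simp only []
    rw [mul_assoc, Complex.ofReal_exp, ← Complex.exp_add]
    congr 2
    push_cast
    ring
  refine Filter.Tendsto.limUnder_eq (Filter.Tendsto.congr' (f₁ := fun ε : ℝ =>
    b * (1 / (Complex.I * a + ε))) ?_ ?_)
  · filter_upwards [self_mem_nhdsWithin] with ε hε using (hint ε hε).symm
  · have hc : ContinuousAt (fun ε : ℝ => b * (1 / (Complex.I * a + ε))) 0 := by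
      refine ContinuousAt.mul continuousAt_const (ContinuousAt.div continuousAt_const ?_ ?_)
      · fun_prop
      · simp [h]
    have := hc.tendsto.mono_left (nhdsWithin_le_nhds (s := Set.Ioi 0))
    convert this using 2
    simp only [Complex.ofReal_zero, add_zero]
    field_simp
    linear_combination -b * Complex.I_sq

theorem outgoingRay_of_eq_zero {leg : α → Leg} {A : Fin 4 → Finset α → ℂ} {v : Vec} {S : Finset α}
    (h : ∀ μ, A μ S = 0) : outgoingRay leg A v S = 0 := by
  have : cdot (toC v) (fun μ => A μ S) = 0 := by simp [cdot, h]
  simp only [outgoingRay, this, zero_mul, MeasureTheory.integral_zero]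
  exact tendsto_const_nhds.limUnder_eq

end ScalarQED
end

noncomputable section
namespace ScalarQED
open scoped Topology
set_option linter.unusedSectionVars false

/-! ### Filtered rings -/

/-- A decreasing multiplicative filtration of a ring, `F p` being thought of as the elements of
order `λ ^ p`. -/
structure Filtration (R : Type*) [CommRing R] where
  F : ℤ → AddSubgroup R
  anti : ∀ {p q : ℤ}, p ≤ q → F q ≤ F p
  one_mem : 1 ∈ F 0
  mul_mem : ∀ {p q : ℤ} {a b : R}, a ∈ F p → b ∈ F q → a * b ∈ F (p + q)

/-- The Minkowski product over an arbitrary ring. -/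
def rdot {R : Type*} [CommRing R] (V W : Fin 4 → R) : R :=
  V 0 * W 0 - V 1 * W 1 - V 2 * W 2 - V 3 * W 3

section rdot

variable {R : Type*} [CommRing R]

theorem rdot_comm (V W : Fin 4 → R) : rdot V W = rdot W V := by simp only [rdot]; ring

theorem rdot_add (V W Z : Fin 4 → R) : rdot V (W + Z) = rdot V W + rdot V Z := by
  simp only [rdot, Pi.add_apply]; ring

theorem rdot_zero (V : Fin 4 → R) : rdot V 0 = 0 := by simp [rdot]

theorem zero_rdot (V : Fin 4 → R) : rdot 0 V = 0 := by simp [rdot]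

end rdot

namespace Filtration

variable {R : Type*} [CommRing R] (P : Filtration R)

theorem mul {a b p : ℤ} {f g : R} (hf : f ∈ P.F a) (hg : g ∈ P.F b) (h : p ≤ a + b) :
    f * g ∈ P.F p := P.anti h (P.mul_mem hf hg)

theorem two_mul {p : ℤ} {f : R} (hf : f ∈ P.F p) : 2 * f ∈ P.F p := by
  rw [_root_.two_mul]; exact add_mem hf hf

theorem rdot_mem {a b p : ℤ} {V W : Fin 4 → R} (hV : ∀ μ, V μ ∈ P.F a) (hW : ∀ μ, W μ ∈ P.F b)
    (h : p ≤ a + b) : rdot V W ∈ P.F p :=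
  sub_mem (sub_mem (sub_mem (P.mul (hV 0) (hW 0) h) (P.mul (hV 1) (hW 1) h))
    (P.mul (hV 2) (hW 2) h)) (P.mul (hV 3) (hW 3) h)

/-- The element `f` has an inverse of order `p`. -/
def InvMem (p : ℤ) (f : R) : Prop := ∃ u ∈ P.F p, u * f = 1

variable {P}

theorem InvMem.mem_of_mul {p a c : ℤ} {f h : R} (hf : P.InvMem p f) (hh : f * h ∈ P.F a)
    (hc : c ≤ p + a) : h ∈ P.F c := by
  obtain ⟨u, hu, huf⟩ := hf
  have : h = u * (f * h) := by rw [← mul_assoc, huf, one_mul]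
  rw [this]
  exact P.mul hu hh hc

end Filtration

/-! ### Legs and power counting -/

/-- The role of a leg: a member of one of the two jets (`true` for the jet with the charge of a
scalar), a soft particle, or one of the two incoming photons. -/
inductive Tag : Type
  | jet (b : Bool)
  | soft
  | beam1
  | beam2
  deriving DecidableEq

/-- The power of `1 / λ` that a leg contributes to a matrix element at leading power. -/
def Tag.weight : Tag → ℤ
  | .jet _ => 1
  | .soft => 2
  | .beam1 => 0
  | .beam2 => 0

/-- The algebraic and power-counting properties of the (gauge-transformed) tree-level fields that
imply factorization.  Everything depends on a scaling parameter `λ`, and takes values in a ring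
filtered by powers of `λ`. -/
structure PowerSystem (R : Type*) [CommRing R] (α : Type*) [DecidableEq α] extends
    Filtration R where
  /-- the coupling -/
  g : R
  g_mem : g ∈ F 0
  tag : α → Tag
  /-- the charges of the legs -/
  q : α → ℤ
  /-- the set of all outgoing legs -/
  full : Finset α
  mem_full : ∀ i, i ∈ full ↔ tag i ≠ .beam1 ∧ tag i ≠ .beam2
  /-- the leg of the incoming photon `2` -/
  b2 : α
  tag_b2 : tag b2 = .beam2
  q_b2 : q b2 = 0
  /-- the jets carry the charges of one scalar and of one antiscalar -/
  q_jet : ∀ b, ∑ i ∈ full.filter (fun i => tag i = .jet b), q i = sgn b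
  /-- total momenta -/
  k : Finset α → Fin 4 → R
  k_split : ∀ {S T}, T ⊆ S → k S = k T + k (S \ T)
  /-- the directions of the jets -/
  n : Bool → Fin 4 → R
  n_sq : ∀ b, rdot (n b) (n b) = 0
  n_mem : ∀ b μ, n b μ ∈ F 0
  /-- the directions of the collinear Wilson lines -/
  t : Bool → Fin 4 → R
  t_mem : ∀ b μ, t b μ ∈ F 0
  /-- the gauge field -/
  A : Fin 4 → Finset α → R
  /-- the fields `φ^*` (for `true`) and `φ` (for `false`) -/
  ψ : Bool → Finset α → R
  /-- soft Wilson lines: direction and sign of the exponent -/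
  Y : Bool → Bool → Finset α → R
  A_empty : ∀ μ, A μ ∅ = 0
  ψ_empty : ∀ σ, ψ σ ∅ = 0
  A_charge : ∀ μ S, ∑ i ∈ S, q i ≠ 0 → A μ S = 0
  ψ_charge : ∀ σ S, ∑ i ∈ S, q i ≠ sgn σ → ψ σ S = 0
  /-- without charged legs there is no source of the gauge field -/
  A_neutral : ∀ μ S, 2 ≤ S.card → (∀ i ∈ S, q i = 0) → A μ S = 0
  /-- the field equations `(∂ ± i g A)² F = 0` in momentum space -/
  eom : ∀ σ S, (∀ i ∈ S, tag i ≠ .beam1) → rdot (k S) (k S) * ψ σ S = - ∑ T ∈ S.powerset,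
    (sgn σ * g * (2 * rdot (fun μ => A μ T) (k (S \ T)) + rdot (fun μ => A μ T) (k T))
      + g ^ 2 * ∑ U ∈ T.powerset, rdot (fun μ => A μ U) (fun μ => A μ (T \ U))) * ψ σ (S \ T)
  Y_empty : ∀ b σ, Y b σ ∅ = 1
  /-- the Wilson lines with opposite signs of the exponent are inverse to each other -/
  Y_mul : ∀ b S, S.Nonempty → ∑ T ∈ S.powerset, Y b true T * Y b false (S \ T) = 0
  /-- the parallel transport equation of the Wilson lines in momentum space -/
  Y_eq : ∀ b σ S, (∀ i ∈ S, tag i = .soft) → rdot (n b) (k S) * Y b σ S =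
    - (sgn σ * g) * ∑ T ∈ S.powerset, rdot (n b) (fun μ => A μ T) * Y b σ (S \ T)
  k_mem : ∀ S μ, k S μ ∈ F 0
  k_soft : ∀ S μ, (∀ i ∈ S, tag i = .soft) → k S μ ∈ F 2
  /-- the momenta in a jet are along its direction up to terms of order `λ` -/
  k_jet : ∀ b S μ, (∀ i ∈ S, tag i = .jet b ∨ tag i = .soft) → k S μ - k S 0 * n b μ ∈ F 1
  /-- the small component of the momenta in a jet -/
  nk_jet : ∀ b S, (∀ i ∈ S, tag i = .jet b ∨ tag i = .soft) → rdot (n b) (k S) ∈ F 2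
  ψ_single : ∀ σ i, ψ σ {i} ∈ F 0
  A_soft_single : ∀ μ i, tag i = .soft → A μ {i} ∈ F 0
  A_jet_single : ∀ b μ i, tag i = .jet b → A μ {i} ∈ F 0
  kA_jet_single : ∀ b i, tag i = .jet b → rdot (k {i}) (fun μ => A μ {i}) = 0
  A_b2 : ∀ μ, A μ {b2} ∈ F 0
  /-- the current, divided by minus the square of the momentum -/
  a : Fin 4 → Finset α → R
  a_eq : ∀ μ S, (∃ u, u * rdot (k S) (k S) = 1) → rdot (k S) (k S) * a μ S =
    g * ∑ T ∈ S.powerset, (k T μ - k (S \ T) μ) * (ψ true T * ψ false (S \ T))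
      + 2 * g ^ 2 * ∑ T ∈ S.powerset, A μ T *
        ∑ U ∈ (S \ T).powerset, ψ true U * ψ false ((S \ T) \ U)
  /-- the gauge of the soft fields is the one of the perturbative solution, except for single
  photons -/
  A_soft : ∀ μ S, (∀ i ∈ S, tag i = .soft) → 2 ≤ S.card → A μ S = a μ S
  /-- axial gauge along the Wilson line in a jet; `- c` is the gauge parameter -/
  A_jet : ∀ b S, (∀ i ∈ S, tag i = .jet b ∨ tag i = .soft) → (∃ i ∈ S, tag i = .jet b) →
    2 ≤ S.card → ∃ c, c * rdot (t b) (k S) = rdot (t b) (fun μ => a μ S) ∧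
      (∀ μ, A μ S = a μ S - c * k S μ) ∧ rdot (k S) (fun μ => a μ S) = 0
  /-- no gauge transformation on sets with legs from both jets -/
  A_both : ∀ μ S, S ⊆ full → (∀ b, ∃ i ∈ S, tag i = .jet b) → A μ S = a μ S
  /-- no gauge transformation on sets with the incoming photon and other legs -/
  A_with_b2 : ∀ μ T, T ⊆ full → T.Nonempty → A μ (insert b2 T) = a μ (insert b2 T)
  /-- current conservation, and transversality of the incoming photon for `T = ∅` -/
  kA_with_b2 : ∀ T, T ⊆ full → rdot (k (insert b2 T)) (fun μ => A μ (insert b2 T)) = 0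
  /-- lower bound for the invariant mass of soft particles -/
  inv_soft : ∀ S, (∀ i ∈ S, tag i = .soft) → 2 ≤ S.card → (∃ i ∈ S, q i ≠ 0) →
    toFiltration.InvMem (-4) (rdot (k S) (k S))
  /-- lower bound for the small component of soft momenta -/
  inv_nk : ∀ b S, (∀ i ∈ S, tag i = .soft) → S.Nonempty →
    toFiltration.InvMem (-2) (rdot (n b) (k S))
  /-- lower bound for the virtuality of a jet that emits soft particles or splits -/
  inv_jet : ∀ b S, (∀ i ∈ S, tag i = .jet b ∨ tag i = .soft) → (∃ i ∈ S, tag i = .jet b) →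
    ((∃ i ∈ S, tag i = .soft) ∨ 2 ≤ S.card ∧ ∃ i ∈ S, q i ≠ 0) →
    toFiltration.InvMem (-2) (rdot (k S) (k S))
  /-- the energy of collinear particles is large -/
  inv_energy : ∀ b S, (∀ i ∈ S, tag i = .jet b ∨ tag i = .soft) → (∃ i ∈ S, tag i = .jet b) →
    toFiltration.InvMem 0 (k S 0)
  /-- the Wilson line of a jet is not collinear to the jet -/
  inv_tk : ∀ b S, (∀ i ∈ S, tag i = .jet b ∨ tag i = .soft) → (∃ i ∈ S, tag i = .jet b) →
    toFiltration.InvMem 0 (rdot (t b) (k S))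
  /-- the invariants of legs from both jets are large -/
  inv_both : ∀ S, S ⊆ full → (∀ b, ∃ i ∈ S, tag i = .jet b) →
    toFiltration.InvMem 0 (rdot (k S) (k S))
  /-- lower bound for the propagators between the incoming photon and soft particles -/
  inv_b2_soft : ∀ T, (∀ i ∈ T, tag i = .soft) → (∃ i ∈ T, q i ≠ 0) →
    toFiltration.InvMem (-2) (rdot (k (insert b2 T)) (k (insert b2 T)))
  /-- the momentum transfer is large if there are collinear particles on both sides -/
  inv_b2_hard : ∀ T, T ⊆ full → (∃ b, ∃ i ∈ T, tag i = .jet b) →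
    (∃ b, ∃ i ∈ full \ T, tag i = .jet b) →
    toFiltration.InvMem 0 (rdot (k (insert b2 T)) (k (insert b2 T)))
  /-- lower bound for the propagators that separate the photon `1` and charged soft particles from
  all other particles -/
  inv_b2_full : ∀ T, T ⊆ full → (∀ b, ¬ ∃ i ∈ full \ T, tag i = .jet b) →
    (∃ i ∈ full \ T, q i ≠ 0) →
    toFiltration.InvMem (-2) (rdot (k (insert b2 T)) (k (insert b2 T)))

namespace PowerSystem

variable {R : Type*} [CommRing R] {α : Type*} [DecidableEq α] (P : PowerSystem R α)

/-- All legs are soft. -/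
def Soft (S : Finset α) : Prop := ∀ i ∈ S, P.tag i = .soft

/-- All legs belong to the jet `b` or are soft. -/
def InJet (b : Bool) (S : Finset α) : Prop := ∀ i ∈ S, P.tag i = .jet b ∨ P.tag i = .soft

/-- Some leg has the role `τ`. -/
def Has (τ : Tag) (S : Finset α) : Prop := ∃ i ∈ S, P.tag i = τ

/-- The legs with the role `τ`. -/
def part (τ : Tag) (S : Finset α) : Finset α := S.filter fun i => P.tag i = τ

/-- The total power of `1 / λ` that a set of legs contributes at leading power. -/
def wt (S : Finset α) : ℤ := ∑ i ∈ S, (P.tag i).weight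

/-- Matrix elements with the legs `S` that are of order `λ ^ p` relative to the natural size
`λ ^ (- wt S)`. -/
abbrev At (p : ℤ) (S : Finset α) : AddSubgroup R := P.F (p - P.wt S)

/-- The gauge field on a set of legs. -/
def av (S : Finset α) : Fin 4 → R := fun μ => P.A μ S

/-- The square of the total momentum. -/
def ksq (S : Finset α) : R := rdot (P.k S) (P.k S)

/-- The factor of the three-point vertex. -/
def vert (T U : Finset α) : R := 2 * rdot (P.av T) (P.k U) + rdot (P.av T) (P.k T)

/-- The square of the gauge field. -/
def asq (T : Finset α) : R := ∑ U ∈ T.powerset, rdot (P.av U) (P.av (T \ U))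

/-- The product `φ^* φ`. -/
def pp (S : Finset α) : R := ∑ T ∈ S.powerset, P.ψ true T * P.ψ false (S \ T)

variable {P}

theorem wt_split {S T : Finset α} (h : T ⊆ S) : P.wt S = P.wt T + P.wt (S \ T) := by
  rw [wt, wt, wt, add_comm, Finset.sum_sdiff h]

theorem wt_empty : P.wt ∅ = 0 := rfl

theorem at_mul {S T : Finset α} (h : T ⊆ S) {a b p : ℤ} {f f' : R} (hf : f ∈ P.At a T)
    (hf' : f' ∈ P.At b (S \ T)) (hp : p ≤ a + b) : f * f' ∈ P.At p S :=
  P.mul hf hf' (by rw [wt_split h]; omega)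

theorem at_smul {S : Finset α} {a b p : ℤ} {f f' : R} (hf : f ∈ P.F a)
    (hf' : f' ∈ P.At b S) (hp : p ≤ a + b) : f * f' ∈ P.At p S :=
  P.mul hf hf' (by omega)

theorem at_mono {S : Finset α} {p q : ℤ} (h : p ≤ q) {f : R} (hf : f ∈ P.At q S) : f ∈ P.At p S :=
  P.anti (by omega) hf

theorem at_rdot {S T : Finset α} (h : T ⊆ S) {a b p : ℤ} {V W : Fin 4 → R}
    (hV : ∀ μ, V μ ∈ P.At a T) (hW : ∀ μ, W μ ∈ P.At b (S \ T)) (hp : p ≤ a + b) :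
    rdot V W ∈ P.At p S :=
  P.rdot_mem hV hW (by rw [wt_split h]; omega)

theorem at_rdot_k {S : Finset α} {a b p : ℤ} {V W : Fin 4 → R}
    (hV : ∀ μ, V μ ∈ P.At a S) (hW : ∀ μ, W μ ∈ P.F b) (hp : p ≤ a + b) :
    rdot V W ∈ P.At p S :=
  P.rdot_mem hV hW (by omega)

theorem intCast_mem (m : ℤ) : (m : R) ∈ P.F 0 := by
  rw [← zsmul_one]
  exact zsmul_mem P.one_mem m

theorem g_sq_mem : P.g ^ 2 ∈ P.F 0 := by
  rw [pow_two]; exact P.mul P.g_mem P.g_mem (by omega)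

theorem sgn_g_mem (σ : Bool) : (sgn σ : R) * P.g ∈ P.F 0 :=
  P.mul (intCast_mem _) P.g_mem (by omega)

theorem av_empty : P.av ∅ = 0 := funext fun μ => P.A_empty μ

theorem vert_empty (U : Finset α) : P.vert ∅ U = 0 := by
  rw [vert, av_empty, zero_rdot, zero_rdot]; ring

theorem asq_empty : P.asq ∅ = 0 := by simp [asq, av_empty, zero_rdot]

theorem eom' (σ : Bool) {S : Finset α} (hS : ∀ i ∈ S, P.tag i ≠ .beam1) :
    P.ksq S * P.ψ σ S = - ∑ T ∈ S.powerset,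
      (sgn σ * P.g * P.vert T (S \ T) + P.g ^ 2 * P.asq T) * P.ψ σ (S \ T) := P.eom σ S hS

/-- The order of a charged field follows from the orders of the terms of the field equation. -/
theorem scalar_mem {σ : Bool} {S : Finset α} (hS : ∀ i ∈ S, P.tag i ≠ .beam1) {m p c : ℤ}
    (hinv : P.InvMem m (P.ksq S)) (hc : c ≤ m + p)
    (h : ∀ T ⊆ S, T.Nonempty → (S \ T).Nonempty →
      P.vert T (S \ T) * P.ψ σ (S \ T) ∈ P.At p S ∧ P.asq T * P.ψ σ (S \ T) ∈ P.At p S) :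
    P.ψ σ S ∈ P.At c S := by
  refine hinv.mem_of_mul (a := p - P.wt S) ?_ (by omega)
  rw [eom' σ hS]
  refine neg_mem (sum_mem fun T hT => ?_)
  rw [Finset.mem_powerset] at hT
  rcases T.eq_empty_or_nonempty with rfl | h1
  · rw [vert_empty, asq_empty]; simp
  rcases (S \ T).eq_empty_or_nonempty with h2 | h2
  · rw [h2, P.ψ_empty]; simp
  obtain ⟨h3, h4⟩ := h T hT h1 h2
  rw [add_mul, mul_assoc, mul_assoc (P.g ^ 2)]
  exact add_mem (at_smul (sgn_g_mem σ) h3 (by omega)) (at_smul g_sq_mem h4 (by omega))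

theorem asq_mem {T : Finset α} {p : ℤ} (h : ∀ U ⊆ T, U.Nonempty → (T \ U).Nonempty →
    ∃ a b, (∀ μ, P.A μ U ∈ P.At a U) ∧ (∀ μ, P.A μ (T \ U) ∈ P.At b (T \ U)) ∧ p ≤ a + b) :
    P.asq T ∈ P.At p T := by
  refine sum_mem fun U hU => ?_
  rw [Finset.mem_powerset] at hU
  rcases U.eq_empty_or_nonempty with rfl | h1
  · rw [av_empty, zero_rdot]; exact zero_mem _
  rcases (T \ U).eq_empty_or_nonempty with h2 | h2
  · rw [h2, av_empty, rdot_zero]; exact zero_mem _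
  obtain ⟨a, b, ha, hb, hp⟩ := h U hU h1 h2
  exact at_rdot hU ha hb hp

theorem pp_mem {S : Finset α} {p : ℤ} (h : ∀ U ⊆ S, U.Nonempty → (S \ U).Nonempty →
    P.ψ true U * P.ψ false (S \ U) ∈ P.At p S) : P.pp S ∈ P.At p S := by
  refine sum_mem fun U hU => ?_
  rw [Finset.mem_powerset] at hU
  rcases U.eq_empty_or_nonempty with rfl | h1
  · rw [P.ψ_empty, zero_mul]; exact zero_mem _
  rcases (S \ U).eq_empty_or_nonempty with h2 | h2
  · rw [h2, P.ψ_empty, mul_zero]; exact zero_mem _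
  exact h U hU h1 h2

theorem pp_empty : P.pp ∅ = 0 := by simp [pp, P.ψ_empty]

/-- The order of the current follows from the orders of its terms; `L` is a component of the
momentum and `B` the same component of the gauge field. -/
theorem currentSum_mem {S : Finset α} {p : ℤ} (L B : Finset α → R) (hB : B ∅ = 0)
    (h : ∑ T ∈ S.powerset, L T * (P.ψ true T * P.ψ false (S \ T)) ∈ P.At p S)
    (h' : ∀ T ⊆ S, T.Nonempty → (S \ T).Nonempty → B T * P.pp (S \ T) ∈ P.At p S) :
    P.g * ∑ T ∈ S.powerset, L T * (P.ψ true T * P.ψ false (S \ T))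
      + 2 * P.g ^ 2 * ∑ T ∈ S.powerset, B T * P.pp (S \ T) ∈ P.At p S := by
  refine add_mem (at_smul P.g_mem h (by omega)) ?_
  rw [mul_assoc]
  refine P.two_mul (at_smul (b := p) g_sq_mem (sum_mem fun T hT => ?_) (by omega))
  rw [Finset.mem_powerset] at hT
  rcases T.eq_empty_or_nonempty with rfl | h1
  · rw [hB, zero_mul]; exact zero_mem _
  rcases (S \ T).eq_empty_or_nonempty with h2 | h2
  · rw [h2, pp_empty, mul_zero]; exact zero_mem _
  exact h' T hT h1 h2

theorem pairSum_mem {S : Finset α} {p : ℤ} (L : Finset α → R)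
    (h : ∀ T ⊆ S, T.Nonempty → (S \ T).Nonempty →
      L T * (P.ψ true T * P.ψ false (S \ T)) ∈ P.At p S) :
    ∑ T ∈ S.powerset, L T * (P.ψ true T * P.ψ false (S \ T)) ∈ P.At p S := by
  refine sum_mem fun T hT => ?_
  rw [Finset.mem_powerset] at hT
  rcases T.eq_empty_or_nonempty with rfl | h1
  · rw [P.ψ_empty, zero_mul, mul_zero]; exact zero_mem _
  rcases (S \ T).eq_empty_or_nonempty with h2 | h2
  · rw [h2, P.ψ_empty, mul_zero, mul_zero]; exact zero_mem _
  exact h T hT h1 h2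

theorem a_eq' (μ : Fin 4) {S : Finset α} {m : ℤ} (h : P.InvMem m (P.ksq S)) :
    P.ksq S * P.a μ S =
      P.g * ∑ T ∈ S.powerset, (P.k T μ - P.k (S \ T) μ) * (P.ψ true T * P.ψ false (S \ T))
      + 2 * P.g ^ 2 * ∑ T ∈ S.powerset, P.A μ T * P.pp (S \ T) := by
  obtain ⟨u, -, hu⟩ := h
  exact P.a_eq μ S ⟨u, hu⟩

/-- The order of the field generated by the current follows from the orders of the terms of the
current. -/
theorem a_mem {μ : Fin 4} {S : Finset α} {m p p' d c : ℤ} (hinv : P.InvMem m (P.ksq S))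
    (hc : c ≤ m + p) (hd : p ≤ d + p') (hk : ∀ T ⊆ S, P.k T μ ∈ P.F d)
    (h : ∀ T ⊆ S, T.Nonempty → (S \ T).Nonempty →
      P.ψ true T * P.ψ false (S \ T) ∈ P.At p' S ∧ P.A μ T * P.pp (S \ T) ∈ P.At p S) :
    P.a μ S ∈ P.At c S := by
  refine hinv.mem_of_mul (a := p - P.wt S) ?_ (by omega)
  rw [a_eq' μ hinv]
  refine currentSum_mem _ (fun T => P.A μ T) (P.A_empty μ) (pairSum_mem _ fun T hT h1 h2 => ?_)
    fun T hT h1 h2 => (h T hT h1 h2).2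
  exact at_smul (sub_mem (hk T hT) (hk _ Finset.sdiff_subset)) (h T hT h1 h2).1 (by omega)

theorem ψ_eq_zero_of_neutral (σ : Bool) {S : Finset α} (h : ¬ ∃ i ∈ S, P.q i ≠ 0) :
    P.ψ σ S = 0 := by
  push Not at h
  refine P.ψ_charge σ S ?_
  rw [Finset.sum_eq_zero h]
  cases σ <;> decide

theorem A_eq_zero_of_neutral (μ : Fin 4) {S : Finset α} (h2 : 2 ≤ S.card)
    (h : ¬ ∃ i ∈ S, P.q i ≠ 0) : P.A μ S = 0 := by
  push Not at h
  exact P.A_neutral μ S h2 h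

theorem ssubset_of_nonempty {S T : Finset α} (hT : T ⊆ S) (h1 : T.Nonempty)
    (h2 : (S \ T).Nonempty) : T ⊂ S ∧ S \ T ⊂ S := by
  refine ⟨⟨hT, fun h => ?_⟩, ⟨Finset.sdiff_subset, fun h => ?_⟩⟩
  · rw [Finset.sdiff_eq_empty_iff_subset.2 h] at h2
    exact Finset.not_nonempty_empty h2
  · obtain ⟨i, hi⟩ := h1
    exact (Finset.mem_sdiff.1 (h (hT hi))).2 hi

/-! ### Soft sector -/

theorem Soft.mono {S T : Finset α} (hS : P.Soft S) (h : T ⊆ S) : P.Soft T := fun i hi => hS i (h hi)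

theorem Soft.sdiff {S : Finset α} (hS : P.Soft S) (T : Finset α) : P.Soft (S \ T) :=
  hS.mono Finset.sdiff_subset

theorem Soft.ne_beam1 {S : Finset α} (hS : P.Soft S) : ∀ i ∈ S, P.tag i ≠ .beam1 := fun i hi => by
  rw [hS i hi]; decide

theorem wt_singleton (i : α) : P.wt {i} = (P.tag i).weight := Finset.sum_singleton _ _

/-- Soft fields are of order `λ²`. -/
theorem soft_mem (S : Finset α) : P.Soft S →
    (∀ σ, P.ψ σ S ∈ P.At 2 S) ∧ ∀ μ, P.A μ S ∈ P.At 2 S := by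
  induction S using Finset.strongInduction with
  | H S ih =>
    intro hS
    rcases S.eq_empty_or_nonempty with rfl | hne
    · exact ⟨fun σ => by rw [P.ψ_empty]; exact zero_mem _, fun μ => by
        rw [P.A_empty]; exact zero_mem _⟩
    by_cases h1 : S.card = 1
    · obtain ⟨i, rfl⟩ := Finset.card_eq_one.1 h1
      have hi := hS i (Finset.mem_singleton_self i)
      have hw : P.wt {i} = 2 := by rw [wt_singleton, hi]; rfl
      simp only [At, hw]
      exact ⟨fun σ => P.ψ_single σ i, fun μ => P.A_soft_single μ i hi⟩
    have h2 : 2 ≤ S.card := by have := hne.card_pos; omega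
    by_cases hc : ∃ i ∈ S, P.q i ≠ 0
    swap
    · exact ⟨fun σ => by rw [ψ_eq_zero_of_neutral σ hc]; exact zero_mem _, fun μ => by
        rw [A_eq_zero_of_neutral μ h2 hc]; exact zero_mem _⟩
    have hinv : P.InvMem (-4) (P.ksq S) := P.inv_soft S hS h2 hc
    have ihs : ∀ T ⊂ S, (∀ σ, P.ψ σ T ∈ P.At 2 T) ∧ ∀ μ, P.A μ T ∈ P.At 2 T := fun T hT =>
      ih T hT (hS.mono hT.1)
    refine ⟨fun σ => scalar_mem hS.ne_beam1 hinv (p := 6) (by omega) fun T hT hT1 hT2 => ?_,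
      fun μ => ?_⟩
    · obtain ⟨hs1, hs2⟩ := ssubset_of_nonempty hT hT1 hT2
      refine ⟨at_mul hT (a := 4) (b := 2) ?_ ((ihs _ hs2).1 σ) (by omega),
        at_mul hT (a := 4) (b := 2) ?_ ((ihs _ hs2).1 σ) (by omega)⟩
      · exact add_mem (P.two_mul (at_rdot_k (b := 2) (ihs T hs1).2
          (fun μ => P.k_soft _ μ (hS.sdiff T)) (by omega)))
          (at_rdot_k (b := 2) (ihs T hs1).2 (fun μ => P.k_soft _ μ (hS.mono hT)) (by omega))
      · exact asq_mem fun U hU _ _ => ⟨2, 2, (ihs U (hU.trans_ssubset hs1)).2,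
          (ihs _ (Finset.sdiff_subset.trans_ssubset hs1)).2, by omega⟩
    · rw [P.A_soft μ S hS h2]
      refine a_mem hinv (p := 6) (p' := 4) (d := 2) (by omega) (by omega)
        (fun T hT => P.k_soft T μ (hS.mono hT)) fun T hT hT1 hT2 => ?_
      obtain ⟨hs1, hs2⟩ := ssubset_of_nonempty hT hT1 hT2
      refine ⟨at_mul hT ((ihs _ hs1).1 true) ((ihs _ hs2).1 false) (by omega),
        at_mul hT (b := 4) ((ihs _ hs1).2 μ) (pp_mem fun U hU _ _ => ?_) (by omega)⟩
      exact at_mul hU ((ihs _ (hU.trans_ssubset hs2)).1 true)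
        ((ihs _ (Finset.sdiff_subset.trans_ssubset hs2)).1 false) (by omega)

/-- Soft Wilson lines have their natural order: the eikonal propagator of order `λ ^ (-2)`
compensates the suppression of the soft gauge field. -/
theorem Y_mem (b σ : Bool) (S : Finset α) : P.Soft S → P.Y b σ S ∈ P.At 0 S := by
  induction S using Finset.strongInduction with
  | H S ih =>
    intro hS
    rcases S.eq_empty_or_nonempty with rfl | hne
    · rw [P.Y_empty]; exact P.one_mem
    refine (P.inv_nk b S hS hne).mem_of_mul (a := 2 - P.wt S) ?_ (by omega)
    rw [P.Y_eq b σ S hS]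
    refine at_smul (neg_mem (sgn_g_mem σ)) (sum_mem fun T hT => ?_) (b := 2) (by omega)
    rw [Finset.mem_powerset] at hT
    rcases T.eq_empty_or_nonempty with rfl | h1
    · rw [show (fun μ => P.A μ ∅) = 0 from av_empty, rdot_zero, zero_mul]; exact zero_mem _
    have hs : S \ T ⊂ S := ⟨Finset.sdiff_subset, fun h => by
      obtain ⟨i, hi⟩ := h1
      exact (Finset.mem_sdiff.1 (h (hT hi))).2 hi⟩
    refine at_mul hT (a := 2) (b := 0) ?_ (ih _ hs (hS.sdiff T)) (by omega)
    rw [rdot_comm]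
    exact at_rdot_k (b := 0) (soft_mem T (hS.mono hT)).2 (P.n_mem b) (by omega)

end PowerSystem
end ScalarQED
end

noncomputable section
namespace ScalarQED
open scoped Topology
set_option linter.unusedSectionVars false
namespace PowerSystem

variable {R : Type*} [CommRing R] {α : Type*} [DecidableEq α] {P : PowerSystem R α}

/-! ### Jets with soft radiation -/

theorem InJet.mono {b : Bool} {S T : Finset α} (hS : P.InJet b S) (h : T ⊆ S) : P.InJet b T :=
  fun i hi => hS i (h hi)

theorem InJet.sdiff {b : Bool} {S : Finset α} (hS : P.InJet b S) (T : Finset α) :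
    P.InJet b (S \ T) := hS.mono Finset.sdiff_subset

theorem InJet.soft_of_not_has {b : Bool} {S : Finset α} (hS : P.InJet b S)
    (h : ¬ P.Has (.jet b) S) : P.Soft S := fun i hi =>
  (hS i hi).resolve_left fun h' => h ⟨i, hi, h'⟩

theorem InJet.ne_beam1 {b : Bool} {S : Finset α} (hS : P.InJet b S) :
    ∀ i ∈ S, P.tag i ≠ .beam1 := fun i hi => by
  rcases hS i hi with h | h <;> simp [h]

theorem Has.mono {τ : Tag} {S T : Finset α} (h : P.Has τ T) (hT : T ⊆ S) : P.Has τ S := by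
  obtain ⟨i, hi, h⟩ := h
  exact ⟨i, hT hi, h⟩

theorem part_subset (τ : Tag) (S : Finset α) : P.part τ S ⊆ S := Finset.filter_subset _ _

theorem mem_part {τ : Tag} {S : Finset α} {i : α} : i ∈ P.part τ S ↔ i ∈ S ∧ P.tag i = τ :=
  Finset.mem_filter

theorem soft_part (S : Finset α) : P.Soft (P.part .soft S) := fun _ hi => (mem_part.1 hi).2

theorem InJet.sdiff_part_jet {b : Bool} {S : Finset α} (hS : P.InJet b S) :
    S \ P.part (.jet b) S = P.part .soft S := by
  ext i
  rw [Finset.mem_sdiff, mem_part, mem_part]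
  refine ⟨fun h => ⟨h.1, (hS i h.1).resolve_left fun h' => h.2 ⟨h.1, h'⟩⟩, fun h => ⟨h.1, ?_⟩⟩
  rw [h.2]
  rintro ⟨-, h'⟩
  exact absurd h' (by simp)

theorem InJet.sdiff_part_soft {b : Bool} {S : Finset α} (hS : P.InJet b S) :
    S \ P.part .soft S = P.part (.jet b) S := by
  rw [← hS.sdiff_part_jet, Finset.sdiff_sdiff_eq_self (part_subset _ _)]

theorem part_sdiff (τ : Tag) (S T : Finset α) : P.part τ (S \ T) = P.part τ S \ P.part τ T := by
  ext i
  simp only [mem_part, Finset.mem_sdiff]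
  tauto

theorem part_eq_empty {τ : Tag} {S : Finset α} : P.part τ S = ∅ ↔ ¬ P.Has τ S := by
  rw [part, Finset.filter_eq_empty_iff, Has]
  push Not
  rfl

theorem part_eq_self {τ : Tag} {S : Finset α} (h : ∀ i ∈ S, P.tag i = τ) : P.part τ S = S :=
  Finset.filter_true_of_mem h

theorem part_mono {τ : Tag} {S T : Finset α} (h : T ⊆ S) : P.part τ T ⊆ P.part τ S :=
  Finset.filter_subset_filter _ h

variable (P) in
/-- The eikonal form of a charged field: the soft particles are emitted from a Wilson line. -/
def eik (b σ : Bool) (S : Finset α) : R := P.ψ σ (P.part (.jet b) S) * P.Y b σ (P.part .soft S)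

variable (P) in
/-- Power counting in a jet with soft radiation. Soft emission factorizes from the charged fields
(`eik`), and it is suppressed by `λ` for the gauge field (`mixed`). The component of the gauge field
along the direction of the jet is smaller by `λ` (`nphoton`, `nmixed`), which compensates the large
component of the momenta in the vertices. -/
structure JetBound (b : Bool) (S : Finset α) : Prop where
  scalar : ∀ σ, P.ψ σ S ∈ P.At 1 S
  eik : ∀ σ, P.ψ σ S - P.eik b σ S ∈ P.At 2 S
  photon : ∀ μ, P.A μ S ∈ P.At 1 S
  nphoton : rdot (P.n b) (P.av S) ∈ P.At 2 S
  mixed : P.Has .soft S → ∀ μ, P.A μ S ∈ P.At 2 S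
  nmixed : P.Has .soft S → P.Has (.jet b) S → rdot (P.n b) (P.av S) ∈ P.At 3 S

theorem Soft.part_jet {S : Finset α} (hS : P.Soft S) (b : Bool) : P.part (.jet b) S = ∅ := by
  rw [part_eq_empty]
  rintro ⟨i, hi, h⟩
  rw [hS i hi] at h
  exact absurd h (by simp)

theorem Soft.not_has_jet {S : Finset α} (hS : P.Soft S) (b : Bool) : ¬ P.Has (.jet b) S :=
  part_eq_empty.1 (hS.part_jet b)

theorem Soft.jetBound {S : Finset α} (hS : P.Soft S) (b : Bool) : P.JetBound b S := by
  obtain ⟨h1, h2⟩ := soft_mem S hS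
  refine ⟨fun σ => at_mono (by omega) (h1 σ), fun σ => ?_, fun μ => at_mono (by omega) (h2 μ), ?_,
    fun _ => h2, fun _ h => absurd h (hS.not_has_jet b)⟩
  · rw [PowerSystem.eik, hS.part_jet b, P.ψ_empty, zero_mul, sub_zero]; exact h1 σ
  · rw [rdot_comm]; exact at_rdot_k h2 (P.n_mem b) (by omega)

/-- The momenta in a jet are large along its direction only; the product with a gauge field is
governed by the small component `n · A`. -/
theorem rdot_k_mem {b : Bool} {T U : Finset α} (hU : P.InJet b U) {c c' : ℤ}
    (hA : ∀ μ, P.A μ T ∈ P.At c T) (hn : rdot (P.n b) (P.av T) ∈ P.At c' T) (hc : c' ≤ c + 1) :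
    rdot (P.av T) (P.k U) ∈ P.At c' T := by
  have e : rdot (P.av T) (P.k U) = P.k U 0 * rdot (P.n b) (P.av T)
      + rdot (P.av T) (fun μ => P.k U μ - P.k U 0 * P.n b μ) := by
    simp only [rdot]; ring
  rw [e]
  exact add_mem (at_smul (P.k_mem U 0) hn (by omega))
    (at_rdot_k hA (fun μ => P.k_jet b U μ hU) hc)

theorem JetBound.vert_mem {b : Bool} {T U : Finset α} (h : P.JetBound b T) (hT : P.InJet b T)
    (hU : P.InJet b U) : P.vert T U ∈ P.At 2 T :=
  add_mem (P.two_mul (rdot_k_mem hU h.photon h.nphoton (by omega)))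
    (rdot_k_mem hT h.photon h.nphoton (by omega))

theorem JetBound.vert_mem_of_mixed {b : Bool} {T U : Finset α} (h : P.JetBound b T)
    (hT : P.InJet b T) (hU : P.InJet b U) (h1 : P.Has .soft T) (h2 : P.Has (.jet b) T) :
    P.vert T U ∈ P.At 3 T :=
  add_mem (P.two_mul (rdot_k_mem hU (h.mixed h1) (h.nmixed h1 h2) (by omega)))
    (rdot_k_mem hT (h.mixed h1) (h.nmixed h1 h2) (by omega))

theorem not_nonempty_has {b : Bool} {S : Finset α} (hS : P.InJet b S) (h : ¬ P.Has .soft S) :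
    ∀ i ∈ S, P.tag i = .jet b := fun i hi => (hS i hi).resolve_right fun h' => h ⟨i, hi, h'⟩

theorem asq_mem_jet {b : Bool} {T : Finset α} (h : ∀ U ⊆ T, P.JetBound b U) :
    P.asq T ∈ P.At 2 T :=
  asq_mem fun U hU _ _ => ⟨1, 1, (h U hU).photon, (h _ Finset.sdiff_subset).photon, by omega⟩

theorem has_or_has_sdiff {τ : Tag} {S U : Finset α} (h : P.Has τ S) :
    P.Has τ U ∨ P.Has τ (S \ U) := by
  obtain ⟨i, hi, h⟩ := h
  by_cases hU : i ∈ U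
  · exact Or.inl ⟨i, hU, h⟩
  · exact Or.inr ⟨i, Finset.mem_sdiff.2 ⟨hi, hU⟩, h⟩

theorem asq_mem_jet_of_has {b : Bool} {T : Finset α} (h : ∀ U ⊆ T, P.JetBound b U)
    (hs : P.Has .soft T) : P.asq T ∈ P.At 3 T := by
  refine asq_mem fun U hU _ _ => ?_
  rcases has_or_has_sdiff (U := U) hs with h' | h'
  · exact ⟨2, 1, (h U hU).mixed h', (h _ Finset.sdiff_subset).photon, by omega⟩
  · exact ⟨1, 2, (h U hU).photon, (h _ Finset.sdiff_subset).mixed h', by omega⟩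

theorem asq_mem_soft {T : Finset α} (hT : P.Soft T) : P.asq T ∈ P.At 4 T :=
  asq_mem fun U hU _ _ => ⟨2, 2, (soft_mem U (hT.mono hU)).2, (soft_mem _ (hT.sdiff U)).2, by omega⟩

section Step

variable {b : Bool} {S : Finset α} (hS : P.InJet b S) (hj : P.Has (.jet b) S)
  (ih : ∀ T ⊂ S, P.JetBound b T)

include hS hj ih

theorem jet_scalar_mem (σ : Bool) : P.ψ σ S ∈ P.At 1 S := by
  obtain ⟨i, hi, hti⟩ := hj
  by_cases h1 : S.card = 1
  · obtain ⟨j, rfl⟩ := Finset.card_eq_one.1 h1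
    obtain rfl : i = j := Finset.mem_singleton.1 hi
    have hw : P.wt {i} = 1 := by rw [wt_singleton, hti]; rfl
    simp only [At, hw]
    exact P.ψ_single σ i
  have h2 : 2 ≤ S.card := by have := Finset.card_pos.2 ⟨i, hi⟩; omega
  by_cases hc : ∃ i ∈ S, P.q i ≠ 0
  swap
  · rw [ψ_eq_zero_of_neutral σ hc]; exact zero_mem _
  have hinv : P.InvMem (-2) (P.ksq S) := P.inv_jet b S hS ⟨i, hi, hti⟩ (Or.inr ⟨h2, hc⟩)
  refine scalar_mem hS.ne_beam1 hinv (p := 3) (by omega) fun T hT hT1 hT2 => ?_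
  obtain ⟨hs1, hs2⟩ := ssubset_of_nonempty hT hT1 hT2
  exact ⟨at_mul hT ((ih T hs1).vert_mem (hS.mono hT) (hS.sdiff T)) ((ih _ hs2).scalar σ) (by omega),
    at_mul hT (asq_mem_jet fun U hU => ih U (hU.trans_ssubset hs1)) ((ih _ hs2).scalar σ) (by omega)⟩

omit hj ih in
theorem eik_mem_aux (σ : Bool) {p : ℤ}
    (h : P.ψ σ (P.part (.jet b) S) ∈ P.At p (P.part (.jet b) S)) : P.eik b σ S ∈ P.At p S := by
  refine at_mul (part_subset _ _) h (b := 0) ?_ (by omega)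
  rw [hS.sdiff_part_jet]
  exact Y_mem b σ _ (soft_part S)

omit hj ih in
/-- The virtuality after soft emission is the one of the collinear part plus the eikonal
denominator. -/
theorem ksq_eik_mem :
    P.ksq S - P.ksq (P.part (.jet b) S)
      - 2 * (P.k (P.part (.jet b) S) 0 * rdot (P.n b) (P.k (P.part .soft S))) ∈ P.F 3 := by
  have hk := P.k_split (part_subset (P := P) (.jet b) S)
  rw [hS.sdiff_part_jet] at hk
  set U := P.part (.jet b) S
  set W := P.part .soft S
  have hU : P.InJet b U := hS.mono (part_subset _ _)
  have hW : P.Soft W := soft_part S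
  have e : P.ksq S - P.ksq U - 2 * (P.k U 0 * rdot (P.n b) (P.k W))
      = 2 * rdot (fun μ => P.k U μ - P.k U 0 * P.n b μ) (P.k W) + rdot (P.k W) (P.k W) := by
    simp only [ksq, hk, rdot, Pi.add_apply]; ring
  rw [e]
  exact add_mem (P.two_mul (P.rdot_mem (fun μ => P.k_jet b U μ hU) (fun μ => P.k_soft W μ hW)
    (by omega))) (P.rdot_mem (fun μ => P.k_soft W μ hW) (fun μ => P.k_soft W μ hW) (by omega))

/-- Soft emission from a charged field of a jet is eikonal. Both the field and its eikonal form
solve the field equation up to corrections suppressed by `λ`. -/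
theorem jet_eik_mem (σ : Bool) : P.ψ σ S - P.eik b σ S ∈ P.At 2 S := by
  by_cases hsoft : P.Has .soft S
  swap
  · have e1 : P.part (.jet b) S = S := part_eq_self (not_nonempty_has hS hsoft)
    have e2 : P.part .soft S = ∅ := part_eq_empty.2 hsoft
    rw [eik, e1, e2, P.Y_empty, mul_one, sub_self]; exact zero_mem _
  have hinv : P.InvMem (-2) (P.ksq S) := P.inv_jet b S hS hj (Or.inl hsoft)
  have hU : P.InJet b (P.part (.jet b) S) := hS.mono (part_subset _ _)
  have hW : P.Soft (P.part .soft S) := soft_part S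
  have hUW := hS.sdiff_part_jet
  have hWU := hS.sdiff_part_soft
  have hksq := ksq_eik_mem hS
  have heik : P.eik b σ S = P.ψ σ (P.part (.jet b) S) * P.Y b σ (P.part .soft S) := rfl
  have hUS : P.part (.jet b) S ⊂ S := by
    obtain ⟨i, hi, h⟩ := hsoft
    refine ⟨part_subset _ _, fun h' => ?_⟩
    have := (mem_part.1 (h' hi)).2
    rw [h] at this
    exact absurd this (by simp)
  have hψU : P.ψ σ (P.part (.jet b) S) ∈ P.At 1 (P.part (.jet b) S) := (ih _ hUS).scalar σ
  have heikm : P.eik b σ S ∈ P.At 1 S := eik_mem_aux hS σ hψU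
  refine hinv.mem_of_mul (a := 4 - P.wt S) ?_ (by omega)
  set U := P.part (.jet b) S with hUdef
  set W := P.part .soft S with hWdef
  have hWS : W ⊆ S := part_subset _ _
  have hdisj : Disjoint U W := by rw [← hUW]; exact Finset.disjoint_sdiff
  -- the three contributions to the field equation: exact, collinear emission, soft emission
  set f : Finset α → R := fun T =>
    (sgn σ * P.g * P.vert T (S \ T) + P.g ^ 2 * P.asq T) * P.ψ σ (S \ T)
  set f1 : Finset α → R := fun T =>
    (sgn σ * P.g * P.vert T (U \ T) + P.g ^ 2 * P.asq T) * P.ψ σ (U \ T) * P.Y b σ W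
  set f2 : Finset α → R := fun T =>
    2 * (sgn σ * P.g) * P.k U 0 * (rdot (P.n b) (P.av T) * P.Y b σ (W \ T)) * P.ψ σ U
  have h0 : P.ksq S * P.ψ σ S = - ∑ T ∈ S.powerset, f T := eom' σ hS.ne_beam1
  have h1 : P.ksq U * P.ψ σ U * P.Y b σ W = - ∑ T ∈ U.powerset, f1 T := by
    rw [eom' σ hU.ne_beam1, neg_mul, Finset.sum_mul]
  have h2 : 2 * (P.k U 0 * rdot (P.n b) (P.k W)) * P.ψ σ U * P.Y b σ W
      = - ∑ T ∈ W.powerset, f2 T := by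
    have := P.Y_eq b σ W hW
    rw [← Finset.sum_mul, ← Finset.mul_sum]
    change rdot (P.n b) (P.k W) * P.Y b σ W = - (sgn σ * P.g) * ∑ T ∈ W.powerset,
      rdot (P.n b) (P.av T) * P.Y b σ (W \ T) at this
    linear_combination 2 * P.k U 0 * P.ψ σ U * this
  have h1' : ∑ T ∈ U.powerset, f1 T = ∑ T ∈ S.powerset, if T ⊆ U then f1 T else 0 := by
    rw [← Finset.sum_filter]
    refine Finset.sum_congr ?_ fun _ _ => rfl
    ext T
    simp only [Finset.mem_powerset, Finset.mem_filter]
    exact ⟨fun h => ⟨h.trans hUS.1, h⟩, fun h => h.2⟩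
  have h2' : ∑ T ∈ W.powerset, f2 T = ∑ T ∈ S.powerset, if T ⊆ W then f2 T else 0 := by
    rw [← Finset.sum_filter]
    refine Finset.sum_congr ?_ fun _ _ => rfl
    ext T
    simp only [Finset.mem_powerset, Finset.mem_filter]
    exact ⟨fun h => ⟨h.trans hWS, h⟩, fun h => h.2⟩
  have key : P.ksq S * (P.ψ σ S - P.eik b σ S)
      = - ∑ T ∈ S.powerset, (f T - (if T ⊆ U then f1 T else 0) - (if T ⊆ W then f2 T else 0))
        - (P.ksq S - P.ksq U - 2 * (P.k U 0 * rdot (P.n b) (P.k W))) * P.eik b σ S := by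
    rw [Finset.sum_sub_distrib, Finset.sum_sub_distrib, ← h1', ← h2', heik]
    linear_combination h0 - h1 - h2
  rw [key]
  refine sub_mem (neg_mem (sum_mem fun T hT => ?_)) (at_smul hksq heikm (by omega))
  rw [Finset.mem_powerset] at hT
  rcases T.eq_empty_or_nonempty with rfl | hT1
  · simp only [Finset.empty_subset, if_true, f, f1, f2, vert_empty, asq_empty, av_empty, rdot_zero]
    simp
  by_cases hTU : T ⊆ U
  · have hTW : ¬ T ⊆ W := fun h => by
      obtain ⟨i, hi⟩ := hT1
      exact Finset.disjoint_left.1 hdisj (hTU hi) (h hi)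
    have hTs : T ⊂ S := hTU.trans_ssubset hUS
    have hSTs : S \ T ⊂ S := ⟨Finset.sdiff_subset, fun h => by
      obtain ⟨i, hi⟩ := hT1
      exact (Finset.mem_sdiff.1 (h (hT hi))).2 hi⟩
    have p1 : P.part (.jet b) (S \ T) = U \ T := by
      rw [part_sdiff, part_eq_self (fun i hi => (mem_part.1 (hTU hi)).2)]
    have p2 : P.part .soft (S \ T) = W := by
      have hTsoft : P.part .soft T = ∅ := part_eq_empty.2 fun ⟨i, hi, h⟩ => by
        have := (mem_part.1 (hTU hi)).2
        rw [h] at this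
        exact absurd this (by simp)
      rw [part_sdiff, hTsoft, Finset.sdiff_empty]
    have hk : P.k (S \ T) = P.k (U \ T) + P.k W := by
      have := P.k_split (part_subset (P := P) (.jet b) (S \ T))
      rwa [(hS.sdiff T).sdiff_part_jet, p1, p2] at this
    have he : P.ψ σ (S \ T) - P.ψ σ (U \ T) * P.Y b σ W ∈ P.At 2 (S \ T) := by
      have := (ih _ hSTs).eik σ
      rwa [eik, p1, p2] at this
    have hv : P.vert T (S \ T) = P.vert T (U \ T) + 2 * rdot (P.av T) (P.k W) := by
      rw [vert, vert, hk, rdot_add]; ring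
    rw [if_pos hTU, if_neg hTW, sub_zero]
    -- The remaining field is eikonal up to higher orders by induction, and the soft momentum in the
    -- vertex is negligible.
    have e : f T - f1 T = (sgn σ * P.g * P.vert T (U \ T) + P.g ^ 2 * P.asq T)
        * (P.ψ σ (S \ T) - P.ψ σ (U \ T) * P.Y b σ W)
        + sgn σ * P.g * (2 * rdot (P.av T) (P.k W)) * P.ψ σ (S \ T) := by
      simp only [f, f1, hv]; ring
    rw [e]
    refine add_mem (at_mul hT (a := 2) (add_mem (at_smul (sgn_g_mem σ)
      ((ih T hTs).vert_mem (hS.mono hT) (hU.sdiff T)) (by omega)) (at_smul g_sq_mem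
      (asq_mem_jet fun V hV => ih V (hV.trans_ssubset hTs)) (by omega))) he (by omega)) ?_
    exact at_mul hT (a := 3) (at_smul (sgn_g_mem σ) (P.two_mul (at_rdot_k (ih T hTs).photon
      (fun μ => P.k_soft W μ hW) (le_refl _))) (by omega)) ((ih _ hSTs).scalar σ) (by omega)
  by_cases hTW : T ⊆ W
  · have hTs : T ⊂ S := ⟨hT, fun h => by
      obtain ⟨i, hi, h'⟩ := hj
      have := (mem_part.1 (hTW (h hi))).2
      rw [h'] at this
      exact absurd this (by simp)⟩
    have hSTs : S \ T ⊂ S := ⟨Finset.sdiff_subset, fun h => by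
      obtain ⟨i, hi⟩ := hT1
      exact (Finset.mem_sdiff.1 (h (hT hi))).2 hi⟩
    have hTsoft : P.Soft T := hW.mono hTW
    have p1 : P.part (.jet b) (S \ T) = U := by
      rw [part_sdiff, hTsoft.part_jet b, Finset.sdiff_empty]
    have p2 : P.part .soft (S \ T) = W \ T := by
      rw [part_sdiff, part_eq_self hTsoft]
    have hk : P.k (S \ T) = P.k U + P.k (W \ T) := by
      have := P.k_split (part_subset (P := P) (.jet b) (S \ T))
      rwa [(hS.sdiff T).sdiff_part_jet, p1, p2] at this
    have he : P.ψ σ (S \ T) - P.ψ σ U * P.Y b σ (W \ T) ∈ P.At 2 (S \ T) := by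
      have := (ih _ hSTs).eik σ
      rwa [eik, p1, p2] at this
    have hA := (soft_mem T hTsoft).2
    have hnA : rdot (P.n b) (P.av T) ∈ P.At 2 T := (hTsoft.jetBound b).nphoton
    have hv : P.vert T (S \ T) - 2 * P.k U 0 * rdot (P.n b) (P.av T) ∈ P.At 3 T := by
      have e : P.vert T (S \ T) - 2 * P.k U 0 * rdot (P.n b) (P.av T)
          = 2 * rdot (P.av T) (fun μ => P.k U μ - P.k U 0 * P.n b μ)
            + 2 * rdot (P.av T) (P.k (W \ T)) + rdot (P.av T) (P.k T) := by
        rw [vert, hk, rdot_add]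
        simp only [rdot]; ring
      rw [e]
      exact add_mem (add_mem (P.two_mul (at_rdot_k hA (fun μ => P.k_jet b U μ hU) (by omega)))
        (P.two_mul (at_rdot_k hA (fun μ => P.k_soft _ μ (hW.sdiff T)) (by omega))))
        (at_rdot_k hA (fun μ => P.k_soft _ μ hTsoft) (by omega))
    rw [if_neg hTU, if_pos hTW, sub_zero]
    -- The vertex is eikonal up to higher orders, the remaining field is so by induction, and the
    -- term with two gauge fields is negligible.
    have e : f T - f2 T = sgn σ * P.g * (P.vert T (S \ T) - 2 * P.k U 0 * rdot (P.n b) (P.av T))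
          * P.ψ σ (S \ T)
        + (sgn σ * P.g * (2 * (P.k U 0 * rdot (P.n b) (P.av T)))) *
          (P.ψ σ (S \ T) - P.ψ σ U * P.Y b σ (W \ T))
        + P.g ^ 2 * P.asq T * P.ψ σ (S \ T) := by
      simp only [f, f2]; ring
    rw [e]
    refine add_mem (add_mem ?_ ?_) ?_
    · exact at_mul hT (a := 3) (at_smul (sgn_g_mem σ) hv (by omega)) ((ih _ hSTs).scalar σ)
        (by omega)
    · exact at_mul hT (a := 2) (at_smul (sgn_g_mem σ) (P.two_mul
        (at_smul (P.k_mem U 0) hnA (le_refl _))) (by omega)) he (by omega)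
    · exact at_mul hT (a := 4) (at_smul g_sq_mem (asq_mem_soft hTsoft) (by omega))
        ((ih _ hSTs).scalar σ) (by omega)
  · -- soft and collinear legs attached at the same vertex: suppressed by an additional `λ`
    rw [if_neg hTU, if_neg hTW, sub_zero, sub_zero]
    rcases (S \ T).eq_empty_or_nonempty with hT2 | hT2
    · simp only [f, hT2, P.ψ_empty, mul_zero]; exact zero_mem _
    obtain ⟨hs1, hs2⟩ := ssubset_of_nonempty hT hT1 hT2
    have m1 : P.Has .soft T := by
      by_contra h
      exact hTU fun i hi => mem_part.2 ⟨hT hi, not_nonempty_has (hS.mono hT) h i hi⟩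
    have m2 : P.Has (.jet b) T := by
      by_contra h
      exact hTW fun i hi => mem_part.2 ⟨hT hi, (hS.mono hT).soft_of_not_has h i hi⟩
    exact at_mul hT (a := 3) (add_mem (at_smul (sgn_g_mem σ) ((ih T hs1).vert_mem_of_mixed
      (hS.mono hT) (hS.sdiff T) m1 m2) (by omega)) (at_smul g_sq_mem (asq_mem_jet_of_has
      (fun V hV => ih V (hV.trans_ssubset hs1)) m1) (by omega))) ((ih _ hs2).scalar σ) (by omega)

end Step

end PowerSystem
end ScalarQED
end

noncomputable section
namespace ScalarQED
open scoped Topology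
set_option linter.unusedSectionVars false

/-! ### The gauge field of a jet -/

theorem sum_powerset_of_union {β M : Type*} [DecidableEq β] [AddCommMonoid M] {S U W : Finset β}
    (hd : Disjoint U W) (hS : S = U ∪ W) (f : Finset β → M) :
    ∑ T ∈ S.powerset, f T = ∑ T₁ ∈ U.powerset, ∑ T₂ ∈ W.powerset, f (T₁ ∪ T₂) := by
  rw [← Finset.sum_product']
  refine Finset.sum_bij' (fun T _ => (T ∩ U, T ∩ W)) (fun x _ => x.1 ∪ x.2) ?_ ?_ ?_ ?_ ?_
  · intro T _
    simp only [Finset.mem_product, Finset.mem_powerset]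
    exact ⟨Finset.inter_subset_right, Finset.inter_subset_right⟩
  · rintro ⟨x, y⟩ h
    simp only [Finset.mem_product, Finset.mem_powerset] at h ⊢
    rw [hS]
    exact Finset.union_subset_union h.1 h.2
  · intro T h
    simp only
    rw [← Finset.inter_union_distrib_left, ← hS]
    exact Finset.inter_eq_left.2 (Finset.mem_powerset.1 h)
  · rintro ⟨x, y⟩ h
    simp only [Finset.mem_product, Finset.mem_powerset] at h
    obtain ⟨h1, h2⟩ := h
    rw [Finset.union_inter_distrib_right, Finset.union_inter_distrib_right,
      Finset.inter_eq_left.2 h1, Finset.inter_eq_left.2 h2,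
      Finset.disjoint_iff_inter_eq_empty.1 (hd.symm.mono_left h2),
      Finset.disjoint_iff_inter_eq_empty.1 (hd.mono_left h1),
      Finset.union_empty, Finset.empty_union]
  · intro T h
    simp only
    rw [← Finset.inter_union_distrib_left, ← hS, Finset.inter_eq_left.2 (Finset.mem_powerset.1 h)]

namespace PowerSystem

variable {R : Type*} [CommRing R] {α : Type*} [DecidableEq α] {P : PowerSystem R α}

theorem eik_empty (b σ : Bool) : P.eik b σ ∅ = 0 := by
  rw [eik, part_eq_empty.2, P.ψ_empty, zero_mul]
  rintro ⟨i, hi, -⟩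
  exact absurd hi (Finset.notMem_empty i)

theorem InJet.eq_union {b : Bool} {S : Finset α} (hS : P.InJet b S) :
    S = P.part (.jet b) S ∪ P.part .soft S := by
  rw [← hS.sdiff_part_jet, Finset.union_sdiff_of_subset (part_subset _ _)]

theorem disjoint_part (S : Finset α) {τ τ' : Tag} (h : τ ≠ τ') :
    Disjoint (P.part τ S) (P.part τ' S) := by
  rw [Finset.disjoint_left]
  intro i hi hi'
  exact h ((mem_part.1 hi).2.symm.trans (mem_part.1 hi').2)

/-- The soft Wilson lines of a neutral jet cancel. -/
theorem sum_eik_eq_zero {b : Bool} {S : Finset α} (hS : P.InJet b S) (hs : P.Has .soft S)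
    (L : Finset α → R) :
    ∑ T ∈ S.powerset, L (P.part (.jet b) T) * (P.eik b true T * P.eik b false (S \ T)) = 0 := by
  have hd := disjoint_part (P := P) S (τ := .jet b) (τ' := .soft) (by simp)
  have hne : (P.part .soft S).Nonempty := by
    obtain ⟨i, hi, h⟩ := hs
    exact ⟨i, mem_part.2 ⟨hi, h⟩⟩
  rw [sum_powerset_of_union hd hS.eq_union]
  refine Finset.sum_eq_zero fun T₁ h₁ => ?_
  rw [Finset.mem_powerset] at h₁
  have e : ∀ T₂ ∈ (P.part .soft S).powerset,
      L (P.part (.jet b) (T₁ ∪ T₂)) * (P.eik b true (T₁ ∪ T₂) * P.eik b false (S \ (T₁ ∪ T₂)))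
      = L T₁ * P.ψ true T₁ * P.ψ false (P.part (.jet b) S \ T₁) *
        (P.Y b true T₂ * P.Y b false (P.part .soft S \ T₂)) := by
    intro T₂ h₂
    rw [Finset.mem_powerset] at h₂
    have p1 : P.part (.jet b) (T₁ ∪ T₂) = T₁ := by
      rw [part, Finset.filter_union]
      change P.part (.jet b) T₁ ∪ P.part (.jet b) T₂ = T₁
      rw [((soft_part S).mono h₂).part_jet b, Finset.union_empty,
        part_eq_self fun i hi => (mem_part.1 (h₁ hi)).2]
    have p2 : P.part .soft (T₁ ∪ T₂) = T₂ := by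
      have h0 : P.part .soft T₁ = ∅ := part_eq_empty.2 fun ⟨i, hi, h⟩ => by
        have := (mem_part.1 (h₁ hi)).2
        rw [h] at this
        exact absurd this (by simp)
      rw [part, Finset.filter_union]
      change P.part .soft T₁ ∪ P.part .soft T₂ = T₂
      rw [h0, Finset.empty_union, part_eq_self ((soft_part S).mono h₂)]
    rw [eik, eik, part_sdiff, part_sdiff, p1, p2]
    ring
  rw [Finset.sum_congr rfl e, ← Finset.mul_sum, P.Y_mul b _ hne, mul_zero]

/-- In sums over the pairs of charged fields, soft emission cancels at leading power. -/
theorem mixed_pairSum_mem {b : Bool} {S : Finset α} (hS : P.InJet b S) (hs : P.Has .soft S)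
    (ih : ∀ T ⊂ S, P.JetBound b T) (L ℓ : Finset α → R) {ε : ℤ} (h1 : ∀ T ⊆ S, L T ∈ P.F ε)
    (h2 : ∀ T ⊆ S, L T - ℓ (P.part (.jet b) T) ∈ P.F (ε + 1)) :
    ∑ T ∈ S.powerset, L T * (P.ψ true T * P.ψ false (S \ T)) ∈ P.At (3 + ε) S := by
  have e : ∑ T ∈ S.powerset, L T * (P.ψ true T * P.ψ false (S \ T))
      = ∑ T ∈ S.powerset, (L T * (P.ψ true T * P.ψ false (S \ T)) -
        ℓ (P.part (.jet b) T) * (P.eik b true T * P.eik b false (S \ T))) := by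
    rw [Finset.sum_sub_distrib, sum_eik_eq_zero hS hs, sub_zero]
  rw [e]
  refine sum_mem fun T hT => ?_
  rw [Finset.mem_powerset] at hT
  rcases T.eq_empty_or_nonempty with rfl | hT1
  · rw [P.ψ_empty, eik_empty, zero_mul, zero_mul, mul_zero, mul_zero, sub_zero]; exact zero_mem _
  rcases (S \ T).eq_empty_or_nonempty with hT2 | hT2
  · rw [hT2, P.ψ_empty, eik_empty, mul_zero, mul_zero, mul_zero, mul_zero, sub_zero]
    exact zero_mem _
  obtain ⟨hs1, hs2⟩ := ssubset_of_nonempty hT hT1 hT2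
  have e' : L T * (P.ψ true T * P.ψ false (S \ T)) -
        ℓ (P.part (.jet b) T) * (P.eik b true T * P.eik b false (S \ T))
      = L T * ((P.ψ true T - P.eik b true T) * P.ψ false (S \ T))
        + L T * (P.eik b true T * (P.ψ false (S \ T) - P.eik b false (S \ T)))
        + (L T - ℓ (P.part (.jet b) T)) * (P.eik b true T * P.eik b false (S \ T)) := by ring
  rw [e']
  have he : ∀ σ, ∀ V ⊂ S, P.eik b σ V ∈ P.At 1 V := fun σ V hV => by
    have h := sub_mem ((ih V hV).scalar σ) (at_mono (p := 1) (by omega) ((ih V hV).eik σ))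
    rwa [sub_sub_cancel] at h
  refine add_mem (add_mem ?_ ?_) ?_
  · exact at_smul (h1 T hT) (at_mul hT ((ih T hs1).eik true) ((ih _ hs2).scalar false)
      (le_refl _)) (by omega)
  · exact at_smul (h1 T hT) (at_mul hT (he true T hs1) ((ih _ hs2).eik false) (le_refl _))
      (by omega)
  · exact at_smul (h2 T hT) (at_mul hT (he true T hs1) (he false _ hs2) (le_refl _)) (by omega)

theorem jet_pp_mem {b : Bool} {S : Finset α} (ih : ∀ T ⊂ S, P.JetBound b T) : P.pp S ∈ P.At 2 S :=
  pp_mem fun U hU h1 h2 => by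
    obtain ⟨hs1, hs2⟩ := ssubset_of_nonempty hU h1 h2
    exact at_mul hU ((ih U hs1).scalar true) ((ih _ hs2).scalar false) (by omega)

/-- The product `φ^* φ` on a jet with soft particles is suppressed, since soft emission from the two
fields cancels. -/
theorem mixed_pp_mem {b : Bool} {S : Finset α} (hS : P.InJet b S) (hs : P.Has .soft S)
    (ih : ∀ T ⊂ S, P.JetBound b T) : P.pp S ∈ P.At 3 S := by
  have := mixed_pairSum_mem hS hs ih (fun _ => 1) (fun _ => 1) (ε := 0) (fun _ _ => P.one_mem)
    fun _ _ => by rw [sub_self]; exact zero_mem _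
  simp only [one_mul, add_zero] at this
  exact this

section Step

variable {b : Bool} {S : Finset α} (hS : P.InJet b S) (hj : P.Has (.jet b) S)
  (ih : ∀ T ⊂ S, P.JetBound b T)

include hS ih

/-- The order of (a combination of) components of the current of a jet; the additional power `e`
in the presence of soft particles is due to the cancellation of their emission. -/
theorem jet_currentSum_mem {e : ℤ} (he : e = 0 ∨ e = 1 ∧ P.Has .soft S) (l B : Finset α → R)
    {ε : ℤ} (hε : ε ≤ 1) (hB : ∀ T ⊂ S, B T ∈ P.At 1 T)
    (hB' : ∀ T ⊂ S, P.Has .soft T → B T ∈ P.At 2 T) (hB0 : B ∅ = 0)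
    (hl : ∀ T ⊆ S, l T ∈ P.F ε) (hls : ∀ T, P.Soft T → l T ∈ P.F 2)
    (hl_split : ∀ {T U}, U ⊆ T → l T = l U + l (T \ U)) :
    P.g * ∑ T ∈ S.powerset, (l T - l (S \ T)) * (P.ψ true T * P.ψ false (S \ T))
      + 2 * P.g ^ 2 * ∑ T ∈ S.powerset, B T * P.pp (S \ T) ∈ P.At (2 + ε + e) S := by
  rcases he with rfl | ⟨rfl, hs⟩
  · refine currentSum_mem (fun T => l T - l (S \ T)) B hB0 (pairSum_mem _ fun T hT h1 h2 => ?_)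
      fun T hT h1 h2 => ?_
    · obtain ⟨hs1, hs2⟩ := ssubset_of_nonempty hT h1 h2
      exact at_smul (sub_mem (hl T hT) (hl _ Finset.sdiff_subset))
        (at_mul hT ((ih T hs1).scalar true) ((ih _ hs2).scalar false) (le_refl _)) (by omega)
    · obtain ⟨hs1, hs2⟩ := ssubset_of_nonempty hT h1 h2
      exact at_mul hT (hB T hs1) (jet_pp_mem fun U hU => ih U (hU.trans hs2)) (by omega)
  · refine currentSum_mem (fun T => l T - l (S \ T)) B hB0 ?_ fun T hT h1 h2 => ?_
    · have := mixed_pairSum_mem hS hs ih (fun T => l T - l (S \ T))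
        (fun T => l T - l (P.part (.jet b) S \ T)) (ε := ε)
        (fun T hT => sub_mem (hl T hT) (hl _ Finset.sdiff_subset)) fun T hT => ?_
      · exact at_mono (by omega) this
      · have e1 := hl_split (part_subset (P := P) (.jet b) T)
        have e2 := hl_split (part_subset (P := P) (.jet b) (S \ T))
        rw [(hS.mono hT).sdiff_part_jet] at e1
        rw [(hS.sdiff T).sdiff_part_jet, part_sdiff] at e2
        have e3 : l T - l (S \ T) - (l (P.part (.jet b) T)
            - l (P.part (.jet b) S \ P.part (.jet b) T))
            = l (P.part .soft T) - l (P.part .soft (S \ T)) := by rw [e1, e2]; ring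
        rw [e3]
        exact P.anti (by omega) (sub_mem (hls _ (soft_part T)) (hls _ (soft_part _)))
    · obtain ⟨hs1, hs2⟩ := ssubset_of_nonempty hT h1 h2
      rcases has_or_has_sdiff (U := T) hs with h | h
      · exact at_mul hT (hB' T hs1 h) (jet_pp_mem fun U hU => ih U (hU.trans hs2)) (by omega)
      · exact at_mul hT (hB T hs1) (mixed_pp_mem (hS.sdiff T) h fun U hU => ih U (hU.trans hs2))
          (by omega)

include hj

theorem ksq_mem : P.ksq S ∈ P.F 2 := by
  have e : P.ksq S = rdot (fun μ => P.k S μ - P.k S 0 * P.n b μ)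
      (fun μ => P.k S μ - P.k S 0 * P.n b μ) + 2 * (P.k S 0 * rdot (P.n b) (P.k S)) := by
    have := P.n_sq b
    rw [ksq]
    simp only [rdot] at this ⊢
    linear_combination - P.k S 0 ^ 2 * this
  rw [e]
  exact add_mem (P.rdot_mem (fun μ => P.k_jet b S μ hS) (fun μ => P.k_jet b S μ hS) (by omega))
    (P.two_mul (P.mul (P.k_mem S 0) (P.nk_jet b S hS) (by omega)))

/-- The field of a jet in the light-cone gauge of its Wilson line. The part of the current along
the direction of the jet, which is enhanced, drops out. -/
theorem jet_photon_mem (h2 : 2 ≤ S.card) {e : ℤ} (he : e = 0 ∨ e = 1 ∧ P.Has .soft S) :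
    (∀ μ, P.A μ S ∈ P.At (1 + e) S) ∧ rdot (P.n b) (P.av S) ∈ P.At (2 + e) S := by
  by_cases hc : ∃ i ∈ S, P.q i ≠ 0
  swap
  · have h0 : ∀ μ, P.A μ S = 0 := fun μ => A_eq_zero_of_neutral μ h2 hc
    refine ⟨fun μ => by rw [h0]; exact zero_mem _, ?_⟩
    rw [show P.av S = 0 from funext h0, rdot_zero]; exact zero_mem _
  have hinv : P.InvMem (-2) (P.ksq S) := P.inv_jet b S hS hj (Or.inr ⟨h2, hc⟩)
  obtain ⟨c, hctk, hA, hka⟩ := P.A_jet b S hS hj h2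
  have ha : ∀ μ, P.a μ S ∈ P.At e S := fun μ => by
    refine hinv.mem_of_mul (a := 2 + e - P.wt S) ?_ (by omega)
    rw [a_eq' μ hinv]
    have := jet_currentSum_mem hS ih he (fun T => P.k T μ) (fun T => P.A μ T) (ε := 0) (by omega)
      (fun T hT => (ih T hT).photon μ) (fun T hT h => (ih T hT).mixed h μ) (P.A_empty μ)
      (fun T _ => P.k_mem T μ) (fun T h => P.k_soft T μ h) fun h => by rw [P.k_split h]; rfl
    rwa [add_zero] at this
  -- The components of the current that are not along the direction of the jet are suppressed by
  -- `λ`, as they involve the corresponding components of the momenta.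
  have hν : ∀ μ, P.a μ S - P.a 0 S * P.n b μ ∈ P.At (1 + e) S := fun μ => by
    refine hinv.mem_of_mul (a := 3 + e - P.wt S) ?_ (by omega)
    have := jet_currentSum_mem hS ih he (fun T => P.k T μ - P.k T 0 * P.n b μ)
      (fun T => P.A μ T - P.A 0 T * P.n b μ) (ε := 1) (by omega)
      (fun T hT => sub_mem ((ih T hT).photon μ) (by
        rw [mul_comm]; exact at_smul (P.n_mem b μ) ((ih T hT).photon 0) (by omega)))
      (fun T hT h => sub_mem ((ih T hT).mixed h μ) (by
        rw [mul_comm]; exact at_smul (P.n_mem b μ) ((ih T hT).mixed h 0) (by omega)))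
      (by rw [P.A_empty, P.A_empty]; ring) (fun T hT => P.k_jet b T μ (hS.mono hT))
      (fun T h => sub_mem (P.k_soft T μ h) (P.mul (P.k_soft T 0 h) (P.n_mem b μ) (by omega)))
      fun h => by rw [P.k_split h]; simp only [Pi.add_apply]; ring
    have e1 := a_eq' μ hinv
    have e2 := a_eq' 0 hinv
    have e3 : P.ksq S * (P.a μ S - P.a 0 S * P.n b μ)
        = P.g * ∑ T ∈ S.powerset, (P.k T μ - P.k T 0 * P.n b μ
            - (P.k (S \ T) μ - P.k (S \ T) 0 * P.n b μ)) * (P.ψ true T * P.ψ false (S \ T))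
          + 2 * P.g ^ 2 * ∑ T ∈ S.powerset, (P.A μ T - P.A 0 T * P.n b μ) * P.pp (S \ T) := by
      have s1 : ∑ T ∈ S.powerset, (P.k T μ - P.k T 0 * P.n b μ
            - (P.k (S \ T) μ - P.k (S \ T) 0 * P.n b μ)) * (P.ψ true T * P.ψ false (S \ T))
          = (∑ T ∈ S.powerset, (P.k T μ - P.k (S \ T) μ) * (P.ψ true T * P.ψ false (S \ T)))
          - P.n b μ *
            ∑ T ∈ S.powerset, (P.k T 0 - P.k (S \ T) 0) * (P.ψ true T * P.ψ false (S \ T)) := by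
        rw [Finset.mul_sum, ← Finset.sum_sub_distrib]
        exact Finset.sum_congr rfl fun T _ => by ring
      have s2 : ∑ T ∈ S.powerset, (P.A μ T - P.A 0 T * P.n b μ) * P.pp (S \ T)
          = (∑ T ∈ S.powerset, P.A μ T * P.pp (S \ T))
          - P.n b μ * ∑ T ∈ S.powerset, P.A 0 T * P.pp (S \ T) := by
        rw [Finset.mul_sum, ← Finset.sum_sub_distrib]
        exact Finset.sum_congr rfl fun T _ => by ring
      rw [s1, s2]
      linear_combination e1 - P.n b μ * e2
    rw [e3, show 3 + e - P.wt S = 2 + 1 + e - P.wt S by ring]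
    exact this
  have hκ : ∀ μ, P.k S μ - P.k S 0 * P.n b μ ∈ P.F 1 := fun μ => P.k_jet b S μ hS
  have hinvt := P.inv_tk b S hS hj
  have hta : rdot (P.t b) (fun μ => P.a μ S) ∈ P.At e S := by
    rw [rdot_comm]; exact at_rdot_k ha (P.t_mem b) (by omega)
  have hcm : c ∈ P.At e S := hinvt.mem_of_mul (a := e - P.wt S)
    (by rw [mul_comm, hctk]; exact hta) (by omega)
  have hAm : ∀ μ, P.A μ S ∈ P.At (1 + e) S := fun μ => by
    refine hinvt.mem_of_mul (a := 1 + e - P.wt S) ?_ (by omega)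
    -- In the axial gauge the enhanced term `a 0 * n` cancels against the gauge term, because the
    -- momentum is along `n` at leading order.
    have e1 : rdot (P.t b) (P.k S) * P.A μ S
        = rdot (P.t b) (P.k S) * (P.a μ S - P.a 0 S * P.n b μ)
        - P.n b μ * (P.k S 0 * rdot (fun ν => P.a ν S - P.a 0 S * P.n b ν) (P.t b))
        - (P.k S μ - P.k S 0 * P.n b μ) * rdot (P.t b) (fun ν => P.a ν S)
        + P.n b μ * (rdot (P.t b) (fun ν => P.k S ν - P.k S 0 * P.n b ν) * P.a 0 S) := by
      rw [hA μ]
      have : rdot (P.t b) (P.k S) * (P.a μ S - c * P.k S μ)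
        = rdot (P.t b) (P.k S) * P.a μ S - P.k S μ * rdot (P.t b) (fun μ => P.a μ S) := by
        linear_combination - P.k S μ * hctk
      rw [this]
      simp only [rdot]; ring
    have htk : rdot (P.t b) (P.k S) ∈ P.F 0 := P.rdot_mem (P.t_mem b) (P.k_mem S) (by omega)
    rw [e1]
    refine add_mem (sub_mem (sub_mem ?_ ?_) ?_) ?_
    · exact at_smul htk (hν μ) (by omega)
    · exact at_smul (P.n_mem b μ) (at_smul (b := 1 + e) (P.k_mem S 0) (at_rdot_k hν (P.t_mem b)
        (by omega)) (le_refl _)) (by omega)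
    · exact at_smul (hκ μ) hta (by omega)
    · exact at_smul (P.n_mem b μ) (at_smul (b := e) (P.rdot_mem (p := 1) (P.t_mem b) hκ (by omega))
        (ha 0) (le_refl _)) (by omega)
  refine ⟨hAm, ?_⟩
  refine (P.inv_energy b S hS hj).mem_of_mul (a := 2 + e - P.wt S) ?_ (by omega)
  -- The small component follows from `k · a = 0`, i.e. `k · A = - c k²`.
  have e1 : P.k S 0 * rdot (P.n b) (P.av S) = - (P.ksq S * c)
      - rdot (P.av S) (fun μ => P.k S μ - P.k S 0 * P.n b μ) := by
    have h1 : rdot (P.k S) (P.av S) = - (P.ksq S * c) := by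
      have : P.av S = fun μ => P.a μ S - c * P.k S μ := funext hA
      rw [this, ksq]
      simp only [rdot] at hka ⊢
      linear_combination hka
    rw [← h1]
    simp only [rdot]; ring
  rw [e1]
  exact sub_mem (neg_mem (at_smul (ksq_mem hS hj ih) hcm (by omega)))
    (at_rdot_k hAm hκ (by omega))

end Step

/-- Power counting in a jet with soft radiation, by induction on the set of legs. -/
theorem jet_bound (b : Bool) (S : Finset α) : P.InJet b S → P.JetBound b S := by
  induction S using Finset.strongInduction with
  | H S ih =>
    intro hS
    by_cases hj : P.Has (.jet b) S
    swap
    · exact (hS.soft_of_not_has hj).jetBound b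
    have ih' : ∀ T ⊂ S, P.JetBound b T := fun T hT => ih T hT (hS.mono hT.1)
    have hsc := jet_scalar_mem hS hj ih'
    have heik := fun σ => jet_eik_mem hS hj ih' σ
    by_cases h1 : S.card = 1
    · obtain ⟨i, rfl⟩ := Finset.card_eq_one.1 h1
      have hti : P.tag i = .jet b := by
        obtain ⟨j, hj1, hj2⟩ := hj
        rwa [Finset.mem_singleton.1 hj1] at hj2
      have hw : P.wt {i} = 1 := by rw [wt_singleton, hti]; rfl
      have hns : ¬ P.Has .soft {i} := by
        rintro ⟨j, hj1, hj2⟩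
        rw [Finset.mem_singleton.1 hj1, hti] at hj2
        exact absurd hj2 (by simp)
      have hA : ∀ μ, P.A μ {i} ∈ P.At 1 {i} := fun μ => by
        rw [At, hw]; exact P.A_jet_single b μ i hti
      refine ⟨hsc, heik, hA, ?_, fun h => absurd h hns, fun h => absurd h hns⟩
      refine (P.inv_energy b {i} hS hj).mem_of_mul (a := 2 - P.wt {i}) ?_ (by omega)
      -- For a single photon, the small component of the wave function follows from transversality.
      have e1 : P.k {i} 0 * rdot (P.n b) (P.av {i})
          = - rdot (P.av {i}) (fun μ => P.k {i} μ - P.k {i} 0 * P.n b μ) := by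
        have := P.kA_jet_single b i hti
        change rdot (P.k {i}) (P.av {i}) = 0 at this
        simp only [rdot] at this ⊢
        linear_combination this
      rw [e1]
      exact neg_mem (at_rdot_k hA (fun μ => P.k_jet b _ μ hS) (by omega))
    have h2 : 2 ≤ S.card := by
      have := Finset.card_pos.2 (let ⟨i, hi, _⟩ := hj; ⟨i, hi⟩ : S.Nonempty); omega
    obtain ⟨hp, hn⟩ := jet_photon_mem hS hj ih' h2 (e := 0) (Or.inl rfl)
    refine ⟨hsc, heik, hp, hn, fun h => ?_, fun h _ => ?_⟩
    · exact (jet_photon_mem hS hj ih' h2 (e := 1) (Or.inr ⟨rfl, h⟩)).1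
    · exact (jet_photon_mem hS hj ih' h2 (e := 1) (Or.inr ⟨rfl, h⟩)).2

end PowerSystem
end ScalarQED
end

noncomputable section
namespace ScalarQED
open scoped Topology
set_option linter.unusedSectionVars false
namespace PowerSystem

variable {R : Type*} [CommRing R] {α : Type*} [DecidableEq α] {P : PowerSystem R α}

/-! ### Both jets -/

variable (P) in
/-- There are legs of both jets. -/
def Both (S : Finset α) : Prop := ∀ b, P.Has (.jet b) S

variable (P) in
/-- The total charge of the legs from the jet `b`. -/
def jetCharge (b : Bool) (S : Finset α) : ℤ := ∑ i ∈ P.part (.jet b) S, P.q i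

theorem tag_of_mem_full {i : α} (h : i ∈ P.full) : (∃ b, P.tag i = .jet b) ∨ P.tag i = .soft := by
  obtain ⟨h1, h2⟩ := (P.mem_full i).1 h
  cases h' : P.tag i with
  | jet b => exact Or.inl ⟨b, rfl⟩
  | soft => exact Or.inr rfl
  | beam1 => exact absurd h' h1
  | beam2 => exact absurd h' h2

theorem ne_beam1_of_subset {S : Finset α} (h : S ⊆ P.full) : ∀ i ∈ S, P.tag i ≠ .beam1 :=
  fun i hi => ((P.mem_full i).1 (h hi)).1

theorem inJet_of_not_has {b : Bool} {S : Finset α} (h : S ⊆ P.full) (hb : ¬ P.Has (.jet b) S) :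
    P.InJet (!b) S := fun i hi => by
  rcases tag_of_mem_full (h hi) with ⟨b', hb'⟩ | h'
  · left
    rcases Bool.eq_or_eq_not b' b with rfl | rfl
    · exact absurd ⟨i, hi, hb'⟩ hb
    · exact hb'
  · exact Or.inr h'

theorem soft_or_inJet_or_both {S : Finset α} (h : S ⊆ P.full) :
    P.Soft S ∨ (∃ b, P.InJet b S ∧ P.Has (.jet b) S) ∨ P.Both S := by
  by_cases hB : P.Both S
  · exact Or.inr (Or.inr hB)
  rw [Both] at hB
  push Not at hB
  obtain ⟨b, hb⟩ := hB
  have := inJet_of_not_has h hb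
  by_cases hb' : P.Has (.jet !b) S
  · exact Or.inr (Or.inl ⟨_, this, hb'⟩)
  · exact Or.inl (this.soft_of_not_has hb')

theorem jetCharge_add (b : Bool) {S T : Finset α} (h : T ⊆ S) :
    P.jetCharge b S = P.jetCharge b T + P.jetCharge b (S \ T) := by
  rw [jetCharge, jetCharge, jetCharge, part_sdiff, add_comm,
    Finset.sum_sdiff (part_mono h)]

theorem jetCharge_eq_zero {b : Bool} {S : Finset α} (h : ¬ P.Has (.jet b) S) :
    P.jetCharge b S = 0 := by
  rw [jetCharge, part_eq_empty.2 h, Finset.sum_empty]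

theorem has_of_jetCharge {b : Bool} {S : Finset α} (h : P.jetCharge b S ≠ 0) :
    P.Has (.jet b) S := by
  by_contra h'
  exact h (jetCharge_eq_zero h')

theorem jetCharge_full (b : Bool) : P.jetCharge b P.full = sgn b := P.q_jet b

theorem sgn_ne_zero (b : Bool) : sgn b ≠ 0 := by cases b <;> decide

theorem InJet.not_has {b : Bool} {S : Finset α} (h : P.InJet b S) : ¬ P.Has (.jet !b) S := by
  rintro ⟨i, hi, hb⟩
  rcases h i hi with h' | h' <;> rw [h'] at hb
  · cases b <;> simp at hb
  · exact absurd hb (by simp)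

/-- A photon is suppressed if it is emitted by a charged part of a jet, since its charge must be
compensated by soft particles. -/
theorem photon_mem_of_jetCharge {b : Bool} {S : Finset α} (h : P.InJet b S)
    (hQ : P.jetCharge b S ≠ 0) (μ : Fin 4) : P.A μ S ∈ P.At 2 S := by
  by_cases hs : P.Has .soft S
  · exact (jet_bound b S h).mixed hs μ
  · rw [P.A_charge μ S]
    · exact zero_mem _
    · rwa [jetCharge, part_eq_self (not_nonempty_has h hs)] at hQ

/-- Fields with legs of both jets have large virtualities and are suppressed by one more power of
`λ`. -/
theorem both_mem (S : Finset α) : S ⊆ P.full →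
    ((∀ σ, P.ψ σ S ∈ P.At 1 S) ∧ ∀ μ, P.A μ S ∈ P.At 1 S) ∧
    (P.Both S → (∀ σ, P.ψ σ S ∈ P.At 2 S) ∧ ∀ μ, P.A μ S ∈ P.At 2 S) := by
  induction S using Finset.strongInduction with
  | H S ih =>
    intro hS
    by_cases hB : P.Both S
    swap
    · rw [Both] at hB
      push Not at hB
      obtain ⟨b, hb⟩ := hB
      have := jet_bound _ S (inJet_of_not_has hS hb)
      exact ⟨⟨this.scalar, this.photon⟩, fun h => absurd (h b) hb⟩
    have hinv : P.InvMem 0 (P.ksq S) := P.inv_both S hS hB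
    have ih1 : ∀ T ⊂ S, (∀ σ, P.ψ σ T ∈ P.At 1 T) ∧ ∀ μ, P.A μ T ∈ P.At 1 T :=
      fun T hT => (ih T hT (hT.1.trans hS)).1
    have main : (∀ σ, P.ψ σ S ∈ P.At 2 S) ∧ ∀ μ, P.A μ S ∈ P.At 2 S := by
      refine ⟨fun σ => scalar_mem (ne_beam1_of_subset hS) hinv (p := 2) (by omega)
        fun T hT h1 h2 => ?_, fun μ => ?_⟩
      · obtain ⟨hs1, hs2⟩ := ssubset_of_nonempty hT h1 h2
        refine ⟨at_mul hT (a := 1) (add_mem (P.two_mul (at_rdot_k (ih1 T hs1).2 (P.k_mem _)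
          (by omega))) (at_rdot_k (ih1 T hs1).2 (P.k_mem _) (by omega))) ((ih1 _ hs2).1 σ)
          (by omega), at_mul hT (a := 2) (asq_mem fun U hU _ _ => ⟨1, 1,
          (ih1 U (hU.trans_ssubset hs1)).2, (ih1 _ (Finset.sdiff_subset.trans_ssubset hs1)).2,
          by omega⟩) ((ih1 _ hs2).1 σ) (by omega)⟩
      · rw [P.A_both μ S hS hB]
        refine a_mem hinv (p := 2) (p' := 2) (d := 0) (by omega) (by omega)
          (fun T _ => P.k_mem T μ) fun T hT h1 h2 => ?_
        obtain ⟨hs1, hs2⟩ := ssubset_of_nonempty hT h1 h2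
        exact ⟨at_mul hT ((ih1 T hs1).1 true) ((ih1 _ hs2).1 false) (by omega),
          at_mul hT ((ih1 T hs1).2 μ) (pp_mem (p := 2) fun U hU h3 h4 => at_mul hU
          ((ih1 U (hU.trans_ssubset hs2)).1 true)
          ((ih1 _ (Finset.sdiff_subset.trans_ssubset hs2)).1 false) (by omega)) (by omega)⟩
    exact ⟨⟨fun σ => at_mono (by omega) (main.1 σ), fun μ => at_mono (by omega) (main.2 μ)⟩,
      fun _ => main⟩

theorem full_scalar_mem {S : Finset α} (hS : S ⊆ P.full) (σ : Bool) : P.ψ σ S ∈ P.At 1 S :=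
  (both_mem S hS).1.1 σ

theorem full_photon_mem {S : Finset α} (hS : S ⊆ P.full) (μ : Fin 4) : P.A μ S ∈ P.At 1 S :=
  (both_mem S hS).1.2 μ

theorem vert_mem {S U : Finset α} {c : ℤ}
    (h : ∀ μ, P.A μ S ∈ P.At c S) : P.vert S U ∈ P.At c S :=
  add_mem (P.two_mul (at_rdot_k h (P.k_mem _) (by omega))) (at_rdot_k h (P.k_mem _) (by omega))

theorem full_asq_mem {S : Finset α} (hS : S ⊆ P.full) : P.asq S ∈ P.At 2 S :=
  asq_mem fun U hU _ _ => ⟨1, 1, full_photon_mem (hU.trans hS),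
    full_photon_mem (Finset.sdiff_subset.trans hS), by omega⟩

theorem full_pp_mem {S : Finset α} (hS : S ⊆ P.full) : P.pp S ∈ P.At 2 S :=
  pp_mem fun U hU _ _ => at_mul hU (full_scalar_mem (hU.trans hS) true)
    (full_scalar_mem (Finset.sdiff_subset.trans hS) false) (by omega)

/-- The exceptional case is a photon that is emitted by a neutral part of one of the jets. -/
theorem photon_mem_or {S : Finset α} (hS : S ⊆ P.full) : (∀ μ, P.A μ S ∈ P.At 2 S) ∨
    ∃ b, P.InJet b S ∧ P.Has (.jet b) S ∧ P.jetCharge b S = 0 := by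
  rcases soft_or_inJet_or_both hS with h | ⟨b, h1, h2⟩ | h
  · exact Or.inl (soft_mem S h).2
  · by_cases hQ : P.jetCharge b S = 0
    · exact Or.inr ⟨b, h1, h2, hQ⟩
    · exact Or.inl (photon_mem_of_jetCharge h1 hQ)
  · exact Or.inl ((both_mem S hS).2 h).2

/-- If a photon is emitted by a neutral part of one of the jets, and both jets are charged, then
the remaining legs belong to both jets. -/
theorem both_sdiff {S T : Finset α} (hT : T ⊆ S) (hQ : ∀ b, P.jetCharge b S ≠ 0) {b : Bool}
    (h1 : P.InJet b T) (h2 : P.jetCharge b T = 0) : P.Both (S \ T) := by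
  intro b'
  refine has_of_jetCharge (P := P) ?_
  have := jetCharge_add (P := P) b' hT
  rcases Bool.eq_or_eq_not b' b with rfl | rfl
  · rw [h2, zero_add] at this; rw [← this]; exact hQ _
  · rw [jetCharge_eq_zero h1.not_has, zero_add] at this; rw [← this]; exact hQ _

/-- The gauge field emitted from a charged field with the charges of both jets is itself suppressed,
or it comes from a neutral part of one jet and leaves a field that still contains both jets; in
either case there is one more power of `λ`. -/
theorem charged_both_mem {S : Finset α} (hS : S ⊆ P.full) (hQ : ∀ b, P.jetCharge b S ≠ 0)
    (σ : Bool) : P.ψ σ S ∈ P.At 3 S := by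
  have hB : P.Both S := fun b => has_of_jetCharge (hQ b)
  refine scalar_mem (ne_beam1_of_subset hS) (P.inv_both S hS hB) (p := 3) (by omega)
    fun T hT h1 h2 => ?_
  have hTf := hT.trans hS
  have hUf : S \ T ⊆ P.full := Finset.sdiff_subset.trans hS
  refine ⟨?_, at_mul hT (full_asq_mem hTf) (full_scalar_mem hUf σ) (by omega)⟩
  rcases photon_mem_or hTf with h | ⟨b, h3, h4, h5⟩
  · exact at_mul hT (vert_mem h) (full_scalar_mem hUf σ) (by omega)
  · exact at_mul hT (vert_mem (full_photon_mem hTf))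
      (((both_mem _ hUf).2 (both_sdiff hT hQ h3 h5)).1 σ) (by omega)

/-! ### The second incoming photon -/

theorem b2_notMem {T : Finset α} (hT : T ⊆ P.full) : P.b2 ∉ T := fun h =>
  ((P.mem_full _).1 (hT h)).2 P.tag_b2

theorem insert_sdiff_of_subset {T : Finset α} (hT : T ⊆ P.full) {V : Finset α} (hV : V ⊆ T) :
    insert P.b2 T \ V = insert P.b2 (T \ V) :=
  Finset.insert_sdiff_of_notMem _ fun h => b2_notMem hT (hV h)

theorem insert_sdiff_insert {T : Finset α} (hT : T ⊆ P.full) (V : Finset α) :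
    insert P.b2 T \ insert P.b2 V = T \ V := by
  rw [Finset.insert_sdiff_insert, Finset.sdiff_insert,
    Finset.erase_eq_of_notMem fun h => b2_notMem hT (Finset.sdiff_subset h)]

theorem ψ_b2 (σ : Bool) : P.ψ σ {P.b2} = 0 := by
  refine P.ψ_charge σ _ ?_
  rw [Finset.sum_singleton, P.q_b2]
  exact (sgn_ne_zero σ).symm

theorem insert_ne_beam1 {T : Finset α} (hT : T ⊆ P.full) :
    ∀ i ∈ insert P.b2 T, P.tag i ≠ .beam1 := fun i hi => by
  rcases Finset.mem_insert.1 hi with rfl | h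
  · rw [P.tag_b2]; decide
  · exact ne_beam1_of_subset hT i h

theorem sum_insert_b2 {M : Type*} [AddCommMonoid M] {T : Finset α} (hT : T ⊆ P.full)
    (f : Finset α → Finset α → M) :
    ∑ V ∈ (insert P.b2 T).powerset, f V (insert P.b2 T \ V) =
      ∑ V ∈ T.powerset, (f V (insert P.b2 (T \ V)) + f (insert P.b2 V) (T \ V)) := by
  rw [Finset.sum_powerset_insert (b2_notMem hT), ← Finset.sum_add_distrib]
  refine Finset.sum_congr rfl fun V hV => ?_
  rw [insert_sdiff_of_subset hT (Finset.mem_powerset.1 hV), insert_sdiff_insert hT]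

/-- Bounds for the square of the gauge field, by the symmetry of the two factors one of which
contains photon `2`. -/
theorem asq_insert_mul_mem {V : Finset α} (hV : V ⊆ P.full) (x : R) (G : AddSubgroup R)
    (h : ∀ U ⊆ V, (V \ U).Nonempty → rdot (P.av (insert P.b2 U)) (P.av (V \ U)) * x ∈ G) :
    P.asq (insert P.b2 V) * x ∈ G := by
  have h' : ∀ U ⊆ V, rdot (P.av (insert P.b2 U)) (P.av (V \ U)) * x ∈ G := fun U hU => by
    rcases (V \ U).eq_empty_or_nonempty with h0 | h0
    · rw [h0, av_empty, rdot_zero, zero_mul]; exact zero_mem _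
    · exact h U hU h0
  rw [asq, sum_insert_b2 hV (fun U W => rdot (P.av U) (P.av W)), Finset.sum_mul]
  refine sum_mem fun U hU => ?_
  rw [Finset.mem_powerset] at hU
  rw [add_mul]
  refine add_mem ?_ (h' U hU)
  have := h' (V \ U) Finset.sdiff_subset
  rwa [Finset.sdiff_sdiff_eq_self hU, rdot_comm] at this

theorem pp_insert_mem {V : Finset α} (hV : V ⊆ P.full) (G : AddSubgroup R)
    (h : ∀ U ⊆ V, U.Nonempty → (V \ U).Nonempty →
      ∀ σ σ', P.ψ σ (insert P.b2 U) * P.ψ σ' (V \ U) ∈ G) : P.pp (insert P.b2 V) ∈ G := by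
  have h' : ∀ U ⊆ V, ∀ σ σ', P.ψ σ (insert P.b2 U) * P.ψ σ' (V \ U) ∈ G := fun U hU σ σ' => by
    rcases U.eq_empty_or_nonempty with rfl | h1
    · rw [insert_empty_eq, ψ_b2, zero_mul]; exact zero_mem _
    rcases (V \ U).eq_empty_or_nonempty with h0 | h0
    · rw [h0, P.ψ_empty, mul_zero]; exact zero_mem _
    · exact h U hU h1 h0 σ σ'
  rw [pp, sum_insert_b2 hV (fun U W => P.ψ true U * P.ψ false W)]
  refine sum_mem fun U hU => ?_
  rw [Finset.mem_powerset] at hU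
  refine add_mem ?_ (h' U hU true false)
  have := h' (V \ U) Finset.sdiff_subset false true
  rwa [Finset.sdiff_sdiff_eq_self hU, mul_comm] at this

/-- The field equation in the presence of the incoming photon `2`, with the term in which this
photon is attached directly to the charged field singled out. -/
theorem scalar_b2_mem {T : Finset α} (hT : T ⊆ P.full) (σ : Bool) {p : ℤ}
    (h : ∀ V ⊆ T, V.Nonempty → (T \ V).Nonempty →
      rdot (P.av (insert P.b2 V)) (P.k (T \ V)) * P.ψ σ (T \ V) ∈ P.At p T ∧
      P.asq (insert P.b2 V) * P.ψ σ (T \ V) ∈ P.At p T ∧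
      P.vert V (insert P.b2 (T \ V)) * P.ψ σ (insert P.b2 (T \ V)) ∈ P.At p T ∧
      P.asq V * P.ψ σ (insert P.b2 (T \ V)) ∈ P.At p T) :
    P.ksq (insert P.b2 T) * P.ψ σ (insert P.b2 T)
      + 2 * (sgn σ * P.g) * rdot (P.av {P.b2}) (P.k T) * P.ψ σ T ∈ P.At p T := by
  have hv : ∀ V ⊆ T, P.vert (insert P.b2 V) (T \ V)
      = 2 * rdot (P.av (insert P.b2 V)) (P.k (T \ V)) := fun V hV => by
    have := P.kA_with_b2 V (hV.trans hT)
    rw [rdot_comm] at this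
    rw [vert]
    change 2 * rdot _ _ + rdot (fun μ => P.A μ (insert P.b2 V)) (P.k (insert P.b2 V)) = _
    rw [this, add_zero]
  have hasq : P.asq (insert P.b2 ∅) = 0 := by
    rw [asq, sum_insert_b2 (Finset.empty_subset _) (fun U W => rdot (P.av U) (P.av W))]
    simp [av_empty, rdot_zero, zero_rdot]
  have e1 := eom' σ (insert_ne_beam1 hT)
  rw [sum_insert_b2 hT (fun V W => (sgn σ * P.g * P.vert V W + P.g ^ 2 * P.asq V) * P.ψ σ W)] at e1
  have e2 : P.ksq (insert P.b2 T) * P.ψ σ (insert P.b2 T)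
      + 2 * (sgn σ * P.g) * rdot (P.av {P.b2}) (P.k T) * P.ψ σ T
      = - ∑ V ∈ T.powerset,
        ((sgn σ * P.g * P.vert V (insert P.b2 (T \ V)) + P.g ^ 2 * P.asq V)
            * P.ψ σ (insert P.b2 (T \ V))
          + ((sgn σ * P.g * P.vert (insert P.b2 V) (T \ V) + P.g ^ 2 * P.asq (insert P.b2 V))
            * P.ψ σ (T \ V)
          - if V = ∅ then 2 * (sgn σ * P.g) * rdot (P.av {P.b2}) (P.k T) * P.ψ σ T else 0)) := by
    rw [e1]
    simp only [add_sub_assoc', Finset.sum_sub_distrib]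
    rw [Finset.sum_ite_eq' T.powerset ∅, if_pos (Finset.empty_mem_powerset T)]
    ring
  rw [e2]
  refine neg_mem (sum_mem fun V hV => ?_)
  rw [Finset.mem_powerset] at hV
  rcases V.eq_empty_or_nonempty with rfl | h1
  · rw [if_pos rfl, hv _ hV, hasq, vert_empty, asq_empty, Finset.sdiff_empty, insert_empty_eq]
    ring_nf
    exact zero_mem _
  rw [if_neg h1.ne_empty, sub_zero]
  rcases (T \ V).eq_empty_or_nonempty with h2 | h2
  · rw [h2, P.ψ_empty, insert_empty_eq, ψ_b2]; simp
  obtain ⟨a1, a2, a3, a4⟩ := h V hV h1 h2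
  rw [hv V hV]
  have e3 : ∀ x y z : R, (sgn σ * P.g * x + P.g ^ 2 * y) * z
      = sgn σ * P.g * (x * z) + P.g ^ 2 * (y * z) := fun x y z => by ring
  rw [e3, e3, mul_assoc 2]
  exact add_mem (add_mem (at_smul (sgn_g_mem σ) a3 (by omega)) (at_smul g_sq_mem a4 (by omega)))
    (add_mem (at_smul (sgn_g_mem σ) (P.two_mul a1) (by omega)) (at_smul g_sq_mem a2 (by omega)))

/-- The order of the gauge field in the presence of the incoming photon `2` follows from the orders
of the terms of the current. -/
theorem photon_b2_mem {T : Finset α} (hT : T ⊆ P.full) (hne : T.Nonempty) {m p c : ℤ}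
    (hinv : P.InvMem m (P.ksq (insert P.b2 T))) (hc : c ≤ m + p) (hpp : P.pp T ∈ P.At p T)
    (h : ∀ V ⊆ T, V.Nonempty → (T \ V).Nonempty →
      (∀ σ σ', P.ψ σ (insert P.b2 V) * P.ψ σ' (T \ V) ∈ P.At p T) ∧
      (∀ μ, P.A μ (insert P.b2 V) * P.pp (T \ V) ∈ P.At p T) ∧
      (∀ μ, P.A μ V * P.pp (insert P.b2 (T \ V)) ∈ P.At p T)) (μ : Fin 4) :
    P.A μ (insert P.b2 T) ∈ P.At c T := by
  rw [P.A_with_b2 μ T hT hne]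
  refine hinv.mem_of_mul (a := p - P.wt T) ?_ (by omega)
  rw [a_eq' μ hinv, sum_insert_b2 hT (fun V W => (P.k V μ - P.k W μ) * (P.ψ true V * P.ψ false W)),
    sum_insert_b2 hT (fun V W => P.A μ V * P.pp W)]
  have hψ : ∀ V ⊆ T, ∀ σ σ', P.ψ σ (insert P.b2 V) * P.ψ σ' (T \ V) ∈ P.At p T :=
    fun V hV σ σ' => by
    rcases V.eq_empty_or_nonempty with rfl | h1
    · rw [insert_empty_eq, ψ_b2, zero_mul]; exact zero_mem _
    rcases (T \ V).eq_empty_or_nonempty with h0 | h0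
    · rw [h0, P.ψ_empty, mul_zero]; exact zero_mem _
    · exact (h V hV h1 h0).1 σ σ'
  refine add_mem (at_smul (b := p) P.g_mem (sum_mem fun V hV => ?_) (by omega)) ?_
  · rw [Finset.mem_powerset] at hV
    refine add_mem (at_smul (b := p) (sub_mem (P.k_mem _ μ) (P.k_mem _ μ)) ?_ (by omega))
      (at_smul (sub_mem (P.k_mem _ μ) (P.k_mem _ μ)) (hψ V hV _ _) (by omega))
    have := hψ (T \ V) Finset.sdiff_subset false true
    rwa [Finset.sdiff_sdiff_eq_self hV, mul_comm] at this
  · rw [mul_assoc]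
    refine P.two_mul (at_smul (b := p) g_sq_mem (sum_mem fun V hV => ?_) (by omega))
    rw [Finset.mem_powerset] at hV
    have hpp0 : P.pp {P.b2} = 0 := by
      rw [← insert_empty_eq, pp, sum_insert_b2 (Finset.empty_subset _)
        (fun U W => P.ψ true U * P.ψ false W)]
      simp [P.ψ_empty]
    rcases V.eq_empty_or_nonempty with rfl | h1
    · rw [P.A_empty, zero_mul, zero_add, Finset.sdiff_empty, insert_empty_eq]
      exact at_smul (P.A_b2 μ) hpp (by omega)
    rcases (T \ V).eq_empty_or_nonempty with h2 | h2
    · rw [h2, insert_empty_eq, hpp0, pp_empty, mul_zero, mul_zero, add_zero]; exact zero_mem _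
    exact add_mem ((h V hV h1 h2).2.2 μ) ((h V hV h1 h2).2.1 μ)

variable (P) in
/-- Some leg of a jet is missing. -/
def Missing (T : Finset α) : Prop := ∃ b, P.Has (.jet b) (P.full \ T)

theorem Missing.mono {S T : Finset α} (h : P.Missing S) (hT : T ⊆ S) : P.Missing T := by
  obtain ⟨b, h⟩ := h
  exact ⟨b, h.mono (Finset.sdiff_subset_sdiff le_rfl hT)⟩

theorem soft_sdiff {T : Finset α} (h : ¬ P.Missing T) {S : Finset α} (hS : S ⊆ P.full) :
    P.Soft (S \ T) := fun i hi => by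
  have hi' := Finset.mem_sdiff.1 hi
  rcases tag_of_mem_full (hS hi'.1) with ⟨b, hb⟩ | h'
  · exact absurd ⟨b, i, Finset.mem_sdiff.2 ⟨hS hi'.1, hi'.2⟩, hb⟩ h
  · exact h'

theorem Soft.missing {T : Finset α} (h : P.Soft T) : P.Missing T := by
  obtain ⟨i, hi, hb⟩ := has_of_jetCharge (P := P) (b := true) (S := P.full)
    (by rw [jetCharge_full]; exact sgn_ne_zero _)
  refine ⟨true, i, Finset.mem_sdiff.2 ⟨hi, fun h' => ?_⟩, hb⟩
  rw [h i h'] at hb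
  exact absurd hb (by simp)

theorem jetCharge_of_not_missing {T : Finset α} (hT : T ⊆ P.full) (h : ¬ P.Missing T) (b : Bool) :
    P.jetCharge b T ≠ 0 := by
  have := jetCharge_add (P := P) b hT
  rw [jetCharge_full, jetCharge_eq_zero ((soft_sdiff h le_rfl).not_has_jet b), add_zero] at this
  rw [← this]
  exact sgn_ne_zero b

variable (P) in
/-- Power counting in the presence of the incoming photon `2`. The leading term of a charged field
with hard legs is the one in which the photon is attached to it directly (`leading`); this fails if
both jets are complete, when the virtuality is as small as `λ²`. -/
structure BeamBound (T : Finset α) : Prop where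
  scalar : ∀ σ, P.ψ σ (insert P.b2 T) ∈ P.At 1 T
  photon : ∀ μ, P.A μ (insert P.b2 T) ∈ P.At 0 T
  photon_missing : P.Missing T → ∀ μ, P.A μ (insert P.b2 T) ∈ P.At 2 T
  scalar_soft : P.Soft T → ∀ σ, P.ψ σ (insert P.b2 T) ∈ P.At 2 T
  leading : ¬ P.Soft T → P.Missing T → ∀ σ, P.ksq (insert P.b2 T) * P.ψ σ (insert P.b2 T)
      + 2 * (sgn σ * P.g) * rdot (P.av {P.b2}) (P.k T) * P.ψ σ T ∈ P.At 2 T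
  scalar_both : P.Both T → P.Missing T → ∀ σ, P.ψ σ (insert P.b2 T) ∈ P.At 2 T

theorem sum_q_insert (T : Finset α) (h : ¬ ∃ i ∈ T, P.q i ≠ 0) :
    ¬ ∃ i ∈ insert P.b2 T, P.q i ≠ 0 := by
  rintro ⟨i, hi, hq⟩
  rcases Finset.mem_insert.1 hi with rfl | h'
  · exact hq P.q_b2
  · exact h ⟨i, h', hq⟩

theorem two_le_card_insert {T : Finset α} (hT : T ⊆ P.full) (hne : T.Nonempty) :
    2 ≤ (insert P.b2 T).card := by
  rw [Finset.card_insert_of_notMem (b2_notMem hT)]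
  have := hne.card_pos
  omega

theorem A_b2_mem (μ : Fin 4) : P.A μ (insert P.b2 ∅) ∈ P.At 0 ∅ := by
  rw [insert_empty_eq, At, wt_empty, sub_zero]
  exact P.A_b2 μ

section Step

variable {T : Finset α} (hT : T ⊆ P.full) (hne : T.Nonempty)
include hT hne

/-- The case that photon `2` interacts with soft particles only. -/
theorem soft_b2_mem (hs : P.Soft T) (ih : ∀ V ⊂ T, V.Nonempty → P.BeamBound V) :
    (∀ σ, P.ψ σ (insert P.b2 T) ∈ P.At 2 T) ∧ ∀ μ, P.A μ (insert P.b2 T) ∈ P.At 2 T := by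
  by_cases hc : ∃ i ∈ T, P.q i ≠ 0
  swap
  · refine ⟨fun σ => ?_, fun μ => ?_⟩
    · rw [ψ_eq_zero_of_neutral σ (sum_q_insert T hc)]; exact zero_mem _
    · rw [A_eq_zero_of_neutral μ (two_le_card_insert hT hne) (sum_q_insert T hc)]
      exact zero_mem _
  have hinv : P.InvMem (-2) (P.ksq (insert P.b2 T)) := P.inv_b2_soft T hs hc
  have hA : ∀ V ⊂ T, V.Nonempty → ∀ μ, P.A μ (insert P.b2 V) ∈ P.At 2 V := fun V hV h =>
    (ih V hV h).photon_missing (hs.mono hV.1).missing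
  have hψ : ∀ V ⊂ T, V.Nonempty → ∀ σ, P.ψ σ (insert P.b2 V) ∈ P.At 2 V := fun V hV h =>
    (ih V hV h).scalar_soft (hs.mono hV.1)
  have hA0 : ∀ V ⊂ T, ∀ μ, P.A μ (insert P.b2 V) ∈ P.At 0 V := fun V hV => by
    rcases V.eq_empty_or_nonempty with rfl | h
    · exact A_b2_mem
    · exact (ih V hV h).photon
  refine ⟨fun σ => ?_, ?_⟩
  · refine hinv.mem_of_mul (a := 4 - P.wt T) ?_ (by omega)
    have key := scalar_b2_mem hT σ (p := 4) fun V hV h1 h2 => ?_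
    · have h3 : 2 * (sgn σ * P.g) * rdot (P.av {P.b2}) (P.k T) * P.ψ σ T ∈ P.At 4 T := by
        rw [mul_assoc, mul_assoc]
        exact P.two_mul (at_smul (b := 4) (sgn_g_mem σ) (at_smul (a := 2) (P.rdot_mem P.A_b2
          (fun μ => P.k_soft T μ hs) (by omega)) ((soft_mem T hs).1 σ) (by omega)) (by omega))
      have := sub_mem key h3
      rwa [add_sub_cancel_right] at this
    · obtain ⟨hs1, hs2⟩ := ssubset_of_nonempty hV h1 h2
      have hψW := (soft_mem _ (hs.sdiff V)).1 σ
      refine ⟨at_mul hV (at_rdot_k (b := 2) (p := 4) (hA V hs1 h1) (fun μ => P.k_soft _ μ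
        (hs.sdiff V)) (by omega)) hψW (by omega), ?_, ?_, ?_⟩
      · refine asq_insert_mul_mem (hV.trans hT) _ _ fun U hU _ => at_mul hV (a := 2) (at_rdot hU
          (hA0 U (hU.trans_ssubset hs1)) (soft_mem _ ((hs.mono hV).sdiff U)).2 (by omega))
          hψW (by omega)
      · exact at_mul hV (vert_mem (soft_mem V (hs.mono hV)).2)
          (hψ _ hs2 h2 σ) (by omega)
      · exact at_mul hV (asq_mem_soft (hs.mono hV)) (hψ _ hs2 h2 σ) (by omega)
  · have hpp : ∀ V ⊆ T, P.pp V ∈ P.At 4 V := fun V hV => pp_mem fun U hU _ _ =>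
      at_mul hU ((soft_mem U (hs.mono (hU.trans hV))).1 true)
        ((soft_mem _ ((hs.mono hV).sdiff U)).1 false) (by omega)
    refine photon_b2_mem hT hne hinv (p := 4) (by omega) (hpp T le_rfl) fun V hV h1 h2 => ?_
    obtain ⟨hs1, hs2⟩ := ssubset_of_nonempty hV h1 h2
    refine ⟨fun σ σ' => at_mul hV (hψ V hs1 h1 σ) ((soft_mem _ (hs.sdiff V)).1 σ') (by omega),
      fun μ => at_mul hV (hA V hs1 h1 μ) (hpp _ Finset.sdiff_subset) (by omega),
      fun μ => at_mul hV (b := 4) ((soft_mem V (hs.mono hV)).2 μ) ?_ (by omega)⟩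
    exact pp_insert_mem (Finset.sdiff_subset.trans hT) _ fun U hU h3 h4 σ σ' => at_mul hU
      (hψ U (hU.trans_ssubset hs2) h3 σ) ((soft_mem _ ((hs.sdiff V).sdiff U)).1 σ') (by omega)

/-- The case that photon `2` interacts with some, but not all of the collinear particles, so that
the momentum transfer is large. -/
theorem hard_b2_mem (hs : ¬ P.Soft T) (hm : P.Missing T)
    (ih : ∀ V ⊂ T, V.Nonempty → P.BeamBound V) :
    (∀ σ, P.ksq (insert P.b2 T) * P.ψ σ (insert P.b2 T)
      + 2 * (sgn σ * P.g) * rdot (P.av {P.b2}) (P.k T) * P.ψ σ T ∈ P.At 2 T) ∧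
    ∀ μ, P.A μ (insert P.b2 T) ∈ P.At 2 T := by
  have hinv : P.InvMem 0 (P.ksq (insert P.b2 T)) := by
    refine P.inv_b2_hard T hT ?_ hm
    by_contra h
    refine hs fun i hi => (tag_of_mem_full (hT hi)).resolve_left ?_
    rintro ⟨b, hb⟩
    exact h ⟨b, i, hi, hb⟩
  have hA : ∀ V ⊂ T, V.Nonempty → ∀ μ, P.A μ (insert P.b2 V) ∈ P.At 2 V := fun V hV h =>
    (ih V hV h).photon_missing (hm.mono hV.1)
  have hA0 : ∀ V ⊂ T, ∀ μ, P.A μ (insert P.b2 V) ∈ P.At 0 V := fun V hV => by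
    rcases V.eq_empty_or_nonempty with rfl | h
    · exact A_b2_mem
    · exact (ih V hV h).photon
  have hf : ∀ V : Finset α, T \ V ⊆ P.full := fun V => Finset.sdiff_subset.trans hT
  refine ⟨fun σ => scalar_b2_mem hT σ fun V hV h1 h2 => ?_, ?_⟩
  · obtain ⟨hs1, hs2⟩ := ssubset_of_nonempty hV h1 h2
    have hψW := full_scalar_mem (hf V) σ
    refine ⟨at_mul hV (at_rdot_k (p := 2) (hA V hs1 h1) (P.k_mem _) (by omega)) hψW (by omega),
      ?_, ?_, ?_⟩
    · exact asq_insert_mul_mem (hV.trans hT) _ _ fun U hU _ => at_mul hV (a := 1) (at_rdot hU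
        (hA0 U (hU.trans_ssubset hs1)) (full_photon_mem (Finset.sdiff_subset.trans (hV.trans hT)))
        (by omega)) hψW (by omega)
    · exact at_mul hV (vert_mem (full_photon_mem (hV.trans hT)))
        ((ih _ hs2 h2).scalar σ) (by omega)
    · exact at_mul hV (full_asq_mem (hV.trans hT)) ((ih _ hs2 h2).scalar σ) (by omega)
  · refine photon_b2_mem hT hne hinv (p := 2) (by omega) (full_pp_mem hT) fun V hV h1 h2 => ?_
    obtain ⟨hs1, hs2⟩ := ssubset_of_nonempty hV h1 h2
    refine ⟨fun σ σ' => at_mul hV ((ih V hs1 h1).scalar σ) (full_scalar_mem (hf V) σ') (by omega),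
      fun μ => at_mul hV (hA V hs1 h1 μ) (full_pp_mem (hf V)) (by omega),
      fun μ => at_mul hV (b := 2) (full_photon_mem (hV.trans hT) μ) ?_ (by omega)⟩
    exact pp_insert_mem (hf V) _ fun U hU h3 h4 σ σ' => at_mul hU
      ((ih U (hU.trans_ssubset hs2) h3).scalar σ)
      (full_scalar_mem (Finset.sdiff_subset.trans (hf V)) σ') (by omega)

/-- The case that photon `2` interacts with all of the collinear particles. The missing charged soft
particles interact with photon `1`, and the virtuality is of order `λ²`; this enhancement is
compensated by the suppression of fields that contain both jets. -/
theorem full_b2_mem (hm : ¬ P.Missing T) (hc : ∃ i ∈ P.full \ T, P.q i ≠ 0)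
    (ih : ∀ V ⊂ T, V.Nonempty → P.BeamBound V) :
    (∀ σ, P.ψ σ (insert P.b2 T) ∈ P.At 1 T) ∧ ∀ μ, P.A μ (insert P.b2 T) ∈ P.At 0 T := by
  have hinv : P.InvMem (-2) (P.ksq (insert P.b2 T)) :=
    P.inv_b2_full T hT (fun b hb => hm ⟨b, hb⟩) hc
  have hQ := jetCharge_of_not_missing hT hm
  have hf : ∀ V : Finset α, T \ V ⊆ P.full := fun V => Finset.sdiff_subset.trans hT
  have hA0 : ∀ V ⊂ T, ∀ μ, P.A μ (insert P.b2 V) ∈ P.At 0 V := fun V hV => by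
    rcases V.eq_empty_or_nonempty with rfl | h
    · exact A_b2_mem
    · exact (ih V hV h).photon
  refine ⟨fun σ => ?_, ?_⟩
  · refine hinv.mem_of_mul (a := 3 - P.wt T) ?_ (by omega)
    have key := scalar_b2_mem hT σ (p := 3) fun V hV h1 h2 => ?_
    · have h3 : 2 * (sgn σ * P.g) * rdot (P.av {P.b2}) (P.k T) * P.ψ σ T ∈ P.At 3 T := by
        rw [mul_assoc, mul_assoc]
        exact P.two_mul (at_smul (b := 3) (sgn_g_mem σ) (at_smul (a := 0) (P.rdot_mem P.A_b2
          (P.k_mem T) (by omega)) (charged_both_mem hT hQ σ) (by omega)) (by omega))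
      have := sub_mem key h3
      rwa [add_sub_cancel_right] at this
    · obtain ⟨hs1, hs2⟩ := ssubset_of_nonempty hV h1 h2
      have hVf := hV.trans hT
      have hψW := full_scalar_mem (hf V) σ
      refine ⟨?_, ?_, ?_, at_mul hV (full_asq_mem hVf) ((ih _ hs2 h2).scalar σ) (by omega)⟩
      · by_cases hmV : P.Missing V
        · exact at_mul hV (at_rdot_k (p := 2) ((ih V hs1 h1).photon_missing hmV) (P.k_mem _)
            (by omega)) hψW (by omega)
        · have hsW : P.Soft (T \ V) := soft_sdiff hmV hT
          exact at_mul hV (at_rdot_k (p := 2) ((ih V hs1 h1).photon) (fun μ => P.k_soft _ μ hsW)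
            (by omega)) ((soft_mem _ hsW).1 σ) (by omega)
      · refine asq_insert_mul_mem hVf _ _ fun U hU hVU => ?_
        have hUf := hU.trans hVf
        have hVUf : V \ U ⊆ P.full := Finset.sdiff_subset.trans hVf
        rcases U.eq_empty_or_nonempty with rfl | hU1
        · rw [Finset.sdiff_empty]
          rcases photon_mem_or hVf with h | ⟨b, h3, h4, h5⟩
          · exact at_mul hV (P.rdot_mem (a := 0) (p := 2 - P.wt V) A_b2_mem h (by omega)) hψW (by omega)
          · exact at_mul hV (P.rdot_mem (a := 0) (p := 1 - P.wt V) A_b2_mem (full_photon_mem hVf)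
              (by omega))
              (((both_mem _ (hf V)).2 (both_sdiff hV hQ h3 h5)).1 σ) (by omega)
        · have hUs : U ⊂ T := hU.trans_ssubset hs1
          by_cases hmU : P.Missing U
          · exact at_mul hV (at_rdot (p := 2) hU ((ih U hUs hU1).photon_missing hmU)
              (full_photon_mem hVUf) (by omega)) hψW (by omega)
          · have hsW : P.Soft (T \ V) :=
              (soft_sdiff hmU hT).mono (Finset.sdiff_subset_sdiff le_rfl hU)
            exact at_mul hV (at_rdot (p := 2) hU ((ih U hUs hU1).photon)
              (soft_mem _ (soft_sdiff hmU hVf)).2 (by omega)) ((soft_mem _ hsW).1 σ) (by omega)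
      · rcases photon_mem_or hVf with h | ⟨b, h3, h4, h5⟩
        · exact at_mul hV (vert_mem h) ((ih _ hs2 h2).scalar σ) (by omega)
        · have hmW : P.Missing (T \ V) := by
            obtain ⟨i, hi, hb⟩ := h4
            exact ⟨b, i, Finset.mem_sdiff.2 ⟨hVf hi, fun h => (Finset.mem_sdiff.1 h).2 hi⟩, hb⟩
          exact at_mul hV (vert_mem (full_photon_mem hVf))
            ((ih _ hs2 h2).scalar_both (both_sdiff hV hQ h3 h5) hmW σ) (by omega)
  · refine photon_b2_mem hT hne hinv (p := 2) (by omega) (full_pp_mem hT) fun V hV h1 h2 => ?_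
    obtain ⟨hs1, hs2⟩ := ssubset_of_nonempty hV h1 h2
    refine ⟨fun σ σ' => at_mul hV ((ih V hs1 h1).scalar σ) (full_scalar_mem (hf V) σ') (by omega),
      fun μ => at_mul hV (hA0 V hs1 μ) (full_pp_mem (hf V)) (by omega),
      fun μ => at_mul hV (b := 2) (full_photon_mem (hV.trans hT) μ) ?_ (by omega)⟩
    exact pp_insert_mem (hf V) _ fun U hU h3 h4 σ σ' => at_mul hU
      ((ih U (hU.trans_ssubset hs2) h3).scalar σ)
      (full_scalar_mem (Finset.sdiff_subset.trans (hf V)) σ') (by omega)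

end Step

/-- Power counting in the presence of the incoming photon `2`, by induction on the set of legs. -/
theorem beam_bound (T : Finset α) : T ⊆ P.full → T.Nonempty →
    (P.Missing T ∨ ∃ i ∈ P.full \ T, P.q i ≠ 0) → P.BeamBound T := by
  induction T using Finset.strongInduction with
  | H T ih =>
    intro hT hne hg
    have ih' : ∀ V ⊂ T, V.Nonempty → P.BeamBound V := fun V hV h =>
      ih V hV (hV.1.trans hT) h (hg.imp (fun h' => h'.mono hV.1) fun ⟨i, hi, hq⟩ =>
        ⟨i, Finset.sdiff_subset_sdiff le_rfl hV.1 hi, hq⟩)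
    by_cases hs : P.Soft T
    · obtain ⟨h1, h2⟩ := soft_b2_mem hT hne hs ih'
      exact ⟨fun σ => at_mono (by omega) (h1 σ), fun μ => at_mono (by omega) (h2 μ), fun _ => h2,
        fun _ => h1, fun h => absurd hs h, fun _ _ => h1⟩
    by_cases hm : P.Missing T
    · obtain ⟨h1, h2⟩ := hard_b2_mem hT hne hs hm ih'
      have hinv : P.InvMem 0 (P.ksq (insert P.b2 T)) := by
        refine P.inv_b2_hard T hT ?_ hm
        by_contra h
        refine hs fun i hi => (tag_of_mem_full (hT hi)).resolve_left ?_
        rintro ⟨b, hb⟩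
        exact h ⟨b, i, hi, hb⟩
      have aux : ∀ c ≤ 2, ∀ σ, P.ψ σ T ∈ P.At c T → P.ψ σ (insert P.b2 T) ∈ P.At c T := by
        intro c hc σ hψ
        refine hinv.mem_of_mul (a := c - P.wt T) ?_ (by omega)
        have h3 : 2 * (sgn σ * P.g) * rdot (P.av {P.b2}) (P.k T) * P.ψ σ T ∈ P.At c T := by
          rw [mul_assoc, mul_assoc]
          exact P.two_mul (at_smul (b := c) (sgn_g_mem σ) (at_smul (a := 0) (P.rdot_mem P.A_b2
            (P.k_mem T) (by omega)) hψ (by omega)) (by omega))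
        have := sub_mem (at_mono hc (h1 σ)) h3
        rwa [add_sub_cancel_right] at this
      exact ⟨fun σ => aux 1 (by omega) σ (full_scalar_mem hT σ), fun μ => at_mono (by omega) (h2 μ),
        fun _ => h2, fun h => absurd h hs, fun _ _ => h1,
        fun hB _ σ => aux 2 (by omega) σ (((both_mem T hT).2 hB).1 σ)⟩
    · obtain ⟨h1, h2⟩ := full_b2_mem hT hne hm (hg.resolve_left hm) ih'
      exact ⟨h1, h2, fun h => absurd h hm, fun h => absurd h hs, fun _ h => absurd h hm,
        fun _ h => absurd h hm⟩

end PowerSystem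
end ScalarQED
end

noncomputable section
namespace ScalarQED
open scoped Topology
set_option linter.unusedSectionVars false
namespace PowerSystem

variable {R : Type*} [CommRing R] {α : Type*} [DecidableEq α] {P : PowerSystem R α}

/-! ### Factorization of the channels -/

variable (P) in
/-- The legs of the jet `b`. -/
abbrev jetLegs (b : Bool) : Finset α := P.part (.jet b) P.full

variable (P) in
/-- The soft Wilson lines of the two jets. -/
def softFactor : R := ∑ W ∈ (P.part .soft P.full).powerset,
  P.Y true true W * P.Y false false (P.part .soft P.full \ W)

/-- A field of the wrong charge vanishes on the legs of a jet. -/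
theorem ψ_jetLegs (b : Bool) : P.ψ (!b) (P.jetLegs b) = 0 := by
  refine P.ψ_charge _ _ ?_
  change P.jetCharge b P.full ≠ _
  rw [jetCharge_full]
  cases b <;> decide

/-- If the other jet takes all legs outside of `V`, then `V` has all legs of the jet `b`. -/
theorem InJet.part_eq_jetLegs {b : Bool} {V : Finset α} (hV : V ⊆ P.full)
    (h : P.InJet (!b) (P.full \ V)) : P.part (.jet b) V = P.jetLegs b := by
  refine (part_mono hV).antisymm fun i hi => mem_part.2 ⟨?_, (mem_part.1 hi).2⟩
  by_contra hi'
  have h5' := h i (Finset.mem_sdiff.2 ⟨(mem_part.1 hi).1, hi'⟩)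
  rw [(mem_part.1 hi).2] at h5'
  rcases h5' with h5' | h5'
  · cases b <;> simp at h5'
  · exact absurd h5' (by simp)

/-- The legs of the final state are shared between the two charged fields in such a way that the
legs of each jet are attached to one of the fields, up to corrections suppressed by `λ`. -/
theorem pair_mem_or (σ : Bool) {V : Finset α} (hV : V ⊆ P.full) :
    P.ψ σ V * P.ψ (!σ) (P.full \ V) ∈ P.At 3 P.full ∨
      P.Has (.jet σ) V ∧ P.InJet σ V ∧ P.InJet (!σ) (P.full \ V) := by
  have hW : P.full \ V ⊆ P.full := Finset.sdiff_subset
  have h1 := full_scalar_mem hV σ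
  have h2 := full_scalar_mem hW (!σ)
  have hfull : P.Both P.full := fun b => has_of_jetCharge (by
    rw [jetCharge_full]; exact sgn_ne_zero b)
  rcases soft_or_inJet_or_both hV with h | ⟨b, h3, h4⟩ | h
  · exact Or.inl (at_mul hV ((soft_mem V h).1 σ) h2 (by omega))
  swap
  · exact Or.inl (at_mul hV (((both_mem V hV).2 h).1 σ) h2 (by omega))
  rcases soft_or_inJet_or_both hW with h | ⟨b', h5, h6⟩ | h
  · exact Or.inl (at_mul hV h1 ((soft_mem _ h).1 (!σ)) (by omega))
  swap
  · exact Or.inl (at_mul hV h1 (((both_mem _ hW).2 h).1 (!σ)) (by omega))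
  have hb : b' = !b := by
    rcases Bool.eq_or_eq_not b' b with rfl | h
    · rcases has_or_has_sdiff (U := V) (hfull !b') with h | h
      · exact absurd h h3.not_has
      · exact absurd h h5.not_has
    · exact h
  subst hb
  rcases Bool.eq_or_eq_not σ b with rfl | rfl
  · exact Or.inr ⟨h4, h3, h5⟩
  · left
    -- the jet is attached to the field of the opposite charge: its leading, eikonal part vanishes
    -- by charge conservation
    have e : P.part (.jet b) V = P.jetLegs b := h5.part_eq_jetLegs hV
    have := (jet_bound b V h3).eik (!b)
    rw [eik, e, ψ_jetLegs, zero_mul, sub_zero] at this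
    exact at_mul hV this h2 (by omega)

/-- The product of the two charged fields factorizes into the jets and the soft Wilson lines. -/
theorem pp_full_mem : P.pp P.full -
    P.ψ true (P.jetLegs true) * P.ψ false (P.jetLegs false) * P.softFactor ∈ P.At 3 P.full := by
  classical
  have hdisj : ∀ W, W ⊆ P.part .soft P.full → P.part (.jet true) (P.jetLegs true ∪ W) =
      P.jetLegs true ∧ P.part (.jet false) (P.jetLegs true ∪ W) = ∅ ∧
      P.part .soft (P.jetLegs true ∪ W) = W := by
    intro W hW
    refine ⟨?_, ?_, ?_⟩ <;> ext i <;> simp only [mem_part, Finset.mem_union, Finset.notMem_empty,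
      iff_false]
    · constructor
      · rintro ⟨h | h, h'⟩
        · exact h
        · have := (mem_part.1 (hW h)).2
          rw [h'] at this; exact absurd this (by simp)
      · exact fun h => ⟨Or.inl h, h.2⟩
    · rintro ⟨h | h, h'⟩
      · rw [h.2] at h'; exact absurd h' (by simp)
      · have := (mem_part.1 (hW h)).2
        rw [h'] at this; exact absurd this (by simp)
    · constructor
      · rintro ⟨h | h, h'⟩
        · rw [h.2] at h'; exact absurd h' (by simp)
        · exact h
      · exact fun h => ⟨Or.inr h, (mem_part.1 (hW h)).2⟩
  have hfull : ∀ i ∈ P.full, P.tag i = .jet true ∨ P.tag i = .jet false ∨ P.tag i = .soft :=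
    fun i hi => by
    rcases tag_of_mem_full hi with ⟨b, hb⟩ | h
    · cases b
      · exact Or.inr (Or.inl hb)
      · exact Or.inl hb
    · exact Or.inr (Or.inr h)
  have e1 : P.ψ true (P.jetLegs true) * P.ψ false (P.jetLegs false) * P.softFactor
      = ∑ V ∈ P.full.powerset,
        if P.part (.jet true) V = P.jetLegs true ∧ P.part (.jet false) V = ∅ then
          P.eik true true V * P.eik false false (P.full \ V) else 0 := by
    rw [← Finset.sum_filter, softFactor, Finset.mul_sum]
    refine Finset.sum_bij' (fun W _ => P.jetLegs true ∪ W) (fun V _ => P.part .soft V) ?_ ?_ ?_ ?_ ?_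
    · intro W hW
      rw [Finset.mem_powerset] at hW
      rw [Finset.mem_filter, Finset.mem_powerset]
      exact ⟨Finset.union_subset (part_subset _ _) (hW.trans (part_subset _ _)), (hdisj W hW).1,
        (hdisj W hW).2.1⟩
    · intro V hV
      rw [Finset.mem_filter, Finset.mem_powerset] at hV
      exact Finset.mem_powerset.2 (part_mono hV.1)
    · intro W hW
      exact (hdisj W (Finset.mem_powerset.1 hW)).2.2
    · intro V hV
      rw [Finset.mem_filter, Finset.mem_powerset] at hV
      obtain ⟨hV, h1, h2⟩ := hV
      rw [← h1]
      ext i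
      simp only [mem_part, Finset.mem_union]
      constructor
      · rintro (h | h)
        · exact h.1
        · exact h.1
      · intro h
        rcases hfull i (hV h) with h' | h' | h'
        · exact Or.inl ⟨h, h'⟩
        · exact absurd (mem_part.2 ⟨h, h'⟩) (by rw [h2]; exact Finset.notMem_empty i)
        · exact Or.inr ⟨h, h'⟩
    · intro W hW
      obtain ⟨p1, p2, p3⟩ := hdisj W (Finset.mem_powerset.1 hW)
      rw [eik, eik, part_sdiff, part_sdiff, p1, p2, p3, Finset.sdiff_empty]
      ring
  rw [e1, pp, ← Finset.sum_sub_distrib]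
  refine sum_mem fun V hV => ?_
  rw [Finset.mem_powerset] at hV
  by_cases hc : P.Has (.jet true) V ∧ P.InJet true V ∧ P.InJet false (P.full \ V)
  · obtain ⟨h1, h2, h3⟩ := hc
    rw [if_pos ⟨h3.part_eq_jetLegs hV, part_eq_empty.2 h2.not_has⟩]
    have e2 : P.ψ true V * P.ψ false (P.full \ V) - P.eik true true V * P.eik false false (P.full \ V)
        = (P.ψ true V - P.eik true true V) * P.ψ false (P.full \ V) +
          P.eik true true V * (P.ψ false (P.full \ V) - P.eik false false (P.full \ V)) := by ring
    have b1 := jet_bound true V h2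
    have b2 := jet_bound false _ h3
    rw [e2]
    refine add_mem (at_mul hV (b1.eik true) (b2.scalar false) (by omega))
      (at_mul hV (a := 1) ?_ (b2.eik false) (by omega))
    have := sub_mem (b1.scalar true) (at_mono (p := 1) (by omega) (b1.eik true))
    rwa [sub_sub_cancel] at this
  · have h0 := (pair_mem_or true hV).resolve_right hc
    by_cases hi : P.part (.jet true) V = P.jetLegs true ∧ P.part (.jet false) V = ∅
    · exfalso
      refine hc ⟨?_, ?_, ?_⟩
      · refine has_of_jetCharge ?_
        rw [jetCharge, hi.1]
        change P.jetCharge true P.full ≠ 0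
        rw [jetCharge_full]
        exact sgn_ne_zero _
      · have := inJet_of_not_has hV (part_eq_empty.1 hi.2)
        exact this
      · refine inJet_of_not_has (b := true) Finset.sdiff_subset ?_
        rw [← part_eq_empty, part_sdiff, hi.1, Finset.sdiff_self]
    · rw [if_neg hi, sub_zero]; exact h0

/-- The power counting with photon `2` applies unless all remaining legs are neutral, in which case
the fields that accompany photon `2` vanish. -/
theorem beam_or_zero {V : Finset α} (hV : V ⊆ P.full) (hne : V.Nonempty) {U : Finset α}
    (hU : U ⊆ P.full \ V) : P.BeamBound V ∨ (∀ σ, P.ψ σ U = 0) ∧ P.pp U = 0 := by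
  by_cases hc : ∃ i ∈ U, P.q i ≠ 0
  · obtain ⟨i, hi, hq⟩ := hc
    exact Or.inl (beam_bound V hV hne (Or.inr ⟨i, hU hi, hq⟩))
  · refine Or.inr ⟨fun σ => ψ_eq_zero_of_neutral σ hc, Finset.sum_eq_zero fun T hT => ?_⟩
    rw [ψ_eq_zero_of_neutral true, zero_mul]
    rintro ⟨i, hi, hq⟩
    exact hc ⟨i, Finset.mem_powerset.1 hT hi, hq⟩

/-- In the four-point vertex of the two photons, photon `2` enters directly at leading power. -/
theorem contact_mem {e : Fin 4 → R} (he : ∀ μ, e μ ∈ P.F 0) :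
    ∑ V ∈ P.full.powerset, rdot e (P.av (insert P.b2 V)) * P.pp (P.full \ V)
      - rdot e (P.av {P.b2}) * P.pp P.full ∈ P.At 3 P.full := by
  have e1 : rdot e (P.av {P.b2}) * P.pp P.full = ∑ V ∈ P.full.powerset,
      if V = ∅ then rdot e (P.av {P.b2}) * P.pp P.full else 0 := by
    rw [Finset.sum_ite_eq' P.full.powerset ∅, if_pos (Finset.empty_mem_powerset _)]
  rw [e1, ← Finset.sum_sub_distrib]
  refine sum_mem fun V hV => ?_
  rw [Finset.mem_powerset] at hV
  rcases V.eq_empty_or_nonempty with rfl | h1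
  · rw [if_pos rfl, Finset.sdiff_empty, insert_empty_eq, sub_self]; exact zero_mem _
  rw [if_neg h1.ne_empty, sub_zero]
  rcases beam_or_zero hV h1 le_rfl with h | ⟨-, h⟩
  swap
  · rw [h, mul_zero]; exact zero_mem _
  have hpp := full_pp_mem (P := P) (S := P.full \ V) Finset.sdiff_subset
  rw [rdot_comm]
  by_cases hm : P.Missing V
  · exact at_mul hV (at_rdot_k (p := 2) (h.photon_missing hm) he (by omega)) hpp (by omega)
  · have hs := soft_sdiff hm (le_refl P.full)
    refine at_mul hV (b := 4) (at_rdot_k (p := 0) h.photon he (by omega)) (pp_mem fun U hU _ _ =>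
      at_mul hU ((soft_mem U (hs.mono hU)).1 true) ((soft_mem _ (hs.sdiff U)).1 false) (by omega))
      (by omega)

/-- The emission of a further gauge field at the vertex of photon `1` is suppressed. -/
theorem beam_quartic_mem {e : Fin 4 → R} (he : ∀ μ, e μ ∈ P.F 0) (σ : Bool) :
    ∑ U ∈ P.full.powerset, rdot e (P.av U) * ∑ V ∈ (P.full \ U).powerset,
      P.ψ σ (insert P.b2 V) * P.ψ (!σ) ((P.full \ U) \ V) ∈ P.At 3 P.full := by
  refine sum_mem fun U hU => ?_
  rw [Finset.mem_powerset] at hU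
  rw [rdot_comm]
  refine at_mul hU (b := 2) (at_rdot_k (p := 1) (full_photon_mem hU) he (by omega))
    (sum_mem fun V hV => ?_) (by omega)
  rw [Finset.mem_powerset] at hV
  rcases V.eq_empty_or_nonempty with rfl | h1
  · rw [insert_empty_eq, ψ_b2, zero_mul]; exact zero_mem _
  have hVf := hV.trans Finset.sdiff_subset
  rcases beam_or_zero hVf h1 (U := (P.full \ U) \ V)
    (Finset.sdiff_subset_sdiff Finset.sdiff_subset le_rfl) with h | ⟨h, -⟩
  · exact at_mul hV (h.scalar σ) (full_scalar_mem
      (Finset.sdiff_subset.trans Finset.sdiff_subset) (!σ)) (by omega)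
  · rw [h, mul_zero]; exact zero_mem _

/-- When the legs are shared between the two jets, the soft momenta are negligible in the total
momenta. -/
theorem k_eq_jetLegs (b : Bool) {V : Finset α} (hV : V ⊆ P.full) (h1 : P.InJet b V)
    (h2 : P.InJet (!b) (P.full \ V)) (μ : Fin 4) : P.k V μ - P.k (P.jetLegs b) μ ∈ P.F 2 := by
  have := P.k_split (part_subset (P := P) (.jet b) V)
  rw [h1.sdiff_part_jet, h2.part_eq_jetLegs hV] at this
  rw [this, Pi.add_apply, add_sub_cancel_left]
  exact P.k_soft _ μ (soft_part V)

/-- The diagrams in which photon `2` is attached to the field `σ`: at leading power it is attached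
directly to this field, next to the vertex of photon `1`, and the propagator between the two
vertices depends only on the total momentum of the other jet. -/
theorem beam_cubic_mem (σ : Bool) {e : Fin 4 → R} (he : ∀ μ, e μ ∈ P.F 0)
    (hp : rdot (P.k (insert P.b2 P.full)) (P.k (insert P.b2 P.full)) = 0) {u : R} (hu : u ∈ P.F 0)
    (hu1 : u * (2 * rdot (P.k (insert P.b2 P.full)) (P.k (P.jetLegs (!σ)))) = 1) :
    ∑ V ∈ P.full.powerset, rdot e (P.k (P.full \ V)) *
        (P.ψ σ (insert P.b2 V) * P.ψ (!σ) (P.full \ V))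
      - sgn σ * P.g * (2 * u * rdot e (P.k (P.jetLegs (!σ))) * rdot (P.av {P.b2}) (P.k (P.jetLegs σ)))
        * ∑ V ∈ P.full.powerset, P.ψ σ V * P.ψ (!σ) (P.full \ V) ∈ P.At 3 P.full := by
  rw [Finset.mul_sum, ← Finset.sum_sub_distrib]
  refine sum_mem fun V hV => ?_
  rw [Finset.mem_powerset] at hV
  have hW : P.full \ V ⊆ P.full := Finset.sdiff_subset
  have hψ := full_scalar_mem hV σ
  have hψ' := full_scalar_mem hW (!σ)
  have hek : ∀ T, rdot e (P.k T) ∈ P.F 0 := fun T => P.rdot_mem he (P.k_mem T) (by omega)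
  have hAk : ∀ T, rdot (P.av {P.b2}) (P.k T) ∈ P.F 0 := fun T =>
    P.rdot_mem P.A_b2 (P.k_mem T) (by omega)
  have hcoef : sgn σ * P.g * (2 * u * rdot e (P.k (P.jetLegs (!σ))) *
      rdot (P.av {P.b2}) (P.k (P.jetLegs σ))) ∈ P.F 0 :=
    P.mul (sgn_g_mem σ) (P.mul (P.mul (P.two_mul hu) (hek _) (le_refl _)) (hAk _) (le_refl _)) (by omega)
  -- it is enough that both terms are small
  have small : P.ψ σ V * P.ψ (!σ) (P.full \ V) ∈ P.At 3 P.full →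
      rdot e (P.k (P.full \ V)) * (P.ψ σ (insert P.b2 V) * P.ψ (!σ) (P.full \ V)) ∈ P.At 3 P.full →
      rdot e (P.k (P.full \ V)) * (P.ψ σ (insert P.b2 V) * P.ψ (!σ) (P.full \ V))
        - sgn σ * P.g * (2 * u * rdot e (P.k (P.jetLegs (!σ))) *
          rdot (P.av {P.b2}) (P.k (P.jetLegs σ))) * (P.ψ σ V * P.ψ (!σ) (P.full \ V))
        ∈ P.At 3 P.full := fun h1 h2 => sub_mem h2 (at_smul hcoef h1 (by omega))
  rcases V.eq_empty_or_nonempty with rfl | hne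
  · refine small ?_ ?_
    · rw [P.ψ_empty, zero_mul]; exact zero_mem _
    · rw [insert_empty_eq, ψ_b2, zero_mul, mul_zero]; exact zero_mem _
  rcases beam_or_zero hV hne le_rfl with hb | ⟨h, -⟩
  swap
  · rw [h, mul_zero, mul_zero, mul_zero, mul_zero, sub_zero]; exact zero_mem _
  by_cases hs : P.Soft V
  · exact small (at_mul hV ((soft_mem V hs).1 σ) hψ' (by omega))
      (at_smul (b := 3) (hek _) (at_mul hV (hb.scalar_soft hs σ) hψ' (by omega)) (by omega))
  by_cases hm : P.Missing V
  swap
  · have hsW := soft_sdiff hm (le_refl P.full)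
    have h2 := (soft_mem _ hsW).1 (!σ)
    exact small (at_mul hV hψ h2 (by omega)) (at_smul (b := 3) (hek _) (at_mul hV (hb.scalar σ) h2
      (by omega)) (by omega))
  have hinv : P.InvMem 0 (P.ksq (insert P.b2 V)) := by
    refine P.inv_b2_hard V hV ?_ hm
    by_contra h
    refine hs fun i hi => (tag_of_mem_full (hV hi)).resolve_left ?_
    rintro ⟨b, hb⟩
    exact h ⟨b, i, hi, hb⟩
  have hlead : (P.ksq (insert P.b2 V) * P.ψ σ (insert P.b2 V)
      + 2 * (sgn σ * P.g) * rdot (P.av {P.b2}) (P.k V) * P.ψ σ V) * P.ψ (!σ) (P.full \ V)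
      ∈ P.At 3 P.full := at_mul hV (hb.leading hs hm σ) hψ' (by omega)
  rcases pair_mem_or σ hV with h | ⟨-, hj, hj'⟩
  · refine small h (at_smul (hek _) (b := 3) ?_ (by omega))
    refine hinv.mem_of_mul (a := 3 - P.wt P.full) ?_ (by omega)
    have e1 : P.ksq (insert P.b2 V) * (P.ψ σ (insert P.b2 V) * P.ψ (!σ) (P.full \ V))
        = (P.ksq (insert P.b2 V) * P.ψ σ (insert P.b2 V)
      + 2 * (sgn σ * P.g) * rdot (P.av {P.b2}) (P.k V) * P.ψ σ V) * P.ψ (!σ) (P.full \ V)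
        - 2 * (sgn σ * P.g * (rdot (P.av {P.b2}) (P.k V) * (P.ψ σ V * P.ψ (!σ) (P.full \ V)))) := by
      ring
    rw [e1]
    exact sub_mem hlead (P.two_mul (at_smul (b := 3) (sgn_g_mem σ) (at_smul (hAk _) h (le_refl _))
      (by omega)))
  · -- the propagator between the two vertices is `-1 / (2 p₁ · P)` at leading power, where `P` is the
    -- momentum of the other jet
    have hkV := k_eq_jetLegs σ hV hj hj'
    have hjj : P.InJet (!!σ) (P.full \ (P.full \ V)) := by
      rw [Bool.not_not, Finset.sdiff_sdiff_eq_self hV]; exact hj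
    have hkW := k_eq_jetLegs (!σ) hW hj' hjj
    have hks : P.k (insert P.b2 P.full) = P.k (insert P.b2 V) + P.k (P.full \ V) := by
      have := P.k_split (Finset.insert_subset_insert P.b2 hV)
      rwa [insert_sdiff_insert le_rfl] at this
    have hjW : P.Has (.jet !σ) (P.full \ V) := by
      by_contra h
      have h' : ¬ P.Has (.jet !σ) P.full := fun h'' => by
        rcases has_or_has_sdiff (U := V) h'' with h3 | h3
        · exact hj.not_has h3
        · exact h h3
      refine h' (has_of_jetCharge ?_)
      rw [jetCharge_full]
      exact sgn_ne_zero _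
    have hprop : P.ksq (insert P.b2 V)
        + 2 * rdot (P.k (insert P.b2 P.full)) (P.k (P.jetLegs (!σ))) ∈ P.F 2 := by
      have e1 : P.ksq (insert P.b2 V)
        + 2 * rdot (P.k (insert P.b2 P.full)) (P.k (P.jetLegs (!σ)))
        = P.ksq (P.full \ V) - 2 * rdot (P.k (insert P.b2 P.full))
          (fun μ => P.k (P.full \ V) μ - P.k (P.jetLegs (!σ)) μ) := by
        have e2 : P.k (insert P.b2 V) = fun μ => P.k (insert P.b2 P.full) μ - P.k (P.full \ V) μ := by
          rw [hks]; funext μ; simp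
        rw [ksq, e2, ksq]
        simp only [rdot] at hp ⊢
        linear_combination hp
      rw [e1]
      exact sub_mem (ksq_mem hj' hjW fun T hT => jet_bound _ T (hj'.mono hT.1))
        (P.two_mul (P.rdot_mem (P.k_mem _) hkW (by omega)))
    have hψ2 := hb.scalar σ
    -- the difference consists of the soft momenta in the vertex of photon `1`, the correction of
    -- the propagator, the remainder of the field equation of the field with photon `2`, and the
    -- soft momenta in the vertex of photon `2`
    have e1 : rdot e (P.k (P.full \ V)) * (P.ψ σ (insert P.b2 V) * P.ψ (!σ) (P.full \ V))
        - sgn σ * P.g * (2 * u * rdot e (P.k (P.jetLegs (!σ))) *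
          rdot (P.av {P.b2}) (P.k (P.jetLegs σ))) * (P.ψ σ V * P.ψ (!σ) (P.full \ V))
        = rdot (fun μ => P.k (P.full \ V) μ - P.k (P.jetLegs (!σ)) μ) e *
            (P.ψ σ (insert P.b2 V) * P.ψ (!σ) (P.full \ V))
          + u * rdot e (P.k (P.jetLegs (!σ))) *
            ((P.ksq (insert P.b2 V) + 2 * rdot (P.k (insert P.b2 P.full)) (P.k (P.jetLegs (!σ))))
              * (P.ψ σ (insert P.b2 V) * P.ψ (!σ) (P.full \ V))
            - (P.ksq (insert P.b2 V) * P.ψ σ (insert P.b2 V)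
              + 2 * (sgn σ * P.g) * rdot (P.av {P.b2}) (P.k V) * P.ψ σ V) * P.ψ (!σ) (P.full \ V)
            + 2 * (sgn σ * P.g * (rdot (P.av {P.b2}) (fun μ => P.k V μ - P.k (P.jetLegs σ) μ)
              * (P.ψ σ V * P.ψ (!σ) (P.full \ V))))) := by
      have : rdot e (P.k (P.full \ V)) = rdot (fun μ => P.k (P.full \ V) μ - P.k (P.jetLegs (!σ)) μ) e
          + rdot e (P.k (P.jetLegs (!σ))) * (u *
            (2 * rdot (P.k (insert P.b2 P.full)) (P.k (P.jetLegs (!σ))))) := by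
        rw [hu1]; simp only [rdot]; ring
      have h2 : rdot (P.av {P.b2}) (fun μ => P.k V μ - P.k (P.jetLegs σ) μ)
          = rdot (P.av {P.b2}) (P.k V) - rdot (P.av {P.b2}) (P.k (P.jetLegs σ)) := by
        simp only [rdot]; ring
      rw [this, h2]
      ring
    have hp2 : P.ψ σ (insert P.b2 V) * P.ψ (!σ) (P.full \ V) ∈ P.At 2 P.full :=
      at_mul hV hψ2 hψ' (by omega)
    rw [e1]
    refine add_mem (at_smul (P.rdot_mem (p := 2) hkW he (by omega)) hp2 (by omega))
      (at_smul (b := 3) (P.mul (p := 0) hu (hek _) (by omega)) (add_mem (sub_mem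
        (at_smul hprop hp2 (by omega)) hlead) (P.two_mul (at_smul (b := 4) (sgn_g_mem σ)
        (at_smul (P.rdot_mem (p := 2) P.A_b2 hkV (by omega)) (at_mul (p := 2) hV hψ hψ' (by omega))
        (by omega)) (by omega)))) (by omega))

end PowerSystem
end ScalarQED
end

noncomputable section
namespace ScalarQED
open scoped Topology
set_option linter.unusedSectionVars false

/-! ### Light-like vectors -/

theorem mdot_eq (a b : Vec) : mdot a b = a 0 * b 0 - a 1 * b 1 - a 2 * b 2 - a 3 * b 3 := by
  simp [mdot, metric, Fin.sum_univ_four]; ring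

theorem abs_le_energy {q : Vec} (h : mdot q q = 0) (h0 : 0 ≤ q 0) (μ : Fin 4) : |q μ| ≤ q 0 := by
  rw [mdot_eq] at h
  refine abs_le_of_sq_le_sq ?_ h0
  fin_cases μ <;> simp <;> nlinarith [sq_nonneg (q 1), sq_nonneg (q 2), sq_nonneg (q 3)]

theorem mdot_nonneg {a b : Vec} (ha : mdot a a = 0) (ha0 : 0 ≤ a 0) (hb : mdot b b = 0)
    (hb0 : 0 ≤ b 0) : 0 ≤ mdot a b := by
  rw [mdot_eq] at *
  have h : (a 1 * b 1 + a 2 * b 2 + a 3 * b 3) ^ 2 ≤ (a 0 * b 0) ^ 2 := by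
    have e : (a 0 * b 0) ^ 2 = (a 1 ^ 2 + a 2 ^ 2 + a 3 ^ 2) * (b 1 ^ 2 + b 2 ^ 2 + b 3 ^ 2) := by
      rw [show a 1 ^ 2 + a 2 ^ 2 + a 3 ^ 2 = a 0 ^ 2 by linarith,
        show b 1 ^ 2 + b 2 ^ 2 + b 3 ^ 2 = b 0 ^ 2 by linarith]; ring
    rw [e]
    nlinarith [sq_nonneg (a 1 * b 2 - a 2 * b 1), sq_nonneg (a 1 * b 3 - a 3 * b 1),
      sq_nonneg (a 2 * b 3 - a 3 * b 2)]
  have := (abs_le_of_sq_le_sq' h (mul_nonneg ha0 hb0)).2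
  linarith

theorem lightDir_zero (P : Vec) : lightDir P 0 = 1 := rfl

theorem lightDir_sq {P : Vec} (h : spatialNorm P ≠ 0) : mdot (lightDir P) (lightDir P) = 0 := by
  have h2 : spatialNorm P ^ 2 = P 1 ^ 2 + P 2 ^ 2 + P 3 ^ 2 := Real.sq_sqrt (by positivity)
  rw [mdot_eq]
  simp [lightDir]
  field_simp
  linarith

theorem lightDir_add_bar (P V : Vec) : mdot (lightDir P) V + mdot (lightDirBar P) V = 2 * V 0 := by
  simp [mdot_eq, lightDir, lightDirBar]; ring

theorem sub_energy_smul_lightDir (P V : Vec) (μ : Fin 4) : V μ - V 0 * lightDir P μ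
    = perp P V μ + mdot (lightDir P) V / 2 * (lightDirBar P μ - lightDir P μ) := by
  have := lightDir_add_bar P V
  simp only [perp]
  linear_combination lightDir P μ / 2 * this

theorem abs_lightDirBar_sub_le {P : Vec} (h : spatialNorm P ≠ 0) (μ : Fin 4) :
    |lightDirBar P μ - lightDir P μ| ≤ 2 := by
  have h1 := abs_le_energy (lightDir_sq h) (by rw [lightDir_zero]; norm_num) μ
  rw [lightDir_zero] at h1
  by_cases hμ : μ = 0
  · simp [lightDir, lightDirBar, hμ]
  · have : lightDirBar P μ - lightDir P μ = -2 * lightDir P μ := by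
      simp [lightDir, lightDirBar, hμ]; ring
    rw [this, abs_mul]
    norm_num
    linarith

theorem mdot_sum_left {β : Type*} (S : Finset β) (f : β → Vec) (v : Vec) :
    mdot (∑ i ∈ S, f i) v = ∑ i ∈ S, mdot (f i) v := by
  simp only [mdot, Finset.sum_apply, Finset.mul_sum, Finset.sum_mul]
  rw [Finset.sum_comm]

theorem mdot_sum_right {β : Type*} (S : Finset β) (f : β → Vec) (v : Vec) :
    mdot v (∑ i ∈ S, f i) = ∑ i ∈ S, mdot v (f i) := by
  rw [mdot_comm, mdot_sum_left]
  exact Finset.sum_congr rfl fun i _ => mdot_comm _ _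

/-- The invariant mass of a set of light-like momenta is bounded below by that of each pair. -/
theorem two_mul_mdot_le {β : Type*} [DecidableEq β] {S : Finset β} {f : β → Vec}
    (h : ∀ i ∈ S, ∀ j ∈ S, 0 ≤ mdot (f i) (f j)) {i j : β} (hi : i ∈ S) (hj : j ∈ S) (hij : i ≠ j) :
    2 * mdot (f i) (f j) ≤ mdot (∑ i ∈ S, f i) (∑ i ∈ S, f i) := by
  rw [mdot_sum_left]
  have h1 : ∀ a ∈ S, 0 ≤ mdot (f a) (∑ i ∈ S, f i) := fun a ha => by
    rw [mdot_sum_right]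
    exact Finset.sum_nonneg fun b hb => h a ha b hb
  have h2 : ∀ a ∈ S, ∀ b ∈ S, mdot (f a) (f b) ≤ mdot (f a) (∑ i ∈ S, f i) := fun a ha b hb => by
    rw [mdot_sum_right]
    exact Finset.single_le_sum (f := fun c => mdot (f a) (f c)) (fun c hc => h a ha c hc) hb
  have h3 : ∑ a ∈ ({i, j} : Finset β), mdot (f a) (∑ i ∈ S, f i)
      ≤ ∑ a ∈ S, mdot (f a) (∑ i ∈ S, f i) :=
    Finset.sum_le_sum_of_subset_of_nonneg (by
      intro a ha
      rcases Finset.mem_insert.1 ha with rfl | ha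
      · exact hi
      · rw [Finset.mem_singleton.1 ha]; exact hj) fun a ha _ => h1 a ha
  rw [Finset.sum_pair hij] at h3
  have h4 := h2 i hi j hj
  have h5 := h2 j hj i hi
  rw [mdot_comm (f j) (f i)] at h5
  linarith

theorem sq_le_spatial_sq {v : Vec} (h0 : v 0 ^ 2 ≤ v 1 ^ 2 + v 2 ^ 2 + v 3 ^ 2) (μ : Fin 4) :
    v μ ^ 2 ≤ v 1 ^ 2 + v 2 ^ 2 + v 3 ^ 2 := by
  have h1 := sq_nonneg (v 1)
  have h2 := sq_nonneg (v 2)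
  have h3 := sq_nonneg (v 3)
  fin_cases μ
  · exact h0
  all_goals simp only [Fin.mk_one, Fin.reduceFinMk]; linarith

/-- Vectors that are orthogonal to two light-like directions are space-like, and their components
are bounded by their length. -/
theorem mdot_mul_sq_le {t k v : Vec} (ht : mdot t t = 0) (ht0 : 0 < t 0) (hk : mdot k k = 0)
    (hk0 : 0 < k 0) (htv : mdot t v = 0) (hkv : mdot k v = 0) (μ : Fin 4) :
    mdot t k * v μ ^ 2 ≤ 2 * t 0 * k 0 * -mdot v v := by
  have htk := mdot_nonneg ht ht0.le hk hk0.le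
  have h0 : 0 < t 0 * k 0 := mul_pos ht0 hk0
  have h00 : 0 < 2 * (t 0 * k 0) := by linarith
  have h4 : 2 * (t 0 * k 0) * v 0 ^ 2
      ≤ (2 * (t 0 * k 0) - mdot t k) * (v 1 ^ 2 + v 2 ^ 2 + v 3 ^ 2) := by
    clear htk
    rw [mdot_eq] at *
    have h1 : 2 * (t 0 * k 0 * v 0) = (k 0 * t 1 + t 0 * k 1) * v 1
        + (k 0 * t 2 + t 0 * k 2) * v 2 + (k 0 * t 3 + t 0 * k 3) * v 3 := by
      linear_combination k 0 * htv + t 0 * hkv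
    have h2 : (2 * (t 0 * k 0 * v 0)) ^ 2 ≤ ((k 0 * t 1 + t 0 * k 1) ^ 2
        + (k 0 * t 2 + t 0 * k 2) ^ 2 + (k 0 * t 3 + t 0 * k 3) ^ 2)
        * (v 1 ^ 2 + v 2 ^ 2 + v 3 ^ 2) := by
      rw [h1]
      generalize k 0 * t 1 + t 0 * k 1 = x
      generalize k 0 * t 2 + t 0 * k 2 = y
      generalize k 0 * t 3 + t 0 * k 3 = z
      have e1 := sq_nonneg (x * v 2 - y * v 1)
      have e2 := sq_nonneg (x * v 3 - z * v 1)
      have e3 := sq_nonneg (y * v 3 - z * v 2)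
      linarith
    have h3 : (k 0 * t 1 + t 0 * k 1) ^ 2 + (k 0 * t 2 + t 0 * k 2) ^ 2
        + (k 0 * t 3 + t 0 * k 3) ^ 2 = 2 * (t 0 * k 0) *
        (2 * (t 0 * k 0) - (t 0 * k 0 - t 1 * k 1 - t 2 * k 2 - t 3 * k 3)) := by
      linear_combination - k 0 ^ 2 * ht - t 0 ^ 2 * hk
    rw [h3] at h2
    refine le_of_mul_le_mul_left ?_ h00
    linarith
  have hs0 : 0 ≤ v 1 ^ 2 + v 2 ^ 2 + v 3 ^ 2 := by positivity
  have hv : -mdot v v = v 1 ^ 2 + v 2 ^ 2 + v 3 ^ 2 - v 0 ^ 2 := by rw [mdot_eq]; ring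
  have h6 : v 0 ^ 2 ≤ v 1 ^ 2 + v 2 ^ 2 + v 3 ^ 2 := by
    have := mul_nonneg htk hs0
    refine le_of_mul_le_mul_left ?_ h00
    linarith
  have h7 := sq_le_spatial_sq h6 μ
  refine (mul_le_mul_of_nonneg_left h7 htk).trans ?_
  rw [hv]
  linarith

/-- The real part of a complex vector. -/
def reV (w : CVec) : Vec := fun μ => (w μ).re

/-- The imaginary part of a complex vector. -/
def imV (w : CVec) : Vec := fun μ => (w μ).im

theorem cdot_toC_left_re (t : Vec) (w : CVec) : (cdot (toC t) w).re = mdot t (reV w) := by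
  simp [cdot, mdot, toC, reV]

theorem cdot_toC_left_im (t : Vec) (w : CVec) : (cdot (toC t) w).im = mdot t (imV w) := by
  simp [cdot, mdot, toC, imV]

theorem cdot_star_re (w : CVec) :
    (cdot (star w) w).re = mdot (reV w) (reV w) + mdot (imV w) (imV w) := by
  simp [cdot, mdot, reV, imV, ← Finset.sum_add_distrib]

/-- The polarization vectors that are orthogonal to a second light-like direction are bounded. -/
theorem mdot_mul_norm_sq_le {t k : Vec} {w : CVec} (ht : mdot t t = 0) (ht0 : 0 < t 0)
    (hk : mdot k k = 0) (hk0 : 0 < k 0) (htw : cdot (toC t) w = 0) (hkw : cdot (toC k) w = 0)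
    (hw : cdot (star w) w = -1) (μ : Fin 4) : mdot t k * ‖w μ‖ ^ 2 ≤ 2 * t 0 * k 0 := by
  have h1 := mdot_mul_sq_le ht ht0 hk hk0 (v := reV w) (by rw [← cdot_toC_left_re, htw]; rfl)
    (by rw [← cdot_toC_left_re, hkw]; rfl) μ
  have h2 := mdot_mul_sq_le ht ht0 hk hk0 (v := imV w) (by rw [← cdot_toC_left_im, htw]; rfl)
    (by rw [← cdot_toC_left_im, hkw]; rfl) μ
  have h3 := cdot_star_re w
  rw [hw] at h3
  simp only [Complex.neg_re, Complex.one_re] at h3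
  have h4 : ‖w μ‖ ^ 2 = reV w μ ^ 2 + imV w μ ^ 2 := by
    rw [← Complex.normSq_eq_norm_sq, Complex.normSq_apply]; simp [reV, imV]; ring
  rw [h4]
  have : mdot (imV w) (imV w) = -1 - mdot (reV w) (reV w) := by linarith
  rw [this] at h2
  linarith

/-- A purely spatial polarization vector is bounded. -/
theorem norm_le_one_of_time_eq_zero {w : CVec} (h0 : w 0 = 0) (hw : cdot (star w) w = -1)
    (μ : Fin 4) : ‖w μ‖ ≤ 1 := by
  have h3 := congrArg Complex.re hw
  have h4 : ∀ μ, ‖w μ‖ ^ 2 = (w μ).re ^ 2 + (w μ).im ^ 2 := fun μ => by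
    rw [← Complex.normSq_eq_norm_sq, Complex.normSq_apply]; ring
  rw [cdot_star_re, mdot_eq, mdot_eq] at h3
  simp only [reV, imV, h0, Complex.neg_re, Complex.one_re, Complex.zero_re, Complex.zero_im] at h3
  refine (sq_le_one_iff₀ (norm_nonneg _)).1 ?_
  rw [h4]
  fin_cases μ
  · simp [h0]
  all_goals
    simp only [Fin.mk_one, Fin.reduceFinMk]
    nlinarith [sq_nonneg (w 1).re, sq_nonneg (w 2).re, sq_nonneg (w 3).re, sq_nonneg (w 1).im,
      sq_nonneg (w 2).im, sq_nonneg (w 3).im]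

/-- The length of a polarization vector is not changed by adding a multiple of the momentum. -/
theorem cdot_star_add_smul {k : Vec} {w : CVec} (hk : mdot k k = 0) (hkw : cdot (toC k) w = 0)
    (z : ℂ) : cdot (star (fun μ => w μ + z * (k μ : ℂ))) (fun μ => w μ + z * (k μ : ℂ))
      = cdot (star w) w := by
  have h1 : cdot (toC k) (toC k) = 0 := by rw [cdot_toC, hk]; simp
  have h2 : cdot (star w) (toC k) = 0 := by
    have := congrArg star hkw
    simp only [cdot, toC, Fin.sum_univ_four] at this ⊢
    simp [metric] at this ⊢
    linear_combination this
  simp only [cdot, toC, Fin.sum_univ_four] at h1 h2 hkw ⊢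
  simp [metric] at h1 h2 hkw ⊢
  linear_combination z * h2 + (starRingEnd ℂ) z * hkw + z * (starRingEnd ℂ) z * h1

theorem cdot_toC_add_smul {k : Vec} {w : CVec} (hk : mdot k k = 0) (hkw : cdot (toC k) w = 0)
    (z : ℂ) : cdot (toC k) (fun μ => w μ + z * (k μ : ℂ)) = 0 := by
  have h1 : cdot (toC k) (toC k) = 0 := by rw [cdot_toC, hk]; simp
  simp only [cdot, toC, Fin.sum_univ_four] at h1 hkw ⊢
  linear_combination hkw + z * h1

end ScalarQED
end

noncomputable section
namespace ScalarQED
open scoped Topology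
set_option linter.unusedSectionVars false

/-! ### Lower bounds for the invariants -/

theorem mdot_lin (a b : ℝ) (x y z v : Vec) : mdot (fun μ => a * x μ + b * y μ + z μ) v
    = a * mdot x v + b * mdot y v + mdot z v := by
  simp only [mdot_eq]; ring

theorem abs_mdot_le {u v : Vec} {A B : ℝ} (hA : 0 ≤ A) (hu : ∀ μ, |u μ| ≤ A)
    (hv : ∀ μ, |v μ| ≤ B) : |mdot u v| ≤ 4 * A * B := by
  have h : ∀ μ, |metric μ * u μ * v μ| ≤ A * B := fun μ => by
    have : |metric μ| = 1 := by unfold metric; split_ifs <;> simp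
    rw [abs_mul, abs_mul, this, one_mul]
    exact mul_le_mul (hu μ) (hv μ) (abs_nonneg _) hA
  refine (Finset.abs_sum_le_sum_abs _ _).trans ((Finset.sum_le_sum fun μ _ => h μ).trans ?_)
  simp; linarith

/-- The momentum transfer `2 p · k - k²` for a part of the final state of momentum `k`, when the total
momentum `tot` satisfies `(tot - p)² = 0`. Here `a, a'` and `b, b'` are the energies of the two jets
inside and outside of this part, along the directions `n` and `m`, and `d` and `D` are the deviations
from these directions. The mass-shell condition eliminates `n · m`, whose contribution to the
momentum transfer is negative, and what is left at leading order is a sum of positive terms. -/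
theorem hard_invariant_eq {n m p d D k tot : Vec} {a a' b b' : ℝ} (hn : mdot n n = 0)
    (hm : mdot m m = 0) (hk : k = fun μ => a * n μ + b * m μ + d μ)
    (ht : tot = fun μ => (a + a') * n μ + (b + b') * m μ + D μ)
    (h : mdot tot tot - 2 * mdot p tot = 0) :
    (a + a') * (b + b') * (2 * mdot p k - mdot k k)
      = 2 * (a * (a + a') * b' * mdot p n + b * (b + b') * a' * mdot p m)
        + ((a + a') * (b + b') * (2 * mdot p d - 2 * a * mdot n d - 2 * b * mdot m d - mdot d d)
        - a * b * (2 * mdot p D - 2 * (a + a') * mdot n D - 2 * (b + b') * mdot m D - mdot D D)) := by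
  have e1 : mdot k k = a ^ 2 * mdot n n + b ^ 2 * mdot m m + mdot d d + 2 * a * b * mdot n m
      + 2 * a * mdot n d + 2 * b * mdot m d := by
    rw [hk, mdot_lin, mdot_comm n, mdot_comm m, mdot_comm d, mdot_lin, mdot_lin, mdot_lin,
      mdot_comm m n, mdot_comm d n, mdot_comm d m]
    ring
  have e2 : mdot p k = a * mdot p n + b * mdot p m + mdot p d := by
    rw [hk, mdot_comm, mdot_lin, mdot_comm n, mdot_comm m, mdot_comm d]
  have e3 : mdot tot tot = (a + a') ^ 2 * mdot n n + (b + b') ^ 2 * mdot m m + mdot D D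
      + 2 * (a + a') * (b + b') * mdot n m
      + 2 * (a + a') * mdot n D + 2 * (b + b') * mdot m D := by
    rw [ht, mdot_lin, mdot_comm n, mdot_comm m, mdot_comm D, mdot_lin, mdot_lin, mdot_lin,
      mdot_comm m n, mdot_comm D n, mdot_comm D m]
    ring
  have e4 : mdot p tot = (a + a') * mdot p n + (b + b') * mdot p m + mdot p D := by
    rw [ht, mdot_comm, mdot_lin, mdot_comm n, mdot_comm m, mdot_comm D]
  rw [e3, e4, hn, hm] at h
  rw [e1, e2, hn, hm]
  linear_combination - a * b * h

/-- The sector of a jet. -/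
def jetSector : Bool → Sector
  | true => .jet3
  | false => .jet4

theorem jetSector_ne_soft (b : Bool) : jetSector b ≠ .soft := by cases b <;> decide

variable {ι : Type*} [Fintype ι] [DecidableEq ι]

theorem mem_members {sec : ι → Sector} {s : Sector} {i : ι} : i ∈ members sec s ↔ sec i = s := by
  simp [members]

namespace Kinematics

/-- The direction of the collinear Wilson line of a jet. -/
def wilsonDir (kin : Kinematics ι) : Bool → Vec
  | true => kin.t3
  | false => kin.t4

/-- The direction of a jet. -/
def jetDir (kin : Kinematics ι) (sec : ι → Sector) (b : Bool) : Vec :=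
  lightDir (kin.sectorMom sec (jetSector b))

/-- The lower bounds for the invariants that follow from the power counting. -/
structure Resolved (kin : Kinematics ι) (sp : ι → Species) (sec : ι → Sector) (c lam : ℝ) :
    Prop where
  jetSoft : ∀ b, ∀ i ∈ members sec (jetSector b), ∀ j ∈ members sec .soft,
    c * lam ^ 2 ≤ mdot (kin.q i) (kin.q j)
  jetWilson : ∀ b, ∀ i ∈ members sec (jetSector b), c ≤ mdot (kin.wilsonDir b) (kin.q i)
  jetJet : ∀ i ∈ members sec .jet3, ∀ j ∈ members sec .jet4, c ≤ mdot (kin.q i) (kin.q j)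
  beamSoft : ∀ a, ∀ T ⊆ members sec .soft, (∃ i ∈ T, sp i ≠ .photon) → c * lam ^ 2 ≤
    2 * mdot (kin.p a) (∑ i ∈ T, kin.q i) - mdot (∑ i ∈ T, kin.q i) (∑ i ∈ T, kin.q i)
  beamHard : ∀ T : Finset ι, (∃ i ∈ T, sec i ≠ .soft) → (∃ i ∉ T, sec i ≠ .soft) → c ≤
    2 * mdot (kin.p 1) (∑ i ∈ T, kin.q i) - mdot (∑ i ∈ T, kin.q i) (∑ i ∈ T, kin.q i)

section Pointwise

variable {kin : Kinematics ι} {sp : ι → Species} {sec : ι → Sector} {K lam : ℝ}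
  (phys : kin.Physical sp) (pc : kin.PowerCounting sp sec K lam) (hK : 1 ≤ K) (hlam : 0 < lam)
  (hsmall : K * lam < 1)

include phys in
theorem q_mdot_nonneg (i j : ι) : 0 ≤ mdot (kin.q i) (kin.q j) :=
  mdot_nonneg (phys.onShell i).1 (phys.onShell i).2.le (phys.onShell j).1 (phys.onShell j).2.le

include hK hlam hsmall in
theorem lam_lt_one : lam < 1 := by nlinarith

include pc hK hlam hsmall in
theorem spatialNorm_ne_zero {b : Bool} {i : ι} (hi : i ∈ members sec (jetSector b)) :
    spatialNorm (kin.sectorMom sec (jetSector b)) ≠ 0 := fun h => by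
  obtain ⟨h1, -, h3, -⟩ := pc.collinear _ (jetSector_ne_soft b) i hi
  have e : lightDirBar (kin.sectorMom sec (jetSector b))
      = lightDir (kin.sectorMom sec (jetSector b)) := by
    funext μ; simp [lightDir, lightDirBar, h]
  rw [e] at h3
  have h4 : 1 / K ≤ K * lam ^ 2 := h3.trans h1
  rw [div_le_iff₀ (by linarith)] at h4
  have h5 : (K * lam) * (K * lam) < 1 * 1 := mul_lt_mul'' hsmall hsmall (by positivity)
    (by positivity)
  nlinarith

include phys pc hK hlam hsmall

theorem jetDir_mdot_nonneg {b : Bool} {i : ι} (hi : i ∈ members sec (jetSector b)) (j : ι) :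
    0 ≤ mdot (kin.jetDir sec b) (kin.q j) :=
  mdot_nonneg (lightDir_sq (spatialNorm_ne_zero pc hK hlam hsmall hi))
    (by change (0 : ℝ) ≤ 1; norm_num) (phys.onShell j).1 (phys.onShell j).2.le

theorem energy_bounds {b : Bool} {i : ι} (hi : i ∈ members sec (jetSector b)) :
    1 / (2 * K) ≤ kin.q i 0 ∧ kin.q i 0 ≤ K := by
  obtain ⟨h1, h2, h3, -⟩ := pc.collinear _ (jetSector_ne_soft b) i hi
  have h4 := jetDir_mdot_nonneg phys pc hK hlam hsmall hi i
  have h5 := lightDir_add_bar (kin.sectorMom sec (jetSector b)) (kin.q i)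
  have h6 : K * lam ^ 2 ≤ K := by
    have := lam_lt_one hK hlam hsmall
    nlinarith
  change 0 ≤ mdot (lightDir _) _ at h4
  constructor
  · rw [show 1 / (2 * K) = 1 / K / 2 by field_simp]
    linarith
  · linarith

theorem abs_sub_energy_le {b : Bool} {i : ι} (hi : i ∈ members sec (jetSector b)) (μ : Fin 4) :
    |kin.q i μ - kin.q i 0 * kin.jetDir sec b μ| ≤ 2 * K * lam := by
  obtain ⟨h1, h2, h3, h4⟩ := pc.collinear _ (jetSector_ne_soft b) i hi
  have h5 := jetDir_mdot_nonneg phys pc hK hlam hsmall hi i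
  change 0 ≤ mdot (lightDir _) _ at h5
  rw [jetDir, sub_energy_smul_lightDir]
  refine (abs_add_le _ _).trans ?_
  rw [abs_mul, abs_of_nonneg (by linarith : 0 ≤ mdot (lightDir (kin.sectorMom sec (jetSector b)))
    (kin.q i) / 2)]
  have h6 := abs_lightDirBar_sub_le (spatialNorm_ne_zero pc hK hlam hsmall hi) μ
  have h7 : mdot (lightDir (kin.sectorMom sec (jetSector b))) (kin.q i) / 2
      * |lightDirBar (kin.sectorMom sec (jetSector b)) μ
        - lightDir (kin.sectorMom sec (jetSector b)) μ| ≤ K * lam ^ 2 / 2 * 2 :=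
    mul_le_mul (by linarith) h6 (abs_nonneg _) (by positivity)
  have h8 : K * lam ^ 2 ≤ K * lam := by
    have := lam_lt_one hK hlam hsmall
    have h9 : lam ^ 2 ≤ lam := by nlinarith
    exact mul_le_mul_of_nonneg_left h9 (by linarith)
  linarith [h4 μ]

/-- The leading term comes from the direction of the jet. -/
theorem le_mdot_q {b : Bool} {i : ι} (hi : i ∈ members sec (jetSector b)) {v : Vec} {B : ℝ}
    (hv : ∀ μ, |v μ| ≤ B) : kin.q i 0 * mdot (kin.jetDir sec b) v - 8 * K * lam * B
      ≤ mdot (kin.q i) v := by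
  have h := abs_mdot_le (by positivity) (abs_sub_energy_le phys pc hK hlam hsmall hi) hv
  have e : mdot (kin.q i) v = kin.q i 0 * mdot (kin.jetDir sec b) v
      + mdot (fun μ => kin.q i μ - kin.q i 0 * kin.jetDir sec b μ) v := by
    simp only [mdot_eq]; ring
  rw [e]
  have := (abs_le.1 h).1
  linarith

theorem abs_jetDir_le {b : Bool} {i : ι} (hi : i ∈ members sec (jetSector b)) (μ : Fin 4) :
    |kin.jetDir sec b μ| ≤ 1 := by
  have := abs_le_energy (lightDir_sq (spatialNorm_ne_zero pc hK hlam hsmall hi))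
    (by rw [lightDir_zero]; norm_num) μ
  rwa [lightDir_zero] at this

end Pointwise

end Kinematics
end ScalarQED
end

noncomputable section
namespace ScalarQED
open scoped Topology
set_option linter.unusedSectionVars false

variable {ι : Type*} [Fintype ι] [DecidableEq ι]

/-! ### Hard and soft invariants -/

namespace Kinematics

section Pointwise

variable {kin : Kinematics ι} {sp : ι → Species} {sec : ι → Sector} {K lam : ℝ}
  (phys : kin.Physical sp) (pc : kin.PowerCounting sp sec K lam)
  (wd : kin.WilsonDirections sec K) (hK : 1 ≤ K) (hlam : 0 < lam)

include wd in
theorem wilsonDir_bounds (b : Bool) : mdot (kin.wilsonDir b) (kin.wilsonDir b) = 0 ∧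
    0 < kin.wilsonDir b 0 ∧ kin.wilsonDir b 0 ≤ K ∧
    1 / K ≤ mdot (kin.wilsonDir b) (kin.jetDir sec b) := by
  cases b
  · exact ⟨wd.out4.1, wd.out4.2.1, wd.out4.2.2, wd.sep4⟩
  · exact ⟨wd.out3.1, wd.out3.2.1, wd.out3.2.2, wd.sep3⟩

include phys pc in
theorem abs_beam_le (a : Fin 2) (μ : Fin 4) : |kin.p a μ| ≤ K :=
  (abs_le_energy (phys.onShellIn a).1 (phys.onShellIn a).2.le μ).trans (pc.incomingEnergy a)

section

variable (hsmall : 128 * K ^ 5 * lam ≤ 1 / 2)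
include phys pc wd hK hlam hsmall

omit phys pc wd in
theorem mul_lam_lt_one : K * lam < 1 := by
  have : K ≤ 128 * K ^ 5 := by
    have h1 : K ^ 1 ≤ K ^ 5 := pow_le_pow_right₀ hK (by norm_num)
    rw [pow_one] at h1
    linarith [pow_pos (by linarith : 0 < K) 5]
  nlinarith

omit phys pc wd in
theorem pow_mul_lam_le {m : ℕ} (hm : m ≤ 5) : 128 * K ^ m * lam ≤ 1 / 2 := by
  refine le_trans ?_ hsmall
  gcongr

omit phys pc wd in
/-- Comparison of an error term with the leading term. -/
theorem half_le_sub_error {m n : ℕ} (h : m + n ≤ 5) {c e : ℝ} (hc : 1 / (4 * K ^ m) ≤ c)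
    (he : e ≤ 16 * K ^ n * lam) : 1 / (8 * K ^ m) ≤ c - e := by
  have hKm : 0 < K ^ m := by positivity
  have h1 := pow_mul_lam_le hK hlam hsmall h
  have h2 : 16 * K ^ n * lam ≤ 1 / (8 * K ^ m) := by
    rw [le_div_iff₀ (by positivity)]
    calc 16 * K ^ n * lam * (8 * K ^ m) = 128 * K ^ (m + n) * lam := by rw [pow_add]; ring
      _ ≤ 1 / 2 := h1
      _ ≤ 1 := by norm_num
  have h3 : 1 / (4 * K ^ m) = 2 * (1 / (8 * K ^ m)) := by field_simp; norm_num
  linarith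

theorem jetSoft_lower {b : Bool} {i j : ι} (hi : i ∈ members sec (jetSector b))
    (hj : j ∈ members sec .soft) : 1 / (8 * K ^ 2) * lam ^ 2 ≤ mdot (kin.q i) (kin.q j) := by
  have hs := mul_lam_lt_one hK hlam hsmall
  have h1 := le_mdot_q phys pc hK hlam hs hi (pc.soft j hj)
  have h2 := (energy_bounds phys pc hK hlam hs hi).1
  have h3 : lam ^ 2 / K ≤ mdot (kin.jetDir sec b) (kin.q j) :=
    pc.sepSoftJet j hj _ (jetSector_ne_soft b)
  have h4 : 1 / (2 * K) * (lam ^ 2 / K) ≤ kin.q i 0 * mdot (kin.jetDir sec b) (kin.q j) :=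
    mul_le_mul h2 h3 (by positivity) ((by positivity : 0 ≤ 1 / (2 * K)).trans h2)
  have h5 := half_le_sub_error hK hlam hsmall (m := 2) (n := 2) (by norm_num)
    (c := 1 / (2 * K ^ 2)) (e := 8 * K ^ 2 * lam) (by gcongr; norm_num) (by
      have : 0 ≤ K ^ 2 * lam := by positivity
      linarith)
  have h6 := mul_le_mul_of_nonneg_right h5 (sq_nonneg lam)
  have h7 : (1 / (2 * K ^ 2) - 8 * K ^ 2 * lam) * lam ^ 2
      = 1 / (2 * K) * (lam ^ 2 / K) - 8 * K * lam * (K * lam ^ 2) := by field_simp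
  linarith

theorem jetWilson_lower {b : Bool} {i : ι} (hi : i ∈ members sec (jetSector b)) :
    1 / (8 * K ^ 2) ≤ mdot (kin.wilsonDir b) (kin.q i) := by
  have hs := mul_lam_lt_one hK hlam hsmall
  obtain ⟨ht, ht0, htK, htn⟩ := wilsonDir_bounds wd b
  have h1 := le_mdot_q phys pc hK hlam hs hi (v := kin.wilsonDir b) (B := K)
    (fun μ => (abs_le_energy ht ht0.le μ).trans htK)
  rw [mdot_comm _ (kin.wilsonDir b), mdot_comm _ (kin.wilsonDir b)] at h1
  have h2 := (energy_bounds phys pc hK hlam hs hi).1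
  have h4 : 1 / (2 * K) * (1 / K) ≤ kin.q i 0 * mdot (kin.wilsonDir b) (kin.jetDir sec b) :=
    mul_le_mul h2 htn (by positivity) ((by positivity : 0 ≤ 1 / (2 * K)).trans h2)
  have h5 := half_le_sub_error hK hlam hsmall (m := 2) (n := 2) (by norm_num)
    (c := 1 / (2 * K ^ 2)) (e := 8 * K ^ 2 * lam) (by gcongr; norm_num) (by
      have : 0 ≤ K ^ 2 * lam := by positivity
      linarith)
  have h7 : 1 / (2 * K ^ 2) - 8 * K ^ 2 * lam
      = 1 / (2 * K) * (1 / K) - 8 * K * lam * K := by field_simp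
  linarith

theorem jetJet_lower {i j : ι} (hi : i ∈ members sec .jet3) (hj : j ∈ members sec .jet4) :
    1 / (8 * K ^ 3) ≤ mdot (kin.q i) (kin.q j) := by
  have hs := mul_lam_lt_one hK hlam hsmall
  have hi' : i ∈ members sec (jetSector true) := hi
  have hj' : j ∈ members sec (jetSector false) := hj
  obtain ⟨hi1, hi2⟩ := energy_bounds phys pc hK hlam hs hi'
  obtain ⟨hj1, hj2⟩ := energy_bounds phys pc hK hlam hs hj'
  have h1 := le_mdot_q phys pc hK hlam hs hi' (v := kin.q j) (B := K) (fun μ =>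
    (abs_le_energy (phys.onShell j).1 (phys.onShell j).2.le μ).trans hj2)
  have h1' := le_mdot_q phys pc hK hlam hs hj' (v := kin.jetDir sec true) (B := 1)
    (abs_jetDir_le phys pc hK hlam hs hi')
  rw [mdot_comm (kin.q j)] at h1'
  have hw : 1 / K ≤ mdot (kin.jetDir sec false) (kin.jetDir sec true) := by
    rw [mdot_comm]; exact pc.sepJets
  have hi0 : 0 ≤ kin.q i 0 := (by positivity : 0 ≤ 1 / (2 * K)).trans hi1
  have hj0 : 0 ≤ kin.q j 0 := (by positivity : 0 ≤ 1 / (2 * K)).trans hj1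
  have h2 := mul_le_mul_of_nonneg_left h1' hi0
  have h3 : 1 / (2 * K) * (1 / (2 * K) * (1 / K))
      ≤ kin.q i 0 * (kin.q j 0 * mdot (kin.jetDir sec false) (kin.jetDir sec true)) :=
    mul_le_mul hi1 (mul_le_mul hj1 hw (by positivity) hj0) (by positivity) hi0
  have h4 : kin.q i 0 * (8 * K * lam) ≤ K * (8 * K * lam) :=
    mul_le_mul_of_nonneg_right hi2 (by positivity)
  have h5 := half_le_sub_error hK hlam hsmall (m := 3) (n := 2) (by norm_num)
    (c := 1 / (4 * K ^ 3)) (e := 16 * K ^ 2 * lam) le_rfl le_rfl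
  have h7 : 1 / (2 * K) * (1 / (2 * K) * (1 / K)) = 1 / (4 * K ^ 3) := by field_simp; norm_num
  rw [h7] at h3
  linarith

end

end Pointwise

section Beam

-- `M` bounds sums over the particles. The power `M ^ 8` in the smallness condition makes the errors of
-- order `M ^ 4 * lam` in `beamHard_lower` small compared with the leading term of order `1 / M ^ 4`.
variable {kin : Kinematics ι} {sp : ι → Species} {sec : ι → Sector} {K lam M : ℝ}
  (phys : kin.Physical sp) (pc : kin.PowerCounting sp sec K lam) (hK : 1 ≤ K) (hlam : 0 < lam)
  (hM : M = ((Fintype.card ι : ℝ) + 1) * K) (hsmall : 2000 * M ^ 8 * lam ≤ 1)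

include hK hM in
theorem K_le_M : K ≤ M := by
  have : (0 : ℝ) ≤ Fintype.card ι := Nat.cast_nonneg _
  rw [hM]; nlinarith

include hK hM in
theorem card_mul_le (T : Finset ι) {x y : ℝ} (hx : x ≤ K * y) (hy : 0 ≤ y) : T.card * x ≤ M * y := by
  have h1 : (T.card : ℝ) ≤ Fintype.card ι + 1 := by
    have : (T.card : ℝ) ≤ Fintype.card ι := by exact_mod_cast Finset.card_le_univ T
    linarith
  rw [hM, mul_assoc]
  refine (mul_le_mul_of_nonneg_left hx (Nat.cast_nonneg _)).trans ?_
  exact mul_le_mul_of_nonneg_right h1 (mul_nonneg (by linarith) hy)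

include hK hM hlam in
theorem abs_sum_le (T : Finset ι) {f : ι → ℝ} {x y : ℝ} (hf : ∀ i ∈ T, |f i| ≤ x)
    (hx : x ≤ K * y) (hy : 0 ≤ y) : |∑ i ∈ T, f i| ≤ M * y := by
  refine (Finset.abs_sum_le_sum_abs _ _).trans ((Finset.sum_le_card_nsmul _ _ _ hf).trans ?_)
  rw [nsmul_eq_mul]
  exact card_mul_le hK hM T hx hy

include phys pc hK hlam hM hsmall

omit phys pc in
theorem beam_small {m : ℕ} (hm : m ≤ 8) : 2000 * M ^ m * lam ≤ 1 := by
  refine le_trans ?_ hsmall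
  have := K_le_M hK hM
  gcongr
  linarith

/-- The square of the soft momentum is of higher order than its product with the momentum of the
photon. -/
theorem beamSoft_lower (a : Fin 2) {T : Finset ι} (hT : T ⊆ members sec .soft)
    (hc : ∃ i ∈ T, sp i ≠ .photon) : 1 / K * lam ^ 2 ≤
    2 * mdot (kin.p a) (∑ i ∈ T, kin.q i) - mdot (∑ i ∈ T, kin.q i) (∑ i ∈ T, kin.q i) := by
  obtain ⟨j, hj, hjc⟩ := hc
  have hKM := K_le_M hK hM
  have h1 : lam ^ 2 / K ≤ mdot (kin.p a) (∑ i ∈ T, kin.q i) := by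
    rw [mdot_sum_right]
    refine (pc.resolvedBeam j (hT hj) hjc a).trans ?_
    exact Finset.single_le_sum (f := fun i => mdot (kin.p a) (kin.q i)) (fun i _ =>
      mdot_nonneg (phys.onShellIn a).1 (phys.onShellIn a).2.le (phys.onShell i).1
        (phys.onShell i).2.le) hj
  have h2 : ∀ μ, |(∑ i ∈ T, kin.q i) μ| ≤ M * lam ^ 2 := fun μ => by
    rw [Finset.sum_apply]
    exact abs_sum_le hK hlam hM T (fun i hi => pc.soft i (hT hi) μ) le_rfl (sq_nonneg _)
  have h3 := (abs_le.1 (abs_mdot_le (mul_nonneg (by linarith) (sq_nonneg _)) h2 h2)).2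
  have h4 : 4 * (M * lam ^ 2) * (M * lam ^ 2) ≤ lam ^ 2 / K := by
    rw [le_div_iff₀ (by linarith)]
    have e1 := beam_small hK hlam hM hsmall (m := 3) (by norm_num)
    have e2 := beam_small hK hlam hM hsmall (m := 0) (by norm_num)
    have e3 : M ^ 3 * lam * lam ≤ 1 / 2000 * (1 / 2000) := mul_le_mul (by linarith)
      (by linarith) hlam.le (by norm_num)
    have e4 : M ^ 2 * K ≤ M ^ 3 := by
      rw [pow_succ M 2]; exact mul_le_mul_of_nonneg_left hKM (sq_nonneg _)
    have e5 : M ^ 2 * K * lam ^ 2 ≤ M ^ 3 * lam ^ 2 := mul_le_mul_of_nonneg_right e4 (sq_nonneg _)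
    have e6 : 4 * (M ^ 2 * K * lam ^ 2) ≤ 1 := by nlinarith
    have e7 := mul_le_mul_of_nonneg_right e6 (sq_nonneg lam)
    linarith
  have h5 : 1 / K * lam ^ 2 = lam ^ 2 / K := by ring
  linarith

/-- The deviation of a momentum from the direction of its jet. -/
def deviation (kin : Kinematics ι) (sec : ι → Sector) (i : ι) : Vec := fun μ => kin.q i μ
  - ((if sec i = jetSector true then kin.q i 0 else 0) * kin.jetDir sec true μ
    + (if sec i = jetSector false then kin.q i 0 else 0) * kin.jetDir sec false μ)

/-- The energy of the members of a jet in a set of particles. -/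
def jetEnergy (kin : Kinematics ι) (sec : ι → Sector) (b : Bool) (T : Finset ι) : ℝ :=
  ∑ i ∈ T, if sec i = jetSector b then kin.q i 0 else 0

omit phys pc hK hlam hM hsmall in
theorem sum_eq_jetEnergy (T : Finset ι) : ∑ i ∈ T, kin.q i = fun μ =>
    kin.jetEnergy sec true T * kin.jetDir sec true μ
      + kin.jetEnergy sec false T * kin.jetDir sec false μ
      + (∑ i ∈ T, kin.deviation sec i) μ := by
  funext μ
  simp only [jetEnergy, Finset.sum_apply, deviation, Finset.sum_mul]
  rw [← Finset.sum_add_distrib, ← Finset.sum_add_distrib]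
  exact Finset.sum_congr rfl fun i _ => by ring

section

omit hsmall
omit hM

theorem abs_deviation_le (hs : K * lam < 1) (i : ι) (μ : Fin 4) :
    |kin.deviation sec i μ| ≤ 2 * K * lam := by
  unfold deviation
  cases h : sec i
  · have := abs_sub_energy_le phys pc hK hlam hs (b := true) (mem_members.2 h) μ
    simpa [jetSector] using this
  · have := abs_sub_energy_le phys pc hK hlam hs (b := false) (mem_members.2 h) μ
    simpa [jetSector] using this
  · have h1 := pc.soft i (mem_members.2 h) μ
    have h2 := lam_lt_one hK hlam hs
    simp only [jetSector, reduceCtorEq, if_false, zero_mul, add_zero, sub_zero]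
    refine h1.trans ?_
    nlinarith [mul_pos (by linarith : 0 < K) hlam]

theorem jetEnergy_nonneg (b : Bool) (T : Finset ι) : 0 ≤ kin.jetEnergy sec b T :=
  Finset.sum_nonneg fun i _ => by split_ifs <;> linarith [(phys.onShell i).2]

theorem le_jetEnergy (hs : K * lam < 1) {b : Bool} {T : Finset ι}
    (h : ∃ i ∈ T, sec i = jetSector b) : 1 / (2 * K) ≤ kin.jetEnergy sec b T := by
  obtain ⟨i, hi, hb⟩ := h
  refine (energy_bounds phys pc hK hlam hs (mem_members.2 hb)).1.trans ?_
  have := Finset.single_le_sum (f := fun i => if sec i = jetSector b then kin.q i 0 else 0)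
    (fun i _ => by split_ifs <;> linarith [(phys.onShell i).2]) hi
  simpa [hb, jetEnergy] using this

end

/-- The term that multiplies each energy in the error of `hard_invariant_eq` is small. -/
theorem hard_error_le (hj : ∀ b, ∃ i, sec i = jetSector b) {d : Vec} {x y : ℝ} (hx : |x| ≤ M)
    (hy : |y| ≤ M) (hd : ∀ μ, |d μ| ≤ 2 * M * lam) :
    |2 * mdot (kin.p 1) d - 2 * x * mdot (kin.jetDir sec true) d
      - 2 * y * mdot (kin.jetDir sec false) d - mdot d d| ≤ 64 * M ^ 2 * lam := by
  have hKM := K_le_M hK hM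
  have hM1 : 1 ≤ M := by linarith
  have h0 := beam_small hK hlam hM hsmall (m := 1) (by norm_num)
  have hs : K * lam < 1 := by nlinarith
  have h1 := abs_mdot_le (by linarith) (abs_beam_le phys pc 1) hd
  have h2 : ∀ b, |mdot (kin.jetDir sec b) d| ≤ 4 * 1 * (2 * M * lam) := fun b => by
    obtain ⟨i, hi⟩ := hj b
    exact abs_mdot_le (by norm_num) (abs_jetDir_le phys pc hK hlam hs (mem_members.2 hi)) hd
  have h3 := abs_mdot_le (by positivity) hd hd
  have h4 : 4 * K * (2 * M * lam) ≤ 4 * M * (2 * M * lam) := by gcongr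
  have h5 : ∀ b, ∀ z, |z| ≤ M → |z * mdot (kin.jetDir sec b) d| ≤ M * (4 * 1 * (2 * M * lam)) :=
    fun b z hz => by
    rw [abs_mul]
    exact mul_le_mul hz (h2 b) (abs_nonneg _) (by linarith)
  have h6 : 4 * (2 * M * lam) * (2 * M * lam) ≤ 16 * M ^ 2 * lam := by
    have : lam ≤ 1 := by nlinarith
    have h7 : M ^ 2 * lam * lam ≤ M ^ 2 * lam * 1 := by gcongr
    linarith
  have h7 := abs_le.1 (h5 true x hx)
  have h8 := abs_le.1 (h5 false y hy)
  have h9 := abs_le.1 h1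
  have h10 := abs_le.1 h3
  rw [abs_le]
  constructor <;> linarith [h7.1, h7.2, h8.1, h8.2, h9.1, h9.2, h10.1, h10.2]

/-- The momentum transfer is large if there are collinear particles on both sides: by
`hard_invariant_eq` it is a sum of nonnegative terms, one of which is of order one, up to errors
proportional to `λ`. -/
theorem beamHard_lower (hj : ∀ b, ∃ i, sec i = jetSector b) {T : Finset ι}
    (hT : ∃ i ∈ T, sec i ≠ .soft) (hT' : ∃ i ∉ T, sec i ≠ .soft) : 1 / (8 * M ^ 6) ≤
    2 * mdot (kin.p 1) (∑ i ∈ T, kin.q i) - mdot (∑ i ∈ T, kin.q i) (∑ i ∈ T, kin.q i) := by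
  have hKM := K_le_M hK hM
  have hM1 : 1 ≤ M := by linarith
  have h0 := beam_small hK hlam hM hsmall (m := 1) (by norm_num)
  have hs : K * lam < 1 := by nlinarith
  have hn : ∀ b, mdot (kin.jetDir sec b) (kin.jetDir sec b) = 0 := fun b => by
    obtain ⟨i, hi⟩ := hj b
    exact lightDir_sq (spatialNorm_ne_zero pc hK hlam hs (mem_members.2 hi))
  have hE : ∀ b (U : Finset ι), |kin.jetEnergy sec b U| ≤ M := fun b U => by
    have := abs_sum_le hK hlam hM U (f := fun i => if sec i = jetSector b then kin.q i 0 else 0)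
      (x := K) (y := 1) (fun i _ => by
        split_ifs with h
        · rw [abs_of_pos (phys.onShell i).2]
          exact (energy_bounds phys pc hK hlam hs (mem_members.2 h)).2
        · rw [abs_zero]; linarith) (by linarith) (by norm_num)
    rwa [mul_one] at this
  have hd : ∀ (U : Finset ι) μ, |(∑ i ∈ U, kin.deviation sec i) μ| ≤ 2 * M * lam := fun U μ => by
    rw [Finset.sum_apply]
    have := abs_sum_le hK hlam hM U (f := fun i => kin.deviation sec i μ) (y := 2 * lam)
      (fun i _ => abs_deviation_le phys pc hK hlam hs i μ) (by linarith) (by linarith)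
    linarith
  have hsplit : ∀ b, kin.jetEnergy sec b T + kin.jetEnergy sec b Tᶜ
      = kin.jetEnergy sec b Finset.univ := fun b => Finset.sum_add_sum_compl T _
  have htot : ∑ i, kin.q i = kin.p 0 + kin.p 1 := phys.conservation
  have htot0 : mdot (∑ i, kin.q i) (∑ i, kin.q i) - 2 * mdot (kin.p 1) (∑ i, kin.q i) = 0 := by
    have e0 := (phys.onShellIn 0).1
    have e1 := (phys.onShellIn 1).1
    rw [htot]
    simp only [mdot_eq, Pi.add_apply] at e0 e1 ⊢
    linear_combination e0 - e1
  have key := hard_invariant_eq (hn true) (hn false)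
    (sum_eq_jetEnergy (kin := kin) (sec := sec) T) (a' := kin.jetEnergy sec true Tᶜ)
    (b' := kin.jetEnergy sec false Tᶜ) (tot := ∑ i, kin.q i) (D := ∑ i, kin.deviation sec i)
    (by rw [hsplit, hsplit]; exact sum_eq_jetEnergy Finset.univ) htot0
  have err1 := hard_error_le phys pc hK hlam hM hsmall hj (hE true T) (hE false T) (hd T)
  have err2 := hard_error_le phys pc hK hlam hM hsmall hj (hE true Finset.univ)
    (hE false Finset.univ) (hd Finset.univ)
  have hu : ∀ b, 1 / K ≤ mdot (kin.p 1) (kin.jetDir sec b) := fun b =>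
    pc.sepBeamJet 1 _ (jetSector_ne_soft b)
  have hnn : ∀ b U, 0 ≤ kin.jetEnergy sec b U := fun b U => jetEnergy_nonneg phys pc hK hlam b U
  have hle : ∀ b (U : Finset ι), (∃ i ∈ U, sec i = jetSector b) → 1 / (2 * K) ≤
    kin.jetEnergy sec b U := fun b U => le_jetEnergy phys pc hK hlam hs
  -- as both jets are nonempty, there are particles of different jets on the two sides
  have hcases : ((∃ i ∈ T, sec i = .jet3) ∧ ∃ i ∈ Tᶜ, sec i = .jet4) ∨
      ((∃ i ∈ T, sec i = .jet4) ∧ ∃ i ∈ Tᶜ, sec i = .jet3) := by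
    obtain ⟨i, hi, hsi⟩ := hT
    obtain ⟨j, hj1, hsj⟩ := hT'
    obtain ⟨x, hx⟩ := hj true
    obtain ⟨y, hy⟩ := hj false
    simp only [jetSector] at hx hy
    simp only [Finset.mem_compl]
    cases h1 : sec i
    · by_cases hyT : y ∈ T
      · cases h2 : sec j
        · exact Or.inr ⟨⟨y, hyT, hy⟩, j, hj1, h2⟩
        · exact Or.inl ⟨⟨i, hi, h1⟩, j, hj1, h2⟩
        · exact absurd h2 hsj
      · exact Or.inl ⟨⟨i, hi, h1⟩, y, hyT, hy⟩
    · by_cases hxT : x ∈ T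
      · cases h2 : sec j
        · exact Or.inr ⟨⟨i, hi, h1⟩, j, hj1, h2⟩
        · exact Or.inl ⟨⟨x, hxT, hx⟩, j, hj1, h2⟩
        · exact absurd h2 hsj
      · exact Or.inr ⟨⟨i, hi, h1⟩, x, hxT, hx⟩
    · exact absurd h1 hsi
  have hu1 := hu true
  have hu2 := hu false
  have hall := fun b => hle b Finset.univ ((hj b).imp fun i hi => ⟨Finset.mem_univ i, hi⟩)
  have e3 := hall true
  have e4 := hall false
  rw [hsplit, hsplit] at key
  have a0 := hnn true T
  have a0' := hnn true Tᶜ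
  have b0 := hnn false T
  have b0' := hnn false Tᶜ
  have e30 := hnn true Finset.univ
  have e40 := hnn false Finset.univ
  have ha := (abs_le.1 (hE true T)).2
  have hb := (abs_le.1 (hE false T)).2
  have he3 := (abs_le.1 (hE true Finset.univ)).2
  have he4 := (abs_le.1 (hE false Finset.univ)).2
  have c1 : (∃ i ∈ T, sec i = .jet3) → 1 / (2 * K) ≤ kin.jetEnergy sec true T := hle true T
  have c2 : (∃ i ∈ Tᶜ, sec i = .jet3) → 1 / (2 * K) ≤ kin.jetEnergy sec true Tᶜ := hle true Tᶜ
  have c3 : (∃ i ∈ T, sec i = .jet4) → 1 / (2 * K) ≤ kin.jetEnergy sec false T := hle false T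
  have c4 : (∃ i ∈ Tᶜ, sec i = .jet4) → 1 / (2 * K) ≤ kin.jetEnergy sec false Tᶜ := hle false Tᶜ
  generalize 2 * mdot (kin.p 1) (∑ i ∈ T, kin.q i)
    - mdot (∑ i ∈ T, kin.q i) (∑ i ∈ T, kin.q i) = X at key ⊢
  generalize 2 * mdot (kin.p 1) (∑ i ∈ T, kin.deviation sec i)
      - 2 * kin.jetEnergy sec true T * mdot (kin.jetDir sec true) (∑ i ∈ T, kin.deviation sec i)
      - 2 * kin.jetEnergy sec false T * mdot (kin.jetDir sec false) (∑ i ∈ T, kin.deviation sec i)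
      - mdot (∑ i ∈ T, kin.deviation sec i) (∑ i ∈ T, kin.deviation sec i) = E1 at key err1
  generalize 2 * mdot (kin.p 1) (∑ i, kin.deviation sec i)
      - 2 * kin.jetEnergy sec true Finset.univ * mdot (kin.jetDir sec true)
        (∑ i, kin.deviation sec i)
      - 2 * kin.jetEnergy sec false Finset.univ * mdot (kin.jetDir sec false)
        (∑ i, kin.deviation sec i)
      - mdot (∑ i, kin.deviation sec i) (∑ i, kin.deviation sec i) = E2 at key err2
  generalize kin.jetEnergy sec true T = a at *
  generalize kin.jetEnergy sec true Tᶜ = a' at *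
  generalize kin.jetEnergy sec false T = b at *
  generalize kin.jetEnergy sec false Tᶜ = b' at *
  generalize kin.jetEnergy sec true Finset.univ = e₃ at *
  generalize kin.jetEnergy sec false Finset.univ = e₄ at *
  generalize mdot (kin.p 1) (kin.jetDir sec true) = u at *
  generalize mdot (kin.p 1) (kin.jetDir sec false) = v at *
  have hKK : 0 ≤ 1 / (2 * K) := by positivity
  have hKi : 0 ≤ 1 / K := by positivity
  have hu0 : 0 ≤ u := hKi.trans hu1
  have hv0 : 0 ≤ v := hKi.trans hu2
  have t1 : 0 ≤ a * e₃ * b' * u := by positivity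
  have t2 : 0 ≤ b * e₄ * a' * v := by positivity
  have hprod : ∀ x y z w : ℝ, 1 / (2 * K) ≤ x → 1 / (2 * K) ≤ y → 1 / (2 * K) ≤ z → 1 / K ≤ w →
      1 / (8 * K ^ 4) ≤ x * y * z * w := by
    intro x y z w hx hy hz hw
    have : 1 / (2 * K) * (1 / (2 * K)) * (1 / (2 * K)) * (1 / K) ≤ x * y * z * w := by
      have hx0 := hKK.trans hx
      have hy0 := hKK.trans hy
      have hz0 := hKK.trans hz
      gcongr
    refine le_trans (le_of_eq ?_) this
    field_simp; norm_num
  have hL : 1 / (8 * K ^ 4) ≤ a * e₃ * b' * u + b * e₄ * a' * v := by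
    rcases hcases with ⟨h1, h2⟩ | ⟨h1, h2⟩
    · linarith [hprod a e₃ b' u (c1 h1) e3 (c4 h2) hu1]
    · linarith [hprod b e₄ a' v (c3 h1) e4 (c2 h2) hu2]
  have hMM : e₃ * e₄ ≤ M ^ 2 := by
    rw [pow_two]; exact mul_le_mul he3 he4 e40 (by linarith)
  have hMM' : a * b ≤ M ^ 2 := by
    rw [pow_two]; exact mul_le_mul ha hb b0 (by linarith)
  have g1 : |e₃ * e₄ * E1| ≤ M ^ 2 * (64 * M ^ 2 * lam) := by
    rw [abs_mul, abs_of_nonneg (mul_nonneg e30 e40)]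
    exact mul_le_mul hMM err1 (abs_nonneg _) (sq_nonneg _)
  have g2 : |a * b * E2| ≤ M ^ 2 * (64 * M ^ 2 * lam) := by
    rw [abs_mul, abs_of_nonneg (mul_nonneg a0 b0)]
    exact mul_le_mul hMM' err2 (abs_nonneg _) (sq_nonneg _)
  have hM4 : 0 < M ^ 4 := by positivity
  have g3 : M ^ 4 * lam ≤ 1 / (2000 * M ^ 4) := by
    rw [le_div_iff₀ (by positivity)]
    have : M ^ 4 * lam * (2000 * M ^ 4) = 2000 * M ^ 8 * lam := by ring
    rw [this]; exact hsmall
  have g4 : 1 / (8 * M ^ 4) ≤ 1 / (8 * K ^ 4) := by gcongr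
  have g5 : 1 / (8 * M ^ 4) = 250 * (1 / (2000 * M ^ 4)) := by field_simp; norm_num
  have g6 : 1 / (8 * M ^ 4) ≤ e₃ * e₄ * X := by
    rw [key]
    have := (abs_le.1 g1).1
    have := (abs_le.1 g2).2
    linarith
  by_contra! hX
  have g7 : e₃ * e₄ * X ≤ M ^ 2 * (1 / (8 * M ^ 6)) := by
    rcases le_or_gt 0 X with hX0 | hX0
    · exact mul_le_mul hMM hX.le hX0 (by positivity)
    · exact (mul_nonpos_of_nonneg_of_nonpos (mul_nonneg e30 e40) hX0.le).trans (by positivity)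
  have g8 : M ^ 2 * (1 / (8 * M ^ 6)) = 1 / (8 * M ^ 4) := by field_simp
  have g9 : e₃ * e₄ * X < 1 / (8 * M ^ 4) := by
    rcases le_or_gt X 0 with hX0 | hX0
    · exact (mul_nonpos_of_nonneg_of_nonpos (mul_nonneg e30 e40) hX0).trans_lt (by positivity)
    · rw [← g8]
      exact (mul_le_mul_of_nonneg_right hMM hX0.le).trans_lt
        (mul_lt_mul_of_pos_left hX (by positivity))
  linarith

/-- For small `λ` all relevant invariants are bounded below by their generic size. -/
theorem resolved (wd : kin.WilsonDirections sec K) (hj : ∀ b, ∃ i, sec i = jetSector b) :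
    kin.Resolved sp sec (1 / (8 * M ^ 6)) lam := by
  have hKM := K_le_M hK hM
  have hM1 : 1 ≤ M := by linarith
  have hs : 128 * K ^ 5 * lam ≤ 1 / 2 := by
    have h1 : K ^ 5 ≤ M ^ 5 := by gcongr
    have h2 : M ^ 5 * lam ≤ M ^ 8 * lam := by gcongr; norm_num
    have h3 : K ^ 5 * lam ≤ M ^ 5 * lam := by gcongr
    linarith
  have hc : ∀ m, m ≤ 6 → 1 / (8 * M ^ 6) ≤ 1 / (8 * K ^ m) := fun m hm => by
    have h1 : K ^ m ≤ K ^ 6 := pow_le_pow_right₀ hK hm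
    have h2 : K ^ 6 ≤ M ^ 6 := by gcongr
    have h3 : 0 < K ^ m := by positivity
    gcongr
    linarith
  refine ⟨fun b i hi j h => ?_, fun b i hi => (hc 2 (by norm_num)).trans
    (jetWilson_lower phys pc wd hK hlam hs hi), fun i hi j h => (hc 3 (by norm_num)).trans
    (jetJet_lower phys pc wd hK hlam hs hi h), fun a T hT h => ?_, fun T hT hT' =>
    beamHard_lower phys pc hK hlam hM hsmall hj hT hT'⟩
  · exact (mul_le_mul_of_nonneg_right (hc 2 (by norm_num)) (sq_nonneg _)).trans
      (jetSoft_lower phys pc wd hK hlam hs hi h)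
  · refine le_trans (mul_le_mul_of_nonneg_right ((hc 1 (by norm_num)).trans ?_) (sq_nonneg _))
      (beamSoft_lower phys pc hK hlam hM hsmall a hT h)
    rw [pow_one]
    gcongr
    linarith

end Beam

end Kinematics
end ScalarQED
end

noncomputable section
namespace ScalarQED
open scoped Topology
set_option linter.unusedSectionVars false

/-! ### Families of processes -/

section PowFiltration

variable {X : Type*} (lam : X → ℝ) (h0 : ∀ x, 0 < lam x) (h1 : ∀ x, lam x ≤ 1)

/-- The filtration of the functions on a family of processes by powers of `λ`, with constants that
are uniform in the family. -/
def powFiltration : Filtration (X → ℂ) where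
  F p :=
    { carrier := {f | ∃ C : ℝ, ∀ x, ‖f x‖ ≤ C * lam x ^ p}
      zero_mem' := ⟨0, fun x => by simp⟩
      add_mem' := by
        rintro f f' ⟨C, hC⟩ ⟨C', hC'⟩
        refine ⟨C + C', fun x => (norm_add_le _ _).trans ?_⟩
        rw [add_mul]
        exact add_le_add (hC x) (hC' x)
      neg_mem' := by
        rintro f ⟨C, hC⟩
        exact ⟨C, fun x => by simpa using hC x⟩ }
  anti := by
    rintro p q hpq f ⟨C, hC⟩
    refine ⟨|C|, fun x => (hC x).trans ?_⟩
    refine (mul_le_mul_of_nonneg_right (le_abs_self C) (zpow_nonneg (h0 x).le q)).trans ?_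
    exact mul_le_mul_of_nonneg_left (zpow_le_zpow_right_of_le_one₀ (h0 x) (h1 x) hpq) (abs_nonneg _)
  one_mem := ⟨1, fun x => by simp⟩
  mul_mem := by
    rintro p q f f' ⟨C, hC⟩ ⟨C', hC'⟩
    refine ⟨C * C', fun x => ?_⟩
    rw [Pi.mul_apply, norm_mul, zpow_add₀ (h0 x).ne']
    refine (mul_le_mul (hC x) (hC' x) (norm_nonneg _) ((norm_nonneg _).trans (hC x))).trans ?_
    exact le_of_eq (by ring)

theorem powFiltration_invMem {p : ℤ} {f : X → ℂ} {c : ℝ} (hc : 0 < c)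
    (hf : ∀ x, c * lam x ^ p ≤ ‖f x‖) : (powFiltration lam h0 h1).InvMem (-p) f := by
  have hpos : ∀ x, 0 < c * lam x ^ p := fun x => mul_pos hc (zpow_pos (h0 x) p)
  refine ⟨fun x => (f x)⁻¹, ⟨c⁻¹, fun x => ?_⟩, funext fun x => ?_⟩
  · rw [norm_inv, zpow_neg, ← mul_inv]
    exact inv_anti₀ (hpos x) (hf x)
  · exact inv_mul_cancel₀ (norm_pos_iff.1 ((hpos x).trans_le (hf x)))

end PowFiltration

variable {ι : Type*} [Fintype ι] [DecidableEq ι]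

/-- The role of a leg of the process. -/
def legTag (sec : ι → Sector) : ι ⊕ Fin 2 → Tag
  | .inl i => match sec i with
    | .jet3 => .jet true
    | .jet4 => .jet false
    | .soft => .soft
  | .inr a => if a = 0 then .beam1 else .beam2

/-- A family of processes that obey the power counting with the same constants. The multiples
`c` of the momenta are subtracted from the polarization vectors of the incoming photons to make
them bounded; the bound in `beam` is the one that holds in the axial gauge. -/
structure Family (sp : ι → Species) (sec : ι → Sector) (K c₀ : ℝ) (X : Type*) where
  lam : X → ℝ
  kin : X → Kinematics ι
  c : X → Fin 2 → ℂ
  one_le : 1 ≤ K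
  c₀_pos : 0 < c₀
  lam_pos : ∀ x, 0 < lam x
  small : ∀ x, K * lam x < 1
  phys : ∀ x, (kin x).Physical sp
  pc : ∀ x, (kin x).PowerCounting sp sec K (lam x)
  wd : ∀ x, (kin x).WilsonDirections sec K
  res : ∀ x, (kin x).Resolved sp sec c₀ (lam x)
  beam : ∀ x a μ, ‖(kin x).polIn a μ - c x a * ((kin x).p a μ : ℂ)‖ ≤ 2 * K ^ 3 + 1
  charge3 : sectorCharge sp sec .jet3 = 1
  charge4 : sectorCharge sp sec .jet4 = -1
  chargeS : sectorCharge sp sec .soft = 0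

theorem legTag_inl_eq_jet {sec : ι → Sector} {i : ι} {b : Bool} :
    legTag sec (.inl i) = .jet b ↔ sec i = jetSector b := by
  cases h : sec i <;> cases b <;> simp [legTag, h, jetSector]

theorem legTag_inl_eq_soft {sec : ι → Sector} {i : ι} :
    legTag sec (.inl i) = .soft ↔ sec i = .soft := by
  cases h : sec i <;> simp [legTag, h]

theorem legTag_inr (sec : ι → Sector) (a : Fin 2) :
    legTag sec (.inr a) = .beam1 ∨ legTag sec (.inr a) = .beam2 := by
  simp only [legTag]; split_ifs <;> simp

theorem exists_inl_of_legTag {sec : ι → Sector} {i : ι ⊕ Fin 2}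
    (h : legTag sec i ≠ .beam1 ∧ legTag sec i ≠ .beam2) : ∃ j, i = .inl j := by
  rcases i with j | a
  · exact ⟨j, rfl⟩
  · rcases legTag_inr sec a with h' | h'
    · exact absurd h' h.1
    · exact absurd h' h.2

theorem exists_inl_of_jet_or_soft {sec : ι → Sector} {i : ι ⊕ Fin 2} {b : Bool}
    (h : legTag sec i = .jet b ∨ legTag sec i = .soft) : ∃ j, i = .inl j :=
  exists_inl_of_legTag (sec := sec) (by rcases h with h | h <;> simp [h])

theorem exists_map_inl {T : Finset (ι ⊕ Fin 2)} (h : ∀ i ∈ T, ∃ j, i = Sum.inl j) :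
    ∃ T' : Finset ι, T = T'.map Function.Embedding.inl := by
  refine ⟨Finset.univ.filter fun j => Sum.inl j ∈ T, ?_⟩
  ext i
  simp only [Finset.mem_map, Finset.mem_filter, Finset.mem_univ, true_and,
    Function.Embedding.inl_apply]
  constructor
  · intro hi
    obtain ⟨j, rfl⟩ := h i hi
    exact ⟨j, hi, rfl⟩
  · rintro ⟨j, hj, rfl⟩
    exact hj

namespace Family

variable {sp : ι → Species} {sec : ι → Sector} {K c₀ : ℝ} {X : Type*}
  (𝓕 : Family sp sec K c₀ X)

/-- The external legs. -/
def leg (x : X) : ι ⊕ Fin 2 → Leg := (𝓕.kin x).legs sp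

theorem lam_le_one (x : X) : 𝓕.lam x ≤ 1 :=
  (Kinematics.lam_lt_one 𝓕.one_le (𝓕.lam_pos x) (𝓕.small x)).le

/-- The filtration by powers of `λ`. -/
def filt : Filtration (X → ℂ) := powFiltration 𝓕.lam 𝓕.lam_pos 𝓕.lam_le_one

theorem mem_of_le {p : ℤ} {f : X → ℂ} (C : ℝ) (h : ∀ x, ‖f x‖ ≤ C * 𝓕.lam x ^ p) :
    f ∈ 𝓕.filt.F p := ⟨C, h⟩

theorem mem_zero_of_le {f : X → ℂ} (C : ℝ) (h : ∀ x, ‖f x‖ ≤ C) : f ∈ 𝓕.filt.F 0 :=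
  𝓕.mem_of_le C fun x => by simpa using h x

/-- The total momenta. -/
def mom (S : Finset (ι ⊕ Fin 2)) (μ : Fin 4) : X → ℂ := fun x => kvec (𝓕.leg x) S μ

/-- The direction of a jet. -/
def dir (b : Bool) (μ : Fin 4) : X → ℂ := fun x => ((𝓕.kin x).jetDir sec b μ : ℂ)

/-- The direction of the Wilson line of a jet. -/
def wil (b : Bool) (μ : Fin 4) : X → ℂ := fun x => ((𝓕.kin x).wilsonDir b μ : ℂ)

/-- The momentum of a single leg. -/
def legMom (i : ι ⊕ Fin 2) (μ : Fin 4) : X → ℂ := fun x => ((𝓕.leg x i).mom μ : ℂ)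

theorem mom_eq_sum (S : Finset (ι ⊕ Fin 2)) (μ : Fin 4) :
    𝓕.mom S μ = ∑ i ∈ S, 𝓕.legMom i μ := by
  funext x
  simp [mom, kvec, toC, totalMom, legMom, Finset.sum_apply]

include 𝓕 in
theorem exists_jet (b : Bool) : ∃ i, sec i = jetSector b := by
  have : (members sec (jetSector b)).Nonempty := by
    by_contra h
    rw [Finset.not_nonempty_iff_eq_empty] at h
    have h3 := 𝓕.charge3
    have h4 := 𝓕.charge4
    cases b
    · simp only [jetSector] at h; simp [sectorCharge, h] at h4
    · simp only [jetSector] at h; simp [sectorCharge, h] at h3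
  obtain ⟨i, hi⟩ := this
  exact ⟨i, mem_members.1 hi⟩

theorem legMom_mem (i : ι ⊕ Fin 2) (μ : Fin 4) : 𝓕.legMom i μ ∈ 𝓕.filt.F 0 := by
  refine 𝓕.mem_zero_of_le K fun x => ?_
  simp only [legMom, Complex.norm_real, Real.norm_eq_abs]
  rcases i with i | a
  · change |(𝓕.kin x).q i μ| ≤ K
    cases h : sec i
    · exact (abs_le_energy ((𝓕.phys x).onShell i).1 ((𝓕.phys x).onShell i).2.le μ).trans
        (Kinematics.energy_bounds (𝓕.phys x) (𝓕.pc x) 𝓕.one_le (𝓕.lam_pos x) (𝓕.small x)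
          (b := true) (mem_members.2 h)).2
    · exact (abs_le_energy ((𝓕.phys x).onShell i).1 ((𝓕.phys x).onShell i).2.le μ).trans
        (Kinematics.energy_bounds (𝓕.phys x) (𝓕.pc x) 𝓕.one_le (𝓕.lam_pos x) (𝓕.small x)
          (b := false) (mem_members.2 h)).2
    · refine ((𝓕.pc x).soft i (mem_members.2 h) μ).trans ?_
      have := 𝓕.one_le
      have h2 : 𝓕.lam x ^ 2 ≤ 1 := pow_le_one₀ (𝓕.lam_pos x).le (𝓕.lam_le_one x)
      nlinarith
  · change |(-(𝓕.kin x).p a) μ| ≤ K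
    rw [Pi.neg_apply, abs_neg]
    exact Kinematics.abs_beam_le (𝓕.phys x) (𝓕.pc x) a μ

theorem legMom_soft {i : ι ⊕ Fin 2} (hi : legTag sec i = .soft) (μ : Fin 4) :
    𝓕.legMom i μ ∈ 𝓕.filt.F 2 := by
  obtain ⟨j, rfl⟩ := exists_inl_of_jet_or_soft (b := true) (Or.inr hi)
  refine 𝓕.mem_of_le K fun x => ?_
  simp only [legMom, Complex.norm_real, Real.norm_eq_abs]
  exact (𝓕.pc x).soft j (mem_members.2 (legTag_inl_eq_soft.1 hi)) μ

theorem dir_mem (b : Bool) (μ : Fin 4) : 𝓕.dir b μ ∈ 𝓕.filt.F 0 := by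
  obtain ⟨i, hi⟩ := 𝓕.exists_jet b
  refine 𝓕.mem_zero_of_le 1 fun x => ?_
  simp only [dir, Complex.norm_real, Real.norm_eq_abs]
  exact Kinematics.abs_jetDir_le (𝓕.phys x) (𝓕.pc x) 𝓕.one_le (𝓕.lam_pos x) (𝓕.small x)
    (mem_members.2 hi) μ

theorem wil_mem (b : Bool) (μ : Fin 4) : 𝓕.wil b μ ∈ 𝓕.filt.F 0 := by
  refine 𝓕.mem_zero_of_le K fun x => ?_
  simp only [wil, Complex.norm_real, Real.norm_eq_abs]
  obtain ⟨h1, h2, h3, -⟩ := Kinematics.wilsonDir_bounds (𝓕.wd x) b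
  exact (abs_le_energy h1 h2.le μ).trans h3

theorem rdot_apply (V W : Fin 4 → X → ℂ) (x : X) :
    rdot V W x = cdot (fun μ => V μ x) (fun μ => W μ x) := by
  simp [rdot, cdot, metric, Fin.sum_univ_four]; ring

theorem rdot_real (v w : X → Vec) (x : X) :
    rdot (fun μ x => (v x μ : ℂ)) (fun μ x => (w x μ : ℂ)) x = (mdot (v x) (w x) : ℂ) := by
  rw [rdot_apply]; exact cdot_toC _ _

theorem dir_sq (b : Bool) : rdot (𝓕.dir b) (𝓕.dir b) = 0 := by
  obtain ⟨i, hi⟩ := 𝓕.exists_jet b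
  funext x
  rw [show 𝓕.dir b = fun μ x => ((𝓕.kin x).jetDir sec b μ : ℂ) from rfl, rdot_real]
  rw [Kinematics.jetDir, lightDir_sq (Kinematics.spatialNorm_ne_zero (𝓕.pc x) 𝓕.one_le (𝓕.lam_pos x)
    (𝓕.small x) (mem_members.2 hi))]
  simp

theorem mom_mem (S : Finset (ι ⊕ Fin 2)) (μ : Fin 4) : 𝓕.mom S μ ∈ 𝓕.filt.F 0 := by
  rw [mom_eq_sum]
  exact sum_mem fun i _ => 𝓕.legMom_mem i μ

theorem mom_soft {S : Finset (ι ⊕ Fin 2)} (μ : Fin 4) (h : ∀ i ∈ S, legTag sec i = .soft) :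
    𝓕.mom S μ ∈ 𝓕.filt.F 2 := by
  rw [mom_eq_sum]
  exact sum_mem fun i hi => 𝓕.legMom_soft (h i hi) μ

theorem mom_jet {b : Bool} {S : Finset (ι ⊕ Fin 2)} (μ : Fin 4)
    (h : ∀ i ∈ S, legTag sec i = .jet b ∨ legTag sec i = .soft) :
    𝓕.mom S μ - 𝓕.mom S 0 * 𝓕.dir b μ ∈ 𝓕.filt.F 1 := by
  rw [mom_eq_sum, mom_eq_sum, Finset.sum_mul, ← Finset.sum_sub_distrib]
  refine sum_mem fun i hi => ?_
  rcases h i hi with h' | h'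
  · obtain ⟨j, rfl⟩ := exists_inl_of_jet_or_soft (Or.inl h')
    refine 𝓕.mem_of_le (2 * K) fun x => ?_
    have := Kinematics.abs_sub_energy_le (𝓕.phys x) (𝓕.pc x) 𝓕.one_le (𝓕.lam_pos x) (𝓕.small x)
      (mem_members.2 (legTag_inl_eq_jet.1 h')) μ
    rw [zpow_one]
    refine le_trans (le_of_eq ?_) this
    rw [← Real.norm_eq_abs, ← Complex.norm_real]
    simp [legMom, dir, leg, Kinematics.legs]
  · exact 𝓕.filt.anti (by norm_num : (1 : ℤ) ≤ 2) (sub_mem (𝓕.legMom_soft h' μ)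
      (𝓕.filt.mul (𝓕.legMom_soft h' 0) (𝓕.dir_mem b μ) (by omega)))

theorem rdot_mom_right (V : Fin 4 → X → ℂ) (S : Finset (ι ⊕ Fin 2)) :
    rdot V (𝓕.mom S) = ∑ i ∈ S, rdot V (𝓕.legMom i) := by
  simp only [rdot, mom_eq_sum, Finset.mul_sum, ← Finset.sum_sub_distrib]

theorem dir_mom {b : Bool} {S : Finset (ι ⊕ Fin 2)}
    (h : ∀ i ∈ S, legTag sec i = .jet b ∨ legTag sec i = .soft) :
    rdot (𝓕.dir b) (𝓕.mom S) ∈ 𝓕.filt.F 2 := by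
  rw [rdot_mom_right]
  refine sum_mem fun i hi => ?_
  rcases h i hi with h' | h'
  · obtain ⟨j, rfl⟩ := exists_inl_of_jet_or_soft (Or.inl h')
    have hj := mem_members.2 (legTag_inl_eq_jet.1 h')
    refine 𝓕.mem_of_le K fun x => ?_
    rw [show 𝓕.dir b = fun μ x => ((𝓕.kin x).jetDir sec b μ : ℂ) from rfl,
      show 𝓕.legMom (.inl j) = fun μ x => (((𝓕.kin x).q j) μ : ℂ) from rfl, rdot_real,
      Complex.norm_real, Real.norm_eq_abs, abs_of_nonneg (Kinematics.jetDir_mdot_nonneg (𝓕.phys x)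
        (𝓕.pc x) 𝓕.one_le (𝓕.lam_pos x) (𝓕.small x) hj j)]
    exact ((𝓕.pc x).collinear _ (jetSector_ne_soft b) j hj).1
  · exact 𝓕.filt.rdot_mem (𝓕.dir_mem b) (fun μ => 𝓕.legMom_soft h' μ) (by omega)

/-! ### Invariants of a family -/

/-- The total momentum as a real vector. -/
abbrev tot (x : X) (S : Finset (ι ⊕ Fin 2)) : Vec := totalMom (𝓕.leg x) S

theorem rdot_mom_mom (S T : Finset (ι ⊕ Fin 2)) (x : X) :
    rdot (𝓕.mom S) (𝓕.mom T) x = (mdot (𝓕.tot x S) (𝓕.tot x T) : ℂ) := rdot_real _ _ x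

theorem invMem_of_real {p : ℤ} {f : X → ℂ} {f' : X → ℝ} (hf : ∀ x, f x = (f' x : ℂ)) {c : ℝ}
    (hc : 0 < c) (h : ∀ x, c * 𝓕.lam x ^ p ≤ |f' x|) : 𝓕.filt.InvMem (-p) f :=
  powFiltration_invMem _ _ _ hc fun x => by
    rw [hf, Complex.norm_real, Real.norm_eq_abs]; exact h x

include 𝓕 in
theorem inv_K_pos : 0 < 1 / K := by have := 𝓕.one_le; positivity

theorem two_mul_le_tot {x : X} {S : Finset (ι ⊕ Fin 2)} (hS : ∀ i ∈ S, ∃ j, i = Sum.inl j)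
    {i j : ι} (hi : Sum.inl i ∈ S) (hj : Sum.inl j ∈ S) (hij : i ≠ j) :
    2 * mdot ((𝓕.kin x).q i) ((𝓕.kin x).q j) ≤ |mdot (𝓕.tot x S) (𝓕.tot x S)| := by
  refine le_trans ?_ (le_abs_self _)
  refine two_mul_mdot_le (f := fun i => (𝓕.leg x i).mom) ?_ hi hj (by simpa using hij)
  intro a ha b hb
  obtain ⟨a', rfl⟩ := hS a ha
  obtain ⟨b', rfl⟩ := hS b hb
  exact Kinematics.q_mdot_nonneg (𝓕.phys x) a' b'

theorem le_of_le_two_mul {a b y : ℝ} (h1 : a ≤ b) (h2 : 2 * b ≤ y) (h : 0 ≤ a) : a ≤ y := by linarith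

theorem species_of_charge {i : ι} (h : (sp i).charge ≠ 0) : sp i ≠ .photon := by
  intro h'; rw [h'] at h; exact h rfl

/-- The charges of the legs. -/
def legCharge (sp : ι → Species) : ι ⊕ Fin 2 → ℤ
  | .inl i => (sp i).charge
  | .inr _ => 0

theorem leg_charge (x : X) (i : ι ⊕ Fin 2) : (𝓕.leg x i).species.charge = legCharge sp i := by
  rcases i with i | a <;> rfl

theorem inv_soft {S : Finset (ι ⊕ Fin 2)} (hS : ∀ i ∈ S, legTag sec i = .soft) (h2 : 2 ≤ S.card)
    (hc : ∃ i ∈ S, legCharge sp i ≠ 0) : 𝓕.filt.InvMem (-4) (rdot (𝓕.mom S) (𝓕.mom S)) := by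
  obtain ⟨i, hi, hq⟩ := hc
  obtain ⟨j, hj, hij⟩ := Finset.exists_mem_ne (by omega : 1 < S.card) i
  have hinl : ∀ i ∈ S, ∃ j, i = Sum.inl j := fun i hi =>
    exists_inl_of_jet_or_soft (b := true) (Or.inr (hS i hi))
  obtain ⟨i, rfl⟩ := hinl i hi
  obtain ⟨j, rfl⟩ := hinl j hj
  have hij' : i ≠ j := fun h => hij (by rw [h])
  refine 𝓕.invMem_of_real (𝓕.rdot_mom_mom S S) 𝓕.inv_K_pos fun x => ?_
  refine le_of_le_two_mul ?_ (𝓕.two_mul_le_tot hinl hi hj hij') (mul_nonneg 𝓕.inv_K_pos.le (zpow_nonneg (𝓕.lam_pos x).le _))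
  have := (𝓕.pc x).resolvedSoft i (mem_members.2 (legTag_inl_eq_soft.1 (hS _ hi))) j
    (mem_members.2 (legTag_inl_eq_soft.1 (hS _ hj))) hij' (species_of_charge hq)
  refine le_trans (le_of_eq ?_) this
  rw [show (4 : ℤ) = ((4 : ℕ) : ℤ) from rfl, zpow_natCast]
  ring

theorem inv_nk (b : Bool) {S : Finset (ι ⊕ Fin 2)} (hS : ∀ i ∈ S, legTag sec i = .soft)
    (hne : S.Nonempty) : 𝓕.filt.InvMem (-2) (rdot (𝓕.dir b) (𝓕.mom S)) := by
  obtain ⟨i, hi⟩ := hne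
  have hinl : ∀ i ∈ S, ∃ j, i = Sum.inl j := fun i hi =>
    exists_inl_of_jet_or_soft (b := true) (Or.inr (hS i hi))
  obtain ⟨a, ha⟩ := 𝓕.exists_jet b
  refine 𝓕.invMem_of_real (fun x => rdot_real (fun x => (𝓕.kin x).jetDir sec b)
    (fun x => 𝓕.tot x S) x) 𝓕.inv_K_pos fun x => ?_
  refine le_trans ?_ (le_abs_self _)
  rw [tot, totalMom, mdot_sum_right]
  have h1 : mdot ((𝓕.kin x).jetDir sec b) (𝓕.leg x i).mom
      ≤ ∑ i ∈ S, mdot ((𝓕.kin x).jetDir sec b) (𝓕.leg x i).mom :=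
    Finset.single_le_sum (f := fun i => mdot ((𝓕.kin x).jetDir sec b) (𝓕.leg x i).mom)
      (fun j hj => by
        obtain ⟨j, rfl⟩ := hinl j hj
        exact Kinematics.jetDir_mdot_nonneg (𝓕.phys x) (𝓕.pc x) 𝓕.one_le (𝓕.lam_pos x)
          (𝓕.small x) (mem_members.2 ha) j) hi
  obtain ⟨i, rfl⟩ := hinl i hi
  refine le_trans (le_trans (le_of_eq ?_) ((𝓕.pc x).sepSoftJet i
    (mem_members.2 (legTag_inl_eq_soft.1 (hS _ hi))) _ (jetSector_ne_soft b))) h1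
  rw [show (2 : ℤ) = ((2 : ℕ) : ℤ) from rfl, zpow_natCast]
  ring

theorem inv_jet (b : Bool) {S : Finset (ι ⊕ Fin 2)}
    (hS : ∀ i ∈ S, legTag sec i = .jet b ∨ legTag sec i = .soft)
    (hj : ∃ i ∈ S, legTag sec i = .jet b)
    (h : (∃ i ∈ S, legTag sec i = .soft) ∨ 2 ≤ S.card ∧ ∃ i ∈ S, legCharge sp i ≠ 0) :
    𝓕.filt.InvMem (-2) (rdot (𝓕.mom S) (𝓕.mom S)) := by
  have hinl : ∀ i ∈ S, ∃ j, i = Sum.inl j := fun i hi => exists_inl_of_jet_or_soft (hS i hi)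
  have e2 : ∀ y : ℝ, y ^ (2 : ℤ) = y ^ 2 := fun y => by
    rw [show (2 : ℤ) = ((2 : ℕ) : ℤ) from rfl, zpow_natCast]
  by_cases hs : ∃ i ∈ S, legTag sec i = .soft
  · obtain ⟨i, hi, hib⟩ := hj
    obtain ⟨j, hj, hjs⟩ := hs
    obtain ⟨i, rfl⟩ := hinl i hi
    obtain ⟨j, rfl⟩ := hinl j hj
    rw [legTag_inl_eq_jet] at hib
    rw [legTag_inl_eq_soft] at hjs
    have hij : i ≠ j := by
      rintro rfl
      rw [hib] at hjs
      exact jetSector_ne_soft b hjs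
    refine 𝓕.invMem_of_real (𝓕.rdot_mom_mom S S) 𝓕.c₀_pos fun x => ?_
    refine le_of_le_two_mul ?_ (𝓕.two_mul_le_tot hinl hi hj hij)
      (mul_nonneg 𝓕.c₀_pos.le (zpow_nonneg (𝓕.lam_pos x).le _))
    rw [e2]
    exact (𝓕.res x).jetSoft b i (mem_members.2 hib) j (mem_members.2 hjs)
  · obtain ⟨h2, i, hi, hq⟩ := h.resolve_left hs
    obtain ⟨j, hj, hij⟩ := Finset.exists_mem_ne (by omega : 1 < S.card) i
    have hib := (hS i hi).resolve_right fun h => hs ⟨i, hi, h⟩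
    have hjb := (hS j hj).resolve_right fun h => hs ⟨j, hj, h⟩
    obtain ⟨i, rfl⟩ := hinl i hi
    obtain ⟨j, rfl⟩ := hinl j hj
    have hij' : i ≠ j := fun h => hij (by rw [h])
    refine 𝓕.invMem_of_real (𝓕.rdot_mom_mom S S) 𝓕.inv_K_pos fun x => ?_
    refine le_of_le_two_mul ?_ (𝓕.two_mul_le_tot hinl hi hj hij')
      (mul_nonneg 𝓕.inv_K_pos.le (zpow_nonneg (𝓕.lam_pos x).le _))
    refine le_trans (le_of_eq ?_) ((𝓕.pc x).resolvedJet _ (jetSector_ne_soft b) i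
      (mem_members.2 (legTag_inl_eq_jet.1 hib)) j (mem_members.2 (legTag_inl_eq_jet.1 hjb)) hij'
      (species_of_charge hq))
    rw [e2]; ring

theorem inv_energy (b : Bool) {S : Finset (ι ⊕ Fin 2)}
    (hS : ∀ i ∈ S, legTag sec i = .jet b ∨ legTag sec i = .soft)
    (hj : ∃ i ∈ S, legTag sec i = .jet b) : 𝓕.filt.InvMem 0 (𝓕.mom S 0) := by
  have hinl : ∀ i ∈ S, ∃ j, i = Sum.inl j := fun i hi => exists_inl_of_jet_or_soft (hS i hi)
  obtain ⟨i, hi, hib⟩ := hj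
  have hK := 𝓕.one_le
  refine 𝓕.invMem_of_real (p := 0) (f' := fun x => 𝓕.tot x S 0) (fun x => rfl)
    (by positivity : 0 < 1 / (2 * K)) fun x => ?_
  refine le_trans ?_ (le_abs_self _)
  have h1 : (𝓕.leg x i).mom 0 ≤ 𝓕.tot x S 0 := by
    rw [tot, totalMom, Finset.sum_apply]
    exact Finset.single_le_sum (f := fun i => (𝓕.leg x i).mom 0) (fun j hj => by
      obtain ⟨j, rfl⟩ := hinl j hj
      exact ((𝓕.phys x).onShell j).2.le) hi
  obtain ⟨i, rfl⟩ := hinl i hi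
  rw [zpow_zero, mul_one]
  exact (Kinematics.energy_bounds (𝓕.phys x) (𝓕.pc x) 𝓕.one_le (𝓕.lam_pos x) (𝓕.small x)
    (mem_members.2 (legTag_inl_eq_jet.1 hib))).1.trans h1

theorem wilson_mdot_ge (b : Bool) {S : Finset (ι ⊕ Fin 2)}
    (hS : ∀ i ∈ S, legTag sec i = .jet b ∨ legTag sec i = .soft)
    (hj : ∃ i ∈ S, legTag sec i = .jet b) (x : X) :
    c₀ ≤ mdot ((𝓕.kin x).wilsonDir b) (𝓕.tot x S) := by
  have hinl : ∀ i ∈ S, ∃ j, i = Sum.inl j := fun i hi => exists_inl_of_jet_or_soft (hS i hi)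
  obtain ⟨i, hi, hib⟩ := hj
  obtain ⟨ht, ht0, -, -⟩ := Kinematics.wilsonDir_bounds (𝓕.wd x) b
  rw [tot, totalMom, mdot_sum_right]
  have h1 : mdot ((𝓕.kin x).wilsonDir b) (𝓕.leg x i).mom
      ≤ ∑ i ∈ S, mdot ((𝓕.kin x).wilsonDir b) (𝓕.leg x i).mom :=
    Finset.single_le_sum (f := fun i => mdot ((𝓕.kin x).wilsonDir b) (𝓕.leg x i).mom)
      (fun j hj => by
        obtain ⟨j, rfl⟩ := hinl j hj
        exact mdot_nonneg ht ht0.le ((𝓕.phys x).onShell j).1 ((𝓕.phys x).onShell j).2.le) hi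
  obtain ⟨i, rfl⟩ := hinl i hi
  exact ((𝓕.res x).jetWilson b i (mem_members.2 (legTag_inl_eq_jet.1 hib))).trans h1

theorem inv_tk (b : Bool) {S : Finset (ι ⊕ Fin 2)}
    (hS : ∀ i ∈ S, legTag sec i = .jet b ∨ legTag sec i = .soft)
    (hj : ∃ i ∈ S, legTag sec i = .jet b) :
    𝓕.filt.InvMem 0 (rdot (𝓕.wil b) (𝓕.mom S)) := by
  refine 𝓕.invMem_of_real (p := 0) (fun x => rdot_real (fun x => (𝓕.kin x).wilsonDir b)
    (fun x => 𝓕.tot x S) x) 𝓕.c₀_pos fun x => ?_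
  rw [zpow_zero, mul_one]
  exact (𝓕.wilson_mdot_ge b hS hj x).trans (le_abs_self _)

theorem inv_both {S : Finset (ι ⊕ Fin 2)} (hS : ∀ i ∈ S, ∃ j, i = Sum.inl j)
    (hj : ∀ b, ∃ i ∈ S, legTag sec i = .jet b) :
    𝓕.filt.InvMem 0 (rdot (𝓕.mom S) (𝓕.mom S)) := by
  obtain ⟨i, hi, hib⟩ := hj true
  obtain ⟨j, hj, hjb⟩ := hj false
  obtain ⟨i, rfl⟩ := hS i hi
  obtain ⟨j, rfl⟩ := hS j hj
  rw [legTag_inl_eq_jet] at hib hjb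
  have hij : i ≠ j := by
    rintro rfl
    rw [hib] at hjb
    exact absurd hjb (by decide)
  refine 𝓕.invMem_of_real (p := 0) (𝓕.rdot_mom_mom S S) 𝓕.c₀_pos fun x => ?_
  rw [zpow_zero, mul_one]
  exact le_of_le_two_mul ((𝓕.res x).jetJet i (mem_members.2 hib) j (mem_members.2 hjb))
    (𝓕.two_mul_le_tot hS hi hj hij) 𝓕.c₀_pos.le

theorem tot_map (x : X) (T : Finset ι) :
    𝓕.tot x (T.map Function.Embedding.inl) = ∑ i ∈ T, (𝓕.kin x).q i := by
  rw [tot, totalMom, Finset.sum_map]; rfl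

theorem tot_insert (x : X) (T : Finset ι) :
    𝓕.tot x (insert (Sum.inr 1) (T.map Function.Embedding.inl))
      = ∑ i ∈ T, (𝓕.kin x).q i - (𝓕.kin x).p 1 := by
  rw [tot, totalMom, Finset.sum_insert (by simp), Finset.sum_map, add_comm, sub_eq_add_neg]; rfl

theorem mdot_sub_self {k p : Vec} (hp : mdot p p = 0) :
    mdot (k - p) (k - p) = -(2 * mdot p k - mdot k k) := by
  simp only [mdot_eq, Pi.sub_apply] at hp ⊢
  linear_combination hp

/-- A propagator with photon `2` carries the difference of the momenta of the outgoing particles and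
of the photon. -/
theorem inv_b2 {T : Finset ι} {p : ℤ} {c : ℝ} (hc : 0 < c) (h : ∀ x, c * 𝓕.lam x ^ p ≤
      2 * mdot ((𝓕.kin x).p 1) (∑ i ∈ T, (𝓕.kin x).q i)
        - mdot (∑ i ∈ T, (𝓕.kin x).q i) (∑ i ∈ T, (𝓕.kin x).q i)) :
    𝓕.filt.InvMem (-p) (rdot (𝓕.mom (insert (Sum.inr 1) (T.map Function.Embedding.inl)))
      (𝓕.mom (insert (Sum.inr 1) (T.map Function.Embedding.inl)))) := by
  refine 𝓕.invMem_of_real (𝓕.rdot_mom_mom _ _) hc fun x => ?_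
  rw [tot_insert, mdot_sub_self ((𝓕.phys x).onShellIn 1).1, abs_neg]
  exact (h x).trans (le_abs_self _)

theorem inv_b2_soft {T : Finset (ι ⊕ Fin 2)} (hT : ∀ i ∈ T, legTag sec i = .soft)
    (hc : ∃ i ∈ T, legCharge sp i ≠ 0) :
    𝓕.filt.InvMem (-2) (rdot (𝓕.mom (insert (Sum.inr 1) T)) (𝓕.mom (insert (Sum.inr 1) T))) := by
  obtain ⟨T, rfl⟩ := exists_map_inl fun i hi =>
    exists_inl_of_jet_or_soft (sec := sec) (b := true) (Or.inr (hT i hi))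
  refine 𝓕.inv_b2 𝓕.c₀_pos fun x => ?_
  rw [show (2 : ℤ) = ((2 : ℕ) : ℤ) from rfl, zpow_natCast]
  refine (𝓕.res x).beamSoft 1 T (fun i hi => mem_members.2 (legTag_inl_eq_soft.1 (hT _ (by
    simpa using hi)))) ?_
  obtain ⟨i, hi, hq⟩ := hc
  obtain ⟨i, hi', rfl⟩ := Finset.mem_map.1 hi
  exact ⟨i, hi', species_of_charge hq⟩

/-- All final-state legs. -/
def final : Finset (ι ⊕ Fin 2) := Finset.univ.map Function.Embedding.inl

theorem mem_final {i : ι ⊕ Fin 2} : i ∈ final ↔ ∃ j : ι, i = .inl j := by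
  simp [final, eq_comm]

theorem inv_b2_hard {T : Finset (ι ⊕ Fin 2)} (hT : T ⊆ final)
    (h1 : ∃ b, ∃ i ∈ T, legTag sec i = .jet b) (h2 : ∃ b, ∃ i ∈ final \ T, legTag sec i = .jet b) :
    𝓕.filt.InvMem 0 (rdot (𝓕.mom (insert (Sum.inr 1) T)) (𝓕.mom (insert (Sum.inr 1) T))) := by
  obtain ⟨T, rfl⟩ := exists_map_inl fun i hi => mem_final.1 (hT hi)
  refine 𝓕.inv_b2 (p := 0) 𝓕.c₀_pos fun x => ?_
  rw [zpow_zero, mul_one]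
  refine (𝓕.res x).beamHard T ?_ ?_
  · obtain ⟨b, i, hi, hb⟩ := h1
    obtain ⟨i, hi', rfl⟩ := Finset.mem_map.1 hi
    refine ⟨i, hi', ?_⟩
    rw [legTag_inl_eq_jet.1 hb]
    exact jetSector_ne_soft b
  · obtain ⟨b, i, hi, hb⟩ := h2
    obtain ⟨hi, hi'⟩ := Finset.mem_sdiff.1 hi
    obtain ⟨i, rfl⟩ := mem_final.1 hi
    refine ⟨i, fun h => hi' (by simpa using h), ?_⟩
    rw [legTag_inl_eq_jet.1 hb]
    exact jetSector_ne_soft b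

/-- If all collinear particles are on the side of photon `2`, the propagator is that of photon `1`
and soft particles. -/
theorem inv_b2_full {T : Finset (ι ⊕ Fin 2)} (hT : T ⊆ final)
    (h1 : ∀ b, ¬ ∃ i ∈ final \ T, legTag sec i = .jet b) (h2 : ∃ i ∈ final \ T, legCharge sp i ≠ 0) :
    𝓕.filt.InvMem (-2) (rdot (𝓕.mom (insert (Sum.inr 1) T)) (𝓕.mom (insert (Sum.inr 1) T))) := by
  obtain ⟨T, rfl⟩ := exists_map_inl fun i hi => mem_final.1 (hT hi)
  have hmem : ∀ i, i ∈ Tᶜ → Sum.inl i ∈ final \ T.map Function.Embedding.inl := fun i hi =>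
    Finset.mem_sdiff.2 ⟨mem_final.2 ⟨i, rfl⟩, fun h => Finset.mem_compl.1 hi (by simpa using h)⟩
  refine 𝓕.inv_b2 𝓕.c₀_pos fun x => ?_
  have key := (𝓕.res x).beamSoft 0 Tᶜ (fun i hi => by
    refine mem_members.2 ?_
    cases h : sec i
    · exact absurd ⟨_, hmem i hi, legTag_inl_eq_jet.2 h⟩ (h1 true)
    · exact absurd ⟨_, hmem i hi, legTag_inl_eq_jet.2 h⟩ (h1 false)
    · rfl) (by
    obtain ⟨i, hi, hq⟩ := h2
    obtain ⟨hi, hi'⟩ := Finset.mem_sdiff.1 hi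
    obtain ⟨i, rfl⟩ := mem_final.1 hi
    exact ⟨i, Finset.mem_compl.2 fun h => hi' (by simpa using h), species_of_charge hq⟩)
  rw [show (2 : ℤ) = ((2 : ℕ) : ℤ) from rfl, zpow_natCast]
  refine key.trans (le_of_eq ?_)
  -- momentum conservation: the two sets of particles recoil against the two photons
  have e := (𝓕.phys x).conservation
  rw [← Finset.sum_add_sum_compl T] at e
  have e0 := ((𝓕.phys x).onShellIn 0).1
  have e1 := ((𝓕.phys x).onShellIn 1).1
  have h0 := mdot_sub_self (k := ∑ i ∈ Tᶜ, (𝓕.kin x).q i) e0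
  have h3 := mdot_sub_self (k := ∑ i ∈ T, (𝓕.kin x).q i) e1
  have h4 : ∑ i ∈ T, (𝓕.kin x).q i - (𝓕.kin x).p 1
      = -(∑ i ∈ Tᶜ, (𝓕.kin x).q i - (𝓕.kin x).p 0) := by
    rw [eq_sub_of_add_eq e]; abel
  rw [h4] at h3
  have h5 : mdot (-(∑ i ∈ Tᶜ, (𝓕.kin x).q i - (𝓕.kin x).p 0))
      (-(∑ i ∈ Tᶜ, (𝓕.kin x).q i - (𝓕.kin x).p 0)) = mdot (∑ i ∈ Tᶜ, (𝓕.kin x).q i - (𝓕.kin x).p 0)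
      (∑ i ∈ Tᶜ, (𝓕.kin x).q i - (𝓕.kin x).p 0) := by
    simp only [mdot_eq, Pi.neg_apply]; ring
  rw [h5] at h3
  linarith

end Family
end ScalarQED
end

noncomputable section
namespace ScalarQED
open scoped Topology
set_option linter.unusedSectionVars false

/-! ### The gauge of the factorized fields -/

section Axial

variable {α : Type*} [DecidableEq α] [Fintype α]

/-- The gauge parameter that makes the component of the gauge field along `v` vanish. -/
def axialGauge (leg : α → Leg) (v : Vec) (A : Fin 4 → SetFun α) (S : Finset α) : ℂ :=
  Complex.I * cdot (toC v) (vec A S) / (mdot v (totalMom leg S) : ℂ)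

theorem axialGauge_eq_zero {leg : α → Leg} {v : Vec} {A : Fin 4 → SetFun α} {S : Finset α}
    (h : ∀ μ, A μ S = 0) : axialGauge leg v A S = 0 := by
  simp [axialGauge, cdot, vec, h]

theorem hatPhoton_apply (g : ℝ) (leg : α → Leg) (r : SetFun α) (μ : Fin 4) (S : Finset α) :
    hatPhoton g leg r μ S = treePhoton g leg μ S + Complex.I * (totalMom leg S μ : ℂ) * r S := by
  rw [hatPhoton, SetFun.add_apply, deriv4_apply]

theorem hatPhoton_of_eq_zero {g : ℝ} {leg : α → Leg} {r : SetFun α} {S : Finset α} (h : r S = 0)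
    (μ : Fin 4) : hatPhoton g leg r μ S = treePhoton g leg μ S := by
  rw [hatPhoton_apply, h, mul_zero, add_zero]

theorem hatPhoton_of_axial {g : ℝ} {leg : α → Leg} {r : SetFun α} {S : Finset α} {v : Vec}
    (h : r S = axialGauge leg v (treePhoton g leg) S) (μ : Fin 4) :
    hatPhoton g leg r μ S = treePhoton g leg μ S
      - cdot (toC v) (vec (treePhoton g leg) S) / (mdot v (totalMom leg S) : ℂ)
        * (totalMom leg S μ : ℂ) := by
  rw [hatPhoton_apply, h, axialGauge]
  linear_combination (totalMom leg S μ : ℂ) * cdot (toC v) (vec (treePhoton g leg) S)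
    / (mdot v (totalMom leg S) : ℂ) * Complex.I_sq

theorem cdot_hatPhoton (g : ℝ) (leg : α → Leg) (r : SetFun α) (v : Vec) (S : Finset α) :
    cdot (toC v) (vec (hatPhoton g leg r) S) = cdot (toC v) (vec (treePhoton g leg) S)
      + Complex.I * r S * (mdot v (totalMom leg S) : ℂ) := by
  have : vec (hatPhoton g leg r) S = vec (treePhoton g leg) S
      + (Complex.I * r S) • toC (totalMom leg S) := by
    funext μ
    simp only [vec, hatPhoton_apply, Pi.add_apply, Pi.smul_apply, smul_eq_mul, toC]
    ring
  rw [this, cdot_add, cdot_smul, cdot_toC]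

end Axial

/-- The unit vector along the time axis. -/
def timeDir : Vec := fun μ => if μ = 0 then 1 else 0

theorem mdot_timeDir (v : Vec) : mdot timeDir v = v 0 := by simp [mdot_eq, timeDir]

theorem cdot_timeDir (v : CVec) : cdot (toC timeDir) v = v 0 := by
  simp [cdot, toC, timeDir, metric, Fin.sum_univ_four]

variable {ι : Type*} [Fintype ι] [DecidableEq ι]

namespace Family

variable {sp : ι → Species} {sec : ι → Sector} {K c₀ : ℝ} {X : Type*}
  (𝓕 : Family sp sec K c₀ X) (g : ℝ)

/-- The gauge parameter: axial gauge along the Wilson line on the legs of a single jet, possibly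
together with soft legs; temporal gauge for single soft photons; and a bounded polarization vector
for the incoming photon `2`. -/
def gauge (x : X) : SetFun (ι ⊕ Fin 2) := .of fun S =>
  if Sum.inr 0 ∈ S then 0
  else if Sum.inr 1 ∈ S then (if S = {Sum.inr 1} then - Complex.I * 𝓕.c x 1 else 0)
  else if ∃ i ∈ S, legTag sec i = .jet true then
    (if ∃ i ∈ S, legTag sec i = .jet false then 0
      else axialGauge (𝓕.leg x) ((𝓕.kin x).wilsonDir true) (treePhoton g (𝓕.leg x)) S)
  else if ∃ i ∈ S, legTag sec i = .jet false then
    axialGauge (𝓕.leg x) ((𝓕.kin x).wilsonDir false) (treePhoton g (𝓕.leg x)) S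
  else if S.card = 1 then axialGauge (𝓕.leg x) timeDir (treePhoton g (𝓕.leg x)) S
  else 0

variable {𝓕 g} {x : X} {S : Finset (ι ⊕ Fin 2)}

theorem inr_notMem (h : ∀ i ∈ S, ∃ j, i = Sum.inl j) (a : Fin 2) : Sum.inr a ∉ S := fun ha => by
  obtain ⟨j, hj⟩ := h _ ha
  exact Sum.inr_ne_inl hj

theorem gauge_empty : 𝓕.gauge g x ∅ = 0 := by simp [gauge, SetFun.of_apply]

theorem gauge_b2 : 𝓕.gauge g x {Sum.inr 1} = - Complex.I * 𝓕.c x 1 := by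
  simp [gauge, SetFun.of_apply]

theorem gauge_of_b2_mem (h : Sum.inr 1 ∈ S) (h' : S ≠ {Sum.inr 1}) : 𝓕.gauge g x S = 0 := by
  simp [gauge, SetFun.of_apply, h, h']

theorem gauge_jet {b : Bool} (hS : ∀ i ∈ S, legTag sec i = .jet b ∨ legTag sec i = .soft)
    (hj : ∃ i ∈ S, legTag sec i = .jet b) : 𝓕.gauge g x S
      = axialGauge (𝓕.leg x) ((𝓕.kin x).wilsonDir b) (treePhoton g (𝓕.leg x)) S := by
  have hinl := inr_notMem fun i hi => exists_inl_of_jet_or_soft (hS i hi)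
  have hn : ¬ ∃ i ∈ S, legTag sec i = .jet !b := by
    rintro ⟨i, hi, h⟩
    rcases hS i hi with h' | h' <;> rw [h] at h' <;> cases b <;> simp at h'
  rw [gauge, SetFun.of_apply, if_neg (hinl 0), if_neg (hinl 1)]
  cases b
  · rw [Bool.not_false] at hn
    rw [if_neg hn, if_pos hj]
  · rw [Bool.not_true] at hn
    rw [if_pos hj, if_neg hn]

theorem gauge_both (hS : S ⊆ final) (hj : ∀ b, ∃ i ∈ S, legTag sec i = .jet b) :
    𝓕.gauge g x S = 0 := by
  have hinl := inr_notMem fun i hi => mem_final.1 (hS hi)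
  rw [gauge, SetFun.of_apply, if_neg (hinl 0), if_neg (hinl 1), if_pos (hj true), if_pos (hj false)]

theorem gauge_soft (hS : ∀ i ∈ S, legTag sec i = .soft) : 𝓕.gauge g x S =
    if S.card = 1 then axialGauge (𝓕.leg x) timeDir (treePhoton g (𝓕.leg x)) S else 0 := by
  have hinl := inr_notMem fun i hi => exists_inl_of_jet_or_soft (b := true) (Or.inr (hS i hi))
  have hn : ∀ b, ¬ ∃ i ∈ S, legTag sec i = .jet b := by
    rintro b ⟨i, hi, h⟩
    rw [hS i hi] at h
    simp at h
  rw [gauge, SetFun.of_apply, if_neg (hinl 0), if_neg (hinl 1), if_neg (hn true), if_neg (hn false)]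

theorem gauge_eq_zero (h : ∀ μ, treePhoton g (𝓕.leg x) μ S = 0) (h' : S ≠ {Sum.inr 1}) :
    𝓕.gauge g x S = 0 := by
  rw [gauge, SetFun.of_apply]
  simp only [axialGauge_eq_zero h, if_neg h', ite_self]

theorem leg_charge_eq : (fun i => (𝓕.leg x i).species.charge) = legCharge sp :=
  funext fun i => 𝓕.leg_charge x i

theorem tree_chargeSupp (μ : Fin 4) : ChargeSupp (legCharge sp) 0 (treePhoton g (𝓕.leg x) μ) := by
  have := treePhoton_chargeSupp g (𝓕.leg x) μ
  rwa [leg_charge_eq] at this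

theorem gauge_chargeSupp : ChargeSupp (legCharge sp) 0 (𝓕.gauge g x) := by
  intro S hS
  by_contra hne
  refine hS (gauge_eq_zero (fun μ => (tree_chargeSupp μ).apply_eq_zero hne) ?_)
  rintro rfl
  simp [legCharge] at hne

variable (𝓕 g) in
/-- The gauge-transformed gauge field. -/
def photon (μ : Fin 4) (S : Finset (ι ⊕ Fin 2)) : X → ℂ := fun x =>
  hatPhoton g (𝓕.leg x) (𝓕.gauge g x) μ S

variable (𝓕 g) in
/-- The gauge-transformed charged fields, with the field of charge `1` for `σ = true`. -/
def scalar (σ : Bool) (S : Finset (ι ⊕ Fin 2)) : X → ℂ := fun x =>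
  hatScalar g (𝓕.leg x) (𝓕.gauge g x) σ S

variable (𝓕 g) in
/-- The solution of the Maxwell equation without external wave functions. -/
def source (μ : Fin 4) (S : Finset (ι ⊕ Fin 2)) : X → ℂ := fun x =>
  - photonSource g (𝓕.leg x) (treeFields g (𝓕.leg x)) μ S
    / (mdot (𝓕.tot x S) (𝓕.tot x S) : ℂ)

theorem ne_zero_of_invMem {p : ℤ} {f : X → ℂ} (h : 𝓕.filt.InvMem p f) (x : X) : f x ≠ 0 := by
  obtain ⟨u, -, hu⟩ := h
  intro h0
  have := congrFun hu x
  simp [h0] at this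

variable (𝓕) in
theorem ksq_ne_zero {p : ℤ} (h : 𝓕.filt.InvMem p (rdot (𝓕.mom S) (𝓕.mom S))) (x : X) :
    mdot (𝓕.tot x S) (𝓕.tot x S) ≠ 0 := by
  have := ne_zero_of_invMem h x
  rw [rdot_mom_mom] at this
  exact_mod_cast this

theorem sum_filter_tag (τ : Tag) (s : Sector) (h : ∀ j, legTag sec (.inl j) = τ ↔ sec j = s) :
    (final.filter fun i => legTag sec i = τ) = Kinematics.state sec s := by
  ext i
  simp only [Kinematics.state, Finset.mem_filter, Finset.mem_map, Function.Embedding.inl_apply,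
    mem_final]
  constructor
  · rintro ⟨⟨j, rfl⟩, hj⟩
    exact ⟨j, mem_members.2 ((h j).1 hj), rfl⟩
  · rintro ⟨j, hj, rfl⟩
    exact ⟨⟨j, rfl⟩, (h j).2 (mem_members.1 hj)⟩

theorem filter_jet (b : Bool) : (final.filter fun i => legTag sec i = .jet b)
    = Kinematics.state sec (jetSector b) := sum_filter_tag _ _ fun _ => legTag_inl_eq_jet

theorem filter_soft : (final.filter fun i => legTag sec i = .soft) = Kinematics.state sec .soft :=
  sum_filter_tag _ _ fun _ => legTag_inl_eq_soft

theorem sum_state (s : Sector) :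
    ∑ i ∈ Kinematics.state sec s, legCharge sp i = sectorCharge sp sec s := by
  rw [Kinematics.state, Finset.sum_map]; rfl

include 𝓕 in
theorem charge_jet (b : Bool) :
    ∑ i ∈ final.filter (fun i => legTag sec i = .jet b), legCharge sp i = sgn b := by
  rw [filter_jet, sum_state]
  cases b
  · exact 𝓕.charge4
  · exact 𝓕.charge3

include 𝓕 in
theorem charge_soft : ∑ i ∈ final.filter (fun i => legTag sec i = .soft), legCharge sp i = 0 := by
  rw [filter_soft, sum_state]; exact 𝓕.chargeS

include 𝓕 in
theorem charge_final : ∑ i ∈ final, legCharge sp i = 0 := by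
  have h : ∀ i ∈ (final : Finset (ι ⊕ Fin 2)), legCharge sp i
      = (if legTag sec i = .jet true then legCharge sp i else 0)
        + (if legTag sec i = .jet false then legCharge sp i else 0)
        + (if legTag sec i = .soft then legCharge sp i else 0) := by
    intro i hi
    obtain ⟨j, rfl⟩ := mem_final.1 hi
    cases h : sec j <;> simp [legTag, h]
  rw [Finset.sum_congr rfl h, Finset.sum_add_distrib, Finset.sum_add_distrib, ← Finset.sum_filter,
    ← Finset.sum_filter, ← Finset.sum_filter, 𝓕.charge_jet, 𝓕.charge_jet, 𝓕.charge_soft]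
  rfl

theorem tag_cases (hS : S ⊆ final) : (∀ i ∈ S, legTag sec i = .soft) ∨
    (∃ b, (∀ i ∈ S, legTag sec i = .jet b ∨ legTag sec i = .soft) ∧
      ∃ i ∈ S, legTag sec i = .jet b) ∨ ∀ b, ∃ i ∈ S, legTag sec i = .jet b := by
  have key : ∀ i ∈ S, legTag sec i = .jet true ∨ legTag sec i = .jet false ∨
      legTag sec i = .soft := by
    intro i hi
    obtain ⟨j, rfl⟩ := mem_final.1 (hS hi)
    cases h : sec j <;> simp [legTag, h]
  by_cases h1 : ∃ i ∈ S, legTag sec i = .jet true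
  · by_cases h2 : ∃ i ∈ S, legTag sec i = .jet false
    · exact Or.inr (Or.inr fun b => by cases b <;> assumption)
    · refine Or.inr (Or.inl ⟨true, fun i hi => ?_, h1⟩)
      rcases key i hi with h | h | h
      · exact Or.inl h
      · exact absurd ⟨i, hi, h⟩ h2
      · exact Or.inr h
  · by_cases h2 : ∃ i ∈ S, legTag sec i = .jet false
    · refine Or.inr (Or.inl ⟨false, fun i hi => ?_, h2⟩)
      rcases key i hi with h | h | h
      · exact absurd ⟨i, hi, h⟩ h1
      · exact Or.inl h
      · exact Or.inr h
    · refine Or.inl fun i hi => ?_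
      rcases key i hi with h | h | h
      · exact absurd ⟨i, hi, h⟩ h1
      · exact absurd ⟨i, hi, h⟩ h2
      · exact h

theorem exists_charged {T : Finset (ι ⊕ Fin 2)} (h : ∑ i ∈ T, legCharge sp i ≠ 0) :
    ∃ i ∈ T, legCharge sp i ≠ 0 := Finset.exists_ne_zero_of_sum_ne_zero h

theorem eq_insert_of_mem (h0 : Sum.inr 0 ∉ S) (h1 : Sum.inr 1 ∈ S) :
    ∃ T ⊆ final, Sum.inr 1 ∉ T ∧ S = insert (Sum.inr 1) T := by
  refine ⟨S.erase (Sum.inr 1), fun i hi => ?_, Finset.notMem_erase _ _,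
    (Finset.insert_erase h1).symm⟩
  obtain ⟨hne, hi⟩ := Finset.mem_erase.1 hi
  rcases i with j | a
  · exact mem_final.2 ⟨j, rfl⟩
  · fin_cases a
    · exact absurd hi h0
    · exact absurd rfl hne

theorem subset_final (h0 : Sum.inr 0 ∉ S) (h1 : Sum.inr 1 ∉ S) : S ⊆ final := by
  intro i hi
  rcases i with j | a
  · exact mem_final.2 ⟨j, rfl⟩
  · fin_cases a
    · exact absurd hi h0
    · exact absurd hi h1

variable (𝓕) in
/-- No propagator of a charged line without photon `1` is singular. -/
theorem ksq_ne_zero_of_charged (h0 : Sum.inr 0 ∉ S) (h2 : 2 ≤ S.card)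
    (hq : ∑ i ∈ S, legCharge sp i ≠ 0) (x : X) : mdot (𝓕.tot x S) (𝓕.tot x S) ≠ 0 := by
  by_cases h1 : Sum.inr 1 ∈ S
  · obtain ⟨T, hT, hn, rfl⟩ := eq_insert_of_mem h0 h1
    rw [Finset.sum_insert hn, legCharge, zero_add] at hq
    rcases tag_cases (sec := sec) hT with h | h
    · exact 𝓕.ksq_ne_zero (𝓕.inv_b2_soft h (exists_charged hq)) x
    · have hj : ∃ b, ∃ i ∈ T, legTag sec i = .jet b := by
        rcases h with ⟨b, -, h⟩ | h
        · exact ⟨b, h⟩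
        · exact ⟨true, h true⟩
      by_cases hc : ∃ b, ∃ i ∈ final \ T, legTag sec i = .jet b
      · exact 𝓕.ksq_ne_zero (𝓕.inv_b2_hard hT hj hc) x
      · refine 𝓕.ksq_ne_zero (𝓕.inv_b2_full hT (fun b hb => hc ⟨b, hb⟩) (exists_charged ?_)) x
        have := 𝓕.charge_final
        rw [← Finset.sum_sdiff hT] at this
        intro h0
        rw [h0, zero_add] at this
        exact hq this
  · have hS := subset_final h0 h1
    rcases tag_cases (sec := sec) hS with h | ⟨b, h, hj⟩ | h
    · exact 𝓕.ksq_ne_zero (𝓕.inv_soft h h2 (exists_charged hq)) x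
    · exact 𝓕.ksq_ne_zero (𝓕.inv_jet b h hj (Or.inr ⟨h2, exists_charged hq⟩)) x
    · exact 𝓕.ksq_ne_zero (𝓕.inv_both (fun i hi => mem_final.1 (hS hi)) h) x

theorem cdot_star_right (v : Vec) (w : CVec) : cdot (toC v) (star w) = star (cdot (toC v) w) := by
  simp [cdot, toC, star_sum]

variable (𝓕) in
theorem wave_spec (x : X) (i : ι) (h : sp i = .photon) :
    cdot (toC ((𝓕.kin x).q i)) (𝓕.leg x (.inl i)).wave = 0 ∧
      cdot (star (𝓕.leg x (.inl i)).wave) (𝓕.leg x (.inl i)).wave = -1 := by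
  obtain ⟨h1, h2⟩ := (𝓕.phys x).polarization i h
  have e : (𝓕.leg x (.inl i)).wave = star ((𝓕.kin x).pol i) := rfl
  rw [e, cdot_star_right, h1, star_star, cdot_comm, h2]
  exact ⟨star_zero _, rfl⟩

variable (𝓕) in
theorem nonSingular (x : X) : NonSingular (𝓕.leg x) (Sum.inr 0) where
  onShell i := by
    rcases i with i | a
    · exact ((𝓕.phys x).onShell i).1
    · change mdot (-(𝓕.kin x).p a) (-(𝓕.kin x).p a) = 0
      rw [← ((𝓕.phys x).onShellIn a).1]
      simp only [mdot_eq, Pi.neg_apply]; ring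
  propagator S h0 h2 hq := by
    rw [Finset.sum_congr rfl fun i _ => 𝓕.leg_charge x i] at hq
    exact 𝓕.ksq_ne_zero_of_charged h0 h2 hq x

variable (𝓕 g) in
/-- The exponent of a soft Wilson line along the direction of a jet. -/
def softRay (b : Bool) (x : X) : SetFun (ι ⊕ Fin 2) := .of fun S =>
  if (∀ i ∈ S, legTag sec i = .soft) ∧ S.Nonempty then
    Complex.I * cdot (toC ((𝓕.kin x).jetDir sec b)) (vec (hatPhoton g (𝓕.leg x) (𝓕.gauge g x)) S)
      / (mdot ((𝓕.kin x).jetDir sec b) (𝓕.tot x S) : ℂ)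
  else 0

variable (𝓕 g) in
/-- The soft Wilson line along the direction of the jet `b`, with the sign `σ` in the exponent. -/
def softLine (b σ : Bool) (x : X) : SetFun (ι ⊕ Fin 2) :=
  SetFun.exp ((Complex.I * (sgn σ : ℂ) * g) • 𝓕.softRay g b x)

theorem softRay_empty (b : Bool) : 𝓕.softRay g b x ∅ = 0 := by
  simp [softRay, SetFun.of_apply]

variable (𝓕) in
theorem jetDir_mdot_ne_zero (b : Bool) (hS : ∀ i ∈ S, legTag sec i = .soft) (h : S.Nonempty)
    (x : X) : (mdot ((𝓕.kin x).jetDir sec b) (𝓕.tot x S) : ℂ) ≠ 0 := by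
  have := ne_zero_of_invMem (𝓕.inv_nk b hS h) x
  rwa [show 𝓕.dir b = fun μ x => ((𝓕.kin x).jetDir sec b μ : ℂ) from rfl,
    show 𝓕.mom S = fun μ x => (𝓕.tot x S μ : ℂ) from rfl, rdot_real] at this

/-- The soft Wilson line solves the equation of parallel transport in the gauge-transformed field.
-/
theorem softLine_eq (b σ : Bool) (hS : ∀ i ∈ S, legTag sec i = .soft) :
    (mdot ((𝓕.kin x).jetDir sec b) (𝓕.tot x S) : ℂ) * 𝓕.softLine g b σ x S =
      - ((sgn σ : ℂ) * g) * ∑ T ∈ S.powerset, cdot (toC ((𝓕.kin x).jetDir sec b))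
        (vec (hatPhoton g (𝓕.leg x) (𝓕.gauge g x)) T) * 𝓕.softLine g b σ x (S \ T) := by
  set n := (𝓕.kin x).jetDir sec b
  set w : ι ⊕ Fin 2 → ℂ := fun i => (mdot n (𝓕.leg x i).mom : ℂ)
  have hw : ∀ T, ∑ i ∈ T, w i = (mdot n (𝓕.tot x T) : ℂ) := fun T => by
    rw [tot, totalMom, mdot_sum_right]; push_cast; rfl
  have h0 : ((Complex.I * (sgn σ : ℂ) * g) • 𝓕.softRay g b x) ∅ = 0 := smul_empty (softRay_empty b) _
  have := congrArg (fun F : SetFun (ι ⊕ Fin 2) => F S) (SetFun.derivation_exp (SetFun.weight w) h0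
    (by rw [SetFun.weight_apply, Finset.sum_empty, zero_mul]))
  simp only [SetFun.weight_apply, SetFun.mul_apply, hw] at this
  rw [softLine, this, Finset.mul_sum]
  refine Finset.sum_congr rfl fun T hT => ?_
  rw [← mul_assoc]
  congr 1
  rw [SetFun.smul_apply]
  have hTs : ∀ i ∈ T, legTag sec i = .soft := fun i hi => hS i (Finset.mem_powerset.1 hT hi)
  rcases T.eq_empty_or_nonempty with rfl | hne
  · have e : vec (hatPhoton g (𝓕.leg x) (𝓕.gauge g x)) ∅ = 0 := by
      funext μ
      rw [vec, hatPhoton_apply, treePhoton_empty, gauge_empty]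
      simp
    rw [e, softRay_empty]
    simp [cdot]
  · have hn := 𝓕.jetDir_mdot_ne_zero b hTs hne x
    rw [softRay, SetFun.of_apply, if_pos ⟨hTs, hne⟩]
    change (mdot n (𝓕.tot x T) : ℂ) ≠ 0 at hn
    refine (mul_left_comm _ _ _).trans ?_
    change _ * (_ * (Complex.I * _ / (mdot n (𝓕.tot x T) : ℂ))) = _
    rw [mul_div_cancel₀ _ hn]
    linear_combination (sgn σ : ℂ) * g * cdot (toC n)
      (vec (hatPhoton g (𝓕.leg x) (𝓕.gauge g x)) T) * Complex.I_sq

theorem photon_single_of_scalar {i : ι} (h : sp i ≠ .photon) (μ : Fin 4) :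
    hatPhoton g (𝓕.leg x) (𝓕.gauge g x) μ {Sum.inl i} = 0 := by
  have : ∀ μ, treePhoton g (𝓕.leg x) μ {Sum.inl i} = 0 := fun μ => by
    rw [treePhoton_singleton]; exact if_neg h
  rw [hatPhoton_of_eq_zero (gauge_eq_zero this (by simp)), this]

/-- In a gauge with `v·A = 0`, the polarization vector of a photon is still physical, since the gauge
transformation adds a multiple of the momentum to it. -/
theorem axial_wave {i : ι} {v : Vec} (h : sp i = .photon)
    (hr : 𝓕.gauge g x {Sum.inl i} = axialGauge (𝓕.leg x) v (treePhoton g (𝓕.leg x)) {Sum.inl i})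
    (hv : mdot v ((𝓕.kin x).q i) ≠ 0) :
    cdot (toC v) (vec (hatPhoton g (𝓕.leg x) (𝓕.gauge g x)) {Sum.inl i}) = 0 ∧
    cdot (toC ((𝓕.kin x).q i)) (vec (hatPhoton g (𝓕.leg x) (𝓕.gauge g x)) {Sum.inl i}) = 0 ∧
    cdot (star (vec (hatPhoton g (𝓕.leg x) (𝓕.gauge g x)) {Sum.inl i}))
      (vec (hatPhoton g (𝓕.leg x) (𝓕.gauge g x)) {Sum.inl i}) = -1 := by
  have hv' : (mdot v ((𝓕.kin x).q i) : ℂ) ≠ 0 := by exact_mod_cast hv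
  have ht : totalMom (𝓕.leg x) {Sum.inl i} = (𝓕.kin x).q i := totalMom_singleton _ _
  have e : vec (hatPhoton g (𝓕.leg x) (𝓕.gauge g x)) {Sum.inl i}
      = fun μ => (𝓕.leg x (.inl i)).wave μ +
        -(cdot (toC v) (vec (treePhoton g (𝓕.leg x)) {Sum.inl i}) / (mdot v ((𝓕.kin x).q i) : ℂ))
          * ((𝓕.kin x).q i μ : ℂ) := by
    funext μ
    rw [vec, hatPhoton_of_axial hr, treePhoton_singleton,
      if_pos (show (𝓕.leg x (.inl i)).species = .photon from h), ht]
    ring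
  obtain ⟨h1, h2⟩ := 𝓕.wave_spec x i h
  have hq := ((𝓕.phys x).onShell i).1
  refine ⟨?_, ?_, ?_⟩
  · rw [cdot_hatPhoton, hr, axialGauge, ht]
    field_simp
    rw [Complex.I_sq]; ring
  · rw [e]; exact cdot_toC_add_smul hq h1 _
  · rw [e, cdot_star_add_smul hq h1]; exact h2

end Family
end ScalarQED
end

noncomputable section
namespace ScalarQED
open scoped Topology
set_option linter.unusedSectionVars false

variable {ι : Type*} [Fintype ι] [DecidableEq ι]

namespace Family

variable {sp : ι → Species} {sec : ι → Sector} {K c₀ : ℝ} {X : Type*}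
  {𝓕 : Family sp sec K c₀ X} {g : ℝ} {S : Finset (ι ⊕ Fin 2)}

/-! ### The power counting of the gauge-transformed fields -/

theorem rdot_photon (V : Fin 4 → X → ℂ) (S : Finset (ι ⊕ Fin 2)) (x : X) :
    rdot V (fun μ => 𝓕.photon g μ S) x
      = cdot (fun μ => V μ x) (vec (hatPhoton g (𝓕.leg x) (𝓕.gauge g x)) S) := rdot_apply _ _ _

theorem photon_eq_source_of_eq_zero (h : ∀ x, 𝓕.gauge g x S = 0) (h2 : 2 ≤ S.card) (μ : Fin 4) :
    𝓕.photon g μ S = 𝓕.source g μ S := by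
  funext x
  rw [photon, hatPhoton_of_eq_zero (h x), treePhoton_of_two_le_card g _ _ h2]
  rfl

theorem scalar_eom (σ : Bool) (h0 : Sum.inr 0 ∉ S) :
    rdot (𝓕.mom S) (𝓕.mom S) * 𝓕.scalar g σ S = - ∑ T ∈ S.powerset,
      ((sgn σ : X → ℂ) * (fun _ => (g : ℂ)) * (2 * rdot (fun μ => 𝓕.photon g μ T) (𝓕.mom (S \ T))
          + rdot (fun μ => 𝓕.photon g μ T) (𝓕.mom T))
        + (fun _ => (g : ℂ)) ^ 2 * ∑ U ∈ T.powerset,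
          rdot (fun μ => 𝓕.photon g μ U) (fun μ => 𝓕.photon g μ (T \ U)))
        * 𝓕.scalar g σ (S \ T) := by
  funext x
  have := ksq_mul_of_covBox_eq_zero
    (covBox_hatScalar g (𝓕.nonSingular x) (gauge_empty (𝓕 := 𝓕) (g := g) (x := x)) σ h0)
  simp only [Pi.mul_apply, Pi.neg_apply, Finset.sum_apply, Pi.add_apply, Pi.pow_apply, rdot_apply,
    Pi.intCast_apply, Pi.ofNat_apply]
  exact this

/-- The Maxwell equation in terms of the gauge-transformed fields, whose current is gauge invariant.
-/
theorem source_eq (μ : Fin 4) (h : ∃ u, u * rdot (𝓕.mom S) (𝓕.mom S) = 1) :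
    rdot (𝓕.mom S) (𝓕.mom S) * 𝓕.source g μ S =
      (fun _ => (g : ℂ)) * ∑ T ∈ S.powerset, (𝓕.mom T μ - 𝓕.mom (S \ T) μ)
          * (𝓕.scalar g true T * 𝓕.scalar g false (S \ T))
        + 2 * (fun _ => (g : ℂ)) ^ 2 * ∑ T ∈ S.powerset, 𝓕.photon g μ T *
          ∑ U ∈ (S \ T).powerset, 𝓕.scalar g true U * 𝓕.scalar g false ((S \ T) \ U) := by
  obtain ⟨u, hu⟩ := h
  funext x
  have hne : (mdot (𝓕.tot x S) (𝓕.tot x S) : ℂ) ≠ 0 := by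
    intro h0
    have := congrFun hu x
    rw [Pi.mul_apply, rdot_mom_mom, h0, mul_zero] at this
    exact zero_ne_one this
  have e := photonSource_eq_current_hat g (𝓕.leg x) (gauge_empty (𝓕 := 𝓕) (g := g) (x := x)) μ S
  rw [current_apply] at e
  simp only [SetFun.mul_apply] at e
  rw [Pi.mul_apply, rdot_mom_mom, source, mul_div_cancel₀ _ hne, e]
  simp only [Pi.mul_apply, Finset.sum_apply, Pi.add_apply, Pi.sub_apply, Pi.pow_apply,
    Pi.ofNat_apply, mom, scalar, photon]
  ring

theorem rdot_mom_source (h0 : Sum.inr 0 ∉ S) :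
    rdot (𝓕.mom S) (fun μ => 𝓕.source g μ S) = 0 := by
  funext x
  have h := momentum_dot_photonSource g (𝓕.nonSingular x) h0
  have e : (fun μ => 𝓕.source g μ S x) = (-(mdot (𝓕.tot x S) (𝓕.tot x S) : ℂ)⁻¹) •
      fun μ => photonSource g (𝓕.leg x) (treeFields g (𝓕.leg x)) μ S := by
    funext μ
    simp only [source, Pi.smul_apply, smul_eq_mul]
    ring
  rw [rdot_apply, e, cdot_smul]
  exact mul_eq_zero_of_right _ h

theorem photon_b2 (x : X) (μ : Fin 4) : 𝓕.photon g μ {Sum.inr 1} x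
    = (𝓕.kin x).polIn 1 μ - 𝓕.c x 1 * ((𝓕.kin x).p 1 μ : ℂ) := by
  rw [photon, hatPhoton_apply, gauge_b2, treePhoton_singleton, totalMom_singleton]
  simp only [leg, Kinematics.legs, Pi.neg_apply, if_true]
  push_cast
  linear_combination (𝓕.c x 1 * ((𝓕.kin x).p 1 μ : ℂ)) * Complex.I_sq

theorem rdot_mom_photon_b2 :
    rdot (𝓕.mom {Sum.inr 1}) (fun μ => 𝓕.photon g μ {Sum.inr 1}) = 0 := by
  funext x
  have e : (fun μ => 𝓕.photon g μ {Sum.inr 1} x) = fun μ => (𝓕.kin x).polIn 1 μ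
      + -(𝓕.c x 1) * ((𝓕.kin x).p 1 μ : ℂ) := by
    funext μ; rw [photon_b2]; ring
  have h := cdot_toC_add_smul ((𝓕.phys x).onShellIn 1).1 ((𝓕.phys x).polarizationIn 1).1
    (-(𝓕.c x 1))
  rw [rdot_apply, e, Pi.zero_apply]
  have e' : (fun μ => 𝓕.mom {Sum.inr 1} μ x) = (-1 : ℂ) • toC ((𝓕.kin x).p 1) := by
    funext μ
    simp [mom, kvec, toC, totalMom_singleton, leg, Kinematics.legs]
  rw [e', smul_cdot, h, mul_zero]

theorem photon_insert (μ : Fin 4) {T : Finset (ι ⊕ Fin 2)} (hT : T ⊆ final) (hne : T.Nonempty) :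
    𝓕.photon g μ (insert (Sum.inr 1) T) = 𝓕.source g μ (insert (Sum.inr 1) T) := by
  have hn : Sum.inr 1 ∉ T := inr_notMem (fun i hi => mem_final.1 (hT hi)) 1
  have hc : 2 ≤ (insert (Sum.inr 1) T).card := by
    rw [Finset.card_insert_of_notMem hn]
    have := hne.card_pos
    omega
  refine photon_eq_source_of_eq_zero (fun x => gauge_of_b2_mem (Finset.mem_insert_self _ _) ?_) hc μ
  intro h
  rw [h] at hc
  simp at hc

theorem rdot_mom_photon_insert {T : Finset (ι ⊕ Fin 2)} (hT : T ⊆ final) :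
    rdot (𝓕.mom (insert (Sum.inr 1) T)) (fun μ => 𝓕.photon g μ (insert (Sum.inr 1) T)) = 0 := by
  rcases T.eq_empty_or_nonempty with rfl | hne
  · exact rdot_mom_photon_b2
  · simp only [photon_insert _ hT hne]
    refine rdot_mom_source ?_
    rw [Finset.mem_insert]
    rintro (h | h)
    · simp at h
    · exact inr_notMem (fun i hi => mem_final.1 (hT hi)) 0 h

/-- A physical polarization vector without time component is bounded. -/
theorem photon_soft_single (μ : Fin 4) {i : ι ⊕ Fin 2} (hi : legTag sec i = .soft) :
    𝓕.photon g μ {i} ∈ 𝓕.filt.F 0 := by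
  obtain ⟨j, rfl⟩ := exists_inl_of_jet_or_soft (b := true) (Or.inr hi)
  refine 𝓕.mem_zero_of_le 1 fun x => ?_
  by_cases h : sp j = .photon
  · have hr : 𝓕.gauge g x {Sum.inl j} = axialGauge (𝓕.leg x) timeDir (treePhoton g (𝓕.leg x))
        {Sum.inl j} := by
      rw [gauge_soft (by simpa using hi), if_pos (Finset.card_singleton _)]
    obtain ⟨h1, -, h3⟩ := axial_wave h hr (by
      rw [mdot_timeDir]; exact ((𝓕.phys x).onShell j).2.ne')
    rw [cdot_timeDir] at h1
    exact norm_le_one_of_time_eq_zero h1 h3 μ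
  · rw [photon, photon_single_of_scalar h]
    simp

theorem photon_jet_single_spec (b : Bool) {j : ι} (hi : legTag sec (.inl j) = .jet b)
    (h : sp j = .photon) (x : X) :
    cdot (toC ((𝓕.kin x).wilsonDir b)) (vec (hatPhoton g (𝓕.leg x) (𝓕.gauge g x)) {Sum.inl j}) = 0 ∧
    cdot (toC ((𝓕.kin x).q j)) (vec (hatPhoton g (𝓕.leg x) (𝓕.gauge g x)) {Sum.inl j}) = 0 ∧
    cdot (star (vec (hatPhoton g (𝓕.leg x) (𝓕.gauge g x)) {Sum.inl j}))
      (vec (hatPhoton g (𝓕.leg x) (𝓕.gauge g x)) {Sum.inl j}) = -1 := by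
  have hj : ∀ i ∈ ({Sum.inl j} : Finset (ι ⊕ Fin 2)), legTag sec i = .jet b ∨ legTag sec i = .soft :=
    by simp [hi]
  have hj' : ∃ i ∈ ({Sum.inl j} : Finset (ι ⊕ Fin 2)), legTag sec i = .jet b := by simp [hi]
  refine axial_wave h (gauge_jet hj hj') ?_
  have := 𝓕.wilson_mdot_ge b hj hj' x
  rw [tot, totalMom_singleton] at this
  exact (𝓕.c₀_pos.trans_le this).ne'

/-- A physical polarization vector in the axial gauge of the Wilson line is bounded, as this line is
not collinear to the jet. -/
theorem photon_jet_single (b : Bool) (μ : Fin 4) {i : ι ⊕ Fin 2} (hi : legTag sec i = .jet b) :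
    𝓕.photon g μ {i} ∈ 𝓕.filt.F 0 := by
  obtain ⟨j, rfl⟩ := exists_inl_of_jet_or_soft (Or.inl hi)
  have hc := 𝓕.c₀_pos
  refine 𝓕.mem_zero_of_le (2 * K * K / c₀ + 1) fun x => ?_
  by_cases h : sp j = .photon
  · obtain ⟨h1, h2, h3⟩ := photon_jet_single_spec (𝓕 := 𝓕) (g := g) b hi h x
    obtain ⟨ht, ht0, htK, -⟩ := Kinematics.wilsonDir_bounds (𝓕.wd x) b
    obtain ⟨hk, hk0⟩ := (𝓕.phys x).onShell j
    have hj := mem_members.2 (legTag_inl_eq_jet.1 hi)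
    have hkK := (Kinematics.energy_bounds (𝓕.phys x) (𝓕.pc x) 𝓕.one_le (𝓕.lam_pos x) (𝓕.small x)
      hj).2
    have key := mdot_mul_norm_sq_le ht ht0 hk hk0 h1 h2 h3 μ
    have hlow := (𝓕.res x).jetWilson b j hj
    set y := ‖vec (hatPhoton g (𝓕.leg x) (𝓕.gauge g x)) {Sum.inl j} μ‖
    change y ≤ _
    have h4 : c₀ * y ^ 2 ≤ 2 * K * K :=
      (mul_le_mul_of_nonneg_right hlow (sq_nonneg y)).trans (key.trans (by
        have := mul_le_mul htK hkK hk0.le (ht0.le.trans htK)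
        linarith))
    have h5 : y ^ 2 ≤ 2 * K * K / c₀ := by rw [le_div_iff₀ hc]; linarith
    nlinarith [sq_nonneg (y - 1)]
  · rw [photon, photon_single_of_scalar h]
    have := 𝓕.one_le
    rw [norm_zero]
    positivity

theorem rdot_mom_photon_jet_single (b : Bool) {i : ι ⊕ Fin 2} (hi : legTag sec i = .jet b) :
    rdot (𝓕.mom {i}) (fun μ => 𝓕.photon g μ {i}) = 0 := by
  obtain ⟨j, rfl⟩ := exists_inl_of_jet_or_soft (Or.inl hi)
  funext x
  rw [rdot_photon]
  by_cases h : sp j = .photon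
  · have := (photon_jet_single_spec (𝓕 := 𝓕) (g := g) b hi h x).2.1
    rw [show (fun μ => 𝓕.mom {Sum.inl j} μ x) = toC ((𝓕.kin x).q j) by
      funext μ; simp [mom, kvec, toC, totalMom_singleton, leg, Kinematics.legs]]
    exact this
  · simp [cdot, vec, photon_single_of_scalar h]

/-- In the axial gauge the field on a jet is the solution of the Maxwell equation with its component
along the Wilson line removed by a gauge transformation. -/
theorem photon_jet (b : Bool) (hS : ∀ i ∈ S, legTag sec i = .jet b ∨ legTag sec i = .soft)
    (hj : ∃ i ∈ S, legTag sec i = .jet b) (h2 : 2 ≤ S.card) :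
    ∃ c, c * rdot (𝓕.wil b) (𝓕.mom S) = rdot (𝓕.wil b) (fun μ => 𝓕.source g μ S) ∧
      (∀ μ, 𝓕.photon g μ S = 𝓕.source g μ S - c * 𝓕.mom S μ) ∧
      rdot (𝓕.mom S) (fun μ => 𝓕.source g μ S) = 0 := by
  have hinl := inr_notMem fun i hi => exists_inl_of_jet_or_soft (hS i hi)
  have hsrc : ∀ x μ, treePhoton g (𝓕.leg x) μ S = 𝓕.source g μ S x := fun x μ =>
    treePhoton_of_two_le_card g _ _ h2
  have ev : ∀ x, vec (treePhoton g (𝓕.leg x)) S = fun μ => 𝓕.source g μ S x := fun x =>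
    funext (hsrc x)
  refine ⟨fun x => cdot (toC ((𝓕.kin x).wilsonDir b)) (vec (treePhoton g (𝓕.leg x)) S)
    / (mdot ((𝓕.kin x).wilsonDir b) (𝓕.tot x S) : ℂ), ?_, ?_, rdot_mom_source (hinl 0)⟩
  · funext x
    have hne : (mdot ((𝓕.kin x).wilsonDir b) (𝓕.tot x S) : ℂ) ≠ 0 := by
      exact_mod_cast (𝓕.c₀_pos.trans_le (𝓕.wilson_mdot_ge b hS hj x)).ne'
    have e : rdot (𝓕.wil b) (𝓕.mom S) x = (mdot ((𝓕.kin x).wilsonDir b) (𝓕.tot x S) : ℂ) :=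
      rdot_real (fun x => (𝓕.kin x).wilsonDir b) (fun x => 𝓕.tot x S) x
    rw [Pi.mul_apply, e, div_mul_cancel₀ _ hne, rdot_apply, ev]
    rfl
  · intro μ
    funext x
    rw [photon, hatPhoton_of_axial (gauge_jet hS hj), hsrc]
    rfl

variable (𝓕 g) in
/-- The gauge-transformed fields of a family of processes. -/
def powerSystem : PowerSystem (X → ℂ) (ι ⊕ Fin 2) where
  toFiltration := 𝓕.filt
  g := fun _ => (g : ℂ)
  g_mem := 𝓕.mem_zero_of_le ‖(g : ℂ)‖ fun _ => le_rfl
  tag := legTag sec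
  q := legCharge sp
  full := final
  mem_full i := by
    rw [mem_final]
    constructor
    · rintro ⟨j, rfl⟩
      cases h : sec j <;> simp [legTag, h]
    · exact exists_inl_of_legTag
  b2 := .inr 1
  tag_b2 := by simp [legTag]
  q_b2 := rfl
  q_jet := 𝓕.charge_jet
  k := 𝓕.mom
  k_split := by
    intro S T hT
    funext μ
    rw [Pi.add_apply, mom_eq_sum, mom_eq_sum, mom_eq_sum, add_comm, Finset.sum_sdiff hT]
  n := 𝓕.dir
  n_sq := 𝓕.dir_sq
  n_mem := 𝓕.dir_mem
  t := 𝓕.wil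
  t_mem := 𝓕.wil_mem
  A := 𝓕.photon g
  ψ := 𝓕.scalar g
  Y b σ S x := 𝓕.softLine g b σ x S
  A_empty μ := by
    funext x
    rw [photon, hatPhoton_apply, treePhoton_empty, gauge_empty, mul_zero, add_zero]; rfl
  ψ_empty σ := by
    funext x
    rw [scalar, hatScalar, SetFun.mul_empty, treeScalar_empty, mul_zero]; rfl
  A_charge μ S hS := by
    funext x
    have := hatPhoton_chargeSupp g (𝓕.leg x) (r := 𝓕.gauge g x) (by
      rw [leg_charge_eq]; exact gauge_chargeSupp) μ
    rw [leg_charge_eq] at this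
    exact this.apply_eq_zero hS
  ψ_charge σ S hS := by
    funext x
    have := hatScalar_chargeSupp g (𝓕.leg x) (r := 𝓕.gauge g x) (by
      rw [leg_charge_eq]; exact gauge_chargeSupp) σ
    rw [leg_charge_eq] at this
    exact this.apply_eq_zero hS
  A_neutral μ S h2 hq := by
    funext x
    have h : ∀ μ, treePhoton g (𝓕.leg x) μ S = 0 := fun μ => by
      rw [treePhoton_of_two_le_card g _ _ h2, photonSource_eq_zero_of_neutral g (𝓕.leg x)
        (treeFields_charged g (𝓕.leg x)) μ (fun i hi => (𝓕.leg_charge x i).trans (hq i hi)),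
        neg_zero, zero_div]
    rw [photon, hatPhoton_of_eq_zero (gauge_eq_zero h _), h μ]
    · rfl
    · rintro rfl
      simp at h2
  eom σ S hS := scalar_eom σ fun h0 => hS _ h0 (by simp [legTag])
  Y_empty b σ := by
    funext x
    exact SetFun.exp_empty _
  Y_mul b S hS := by
    funext x
    have h : 𝓕.softLine g b true x * 𝓕.softLine g b false x = 1 := by
      have e : (Complex.I * (sgn false : ℂ) * g) • 𝓕.softRay g b x
          = -((Complex.I * (sgn true : ℂ) * g) • 𝓕.softRay g b x) := by
        rw [← neg_smul]; congr 1; simp [sgn]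
      rw [softLine, softLine, e]
      exact SetFun.exp_mul_exp_neg (smul_empty (softRay_empty b) _)
    have := congrArg (fun F : SetFun (ι ⊕ Fin 2) => F S) h
    simp only [SetFun.mul_apply, SetFun.one_apply, if_neg hS.ne_empty] at this
    simpa only [Finset.sum_apply, Pi.mul_apply, Pi.zero_apply] using this
  Y_eq b σ S hS := by
    funext x
    have := softLine_eq (𝓕 := 𝓕) (g := g) (x := x) b σ hS
    rw [Pi.mul_apply, show rdot (𝓕.dir b) (𝓕.mom S) x
      = (mdot ((𝓕.kin x).jetDir sec b) (𝓕.tot x S) : ℂ) from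
      rdot_real (fun x => (𝓕.kin x).jetDir sec b) (fun x => 𝓕.tot x S) x, this]
    simp only [Pi.mul_apply, Pi.neg_apply, Finset.sum_apply, Pi.intCast_apply, rdot_photon]
    rfl
  k_mem := 𝓕.mom_mem
  k_soft _ μ h := 𝓕.mom_soft μ h
  k_jet _ _ μ h := 𝓕.mom_jet μ h
  nk_jet _ _ h := 𝓕.dir_mom h
  ψ_single σ i := by
    refine 𝓕.mem_zero_of_le 1 fun x => ?_
    rw [scalar, hatScalar_singleton, treeScalar_singleton]
    split_ifs <;> simp
  A_soft_single μ _ h := photon_soft_single μ h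
  A_jet_single b μ _ h := photon_jet_single b μ h
  kA_jet_single b _ h := rdot_mom_photon_jet_single b h
  A_b2 μ := by
    refine 𝓕.mem_zero_of_le (2 * K ^ 3 + 1) fun x => ?_
    rw [photon_b2]
    exact 𝓕.beam x 1 μ
  a := 𝓕.source g
  a_eq μ _ h := source_eq μ h
  A_soft μ S hS h2 := photon_eq_source_of_eq_zero (fun x => by
    rw [gauge_soft hS, if_neg (by omega)]) h2 μ
  A_jet b _ hS hj h2 := photon_jet b hS hj h2
  A_both μ S hS hj := by
    refine photon_eq_source_of_eq_zero (fun x => gauge_both hS hj) ?_ μ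
    obtain ⟨i, hi, h⟩ := hj true
    obtain ⟨j, hj, h'⟩ := hj false
    refine Finset.one_lt_card.2 ⟨i, hi, j, hj, ?_⟩
    rintro rfl
    rw [h] at h'
    simp at h'
  A_with_b2 μ _ hT hne := photon_insert μ hT hne
  kA_with_b2 _ hT := rdot_mom_photon_insert hT
  inv_soft _ h h2 hq := 𝓕.inv_soft h h2 hq
  inv_nk b _ h hne := 𝓕.inv_nk b h hne
  inv_jet b _ h hj h2 := 𝓕.inv_jet b h hj h2
  inv_energy b _ h hj := 𝓕.inv_energy b h hj
  inv_tk b _ h hj := 𝓕.inv_tk b h hj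
  inv_both _ hS hj := 𝓕.inv_both (fun i hi => mem_final.1 (hS hi)) hj
  inv_b2_soft _ h hq := 𝓕.inv_b2_soft h hq
  inv_b2_hard _ hT h1 h2 := 𝓕.inv_b2_hard hT h1 h2
  inv_b2_full _ hT h1 h2 := 𝓕.inv_b2_full hT h1 h2

/-! ### Collinear and soft matrix elements -/

theorem state_jet_spec (b : Bool) {T : Finset (ι ⊕ Fin 2)}
    (hT : T ⊆ Kinematics.state sec (jetSector b)) (hne : T.Nonempty) :
    (∀ i ∈ T, legTag sec i = .jet b ∨ legTag sec i = .soft) ∧ ∃ i ∈ T, legTag sec i = .jet b := by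
  rw [← filter_jet] at hT
  have h : ∀ i ∈ T, legTag sec i = .jet b := fun i hi => (Finset.mem_filter.1 (hT hi)).2
  obtain ⟨i, hi⟩ := hne
  exact ⟨fun i hi => Or.inl (h i hi), i, hi, h i hi⟩

/-- On the legs of a jet, the exponent of the collinear Wilson line is the gauge parameter. -/
theorem outgoingRay_wilson (x : X) (b : Bool) {T : Finset (ι ⊕ Fin 2)}
    (hT : T ⊆ Kinematics.state sec (jetSector b)) :
    outgoingRay (𝓕.leg x) (treeFields g (𝓕.leg x)).A ((𝓕.kin x).wilsonDir b) T
      = 𝓕.gauge g x T := by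
  rcases T.eq_empty_or_nonempty with rfl | hne
  · rw [gauge_empty]
    exact outgoingRay_of_eq_zero fun μ => treePhoton_empty g _ μ
  · obtain ⟨h, hj⟩ := state_jet_spec b hT hne
    rw [gauge_jet h hj, outgoingRay_of_ne (𝓕.c₀_pos.trans_le (𝓕.wilson_mdot_ge b h hj x)).ne']
    rfl

/-- Dressing the charged field with the Wilson line of its jet is the gauge transformation to the
axial gauge. -/
theorem scalar_jet3 (x : X) : 𝓕.scalar g true (Kinematics.state sec .jet3) x
    = (𝓕.kin x).collinear3 g sp sec := by
  rw [Kinematics.collinear3, SetFun.conv_apply, mul_comm, scalar, hatScalar]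
  refine SetFun.mul_congr (fun T hT => SetFun.exp_congr fun U hU => ?_) fun T hT => rfl
  rw [SetFun.smul_apply, ← outgoingRay_wilson x true (hU.trans hT)]
  simp only [sgn, Int.cast_one, mul_one]
  rw [← neg_mul]
  rfl

theorem scalar_jet4 (x : X) : 𝓕.scalar g false (Kinematics.state sec .jet4) x
    = (𝓕.kin x).collinear4 g sp sec := by
  rw [Kinematics.collinear4, SetFun.conv_apply, scalar, hatScalar]
  refine SetFun.mul_congr (fun T hT => SetFun.exp_congr fun U hU => ?_) fun T hT => rfl
  rw [SetFun.smul_apply, ← outgoingRay_wilson x false (hU.trans hT)]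
  simp only [sgn, Int.cast_neg, Int.cast_one, mul_neg, mul_one, neg_mul, neg_neg]
  rfl

/-- The exponent of a soft Wilson line changes under a gauge transformation by the gauge parameter.
-/
theorem softRay_eq (x : X) (b : Bool) {T : Finset (ι ⊕ Fin 2)}
    (hT : T ⊆ Kinematics.state sec .soft) : 𝓕.softRay g b x T
      = outgoingRay (𝓕.leg x) (treeFields g (𝓕.leg x)).A ((𝓕.kin x).jetDir sec b) T
        - 𝓕.gauge g x T := by
  rcases T.eq_empty_or_nonempty with rfl | hne
  · have h0 : ∀ μ, (treeFields g (𝓕.leg x)).A μ ∅ = 0 := fun μ => treePhoton_empty g _ μ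
    rw [gauge_empty, softRay_empty, outgoingRay_of_eq_zero h0, sub_zero]
  · have h : ∀ i ∈ T, legTag sec i = .soft := fun i hi => by
      have := hT hi
      rw [← filter_soft] at this
      exact (Finset.mem_filter.1 this).2
    have hn := 𝓕.jetDir_mdot_ne_zero b h hne x
    rw [softRay, SetFun.of_apply, if_pos ⟨h, hne⟩, outgoingRay_of_ne (by exact_mod_cast hn),
      cdot_hatPhoton, mul_add, add_div]
    change _ + _ = _ / _ - _
    rw [sub_eq_add_neg]
    refine congrArg₂ (· + ·) rfl ?_
    rw [div_eq_iff hn]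
    linear_combination 𝓕.gauge g x T * (mdot ((𝓕.kin x).jetDir sec b) (𝓕.tot x T) : ℂ)
      * Complex.I_sq

/-- The product of the two soft Wilson lines is gauge invariant: the gauge parameters cancel between
the two exponents. -/
theorem softFactor_eq (x : X) : (𝓕.powerSystem g).softFactor x = (𝓕.kin x).softME g sp sec := by
  have e : (𝓕.powerSystem g).part .soft (𝓕.powerSystem g).full = Kinematics.state sec .soft :=
    filter_soft
  have e1 : (𝓕.powerSystem g).softFactor x
      = (𝓕.softLine g true true x * 𝓕.softLine g false false x)
        (Kinematics.state sec .soft) := by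
    rw [PowerSystem.softFactor, e, SetFun.mul_apply, Finset.sum_apply]
    rfl
  set n := fun b => (𝓕.kin x).jetDir sec b
  set ray : Bool → SetFun (ι ⊕ Fin 2) := fun b =>
    .of (outgoingRay (𝓕.leg x) (treeFields g (𝓕.leg x)).A (n b))
  have hray : ∀ b, ray b ∅ = 0 := fun b =>
    outgoingRay_of_eq_zero fun μ => treePhoton_empty g _ μ
  have e2 : (𝓕.kin x).softME g sp sec = (SetFun.exp ((Complex.I * g) • ray true)
      * SetFun.exp ((-Complex.I * g) • ray false)) (Kinematics.state sec .soft) := by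
    rw [Kinematics.softME, SetFun.conv_apply]; rfl
  rw [e1, e2, softLine, softLine, ← SetFun.exp_add (smul_empty (softRay_empty _) _)
    (smul_empty (softRay_empty _) _), ← SetFun.exp_add (smul_empty (hray _) _)
    (smul_empty (hray _) _)]
  refine SetFun.exp_congr fun T hT => ?_
  simp only [SetFun.add_apply, SetFun.smul_apply, softRay_eq x _ hT, sgn, ray, SetFun.of_apply, n]
  push_cast
  ring

end Family
end ScalarQED
end

noncomputable section
namespace ScalarQED
open scoped Topology
set_option linter.unusedSectionVars false

/-! ### The channels of the hard process -/

section Channels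

variable {α : Type*} [DecidableEq α] [Fintype α]

theorem sum_cdot_mul {β : Type*} (s : Finset β) (e : CVec) (v : β → CVec) (y : β → ℂ) :
    cdot e (fun ν => ∑ V ∈ s, v V ν * y V) = ∑ V ∈ s, cdot e (v V) * y V := by
  simp only [cdot, Finset.mul_sum, Finset.sum_mul]
  rw [Finset.sum_comm]
  exact Finset.sum_congr rfl fun V _ => Finset.sum_congr rfl fun μ _ => by ring

theorem cdot_mul_sub_mul (e v w : CVec) (y z : ℂ) :
    cdot e (fun ν => y * v ν - z * w ν) = y * cdot e v - z * cdot e w := by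
  simp only [cdot, Finset.mul_sum, ← Finset.sum_sub_distrib]
  exact Finset.sum_congr rfl fun μ _ => by ring

theorem attach_mul_apply {a : α} {S : Finset α} (ha : a ∉ S) (A B : SetFun α) :
    (attach a A * B) (insert a S) = ∑ V ∈ S.powerset, A (insert a V) * B (S \ V) := by
  rw [SetFun.mul_apply, Finset.sum_powerset_insert ha]
  have h1 : ∑ V ∈ S.powerset, attach a A V * B (insert a S \ V) = 0 :=
    Finset.sum_eq_zero fun V hV => by
      rw [attach_apply, if_neg fun h => ha (Finset.mem_powerset.1 hV h), zero_mul]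
  rw [h1, zero_add]
  refine Finset.sum_congr rfl fun V _ => ?_
  rw [attach_apply, if_pos (Finset.mem_insert_self _ _), Finset.insert_sdiff_insert,
    Finset.sdiff_insert, Finset.erase_eq_of_notMem fun h => ha (Finset.sdiff_subset h)]

theorem attach_mul_apply_of_notMem {a : α} {S : Finset α} (ha : a ∉ S) (A B : SetFun α) :
    (attach a A * B) S = 0 := by
  rw [SetFun.mul_apply]
  refine Finset.sum_eq_zero fun V hV => ?_
  rw [attach_apply, if_neg fun h => ha (Finset.mem_powerset.1 hV h), zero_mul]

theorem mul_attach_mul_apply {a : α} {S : Finset α} (ha : a ∉ S) (A B C : SetFun α) :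
    ∑ U ∈ (insert a S).powerset, A U * (attach a B * C) (insert a S \ U)
      = ∑ U ∈ S.powerset, A U * ∑ V ∈ (S \ U).powerset, B (insert a V) * C ((S \ U) \ V) := by
  rw [Finset.sum_powerset_insert ha]
  have h1 : ∑ U ∈ S.powerset, A (insert a U) * (attach a B * C) (insert a S \ insert a U) = 0 :=
    Finset.sum_eq_zero fun U _ => by
      rw [attach_mul_apply_of_notMem (by simp), mul_zero]
  rw [h1, add_zero]
  refine Finset.sum_congr rfl fun U hU => ?_
  rw [Finset.insert_sdiff_of_notMem _ fun h => ha (Finset.mem_powerset.1 hU h),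
    attach_mul_apply fun h => ha (Finset.sdiff_subset h)]

theorem current_swap (g : ℝ) (leg : α → Leg) (A : Fin 4 → SetFun α) (F G : SetFun α) (ν : Fin 4) :
    current g leg A F G ν = current (-g) leg A G F ν := by
  rw [current, current, mul_comm F G, Complex.ofReal_neg, neg_sq, mul_neg, neg_smul, ← smul_neg,
    neg_sub]

/-- The current in which the leg `a` is attached to the first of the two charged fields, contracted
with a vector that is orthogonal to the total momentum. -/
theorem cdot_current_attach (g : ℝ) (leg : α → Leg) {a : α} {S : Finset α} (ha : a ∉ S) (e : CVec)
    (he : cdot e (kvec leg (insert a S)) = 0) (A : Fin 4 → SetFun α) (F G : SetFun α) :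
    cdot e (fun ν => current g leg A (attach a F) G ν (insert a S)) =
      2 * g * ∑ V ∈ S.powerset, cdot e (kvec leg (S \ V)) * (F (insert a V) * G (S \ V))
        - 2 * (g : ℂ) ^ 2 * ∑ U ∈ S.powerset, cdot e (vec A U) *
          ∑ V ∈ (S \ U).powerset, F (insert a V) * G ((S \ U) \ V) := by
  have h1 : ∀ ν, ∑ T ∈ (insert a S).powerset, (kvec leg T ν - kvec leg (insert a S \ T) ν)
        * (attach a F T * G (insert a S \ T))
      = ∑ V ∈ S.powerset, (kvec leg (insert a V) - kvec leg (S \ V)) ν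
        * (F (insert a V) * G (S \ V)) := by
    intro ν
    rw [Finset.sum_powerset_insert ha]
    have h1 : ∑ V ∈ S.powerset, (kvec leg V ν - kvec leg (insert a S \ V) ν)
        * (attach a F V * G (insert a S \ V)) = 0 :=
      Finset.sum_eq_zero fun V hV => by
        rw [attach_apply, if_neg fun h => ha (Finset.mem_powerset.1 hV h), zero_mul, mul_zero]
    rw [h1, zero_add]
    refine Finset.sum_congr rfl fun V _ => ?_
    rw [attach_apply, if_pos (Finset.mem_insert_self _ _), Finset.insert_sdiff_insert,
      Finset.sdiff_insert, Finset.erase_eq_of_notMem fun h => ha (Finset.sdiff_subset h)]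
    rfl
  have h2 : ∀ V ∈ S.powerset, cdot e (kvec leg (insert a V) - kvec leg (S \ V))
      = -2 * cdot e (kvec leg (S \ V)) := by
    intro V hV
    have hsum : kvec leg (insert a S) = kvec leg (insert a V) + kvec leg (S \ V) := by
      funext μ
      have hV' := Finset.mem_powerset.1 hV
      simp only [kvec, toC, Pi.add_apply, totalMom_apply]
      rw [Finset.sum_insert ha, Finset.sum_insert fun h => ha (hV' h), ← Finset.sum_sdiff hV']
      push_cast
      ring
    rw [hsum, cdot_add] at he
    rw [sub_eq_add_neg, ← neg_one_smul ℂ, cdot_add, cdot_smul]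
    linear_combination he
  have h3 := sum_cdot_mul S.powerset e (fun U => vec A U)
    fun U => ∑ V ∈ (S \ U).powerset, F (insert a V) * G ((S \ U) \ V)
  simp only [current_apply, h1, mul_attach_mul_apply ha]
  rw [cdot_mul_sub_mul, sum_cdot_mul]
  refine Eq.trans (congrArg (fun y => _ - 2 * (g : ℂ) ^ 2 * y) h3) ?_
  rw [Finset.sum_congr rfl fun V hV => by rw [h2 V hV]]
  simp only [mul_assoc, ← Finset.mul_sum]
  ring

/-- The channel in which photon `2` is attached to the field `φ^*` (for `true`) or `φ`. -/
def scalarChannel : Bool → Kinematics.Channel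
  | true => .tChannel
  | false => .uChannel

theorem channelCurrent_scalarChannel (g : ℝ) (leg : α → Leg) (a : α) (A : Fin 4 → SetFun α)
    (F : Bool → SetFun α) (ν : Fin 4) (σ : Bool) :
    channelCurrent g leg a A (F true) (F false) ν (scalarChannel σ)
      = current (sgn σ * g) leg A (attach a (F σ)) (F !σ) ν := by
  cases σ
  · simp only [scalarChannel, channelCurrent, sgn, Bool.not_false]
    rw [current_swap]
    congr 1
    push_cast; ring
  · simp [scalarChannel, channelCurrent, sgn]

end Channels

variable {ι : Type*} [Fintype ι] [DecidableEq ι]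

theorem allButFirst_eq : (Kinematics.allButFirst : Finset (ι ⊕ Fin 2))
    = insert (Sum.inr 1) Family.final := by
  ext i
  rw [Kinematics.allButFirst, Finset.mem_erase, Finset.mem_insert, Family.mem_final]
  rcases i with j | a
  · simp
  · fin_cases a <;> simp

namespace Family

variable {sp : ι → Species} {sec : ι → Sector} {K c₀ : ℝ} {X : Type*}
  {𝓕 : Family sp sec K c₀ X} {g : ℝ}

variable (𝓕) in
/-- The bounded polarization vectors of the incoming photons. -/
def incoming (a : Fin 2) (μ : Fin 4) : X → ℂ := fun x =>
  (𝓕.kin x).polIn a μ - 𝓕.c x a * ((𝓕.kin x).p a μ : ℂ)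

variable (𝓕 g) in
/-- The part of the amplitude that belongs to a channel, in terms of the gauge-transformed
fields. -/
def channelAmp (ch : Kinematics.Channel) : X → ℂ := fun x =>
  - Complex.I * cdot (fun μ => 𝓕.incoming 0 μ x) fun ν =>
    channelCurrent g (𝓕.leg x) (Sum.inr 1) (hatPhoton g (𝓕.leg x) (𝓕.gauge g x))
      (hatScalar g (𝓕.leg x) (𝓕.gauge g x) true) (hatScalar g (𝓕.leg x) (𝓕.gauge g x) false) ν ch
      Kinematics.allButFirst

variable (𝓕 g) in
/-- The factorized form of a channel, with bounded polarization vectors. -/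
def channelLeading (ch : Kinematics.Channel) : X → ℂ := fun x =>
  - 2 * Complex.I * (∑ μ, ∑ ν, ((𝓕.kin x).hardTensor sec μ ν ch : ℂ)
      * (- Complex.I * g * ((metric μ : ℂ) * 𝓕.incoming 0 μ x))
      * (- Complex.I * g * ((metric ν : ℂ) * 𝓕.incoming 1 ν x)))
    * (𝓕.kin x).collinear3 g sp sec * (𝓕.kin x).collinear4 g sp sec * (𝓕.kin x).softME g sp sec

theorem incoming_mem (a : Fin 2) (μ : Fin 4) : 𝓕.incoming a μ ∈ 𝓕.filt.F 0 :=
  𝓕.mem_zero_of_le _ fun x => 𝓕.beam x a μ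

theorem photon_b2_eq : (fun μ => 𝓕.photon g μ {Sum.inr 1}) = 𝓕.incoming 1 :=
  funext fun μ => funext fun x => photon_b2 x μ

theorem tot_full (x : X) : 𝓕.tot x (insert (Sum.inr 1) final) = (𝓕.kin x).p 0 := by
  rw [final, tot_insert, (𝓕.phys x).conservation, add_sub_cancel_right]

theorem mom_full : 𝓕.mom (insert (Sum.inr 1) final) = fun μ x => ((𝓕.kin x).p 0 μ : ℂ) := by
  funext μ x
  rw [← tot_full]; rfl

theorem tot_jet (x : X) (b : Bool) : 𝓕.tot x (Kinematics.state sec (jetSector b))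
    = (𝓕.kin x).sectorMom sec (jetSector b) := 𝓕.tot_map x _

theorem mom_jetLegs (b : Bool) : 𝓕.mom (Kinematics.state sec (jetSector b))
    = fun μ x => ((𝓕.kin x).sectorMom sec (jetSector b) μ : ℂ) := by
  funext μ x
  rw [← tot_jet]; rfl

theorem cdot_incoming_zero (x : X) :
    cdot (toC ((𝓕.kin x).p 0)) (fun μ => 𝓕.incoming 0 μ x) = 0 := by
  have h := cdot_toC_add_smul ((𝓕.phys x).onShellIn 0).1 ((𝓕.phys x).polarizationIn 0).1
    (-(𝓕.c x 0))
  rw [← h]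
  congr 1
  funext μ
  rw [incoming]; ring

variable (𝓕) in
/-- The momentum of photon `1` has a large invariant with each jet. -/
theorem beam_jet_lower (b : Bool) (x : X) :
    c₀ ≤ 2 * mdot ((𝓕.kin x).p 0) ((𝓕.kin x).sectorMom sec (jetSector b)) := by
  obtain ⟨i, hi⟩ := 𝓕.exists_jet b
  obtain ⟨j, hj⟩ := 𝓕.exists_jet !b
  have hji : sec j ≠ jetSector b := by rw [hj]; cases b <;> decide
  have key := (𝓕.res x).beamHard (members sec (jetSector b))ᶜ
    ⟨j, by simpa [mem_members] using hji, by rw [hj]; exact jetSector_ne_soft _⟩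
    ⟨i, by simpa [mem_members] using hi, by rw [hi]; exact jetSector_ne_soft _⟩
  set P := (𝓕.kin x).sectorMom sec (jetSector b)
  have e := (𝓕.phys x).conservation
  rw [← Finset.sum_add_sum_compl (members sec (jetSector b))] at e
  change P + _ = _ at e
  have h0 := mdot_sub_self (k := P) ((𝓕.phys x).onShellIn 0).1
  have h1 := mdot_sub_self (k := ∑ i ∈ (members sec (jetSector b))ᶜ, (𝓕.kin x).q i)
    ((𝓕.phys x).onShellIn 1).1
  have h2 : ∑ i ∈ (members sec (jetSector b))ᶜ, (𝓕.kin x).q i - (𝓕.kin x).p 1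
      = -(P - (𝓕.kin x).p 0) := by
    rw [eq_sub_of_add_eq' e]; abel
  have h3 : mdot (-(P - (𝓕.kin x).p 0)) (-(P - (𝓕.kin x).p 0))
      = mdot (P - (𝓕.kin x).p 0) (P - (𝓕.kin x).p 0) := by
    simp only [mdot_eq, Pi.neg_apply]; ring
  have h4 : 0 ≤ mdot P P := by
    rw [show P = ∑ i ∈ members sec (jetSector b), (𝓕.kin x).q i from rfl, mdot_sum_left]
    refine Finset.sum_nonneg fun i _ => ?_
    rw [mdot_sum_right]
    exact Finset.sum_nonneg fun j _ => Kinematics.q_mdot_nonneg (𝓕.phys x) i j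
  rw [h2, h3] at h1
  linarith

theorem sum_metric_mul (a b : ℂ) (e f : CVec) (P Q : Vec) :
    ∑ μ, ∑ ν, ((P μ : ℂ) * Q ν) * (a * ((metric μ : ℂ) * e μ)) * (b * ((metric ν : ℂ) * f ν))
      = a * b * cdot e (toC P) * cdot f (toC Q) := by
  simp only [cdot, toC, Fin.sum_univ_four]
  ring

theorem hardTensor_contact_sum (kin : Kinematics ι) (a b : ℂ) (e f : CVec) :
    ∑ μ, ∑ ν, (kin.hardTensor sec μ ν .contact : ℂ) * (a * ((metric μ : ℂ) * e μ))
      * (b * ((metric ν : ℂ) * f ν)) = a * b * cdot e f := by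
  simp [Kinematics.hardTensor, cdot, Fin.sum_univ_four, metric]
  ring

theorem hardTensor_scalarChannel_sum (kin : Kinematics ι) (σ : Bool) (a b : ℂ) (e f : CVec) :
    ∑ μ, ∑ ν, (kin.hardTensor sec μ ν (scalarChannel σ) : ℂ) * (a * ((metric μ : ℂ) * e μ))
      * (b * ((metric ν : ℂ) * f ν)) = - (a * b * cdot e (toC (kin.sectorMom sec (jetSector (!σ))))
        * cdot f (toC (kin.sectorMom sec (jetSector σ))))
        / (mdot (kin.p 0) (kin.sectorMom sec (jetSector (!σ))) : ℂ) := by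
  rw [← sum_metric_mul, neg_div, Finset.sum_div, ← Finset.sum_neg_distrib]
  refine Finset.sum_congr rfl fun μ _ => ?_
  rw [Finset.sum_div, ← Finset.sum_neg_distrib]
  refine Finset.sum_congr rfl fun ν _ => ?_
  cases σ <;>
    simp only [scalarChannel, Kinematics.hardTensor, jetSector, Bool.not_true, Bool.not_false,
      mdot_comm (kin.p 0)] <;>
    push_cast <;> ring

/-- The factorized product of the collinear and soft matrix elements. -/
theorem product_eq (x : X) : (𝓕.kin x).collinear3 g sp sec * (𝓕.kin x).collinear4 g sp sec
    * (𝓕.kin x).softME g sp sec = ((𝓕.powerSystem g).ψ true ((𝓕.powerSystem g).jetLegs true)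
      * (𝓕.powerSystem g).ψ false ((𝓕.powerSystem g).jetLegs false)
      * (𝓕.powerSystem g).softFactor) x := by
  have e : ∀ b, (𝓕.powerSystem g).jetLegs b = Kinematics.state sec (jetSector b) := filter_jet
  rw [e, e, Pi.mul_apply, Pi.mul_apply, softFactor_eq, ← scalar_jet3 x, ← scalar_jet4 x]
  rfl

theorem const_mem (z : ℂ) : (fun _ : X => z) ∈ 𝓕.filt.F 0 := 𝓕.mem_zero_of_le ‖z‖ fun _ => le_rfl

/-- Replacing the product of the charged fields by its factorized form. -/
theorem leading_mem {f T : X → ℂ} (z : ℂ) (hT : T ∈ 𝓕.filt.F 0)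
    (hf : f - T * (𝓕.powerSystem g).pp final ∈ (𝓕.powerSystem g).At 3 final) :
    (fun _ => z) * f - (fun x => z * T x * ((𝓕.kin x).collinear3 g sp sec
      * (𝓕.kin x).collinear4 g sp sec * (𝓕.kin x).softME g sp sec))
      ∈ (𝓕.powerSystem g).At 3 final := by
  have h1 := PowerSystem.at_smul (P := 𝓕.powerSystem g) (p := 3) (const_mem z) hf (by omega)
  have h2 := PowerSystem.at_smul (P := 𝓕.powerSystem g) (p := 3)
    (𝓕.filt.mul (const_mem z) hT (le_refl _)) (PowerSystem.pp_full_mem (P := 𝓕.powerSystem g))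
    (by omega)
  have := add_mem h1 h2
  convert this using 1
  funext x
  simp only [Pi.add_apply, Pi.sub_apply, Pi.mul_apply, product_eq]
  change _ = z * (f x - T x * (𝓕.powerSystem g).pp final x) + z * T x
    * ((𝓕.powerSystem g).pp final x - _)
  ring

theorem b2_notMem_final : (Sum.inr 1 : ι ⊕ Fin 2) ∉ (final : Finset (ι ⊕ Fin 2)) := by
  simp [mem_final]

theorem contact_channel_mem :
    𝓕.channelAmp g .contact - 𝓕.channelLeading g .contact ∈ (𝓕.powerSystem g).At 3 final := by
  have h := leading_mem (𝓕 := 𝓕) (g := g) (2 * Complex.I * g ^ 2)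
    (T := rdot (𝓕.incoming 0) (𝓕.incoming 1))
    (𝓕.filt.rdot_mem (incoming_mem 0) (incoming_mem 1) (le_refl 0)) (by
      have := PowerSystem.contact_mem (P := 𝓕.powerSystem g) (e := 𝓕.incoming 0) (incoming_mem 0)
      rwa [show (𝓕.powerSystem g).av {(𝓕.powerSystem g).b2} = 𝓕.incoming 1 from photon_b2_eq]
        at this)
  convert h using 1
  congr 1
  · funext x
    have e : ∀ ν, channelCurrent g (𝓕.leg x) (Sum.inr 1) (hatPhoton g (𝓕.leg x) (𝓕.gauge g x))
        (hatScalar g (𝓕.leg x) (𝓕.gauge g x) true) (hatScalar g (𝓕.leg x) (𝓕.gauge g x) false) ν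
        .contact Kinematics.allButFirst = (-(2 * (g : ℂ) ^ 2)) * (∑ V ∈ final.powerset,
          vec (hatPhoton g (𝓕.leg x) (𝓕.gauge g x)) (insert (Sum.inr 1) V) ν
          * (hatScalar g (𝓕.leg x) (𝓕.gauge g x) true * hatScalar g (𝓕.leg x) (𝓕.gauge g x) false)
            (final \ V)) - 0 * 0 := by
      intro ν
      rw [channelCurrent, SetFun.neg_apply, SetFun.smul_apply, allButFirst_eq,
        attach_mul_apply b2_notMem_final]
      simp only [vec]
      ring
    rw [channelAmp]
    simp only [e]
    rw [cdot_mul_sub_mul _ _ (fun _ => 0), sum_cdot_mul]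
    simp only [zero_mul, sub_zero, Pi.mul_apply]
    rw [Finset.sum_apply]
    have e' : ∀ V, ((rdot (𝓕.incoming 0) ((𝓕.powerSystem g).av (insert (Sum.inr 1) V))
        * (𝓕.powerSystem g).pp (final \ V)) x) = cdot (fun μ => 𝓕.incoming 0 μ x)
        (vec (hatPhoton g (𝓕.leg x) (𝓕.gauge g x)) (insert (Sum.inr 1) V))
        * (hatScalar g (𝓕.leg x) (𝓕.gauge g x) true * hatScalar g (𝓕.leg x) (𝓕.gauge g x) false)
            (final \ V) := by
      intro V
      rw [Pi.mul_apply, rdot_apply, PowerSystem.pp, Finset.sum_apply, SetFun.mul_apply]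
      rfl
    change _ = _ * ∑ V ∈ final.powerset, (rdot (𝓕.incoming 0)
      ((𝓕.powerSystem g).av (insert (Sum.inr 1) V)) * (𝓕.powerSystem g).pp (final \ V)) x
    simp only [e']
    ring
  · funext x
    rw [channelLeading, hardTensor_contact_sum, rdot_apply]
    linear_combination (-2 * Complex.I * g ^ 2 * cdot (fun μ => 𝓕.incoming 0 μ x)
      (fun μ => 𝓕.incoming 1 μ x) * (𝓕.kin x).collinear3 g sp sec * (𝓕.kin x).collinear4 g sp sec
      * (𝓕.kin x).softME g sp sec) * Complex.I_sq

theorem scalar_channel_mem (σ : Bool) : 𝓕.channelAmp g (scalarChannel σ)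
    - 𝓕.channelLeading g (scalarChannel σ) ∈ (𝓕.powerSystem g).At 3 final := by
  set P := 𝓕.powerSystem g
  set e := 𝓕.incoming 0
  have eL : ∀ b, P.jetLegs b = Kinematics.state sec (jetSector b) := filter_jet
  have ec : ∀ x, cdot (fun μ => e μ x) (kvec (𝓕.leg x) (insert (Sum.inr 1) final)) = 0 := fun x => by
    rw [cdot_comm, kvec, show totalMom (𝓕.leg x) (insert (Sum.inr 1) final) = (𝓕.kin x).p 0 from
      tot_full x]
    exact cdot_incoming_zero x
  have hpos : ∀ x, (2 * mdot ((𝓕.kin x).p 0) ((𝓕.kin x).sectorMom sec (jetSector (!σ))) : ℂ) ≠ 0 := by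
    intro x
    exact_mod_cast (𝓕.c₀_pos.trans_le (𝓕.beam_jet_lower (!σ) x)).ne'
  have hpk : ∀ x, rdot (P.k (insert P.b2 P.full)) (P.k (P.jetLegs (!σ))) x
      = (mdot ((𝓕.kin x).p 0) ((𝓕.kin x).sectorMom sec (jetSector (!σ))) : ℂ) := by
    intro x
    rw [eL, show P.k (Kinematics.state sec (jetSector (!σ))) = _ from mom_jetLegs (!σ),
      show P.k (insert P.b2 P.full) = _ from mom_full]
    exact rdot_real _ _ x
  obtain ⟨u, hu, hu1⟩ : 𝓕.filt.InvMem 0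
      (2 * rdot (P.k (insert P.b2 P.full)) (P.k (P.jetLegs (!σ)))) := by
    refine 𝓕.invMem_of_real (p := 0) (f' := fun x =>
      2 * mdot ((𝓕.kin x).p 0) ((𝓕.kin x).sectorMom sec (jetSector (!σ)))) (fun x => ?_) 𝓕.c₀_pos
      fun x => ?_
    · rw [Pi.mul_apply, hpk]
      push_cast
      rfl
    · rw [zpow_zero, mul_one]
      exact (𝓕.beam_jet_lower (!σ) x).trans (le_abs_self _)
  have hu2 : ∀ x, 2 * u x = 1 / (mdot ((𝓕.kin x).p 0)
      ((𝓕.kin x).sectorMom sec (jetSector (!σ))) : ℂ) := by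
    intro x
    have h := congrFun hu1 x
    rw [Pi.mul_apply, Pi.mul_apply, hpk, Pi.ofNat_apply, Pi.one_apply] at h
    have h' := hpos x
    rw [eq_div_iff (right_ne_zero_of_mul h')]
    linear_combination h
  have hp : rdot (P.k (insert P.b2 P.full)) (P.k (insert P.b2 P.full)) = 0 := by
    funext x
    rw [show P.k (insert P.b2 P.full) = _ from mom_full]
    refine (rdot_real _ _ x).trans ?_
    rw [((𝓕.phys x).onShellIn 0).1]
    simp
  have hek : ∀ S, rdot e (P.k S) ∈ P.F 0 := fun S =>
    P.rdot_mem (incoming_mem 0) (P.k_mem S) (le_refl 0)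
  have hak : ∀ S, rdot (P.av {P.b2}) (P.k S) ∈ P.F 0 := fun S =>
    P.rdot_mem P.A_b2 (P.k_mem S) (le_refl 0)
  have hq := PowerSystem.beam_quartic_mem (P := P) (e := e) (incoming_mem 0) σ
  have hc := PowerSystem.beam_cubic_mem (P := P) σ (e := e) (incoming_mem 0) hp hu hu1
  set cub := ∑ V ∈ P.full.powerset, rdot e (P.k (P.full \ V)) *
        (P.ψ σ (insert P.b2 V) * P.ψ (!σ) (P.full \ V)) with hcub
  set qua := ∑ U ∈ P.full.powerset, rdot e (P.av U) * ∑ V ∈ (P.full \ U).powerset,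
      P.ψ σ (insert P.b2 V) * P.ψ (!σ) ((P.full \ U) \ V) with hqua
  have hpp : ∑ V ∈ P.full.powerset, P.ψ σ V * P.ψ (!σ) (P.full \ V) = P.pp P.full := by
    cases σ
    · funext x
      rw [PowerSystem.pp, Finset.sum_apply, Finset.sum_apply]
      have := congrArg (fun F : SetFun (ι ⊕ Fin 2) => F final) (mul_comm
        (hatScalar g (𝓕.leg x) (𝓕.gauge g x) false) (hatScalar g (𝓕.leg x) (𝓕.gauge g x) true))
      simp only [SetFun.mul_apply] at this
      exact this
    · rfl
  rw [hpp] at hc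
  -- the current contracted with the polarization vector of photon `1`
  have hf : ((sgn σ : X → ℂ) * (fun _ => (g : ℂ)) * cub - (fun _ => (g : ℂ)) ^ 2 * qua)
      - ((fun _ => (g : ℂ)) ^ 2 * (2 * u * rdot e (P.k (P.jetLegs (!σ)))
        * rdot (P.av {P.b2}) (P.k (P.jetLegs σ)))) * P.pp final ∈ P.At 3 final := by
    have h1 := PowerSystem.at_smul (P := P) (PowerSystem.sgn_g_mem (P := P) σ) hc (le_refl _)
    have h2 := PowerSystem.at_smul (P := P) PowerSystem.g_sq_mem hq (le_refl _)
    rw [zero_add] at h1 h2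
    have := sub_mem h1 h2
    refine Eq.mpr (congrArg (fun z => z ∈ P.At 3 P.full) ?_) this
    have hs : (sgn σ : X → ℂ) * sgn σ = 1 := by
      rw [← Int.cast_mul]; cases σ <;> simp [sgn]
    change _ = (sgn σ : X → ℂ) * (fun _ => (g : ℂ)) * (cub - (sgn σ : X → ℂ) * (fun _ => (g : ℂ)) * _ * P.pp final)
      - (fun _ => (g : ℂ)) ^ 2 * qua
    linear_combination ((fun _ => (g : ℂ)) ^ 2 * (2 * u * rdot e (P.k (P.jetLegs (!σ)))
        * rdot (P.av {P.b2}) (P.k (P.jetLegs σ)))) * P.pp final * hs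
  have hT : (fun _ => (g : ℂ)) ^ 2 * (2 * u * rdot e (P.k (P.jetLegs (!σ)))
        * rdot (P.av {P.b2}) (P.k (P.jetLegs σ))) ∈ 𝓕.filt.F 0 :=
    P.mul PowerSystem.g_sq_mem (P.mul (P.mul (P.two_mul hu) (hek _) (le_refl _)) (hak _)
      (le_refl _)) (le_refl _)
  have h := leading_mem (𝓕 := 𝓕) (g := g) (-2 * Complex.I) hT hf
  convert h using 1
  congr 1
  · funext x
    rw [channelAmp]
    simp only [channelCurrent_scalarChannel g (𝓕.leg x) (Sum.inr 1) _
      (hatScalar g (𝓕.leg x) (𝓕.gauge g x)), allButFirst_eq]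
    rw [cdot_current_attach _ _ b2_notMem_final _ (ec x)]
    have hs : ((sgn σ : ℤ) : ℂ) ^ 2 = 1 := sgn_sq σ
    have e1 : cub x = ∑ V ∈ final.powerset, cdot (fun μ => e μ x) (kvec (𝓕.leg x) (final \ V))
        * (hatScalar g (𝓕.leg x) (𝓕.gauge g x) σ (insert (Sum.inr 1) V)
          * hatScalar g (𝓕.leg x) (𝓕.gauge g x) (!σ) (final \ V)) := by
      rw [hcub, Finset.sum_apply]
      refine Finset.sum_congr rfl fun V _ => ?_
      rw [Pi.mul_apply, rdot_apply]
      rfl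
    have e2 : qua x = ∑ U ∈ final.powerset, cdot (fun μ => e μ x)
          (vec (hatPhoton g (𝓕.leg x) (𝓕.gauge g x)) U) * ∑ V ∈ (final \ U).powerset,
          hatScalar g (𝓕.leg x) (𝓕.gauge g x) σ (insert (Sum.inr 1) V)
          * hatScalar g (𝓕.leg x) (𝓕.gauge g x) (!σ) ((final \ U) \ V) := by
      rw [hqua, Finset.sum_apply]
      refine Finset.sum_congr rfl fun U _ => ?_
      rw [Pi.mul_apply, rdot_apply, Finset.sum_apply]
      rfl
    rw [← e1, ← e2]
    simp only [Pi.mul_apply, Pi.sub_apply, Pi.pow_apply, Pi.intCast_apply]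
    push_cast
    linear_combination 2 * Complex.I * g ^ 2 * qua x * hs
  · funext x
    have e1 : rdot e (P.k (P.jetLegs (!σ))) x = cdot (fun μ => e μ x)
        (toC ((𝓕.kin x).sectorMom sec (jetSector (!σ)))) := by
      rw [rdot_apply, eL, show P.k (Kinematics.state sec (jetSector (!σ))) = _ from mom_jetLegs (!σ)]
      rfl
    have e2 : rdot (P.av {P.b2}) (P.k (P.jetLegs σ)) x = cdot (fun μ => 𝓕.incoming 1 μ x)
        (toC ((𝓕.kin x).sectorMom sec (jetSector σ))) := by
      rw [rdot_apply, eL, show P.k (Kinematics.state sec (jetSector σ)) = _ from mom_jetLegs σ,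
        show P.av {P.b2} = 𝓕.incoming 1 from photon_b2_eq]
      rfl
    rw [channelLeading, hardTensor_scalarChannel_sum]
    simp only [Pi.mul_apply, Pi.pow_apply, Pi.ofNat_apply, e1, e2, hu2]
    linear_combination (2 * Complex.I * g ^ 2
      * cdot (fun μ => e μ x) (toC ((𝓕.kin x).sectorMom sec (jetSector (!σ))))
      * cdot (fun μ => 𝓕.incoming 1 μ x) (toC ((𝓕.kin x).sectorMom sec (jetSector σ)))
      / (mdot ((𝓕.kin x).p 0) ((𝓕.kin x).sectorMom sec (jetSector (!σ))) : ℂ)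
      * (𝓕.kin x).collinear3 g sp sec * (𝓕.kin x).collinear4 g sp sec
      * (𝓕.kin x).softME g sp sec) * Complex.I_sq

theorem channel_mem (ch : Kinematics.Channel) :
    𝓕.channelAmp g ch - 𝓕.channelLeading g ch ∈ (𝓕.powerSystem g).At 3 final := by
  cases ch
  · exact contact_channel_mem
  · exact scalar_channel_mem true
  · exact scalar_channel_mem false

include 𝓕 in
/-- Apart from the two jets themselves, the weight counts the particles with the powers of the
natural size of the amplitude. -/
theorem wt_final : (𝓕.powerSystem g).wt final = leadingExponent sec + 2 := by
  have h : (𝓕.powerSystem g).wt final = ∑ i : ι, ((if sec i = .jet3 then 1 else 0)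
      + (if sec i = .jet4 then 1 else 0) + 2 * (if sec i = .soft then 1 else 0)) := by
    rw [PowerSystem.wt, final, Finset.sum_map]
    refine Finset.sum_congr rfl fun i _ => ?_
    change (legTag sec (Sum.inl i)).weight = _
    cases hs : sec i <;> simp [legTag, hs, Tag.weight]
  rw [h, leadingExponent, Finset.sum_add_distrib, Finset.sum_add_distrib, ← Finset.mul_sum]
  simp only [members, Finset.sum_boole]
  ring

/-- The factorization of the channels with constants that are uniform in the family. -/
theorem channel_bound (𝓕 : Family sp sec K c₀ X) (g : ℝ) (ch : Kinematics.Channel) :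
    ∃ C : ℝ, 0 ≤ C ∧ ∀ x, ‖𝓕.channelAmp g ch x - 𝓕.channelLeading g ch x‖
      ≤ C * 𝓕.lam x * 𝓕.lam x ^ (-leadingExponent sec) := by
  obtain ⟨C, hC⟩ := channel_mem (𝓕 := 𝓕) (g := g) ch
  refine ⟨|C|, abs_nonneg C, fun x => (hC x).trans ?_⟩
  have h0 := 𝓕.lam_pos x
  rw [wt_final, show (3 : ℤ) - (leadingExponent sec + 2) = 1 + -leadingExponent sec by ring,
    zpow_add₀ h0.ne', zpow_one, ← mul_assoc]
  refine mul_le_mul_of_nonneg_right (mul_le_mul_of_nonneg_right (le_abs_self C) h0.le)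
    (zpow_nonneg h0.le _)

end Family
end ScalarQED
end

noncomputable section
namespace ScalarQED
open scoped Topology
set_option linter.unusedSectionVars false

variable {ι : Type*} [Fintype ι] [DecidableEq ι]

/-! ### The incoming photons -/

namespace Kinematics

variable {kin : Kinematics ι} {sp : ι → Species} {sec : ι → Sector} {K lam g : ℝ}

theorem treePhoton_beam (a : Fin 2) (μ : Fin 4) :
    treePhoton g (kin.legs sp) μ {Sum.inr a} = kin.polIn a μ := by
  rw [treePhoton_singleton]
  rfl

theorem incomingField_eq (a : Fin 2) (μ : Fin 4) : kin.incomingField g sp a μ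
    = - Complex.I * g * ((metric μ : ℂ) * kin.polIn a μ) := by
  rw [incomingField, ← treePhoton_beam (g := g) (sp := sp)]
  rfl

/-- The incoming Wilson line turns the polarization vector into the one of the axial gauge. -/
theorem incomingME_eq {a : Fin 2} (h : mdot (kin.tIn a) (kin.p a) ≠ 0) (μ : Fin 4) :
    kin.incomingME g sp a μ = - Complex.I * g * ((metric μ : ℂ) * (kin.polIn a μ
      - cdot (toC (kin.tIn a)) (kin.polIn a) / (mdot (kin.tIn a) (kin.p a) : ℂ)
        * (kin.p a μ : ℂ))) := by
  set leg := kin.legs sp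
  set R : SetFun (ι ⊕ Fin 2) := .of (incomingRay leg (treeFields g leg).A (kin.tIn a))
  have hk : totalMom leg {Sum.inr a} = - kin.p a := totalMom_singleton _ _
  have hR : R {Sum.inr a}
      = Complex.I * cdot (toC (kin.tIn a)) (kin.polIn a) / (mdot (kin.tIn a) (kin.p a) : ℂ) := by
    have hneg : mdot (kin.tIn a) (totalMom leg {Sum.inr a}) = - mdot (kin.tIn a) (kin.p a) := by
      rw [hk]; simp only [mdot_eq, Pi.neg_apply]; ring
    have e : (fun μ => (treeFields g leg).A μ {Sum.inr a}) = kin.polIn a :=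
      funext fun μ => treePhoton_beam a μ
    change incomingRay leg (treeFields g leg).A (kin.tIn a) {Sum.inr a} = _
    rw [incomingRay_of_ne (by rw [hneg]; exact neg_ne_zero.2 h), e, hneg]
    push_cast
    rw [neg_mul, neg_div_neg_eq]
  have h1 : kin.incomingME g sp a μ = (SetFun.exp ((-Complex.I * g) • R) * (metric μ : ℂ) •
      (deriv4 leg μ (SetFun.exp ((Complex.I * g) • R)) - (Complex.I * g) •
        (treePhoton g leg μ * SetFun.exp ((Complex.I * g) • R)))) {Sum.inr a} := by
    rw [incomingME, SetFun.conv_apply]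
    refine SetFun.mul_congr (fun T _ => rfl) fun T _ => ?_
    rw [SetFun.of_apply, covD, SetFun.smul_apply, SetFun.sub_apply, SetFun.smul_apply,
      SetFun.conv_apply, deriv4_apply]
    rfl
  have hz : ∀ F : SetFun (ι ⊕ Fin 2), (treePhoton g leg μ * F) ∅ = 0 := fun F => by
    rw [SetFun.mul_empty, treePhoton_empty, zero_mul]
  rw [h1, SetFun.mul_singleton, SetFun.exp_empty, SetFun.smul_apply, SetFun.smul_apply,
    SetFun.sub_apply, SetFun.sub_apply, SetFun.smul_apply, SetFun.smul_apply, hz, deriv4_apply,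
    deriv4_apply, SetFun.mul_singleton, SetFun.exp_empty, SetFun.exp_singleton, SetFun.smul_apply,
    hR, treePhoton_empty, treePhoton_beam, hk, totalMom]
  simp only [Finset.sum_empty, Pi.zero_apply, Pi.neg_apply]
  push_cast
  linear_combination -(metric μ : ℂ) * (kin.p a μ : ℂ) * Complex.I * g
    * (cdot (toC (kin.tIn a)) (kin.polIn a) / (mdot (kin.tIn a) (kin.p a) : ℂ)) * Complex.I_sq

/-- In the axial gauge of the incoming Wilson line the polarization vectors of the incoming photons
are bounded. -/
theorem axial_polarization_bound (phys : kin.Physical sp) (pc : kin.PowerCounting sp sec K lam)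
    (wd : kin.WilsonDirections sec K) (hK : 1 ≤ K) (a : Fin 2) (μ : Fin 4) :
    ‖kin.polIn a μ - cdot (toC (kin.tIn a)) (kin.polIn a) / (mdot (kin.tIn a) (kin.p a) : ℂ)
      * (kin.p a μ : ℂ)‖ ≤ 2 * K ^ 3 + 1 := by
  obtain ⟨ht, ht0, htK⟩ := wd.inc a
  obtain ⟨hp, hp0⟩ := phys.onShellIn a
  obtain ⟨h1, h2⟩ := phys.polarizationIn a
  have hsep := wd.sepIn a
  have hKpos : 0 < K := by linarith
  have hpos : 0 < mdot (kin.tIn a) (kin.p a) := lt_of_lt_of_le (by positivity) hsep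
  have hne : (mdot (kin.tIn a) (kin.p a) : ℂ) ≠ 0 := by exact_mod_cast hpos.ne'
  set z := - (cdot (toC (kin.tIn a)) (kin.polIn a) / (mdot (kin.tIn a) (kin.p a) : ℂ))
  set w : CVec := fun μ => kin.polIn a μ + z * (kin.p a μ : ℂ)
  have hw : w μ = kin.polIn a μ - cdot (toC (kin.tIn a)) (kin.polIn a)
      / (mdot (kin.tIn a) (kin.p a) : ℂ) * (kin.p a μ : ℂ) := by
    simp only [w, z]; ring
  have htw : cdot (toC (kin.tIn a)) w = 0 := by
    rw [show w = kin.polIn a + z • toC (kin.p a) from rfl, cdot_add, cdot_smul, cdot_toC]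
    simp only [z]
    field_simp
    ring
  have key := mdot_mul_norm_sq_le ht ht0 hp hp0 htw (cdot_toC_add_smul hp h1 z)
    ((cdot_star_add_smul hp h1 z).trans h2) μ
  rw [← hw]
  set y := ‖w μ‖
  have h3 : 2 * kin.tIn a 0 * kin.p a 0 ≤ 2 * K * K := by
    have := mul_le_mul htK (pc.incomingEnergy a) hp0.le hKpos.le
    linarith
  have h4 : y ^ 2 / K ≤ 2 * K * K := by
    rw [div_eq_mul_one_div, mul_comm]
    exact (mul_le_mul_of_nonneg_right hsep (sq_nonneg y)).trans (key.trans h3)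
  rw [div_le_iff₀ hKpos] at h4
  nlinarith [sq_nonneg (y - 1)]

/-! ### The amplitude -/

/-- The channels of the amplitude are the parts of the current in which photon `2` is attached to
the gauge field or to one of the charged fields. -/
theorem channelAmplitude_eq (g : ℝ) (ch : Channel) : kin.channelAmplitude g sp ch
    = - Complex.I * cdot (kin.polIn 0) fun ν =>
      channelCurrent g (kin.legs sp) (Sum.inr 1) (treePhoton g (kin.legs sp))
        (treeScalar g (kin.legs sp) true) (treeScalar g (kin.legs sp) false) ν ch allButFirst := by
  set T := treeFields g (kin.legs sp)
  have cub : ∀ (F G : Finset (ι ⊕ Fin 2) → ℂ) ν S, cubicCurrent g (kin.legs sp) F G ν S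
      + quarticCurrent g T.A F G ν S
      = current g (kin.legs sp) (treePhoton g (kin.legs sp)) (.of F) (.of G) ν S := by
    intro F G ν S
    exact photonSource_apply g (kin.legs sp) ⟨F, G, T.A⟩ ν S
  cases ch
  · simp only [channelAmplitude]
    congr 2
    funext ν
    rw [quarticCurrent, SetFun.conv_apply, SetFun.of_conv, of_withLeg, channelCurrent,
      SetFun.neg_apply, SetFun.smul_apply, neg_mul, neg_mul]
    rfl
  · simp only [channelAmplitude, channelCurrent]
    congr 2
    funext ν
    rw [cub, of_withLeg]
    rfl
  · simp only [channelAmplitude, channelCurrent]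
    congr 2
    funext ν
    rw [cub, of_withLeg]
    rfl

theorem cdot_current_eq_sum (e : CVec) (leg : ι ⊕ Fin 2 → Leg) (A : Fin 4 → SetFun (ι ⊕ Fin 2))
    (F G : SetFun (ι ⊕ Fin 2)) : cdot e (fun ν => current g leg A F G ν allButFirst)
      = cdot e (fun ν => channelCurrent g leg (Sum.inr 1) A F G ν .contact allButFirst)
      + cdot e (fun ν => channelCurrent g leg (Sum.inr 1) A F G ν .tChannel allButFirst)
      + cdot e (fun ν => channelCurrent g leg (Sum.inr 1) A F G ν .uChannel allButFirst) := by
  have h : ∀ ν, current g leg A F G ν allButFirst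
      = channelCurrent g leg (Sum.inr 1) A F G ν .contact allButFirst
      + channelCurrent g leg (Sum.inr 1) A F G ν .tChannel allButFirst
      + channelCurrent g leg (Sum.inr 1) A F G ν .uChannel allButFirst := by
    intro ν
    have := congrArg (fun F : SetFun (ι ⊕ Fin 2) => F allButFirst)
      (attach_current g leg (Sum.inr 1) A F G ν)
    simp only [SetFun.add_apply, attach_apply] at this
    rwa [if_pos (by simp [allButFirst])] at this
  simp only [h]
  rw [← cdot_add, ← cdot_add]
  rfl

theorem amplitude_eq_sum (g : ℝ) : kin.amplitude g sp = kin.channelAmplitude g sp .contact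
    + kin.channelAmplitude g sp .tChannel + kin.channelAmplitude g sp .uChannel := by
  rw [channelAmplitude_eq, channelAmplitude_eq, channelAmplitude_eq, ← mul_add, ← mul_add,
    ← cdot_current_eq_sum]
  simp only [amplitude, photonSource_apply]
  rfl

/-! ### Monotonicity in the constant of the power counting -/

theorem PowerCounting.mono {K' : ℝ} (h : kin.PowerCounting sp sec K lam) (hK : 0 < K)
    (hKK : K ≤ K') (hlam : 0 < lam) : kin.PowerCounting sp sec K' lam := by
  have h1 : 1 / K' ≤ 1 / K := one_div_le_one_div_of_le hK hKK
  have h2 : ∀ n, lam ^ n / K' ≤ lam ^ n / K := fun n =>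
    div_le_div_of_nonneg_left (pow_nonneg hlam.le n) hK hKK
  have h3 : ∀ n, K * lam ^ n ≤ K' * lam ^ n := fun n =>
    mul_le_mul_of_nonneg_right hKK (pow_nonneg hlam.le n)
  refine ⟨fun s hs i hi => ?_, fun i hi μ => (h.soft i hi μ).trans (h3 2),
    fun a => (h.incomingEnergy a).trans hKK, h1.trans h.sepBeams, h1.trans h.sepJets,
    fun a s hs => h1.trans (h.sepBeamJet a s hs),
    fun i hi s hs => (h2 2).trans (h.sepSoftJet i hi s hs),
    fun s hs i hi j hj hij hsp => (h2 2).trans (h.resolvedJet s hs i hi j hj hij hsp),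
    fun i hi j hj hij hsp => (h2 4).trans (h.resolvedSoft i hi j hj hij hsp),
    fun i hi hsp a => (h2 2).trans (h.resolvedBeam i hi hsp a)⟩
  obtain ⟨c1, c2, c3, c4⟩ := h.collinear s hs i hi
  exact ⟨c1.trans (h3 2), c2.trans hKK, h1.trans c3, fun μ => (c4 μ).trans
    (mul_le_mul_of_nonneg_right hKK hlam.le)⟩

theorem WilsonDirections.mono {K' : ℝ} (h : kin.WilsonDirections sec K) (hK : 0 < K)
    (hKK : K ≤ K') : kin.WilsonDirections sec K' := by
  have h1 : 1 / K' ≤ 1 / K := one_div_le_one_div_of_le hK hKK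
  exact ⟨⟨h.out3.1, h.out3.2.1, h.out3.2.2.trans hKK⟩, h1.trans h.sep3,
    ⟨h.out4.1, h.out4.2.1, h.out4.2.2.trans hKK⟩, h1.trans h.sep4,
    fun a => ⟨(h.inc a).1, (h.inc a).2.1, (h.inc a).2.2.trans hKK⟩, fun a => h1.trans (h.sepIn a)⟩

/-- The processes that obey the power counting with given constants. For the lower bounds of the
invariants, `M` is `K` times one more than the number of outgoing particles. -/
structure Admissible (sp : ι → Species) (sec : ι → Sector) (K M lam : ℝ) (kin : Kinematics ι) :
    Prop where
  pos : 0 < lam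
  small : 2000 * M ^ 8 * lam ≤ 1
  phys : kin.Physical sp
  pc : kin.PowerCounting sp sec K lam
  wd : kin.WilsonDirections sec K

end Kinematics

namespace Family

variable {sp : ι → Species} {sec : ι → Sector} {K M : ℝ}

theorem exists_member {s : Sector} (h : sectorCharge sp sec s ≠ 0) : ∃ i, sec i = s := by
  by_contra hn
  refine h (Finset.sum_eq_zero fun i hi => ?_)
  exact absurd ⟨i, mem_members.1 hi⟩ hn

/-- The family of all admissible processes with a given gauge for the incoming photons. -/
def ofAdmissible (hK : 1 ≤ K) (hM : M = ((Fintype.card ι : ℝ) + 1) * K)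
    (h3 : sectorCharge sp sec .jet3 = 1) (h4 : sectorCharge sp sec .jet4 = -1)
    (hs : sectorCharge sp sec .soft = 0) (Q : Kinematics ι → Prop) (c : Kinematics ι → Fin 2 → ℂ)
    (hc : ∀ lam kin, Kinematics.Admissible sp sec K M lam kin → Q kin → ∀ a μ,
      ‖kin.polIn a μ - c kin a * (kin.p a μ : ℂ)‖ ≤ 2 * K ^ 3 + 1) :
    Family sp sec K (1 / (8 * M ^ 6))
      {y : ℝ × Kinematics ι // Kinematics.Admissible sp sec K M y.1 y.2 ∧ Q y.2} where
  lam x := x.1.1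
  kin x := x.1.2
  c x := c x.1.2
  one_le := hK
  c₀_pos := by
    have : 0 < M := by rw [hM]; positivity
    positivity
  lam_pos x := x.2.1.pos
  small x := by
    have h1 := x.2.1.small
    have h0 := x.2.1.pos
    have hKM := Kinematics.K_le_M hK hM
    have h2 : M ≤ M ^ 8 := le_self_pow₀ (hK.trans hKM) (by norm_num)
    nlinarith
  phys x := x.2.1.phys
  pc x := x.2.1.pc
  wd x := x.2.1.wd
  res x := Kinematics.resolved x.2.1.phys x.2.1.pc hK x.2.1.pos hM x.2.1.small x.2.1.wd fun b => by
    cases b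
    · exact exists_member (by rw [jetSector, h4]; norm_num)
    · exact exists_member (by rw [jetSector, h3]; norm_num)
  beam x a μ := hc _ _ x.2.1 x.2.2 a μ
  charge3 := h3
  charge4 := h4
  chargeS := hs

section

variable {c₀ : ℝ} {X : Type*} {𝓕 : Family sp sec K c₀ X} {g : ℝ}

/-- By current conservation, the amplitude may be computed with the bounded polarization vectors
and the gauge-transformed fields. -/
theorem amplitude_eq (x : X) : (𝓕.kin x).amplitude g sp = 𝓕.channelAmp g .contact x
    + 𝓕.channelAmp g .tChannel x + 𝓕.channelAmp g .uChannel x := by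
  simp only [channelAmp]
  rw [← mul_add, ← mul_add, ← Kinematics.cdot_current_eq_sum]
  simp only [← photonSource_eq_current_hat g (𝓕.leg x) (gauge_empty (𝓕 := 𝓕) (g := g) (x := x))]
  have h := momentum_dot_photonSource g (𝓕.nonSingular x) (S := Kinematics.allButFirst)
    (Finset.notMem_erase _ _)
  rw [show totalMom (𝓕.leg x) Kinematics.allButFirst = (𝓕.kin x).p 0 by
    rw [allButFirst_eq]; exact tot_full x] at h
  rw [Kinematics.amplitude, show (fun μ => 𝓕.incoming 0 μ x)
    = (𝓕.kin x).polIn 0 + (-(𝓕.c x 0)) • toC ((𝓕.kin x).p 0) by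
      funext μ; simp only [incoming, Pi.add_apply, Pi.smul_apply, smul_eq_mul, toC]; ring,
    add_cdot, smul_cdot, h, mul_zero, add_zero]
  rfl

/-- Without a gauge transformation of the incoming photons, the gauge parameter vanishes on all sets
that contain photon `2`, and each channel is invariant separately. -/
theorem channelAmp_of_c_eq_zero (hc : ∀ x a, 𝓕.c x a = 0) (x : X) (ch : Kinematics.Channel) :
    𝓕.channelAmp g ch x = (𝓕.kin x).channelAmplitude g sp ch := by
  have hr : ∀ S, Sum.inr 1 ∈ S → 𝓕.gauge g x S = 0 := by
    intro S hS
    by_cases h : S = {Sum.inr 1}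
    · rw [h, gauge_b2, hc, mul_zero]
    · exact gauge_of_b2_mem hS h
  rw [Kinematics.channelAmplitude_eq, channelAmp]
  simp only [channelCurrent_hat g (𝓕.leg x) (gauge_empty (𝓕 := 𝓕) (g := g) (x := x)) hr]
  rw [show (fun μ => 𝓕.incoming 0 μ x) = (𝓕.kin x).polIn 0 by
    funext μ; rw [incoming, hc, zero_mul, sub_zero]]
  rfl

theorem channelLeading_of_c_eq_zero (hc : ∀ x a, 𝓕.c x a = 0) (x : X) (ch : Kinematics.Channel) :
    𝓕.channelLeading g ch x = (𝓕.kin x).channelFactorized g sp sec ch := by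
  simp only [channelLeading, Kinematics.channelFactorized, Kinematics.incomingField_eq, incoming,
    hc, zero_mul, sub_zero]

/-- If the incoming photons are in the axial gauges of their Wilson lines, the hard tensor splits
the factorized amplitude into the leading terms of the channels. -/
theorem factorized_eq (hc : ∀ x a, 𝓕.c x a = cdot (toC ((𝓕.kin x).tIn a)) ((𝓕.kin x).polIn a)
      / (mdot ((𝓕.kin x).tIn a) ((𝓕.kin x).p a) : ℂ)) (x : X) :
    (𝓕.kin x).factorized g sp sec = 𝓕.channelLeading g .contact x
      + 𝓕.channelLeading g .tChannel x + 𝓕.channelLeading g .uChannel x := by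
  have hne : ∀ a, mdot ((𝓕.kin x).tIn a) ((𝓕.kin x).p a) ≠ 0 := fun a =>
    (𝓕.inv_K_pos.trans_le ((𝓕.wd x).sepIn a)).ne'
  simp only [channelLeading, Kinematics.factorized, Kinematics.incomingME_eq (hne _), incoming, hc]
  rw [← add_mul, ← add_mul, ← add_mul, ← add_mul, ← add_mul, ← add_mul, ← mul_add, ← mul_add,
    ← Finset.sum_add_distrib, ← Finset.sum_add_distrib]
  congr 4
  refine Finset.sum_congr rfl fun μ _ => ?_
  rw [← Finset.sum_add_distrib, ← Finset.sum_add_distrib]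
  refine Finset.sum_congr rfl fun ν _ => ?_
  push_cast
  ring

end

end Family
end ScalarQED
end

theorem mainTheorem10 {ι : Type*} [Fintype ι] [DecidableEq ι]
    (sp : ι → Species) (sec : ι → Sector)
    (h3 : sectorCharge sp sec .jet3 = 1)
    (h4 : sectorCharge sp sec .jet4 = -1)
    (hs : sectorCharge sp sec .soft = 0)
    (g K : ℝ) (hK : 0 < K) :
    ∃ C lam₀ : ℝ, 0 < lam₀ ∧
      ∀ lam : ℝ, 0 < lam → lam ≤ lam₀ →
      ∀ kin : Kinematics ι,
        kin.Physical sp → kin.PowerCounting sp sec K lam → kin.WilsonDirections sec K →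
        ‖kin.amplitude g sp - kin.factorized g sp sec‖
            ≤ C * lam * lam ^ (-leadingExponent sec) ∧
        kin.amplitude g sp = kin.channelAmplitude g sp .contact
          + kin.channelAmplitude g sp .tChannel + kin.channelAmplitude g sp .uChannel ∧
        (kin.GenericPolarizations sp K → ∀ c : Kinematics.Channel,
          ‖kin.channelAmplitude g sp c - kin.channelFactorized g sp sec c‖
            ≤ C * lam * lam ^ (-leadingExponent sec)) := by
  -- the power counting is weaker for a larger constant
  set K' := max K 1
  have hK' : 1 ≤ K' := le_max_right _ _
  have hKK : K ≤ K' := le_max_left _ _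
  set M := ((Fintype.card ι : ℝ) + 1) * K' with hM
  have hMpos : 0 < M := by positivity
  -- the family for the sum of the channels: the incoming photons are in the axial gauges of their
  -- Wilson lines
  let 𝓐 := Family.ofAdmissible hK' hM h3 h4 hs (fun _ => True)
    (fun kin a => cdot (toC (kin.tIn a)) (kin.polIn a) / (mdot (kin.tIn a) (kin.p a) : ℂ))
    fun lam kin h _ a μ => Kinematics.axial_polarization_bound h.phys h.pc h.wd hK' a μ
  -- the family for the separate channels: the given polarization vectors
  let 𝓑 := Family.ofAdmissible hK' hM h3 h4 hs (fun kin => kin.GenericPolarizations sp K)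
    (fun _ _ => 0) fun lam kin _ hgen a μ => by
      rw [zero_mul, sub_zero]
      refine ((hgen.2 a μ).trans hKK).trans ?_
      have : K' ≤ K' ^ 3 := le_self_pow₀ hK' (by norm_num)
      linarith
  choose CA hCA0 hCA using Family.channel_bound 𝓐 g
  choose CB hCB0 hCB using Family.channel_bound 𝓑 g
  refine ⟨CA .contact + CA .tChannel + CA .uChannel + (CB .contact + CB .tChannel + CB .uChannel),
    1 / (2000 * M ^ 8), by positivity, fun lam hlam hle kin phys pc wd => ?_⟩
  have adm : Kinematics.Admissible sp sec K' M lam kin := by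
    refine ⟨hlam, ?_, phys, pc.mono hK hKK hlam, wd.mono hK hKK⟩
    rw [le_div_iff₀ (by positivity)] at hle
    linarith
  set pw := lam ^ (-leadingExponent sec)
  have hpw : 0 ≤ lam * pw := mul_nonneg hlam.le (zpow_nonneg hlam.le _)
  refine ⟨?_, Kinematics.amplitude_eq_sum g, fun hgen ch => ?_⟩
  · let x : {y : ℝ × Kinematics ι // Kinematics.Admissible sp sec K' M y.1 y.2 ∧ True} :=
      ⟨(lam, kin), adm, trivial⟩
    have e1 := Family.amplitude_eq (𝓕 := 𝓐) (g := g) x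
    have e2 := Family.factorized_eq (𝓕 := 𝓐) (g := g) (fun _ _ => rfl) x
    have b1 := hCA .contact x
    have b2 := hCA .tChannel x
    have b3 := hCA .uChannel x
    change kin.amplitude g sp = _ at e1
    change kin.factorized g sp sec = _ at e2
    change _ ≤ _ * lam * pw at b1 b2 b3
    rw [e1, e2, add_sub_add_comm, add_sub_add_comm]
    refine (norm_add₃_le).trans ((add_le_add (add_le_add b1 b2) b3).trans ?_)
    have := mul_nonneg (add_nonneg (add_nonneg (hCB0 .contact) (hCB0 .tChannel)) (hCB0 .uChannel)) hpw
    linarith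
  · let x : {y : ℝ × Kinematics ι // Kinematics.Admissible sp sec K' M y.1 y.2 ∧
        y.2.GenericPolarizations sp K} := ⟨(lam, kin), adm, hgen⟩
    have b := hCB ch x
    rw [Family.channelAmp_of_c_eq_zero (𝓕 := 𝓑) (fun _ _ => rfl),
      Family.channelLeading_of_c_eq_zero (𝓕 := 𝓑) (fun _ _ => rfl)] at b
    refine b.trans ?_
    change _ * lam * pw ≤ _
    rw [mul_assoc, mul_assoc]
    refine mul_le_mul_of_nonneg_right ?_ hpw
    have h1 := hCA0 .contact
    have h2 := hCA0 .tChannel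
    have h3 := hCA0 .uChannel
    have h4 := hCB0 .contact
    have h5 := hCB0 .tChannel
    have h6 := hCB0 .uChannel
    cases ch <;> linarith
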